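/- \textbf{Setting.} Let $\beta\in\mathbb R$, $q_0>0$, $|q_\pm|=q_0$. Let $\hat q$ solve the focusing Kundu--Eckhaus equation $$i\hat q_t+\tfrac12\hat q_{xx}+|\hat q|^2\hat q+2\beta^2|\hat q|^4\hat q-2i\beta(|\hat q|^2)_x\hat q=0\qquad(x,t\in\mathbb R),$$ and let $q$ be its reduced potential: $\hat q=q\,e^{i(q_0^2t+\varphi)}$ with $\varphi$ real, $\varphi_x=2\beta|q|^2$, $\varphi_t=-2\beta\,\mathrm{Im}(q^*q_x)$. Assume that $q$ is $C^2$ in $x$ and differentiable in $t$, and that for every $t$: $q(x,t)\to q_\pm$ as $x\to\pm\infty$, $(1+|x|)(q-q_\pm)\in L^1(\mathbb R^\pm)$, and $q_x,q_{xx}\in L^1(\mathbb R)$. Put $k=\frac12(z-q_0^2/z)$, $\lambda=\frac12(z+q_0^2/z)$, $\theta(x,t;z)=\lambda(x+kt)$, $\gamma=1+q_0^2/z^2$, $D^\pm=\{z:\pm(|z|^2-q_0^2)\,\mathrm{Im}\,z>0\}$, $\Sigma=\mathbb R\cup\{|z|=q_0\}$ oriented with $D^+$ on its left, $\Sigma_0=\Sigma\setminus\{0,\pm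 iq_0\}$, $\sigma_3=\mathrm{diag}(1,-1)$, $Q=\begin{pmatrix}0&q\\-q^*&0\end{pmatrix}$, and let $Q_\pm$ be the same matrix for $q_\pm$. Let $\psi_\pm$ be the Jost solutions, i.e. simultaneous solutions of $$\psi_x=(-ik\sigma_3+Q)\psi,\qquad \psi_t=\bigl(-ik^2\sigma_3+kQ+\tfrac i2\sigma_3Q_x-\tfrac i2(Q^2+q_0^2)\sigma_3\bigr)\psi$$ with $u_\pm:=\psi_\pm e^{i\theta\sigma_3}\to I-\frac iz\sigma_3Q_\pm$ as $x\to\pm\infty$; the columns $\psi_{-,1},\psi_{+,2}$ are taken for $z\in D^+\cup\Sigma_0$ and $\psi_{+,1},\psi_{-,2}$ for $z\in D^-\cup\Sigma_0$. Define $S$ by $\psi_+=\psi_-S$, that is, $s_{11}=\mathrm{Wr}(\psi_{+,1},\psi_{-,2})/\gamma$, $s_{22}=\mathrm{Wr}(\psi_{-,1},\psi_{+,2})/\gamma$, $s_{12}=\mathrm{Wr}(\psi_{+,2},\psi_{-,2})/\gamma$, $s_{21}=\mathrm{Wr}(\psi_{-,1},\psi_{+,1})/\gamma$; put $\rho=s_{21}/s_{11}$,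 $\tilde\rho=s_{12}/s_{22}$, $$M^-=\Bigl(\tfrac{u_{+,1}}{s_{11}},\,u_{-,2}\Bigr),\qquad G=\begin{pmatrix}0&-\tilde\rho e^{-2i\theta}\\ \rho e^{2i\theta}&\rho\tilde\rho\end{pmatrix}.$$ Assume that there are no spectral singularities ($s_{11}\ne0$ on $\Sigma_0$, and $1/s_{11}$ is bounded on $D^-\cup\Sigma_0$ near $\pm iq_0$) and that the zeros of $s_{11}$ in $D^-\cap\{\mathrm{Im}\,z<0\}$ are $N\ge0$ distinct points $z_1,\dots,z_N$, all double ($s_{11}=s_{11}'=0\neq s_{11}''$). Here $'$ is $d/dz$. Put $\xi_n=z_n$ and $\xi_{N+n}=-q_0^2/z_n^*$ for $n\le N$, and $\hat\xi_n=-q_0^2/\xi_n$ for $n\le 2N$. \textbf{Conclusions.} (0) For every $(x,t)$, $\psi_{-,1}$ and $\psi_{+,2}$ are holomorphic in $z\in D^+$, and so is $s_{22}$; for $n\le 2N$, $\hat\xi_n\in D^+$ and $s_{22}''(\hat\xi_n)\ne0$. For each $n$ there are unique constants $b_n,d_n$, independent of $x,t$, with $$\psi_{+,2}(\hat\xi_n)=b_n\psi_{-,1}(\hat\xi_n),\qquad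 \psi_{+,2}'(\hat\xi_n)=d_n\psi_{-,1}(\hat\xi_n)+b_n\psi_{-,1}'(\hat\xi_n),$$ and $b_n\ne0$. Put $$A_+[\hat\xi_n]=\frac{2b_n}{s_{22}''(\hat\xi_n)},\quad B_+[\hat\xi_n]=\frac{d_n}{b_n}-\frac{s_{22}'''(\hat\xi_n)}{3s_{22}''(\hat\xi_n)},\quad \chi_n^+=B_+[\hat\xi_n]-2i\theta'(\hat\xi_n).$$ (1) For all $x,t$ the function $(M^-G)_{12}$ is absolutely integrable on $\Sigma$ and $$q=q_-+i\sum_{n=1}^{2N}A_+[\hat\xi_n]e^{-2i\theta(\hat\xi_n)}\bigl[u_{-,11}'(\hat\xi_n)+\chi_n^+u_{-,11}(\hat\xi_n)\bigr]+\frac1{2\pi}\int_\Sigma (M^-G)_{12}(x,t;\zeta)\,d\zeta .$$ (2) If $G=0$ on $\Sigma_0$, then for all $x,t$ $$q=q_-+i\sum_{n=1}^{2N}A_+[\hat\xi_n]e^{-2i\theta(\hat\xi_n)}\bigl[u_{-,11}'(\hat\xi_n)+\chi_n^+u_{-,11}(\hat\xi_n)\bigr],$$ and moreover $$\det\tilde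 M\neq0,\qquad q=q_--i\,\frac{\det\begin{pmatrix}\tilde M&\nu\\ \omega^T&0\end{pmatrix}}{\det\tilde M},$$ where $\tilde M=\begin{pmatrix}\tilde M^{(11)}&\tilde M^{(12)}\\ \tilde M^{(21)}&\tilde M^{(22)}\end{pmatrix}$ is the $4N\times4N$ matrix with $2N\times2N$ blocks, in which, with $H_n(w)=\dfrac{A_+[\hat\xi_n]e^{-2i\theta(\hat\xi_n)}}{w-\hat\xi_n}$, $$\tilde m^{(11)}_{kn}=H_n(\xi_k)\Bigl(\chi_n^++\frac1{\xi_k-\hat\xi_n}\Bigr)+\frac{iq_-}{\xi_k}\delta_{kn},\qquad \tilde m^{(12)}_{kn}=H_n(\xi_k),$$ $$\tilde m^{(21)}_{kn}=\frac{H_n(\xi_k)}{\xi_k-\hat\xi_n}\Bigl(\chi_n^++\frac2{\xi_k-\hat\xi_n}\Bigr)+\frac{iq_-}{\xi_k^2}\delta_{kn},\qquad \tilde m^{(22)}_{kn}=\frac{H_n(\xi_k)}{\xi_k-\hat\xi_n}-\frac{iq_-q_0^2}{\xi_k^3}\delta_{kn},$$ and $\omega=(\omega^{(1)},\omega^{(2)})$,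 $\nu=(\nu^{(1)},\nu^{(2)})$ with $\omega^{(1)}_n=A_+[\hat\xi_n]e^{-2i\theta(\hat\xi_n)}\chi_n^+$, $\omega^{(2)}_n=A_+[\hat\xi_n]e^{-2i\theta(\hat\xi_n)}$, $\nu^{(1)}_n=iq_- /\xi_n$, $\nu^{(2)}_n=iq_- /\xi_n^2$. -/

import Mathlib

open Filter Topology MeasureTheory Complex
open scoped ComplexConjugate

noncomputable section

namespace KE

/-! ## The equation and the reduced potential -/

/-- `qh` solves the Kundu-Eckhaus equation
`i q_t + q_xx / 2 + |q|^2 q + 2 β^2 |q|^4 q - 2 i β (|q|^2)_x q = 0`. -/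
def IsSolution (β : ℝ) (qh : ℝ → ℝ → ℂ) : Prop :=
  ∀ x t : ℝ,
    I * deriv (fun s => qh x s) t + 1 / 2 * iteratedDeriv 2 (fun y => qh y t) x
      + (‖qh x t‖ : ℂ) ^ 2 * qh x t + 2 * (β : ℂ) ^ 2 * (‖qh x t‖ : ℂ) ^ 4 * qh x t
      - 2 * I * β * ((deriv (fun y => ‖qh y t‖ ^ 2) x : ℝ) : ℂ) * qh x t = 0

/-- `qh = q exp (i (q0^2 t + φ))`, where the real phase `φ` is the antiderivative `2 β ∫ |q|^2 dx`
(`|q| = |qh|`), its additive function of time being fixed by the equation. -/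
def IsGauge (β q0 : ℝ) (qh q : ℝ → ℝ → ℂ) (φ : ℝ → ℝ → ℝ) : Prop :=
  ∀ x t : ℝ,
    qh x t = q x t * exp (I * ((q0 : ℂ) ^ 2 * t + φ x t)) ∧
    HasDerivAt (fun y => φ y t) (2 * β * ‖q x t‖ ^ 2) x ∧
    HasDerivAt (fun s => φ x s) (-2 * β * (conj (q x t) * deriv (fun y => q y t) x).im) t

/-- Regularity of the reduced potential and its boundary values `qm`, `qp` at `x = -∞`, `x = +∞`. -/
structure HasBoundaryValues (q : ℝ → ℝ → ℂ) (qm qp : ℂ) : Prop where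
  contDiff_x : ∀ t, ContDiff ℝ 2 (fun x => q x t)
  differentiable_t : ∀ x, Differentiable ℝ (fun t => q x t)
  tendsto_minus : ∀ t, Tendsto (fun x => q x t) atBot (𝓝 qm)
  tendsto_plus : ∀ t, Tendsto (fun x => q x t) atTop (𝓝 qp)
  integrable_minus : ∀ t, IntegrableOn (fun x : ℝ => (1 + |x|) * ‖q x t - qm‖) (Set.Iic 0)
  integrable_plus : ∀ t, IntegrableOn (fun x : ℝ => (1 + |x|) * ‖q x t - qp‖) (Set.Ici 0)
  integrable_deriv : ∀ t, Integrable (deriv (fun x => q x t))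
  integrable_deriv_two : ∀ t, Integrable (iteratedDeriv 2 (fun x => q x t))

/-! ## Uniformization variable -/

/-- `k(z) = (z - q0^2 / z) / 2`. -/
def kz (q0 : ℝ) (z : ℂ) : ℂ := (z - (q0 : ℂ) ^ 2 / z) / 2

/-- `λ(z) = (z + q0^2 / z) / 2`. -/
def lam (q0 : ℝ) (z : ℂ) : ℂ := (z + (q0 : ℂ) ^ 2 / z) / 2

/-- `θ(x,t;z) = λ(z) (x + k(z) t)`. -/
def theta (q0 : ℝ) (x t : ℝ) (z : ℂ) : ℂ := lam q0 z * (x + kz q0 z * t)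

/-- `γ(z) = 1 + q0^2 / z^2`. -/
def gam (q0 : ℝ) (z : ℂ) : ℂ := 1 + (q0 : ℂ) ^ 2 / z ^ 2

/-- `D⁺ = {(|z|^2 - q0^2) Im z > 0}`. -/
def Dplus (q0 : ℝ) : Set ℂ := {z | 0 < (‖z‖ ^ 2 - q0 ^ 2) * z.im}

/-- `D⁻ = {(|z|^2 - q0^2) Im z < 0}`. -/
def Dminus (q0 : ℝ) : Set ℂ := {z | (‖z‖ ^ 2 - q0 ^ 2) * z.im < 0}

/-- The continuous spectrum `ℝ ∪ {|z| = q0}` without `0` (which is `k = ∞`) and without the branch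
points `± i q0`. -/
def Sigma0 (q0 : ℝ) : Set ℂ :=
  {z | (z.im = 0 ∨ ‖z‖ = q0) ∧ z ≠ 0 ∧ z ≠ I * q0 ∧ z ≠ -(I * q0)}

/-! ## Lax pair and Jost solutions -/

def sigma3 : Matrix (Fin 2) (Fin 2) ℂ := !![1, 0; 0, -1]

/-- `Q = [[0, q], [-q^*, 0]]`. -/
def Qmat (q : ℂ) : Matrix (Fin 2) (Fin 2) ℂ := !![0, q; -conj q, 0]

/-- `X = -i k σ₃ + Q`. -/
def laxX (q0 : ℝ) (q : ℝ → ℝ → ℂ) (x t : ℝ) (z : ℂ) : Matrix (Fin 2) (Fin 2) ℂ :=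
  -(I * kz q0 z) • sigma3 + Qmat (q x t)

/-- `T = -i k^2 σ₃ + k Q + (i/2) σ₃ Q_x - (i/2) (Q^2 + q0^2) σ₃`. -/
def laxT (q0 : ℝ) (q : ℝ → ℝ → ℂ) (x t : ℝ) (z : ℂ) : Matrix (Fin 2) (Fin 2) ℂ :=
  -(I * kz q0 z ^ 2) • sigma3 + kz q0 z • Qmat (q x t)
    + (I / 2) • (sigma3 * Qmat (deriv (fun y => q y t) x))
    - (I / 2) • ((Qmat (q x t) * Qmat (q x t) + ((q0 : ℂ) ^ 2) • 1) * sigma3)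

/-- `Y(z) = 1 - (i / z) σ₃ Q` for the boundary value `qb`. -/
def Ymat (qb : ℂ) (z : ℂ) : Matrix (Fin 2) (Fin 2) ℂ := 1 - (I / z) • (sigma3 * Qmat qb)

/-- The modified Jost matrix `u = ψ exp (i θ σ₃)`. -/
def modified (q0 : ℝ) (ψ : ℝ → ℝ → ℂ → Matrix (Fin 2) (Fin 2) ℂ) (x t : ℝ) (z : ℂ) :
    Matrix (Fin 2) (Fin 2) ℂ :=
  ψ x t z * Matrix.diagonal ![exp (I * theta q0 x t z), exp (-(I * theta q0 x t z))]

/-- `ψ` is the Jost solution normalized at the end `l` of the line, where `q → qb`: for `z` in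
`D j ∪ Σ₀` the column `j` of `ψ` solves both equations of the Lax pair and the column `j` of
`u = ψ exp (i θ σ₃)` tends to that of `Y`.  (For integrable `q - qb` these columns are unique when
`D j` is the half of the plane in which `exp (∓ i θ)` decays at `l`.) -/
def IsJost (q0 : ℝ) (q : ℝ → ℝ → ℂ) (qb : ℂ) (l : Filter ℝ) (D : Fin 2 → Set ℂ)
    (ψ : ℝ → ℝ → ℂ → Matrix (Fin 2) (Fin 2) ℂ) : Prop :=
  ∀ j : Fin 2, ∀ z ∈ D j ∪ Sigma0 q0, ∀ i : Fin 2,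
    (∀ x t, HasDerivAt (fun y => ψ y t z i j) ((laxX q0 q x t z * ψ x t z) i j) x) ∧
    (∀ x t, HasDerivAt (fun s => ψ x s z i j) ((laxT q0 q x t z * ψ x t z) i j) t) ∧
    (∀ t, Tendsto (fun x => modified q0 ψ x t z i j) l (𝓝 (Ymat qb z i j)))

/-- `ψ₋`: first column on `D⁺`, second column on `D⁻`, normalized at `x = -∞`. -/
def IsJostMinus (q0 : ℝ) (q : ℝ → ℝ → ℂ) (qm : ℂ)
    (ψ : ℝ → ℝ → ℂ → Matrix (Fin 2) (Fin 2) ℂ) : Prop :=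
  IsJost q0 q qm atBot ![Dplus q0, Dminus q0] ψ

/-- `ψ₊`: first column on `D⁻`, second column on `D⁺`, normalized at `x = +∞`. -/
def IsJostPlus (q0 : ℝ) (q : ℝ → ℝ → ℂ) (qp : ℂ)
    (ψ : ℝ → ℝ → ℂ → Matrix (Fin 2) (Fin 2) ℂ) : Prop :=
  IsJost q0 q qp atTop ![Dminus q0, Dplus q0] ψ

/-! ## Scattering data

`ψ₊ = ψ₋ S` and `det ψ₋ = γ` give the entries of `S` as Wronskians; these do not depend on
`(x, t)` and are taken at `(0, 0)`. -/

section Scattering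

variable (q0 : ℝ) (ψm ψp : ℝ → ℝ → ℂ → Matrix (Fin 2) (Fin 2) ℂ)

/-- Wronskian of the column `j` of `A` and the column `l` of `B`. -/
def wr (A : Matrix (Fin 2) (Fin 2) ℂ) (j : Fin 2) (B : Matrix (Fin 2) (Fin 2) ℂ) (l : Fin 2) : ℂ :=
  A 0 j * B 1 l - A 1 j * B 0 l

def s11 (z : ℂ) : ℂ := wr (ψp 0 0 z) 0 (ψm 0 0 z) 1 / gam q0 z
def s22 (z : ℂ) : ℂ := wr (ψm 0 0 z) 0 (ψp 0 0 z) 1 / gam q0 z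
def s12 (z : ℂ) : ℂ := wr (ψp 0 0 z) 1 (ψm 0 0 z) 1 / gam q0 z
def s21 (z : ℂ) : ℂ := wr (ψm 0 0 z) 0 (ψp 0 0 z) 0 / gam q0 z

/-- `ρ = s₂₁ / s₁₁`. -/
def rho (z : ℂ) : ℂ := s21 q0 ψm ψp z / s11 q0 ψm ψp z

/-- `ρ̃ = s₁₂ / s₂₂`. -/
def rhoT (z : ℂ) : ℂ := s12 q0 ψm ψp z / s22 q0 ψm ψp z

/-- `M⁻ = (u₊₁ / s₁₁, u₋₂)`. -/
def Mminus (x t : ℝ) (z : ℂ) : Matrix (Fin 2) (Fin 2) ℂ :=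
  Matrix.of fun i => ![modified q0 ψp x t z i 0 / s11 q0 ψm ψp z, modified q0 ψm x t z i 1]

/-- `G = exp (-i θ σ₃) [[0, -ρ̃], [ρ, ρ ρ̃]] exp (i θ σ₃)`; the jump relation on the continuous
spectrum is `M⁺ = M⁻ (1 - G)` with `M⁺ = (u₋₁, u₊₂ / s₂₂)`. -/
def Gmat (x t : ℝ) (z : ℂ) : Matrix (Fin 2) (Fin 2) ℂ :=
  !![0, -rhoT q0 ψm ψp z * exp (-2 * I * theta q0 x t z);
     rho q0 ψm ψp z * exp (2 * I * theta q0 x t z), rho q0 ψm ψp z * rhoT q0 ψm ψp z]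

/-- There are no spectral singularities: `s₁₁` does not vanish on the continuous spectrum and
`1 / s₁₁` is bounded near the branch points `± i q0`. -/
def NoSpectralSingularity : Prop :=
  (∀ z ∈ Sigma0 q0, s11 q0 ψm ψp z ≠ 0) ∧
  ∃ c > 0, ∃ ε > 0, ∀ z ∈ Dminus q0 ∪ Sigma0 q0,
    (‖z - I * q0‖ < ε ∨ ‖z + I * q0‖ < ε) → c ≤ ‖s11 q0 ψm ψp z‖

/-- The zeros of `s₁₁` in `D⁻ ∩ {Im z < 0}` are exactly the points `z 0, …, z (N - 1)`, which are
distinct, and each of them is a double zero. -/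
def HasDoubleZeros {N : ℕ} (z : Fin N → ℂ) : Prop :=
  Function.Injective z ∧
  (∀ w : ℂ, (w ∈ Dminus q0 ∧ w.im < 0 ∧ s11 q0 ψm ψp w = 0) ↔ ∃ n, w = z n) ∧
  ∀ n, deriv (s11 q0 ψm ψp) (z n) = 0 ∧ iteratedDeriv 2 (s11 q0 ψm ψp) (z n) ≠ 0

end Scattering

/-- The constants `b₊`, `d₊` at `w ∈ D⁺`: `ψ₊₂(w) = b₊ ψ₋₁(w)` and
`ψ₊₂'(w) = d₊ ψ₋₁(w) + b₊ ψ₋₁'(w)` for all `x`, `t`. -/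
def IsNorming (ψm ψp : ℝ → ℝ → ℂ → Matrix (Fin 2) (Fin 2) ℂ) (w b d : ℂ) : Prop :=
  ∀ (x t : ℝ) (i : Fin 2),
    ψp x t w i 1 = b * ψm x t w i 0 ∧
    deriv (fun z => ψp x t z i 1) w = d * ψm x t w i 0 + b * deriv (fun z => ψm x t z i 0) w

/-- `A₊[w] = 2 b₊ / s₂₂''(w)`. -/
def Aplus (q0 : ℝ) (ψm ψp : ℝ → ℝ → ℂ → Matrix (Fin 2) (Fin 2) ℂ) (w b : ℂ) : ℂ :=
  2 * b / iteratedDeriv 2 (s22 q0 ψm ψp) w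

/-- `B₊[w] = d₊ / b₊ - s₂₂'''(w) / (3 s₂₂''(w))`. -/
def Bplus (q0 : ℝ) (ψm ψp : ℝ → ℝ → ℂ → Matrix (Fin 2) (Fin 2) ℂ) (w b d : ℂ) : ℂ :=
  d / b - iteratedDeriv 3 (s22 q0 ψm ψp) w / (3 * iteratedDeriv 2 (s22 q0 ψm ψp) w)

/-! ## The contour `Σ = ℝ ∪ {|z| = q0}`, oriented with `D⁺` on its left

Rightwards on `|s| > q0`, leftwards on `(-q0, q0)`, and along both half circles from `-q0` to
`q0`. -/

/-- Absolute integrability on `Σ`. -/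
def SigmaIntegrable (q0 : ℝ) (f : ℂ → ℂ) : Prop :=
  Integrable (fun s : ℝ => f s) ∧
  IntegrableOn (fun φ : ℝ => f (q0 * exp (I * φ))) (Set.Ioc (-Real.pi) Real.pi)

/-- `∫_Σ f(ζ) dζ`. -/
def sigmaIntegral (q0 : ℝ) (f : ℂ → ℂ) : ℂ :=
  (∫ s in {s : ℝ | q0 < |s|}, f s) - (∫ s in (-q0)..q0, f (s : ℂ))
    + (∫ φ in (-Real.pi)..0, f (q0 * exp (I * φ)) * (I * q0 * exp (I * φ)))
    - (∫ φ in (0)..Real.pi, f (q0 * exp (I * φ)) * (I * q0 * exp (I * φ)))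

/-! ## Discrete spectrum and the block matrix -/

/-- The index set of the `2N` points `ξ`. -/
abbrev Idx (N : ℕ) := Fin N ⊕ Fin N

section Discrete

variable (q0 : ℝ) {N : ℕ} (z : Fin N → ℂ)

/-- `ξ_n = z_n` and `ξ_{N+n} = -q0^2 / z_n^*`. -/
def xi : Idx N → ℂ := Sum.elim z fun n => -(q0 : ℂ) ^ 2 / conj (z n)

/-- `ξ̂_n = -q0^2 / ξ_n`. -/
def xiHat (n : Idx N) : ℂ := -(q0 : ℂ) ^ 2 / xi q0 z n

/-- `χ_n⁺ = B₊[ξ̂_n] - 2 i θ'(ξ̂_n)`. -/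
def chi (B : Idx N → ℂ) (x t : ℝ) (n : Idx N) : ℂ :=
  B n - 2 * I * deriv (theta q0 x t) (xiHat q0 z n)

/-- `A₊[ξ̂_n] exp (-2 i θ(ξ̂_n))`. -/
def Aexp (A : Idx N → ℂ) (x t : ℝ) (n : Idx N) : ℂ :=
  A n * exp (-2 * I * theta q0 x t (xiHat q0 z n))

/-- `H_n⁺(w) = A₊[ξ̂_n] exp (-2 i θ(ξ̂_n)) / (w - ξ̂_n)`. -/
def Hplus (A : Idx N → ℂ) (x t : ℝ) (n : Idx N) (w : ℂ) : ℂ :=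
  Aexp q0 z A x t n / (w - xiHat q0 z n)

/-- The `4N × 4N` block matrix `M̃`. -/
def Mtilde (qm : ℂ) (A B : Idx N → ℂ) (x t : ℝ) : Matrix (Idx N ⊕ Idx N) (Idx N ⊕ Idx N) ℂ :=
  Matrix.fromBlocks
    (Matrix.of fun k n =>
      Hplus q0 z A x t n (xi q0 z k)
          * (chi q0 z B x t n + 1 / (xi q0 z k - xiHat q0 z n))
        + if k = n then I * qm / xi q0 z k else 0)
    (Matrix.of fun k n => Hplus q0 z A x t n (xi q0 z k))
    (Matrix.of fun k n =>
      Hplus q0 z A x t n (xi q0 z k) / (xi q0 z k - xiHat q0 z n)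
          * (chi q0 z B x t n + 2 / (xi q0 z k - xiHat q0 z n))
        + if k = n then I * qm / xi q0 z k ^ 2 else 0)
    (Matrix.of fun k n =>
      Hplus q0 z A x t n (xi q0 z k) / (xi q0 z k - xiHat q0 z n)
        - if k = n then I * qm * (q0 : ℂ) ^ 2 / xi q0 z k ^ 3 else 0)

/-- `ν`. -/
def nuVec (qm : ℂ) : Idx N ⊕ Idx N → ℂ :=
  Sum.elim (fun n => I * qm / xi q0 z n) (fun n => I * qm / xi q0 z n ^ 2)

/-- `ω`. -/
def omegaVec (A B : Idx N → ℂ) (x t : ℝ) : Idx N ⊕ Idx N → ℂ :=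
  Sum.elim (fun n => Aexp q0 z A x t n * chi q0 z B x t n) (fun n => Aexp q0 z A x t n)

/-- The bordered matrix `[[M̃, ν], [ωᵀ, 0]]`. -/
def bordered (qm : ℂ) (A B : Idx N → ℂ) (x t : ℝ) :
    Matrix ((Idx N ⊕ Idx N) ⊕ Unit) ((Idx N ⊕ Idx N) ⊕ Unit) ℂ :=
  Matrix.fromBlocks (Mtilde q0 z qm A B x t)
    (Matrix.of fun k _ => nuVec q0 z qm k)
    (Matrix.of fun _ n => omegaVec q0 z A B x t n) 0

/-- `∑_n A₊[ξ̂_n] exp (-2 i θ(ξ̂_n)) (u₋₁₁'(ξ̂_n) + χ_n⁺ u₋₁₁(ξ̂_n))`. -/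
def poleSum (ψm : ℝ → ℝ → ℂ → Matrix (Fin 2) (Fin 2) ℂ) (A B : Idx N → ℂ) (x t : ℝ) : ℂ :=
  ∑ n : Idx N, Aexp q0 z A x t n *
    (deriv (fun w => modified q0 ψm x t w 0 0) (xiHat q0 z n)
      + chi q0 z B x t n * modified q0 ψm x t (xiHat q0 z n) 0 0)

end Discrete

end KE

end

/-! The potential is read off the 1/z coefficient at infinity of the (1,2) entry of the Jost
matrices. Take g⁺ = u₊₁₂/s₂₂ on D⁺ and g⁻ = u₋₁₂ on D⁻. The scattering relation makes g⁻ - g⁺ equal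
to (M⁻G)₁₂ on Σ₀ (`JostPair.jump`). The function g⁺ has double poles at the points ξ̂_n, and the
norming relations express their principal parts through u₋₁₁ and its derivative
(`DiscreteData.principal_part`). After subtraction of these principal parts from both functions,
nothing but the jump is left; z g± tends to a = -iq - Σ (residues) at infinity and to c = -iq₋ at
the origin, on either side. Cauchy's theorem on half annuli then gives the integral of the jump over
Σ as 2πi (a - c) (`sigmaIntegral_jump`), which is the reconstruction formula.

The analytic input concerns a single object, the first column of u₋, called the model column.
Multiplication by exp(iθ) removes the exponential, and variation of constants about the constant
background gives a Volterra equation (`IsModel.volterra`) whose majorant is uniform for z in an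
annulus, the branch points ±iq₀ included; this uses the weight 1 + |x|. The Picard iterates converge
uniformly in z, so the given solutions are holomorphic in D⁺, continuous up to Σ₀ and bounded near
±iq₀. For large z two integrations by parts in a diagonalized system (`DiagonalSystem`) give u₁₁ = 1
+ O(1/z) and u₂₁ = -(i/z)q* + O(1/z²), at the cost of two derivatives of q in L¹. Uniqueness of the
model column yields the symmetries under conjugation and under z ↦ -q₀²/z; the second column follows
by conjugation, the behaviour at 0 from that at infinity, and ψ₊ from ψ₋ by (x, z, q) ↦ (-x, -z,
-q).

The norming constants come from the vanishing of the Wronskian of ψ₋₁ and ψ₊₂ and of its derivative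
at ξ̂_n. They are found at (x,t) = (0,0), and the statement that ψ₊₂ - (b + d(z - ξ̂_n))ψ₋₁ is o(z -
ξ̂_n) is carried to every (x,t) by a Gronwall argument (`isLittleO_propagate`).

Without jump, a Liouville argument writes u₋₁₂ on D⁻ as the sum of its principal parts minus iq₋/z.
Evaluated at ξ_k together with its first derivative, and combined with the symmetry u₋₁₂(w) =
-(iq₋/w)u₋₁₁(ŵ), this is the linear system with matrix `Mtilde` for the values u₋₁₁(ξ̂_n),
u₋₁₁'(ξ̂_n); Cramer's rule in bordered form then gives q. The matrix is invertible because a kernel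
vector produces a row vector with the same symmetry and proportional poles. Multiplied by the
adjugate of the solution it becomes a constant vector divided by z; the sum of the squared moduli of
the constants carries the factor z² + q₀², which vanishes at the branch point, so the kernel vector
is zero (`NoJump.reflect_eq_zero`). -/

noncomputable section

namespace KE

/-! ## Volterra equations with a holomorphic parameter -/

section Volterra

/-- Integrals depending holomorphically on a parameter are holomorphic. -/
theorem differentiableOn_integral_of_dominated {E : Type*} [NormedAddCommGroup E] [NormedSpace ℂ E]
    [CompleteSpace E] {α : Type*} [MeasurableSpace α] {μ : Measure α}
    {Z : Set ℂ} (hZ : IsOpen Z) {F : ℂ → α → E} {bound : α → ℝ}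
    (hF : ∀ z ∈ Z, AEStronglyMeasurable (F z) μ)
    (hb : ∀ z ∈ Z, ∀ᵐ a ∂μ, ‖F z a‖ ≤ bound a) (hbi : Integrable bound μ)
    (hd : ∀ a, DifferentiableOn ℂ (fun z => F z a) Z)
    (hb' : ∀ a, ∀ z ∈ Z, ‖F z a‖ ≤ bound a) :
    DifferentiableOn ℂ (fun z => ∫ a, F z a ∂μ) Z := by
  intro z0 hz0
  obtain ⟨r, hr, hball⟩ := Metric.isOpen_iff.1 hZ z0 hz0
  have hsub : ∀ z ∈ Metric.ball z0 (r / 2), Metric.closedBall z (r / 4) ⊆ Z := by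
    intro z hz w hw
    apply hball
    rw [Metric.mem_ball] at hz ⊢
    rw [Metric.mem_closedBall] at hw
    have := dist_triangle w z z0
    linarith
  have hmemZ : ∀ z ∈ Metric.ball z0 (r / 2), z ∈ Z := fun z hz =>
    hsub z hz (Metric.mem_closedBall_self (by positivity))
  have hderiv : ∀ a, ∀ z ∈ Metric.ball z0 (r / 2), HasDerivAt (fun z => F z a)
      (deriv (fun z => F z a) z) z := fun a z hz =>
    ((hd a z (hmemZ z hz)).differentiableAt (hZ.mem_nhds (hmemZ z hz))).hasDerivAt
  -- Cauchy's estimate on the circle of radius r/4 about z, which stays in Z, turns the bound on F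
  -- into an integrable majorant of the derivative.
  have hnorm : ∀ a, ∀ z ∈ Metric.ball z0 (r / 2),
      ‖deriv (fun z => F z a) z‖ ≤ bound a / (r / 4) := by
    intro a z hz
    apply Complex.norm_deriv_le_of_forall_mem_sphere_norm_le (by positivity)
    · exact ((hd a).mono (hsub z hz)).diffContOnCl_ball subset_rfl
    · intro w hw
      exact hb' a w (hsub z hz (Metric.sphere_subset_closedBall hw))
  have hmeas : AEStronglyMeasurable (fun a => deriv (fun z => F z a) z0) μ := by
    -- the derivative is a limit of difference quotients
    have hlim : ∀ a, Tendsto (fun n : ℕ => ((r / 2 / (n + 2 : ℝ) : ℝ) : ℂ)⁻¹ •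
        (F (z0 + ((r / 2 / (n + 2 : ℝ) : ℝ) : ℂ)) a - F z0 a)) atTop
        (𝓝 (deriv (fun z => F z a) z0)) := by
      intro a
      have h1 := (hderiv a z0 (Metric.mem_ball_self (by positivity))).tendsto_slope_zero
      refine h1.comp ?_
      have h2 : Tendsto (fun n : ℕ => (r / 2 / (n + 2 : ℝ) : ℝ)) atTop (𝓝 0) := by
        apply Tendsto.div_atTop tendsto_const_nhds
        exact tendsto_atTop_add_const_right _ _ tendsto_natCast_atTop_atTop
      rw [tendsto_nhdsWithin_iff]
      constructor
      · have := (continuous_ofReal.tendsto 0).comp h2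
        simpa [Function.comp_def] using this
      · refine Eventually.of_forall fun n => ?_
        have : (0 : ℝ) < r / 2 / (n + 2 : ℝ) := by positivity
        exact Complex.ofReal_ne_zero.2 this.ne'
    refine aestronglyMeasurable_of_tendsto_ae atTop (fun n => ?_) (ae_of_all _ hlim)
    apply AEStronglyMeasurable.const_smul
    refine (hF _ ?_).sub (hF _ hz0)
    apply hmemZ
    rw [Metric.mem_ball, dist_eq_norm, add_sub_cancel_left, Complex.norm_real, Real.norm_eq_abs,
      abs_of_pos (by positivity)]
    apply div_lt_self (by positivity)
    have : (0 : ℝ) ≤ n := n.cast_nonneg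
    linarith
  have := hasDerivAt_integral_of_dominated_loc_of_deriv_le (μ := μ) (F := F)
    (F' := fun z a => deriv (fun z => F z a) z) (x₀ := z0) (s := Metric.ball z0 (r / 2))
    (bound := fun a => bound a / (r / 4))
    (Metric.ball_mem_nhds _ (by positivity))
    (by
      filter_upwards [hZ.mem_nhds hz0] with z hz using hF z hz)
    (hbi.mono' (hF z0 hz0) (hb z0 hz0)) hmeas
    (ae_of_all _ fun a z hz => hnorm a z hz) (hbi.div_const _)
    (ae_of_all _ fun a z hz => hderiv a z hz)
  exact this.2.differentiableAt.differentiableWithinAt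

variable {m : ℝ → ℝ}

theorem hasDerivAt_integral_Iic (hm : Continuous m) (hmi : ∀ x, IntegrableOn m (Set.Iic x)) (x : ℝ) :
    HasDerivAt (fun x => ∫ y in Set.Iic x, m y) (m x) x := by
  have h : (fun x => ∫ y in Set.Iic x, m y) =
      fun x => (∫ y in Set.Iic (0 : ℝ), m y) + ∫ y in (0 : ℝ)..x, m y := by
    funext x
    rw [← intervalIntegral.integral_Iic_sub_Iic (hmi 0) (hmi x)]
    ring
  rw [h]
  exact (intervalIntegral.integral_hasDerivAt_right (hm.intervalIntegrable _ _)
    hm.aestronglyMeasurable.stronglyMeasurableAtFilter hm.continuousAt).const_add _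

theorem tendsto_integral_Iic_atBot (hmi : ∀ x, IntegrableOn m (Set.Iic x)) :
    Tendsto (fun x => ∫ y in Set.Iic x, m y) atBot (𝓝 0) := by
  have h : (fun x => ∫ y in Set.Iic x, m y) =
      fun x => (∫ y in Set.Iic (0 : ℝ), m y) - ∫ y in x..(0 : ℝ), m y := by
    funext x
    rw [← intervalIntegral.integral_Iic_sub_Iic (hmi x) (hmi 0)]
    ring
  rw [h]
  have := intervalIntegral_tendsto_integral_Iic (f := m) (μ := volume) 0 (hmi 0) tendsto_id
  simpa using (tendsto_const_nhds (x := ∫ y in Set.Iic (0 : ℝ), m y)).sub this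

theorem integrableOn_mul_exp_primitive (hm : Continuous m) (hmi : ∀ x, IntegrableOn m (Set.Iic x))
    (hm0 : ∀ x, 0 ≤ m x) (x : ℝ) :
    IntegrableOn (fun y => m y * Real.exp (2 * ∫ s in Set.Iic y, m s)) (Set.Iic x) := by
  have hc : Continuous fun y => m y * Real.exp (2 * ∫ s in Set.Iic y, m s) := by
    refine hm.mul (Real.continuous_exp.comp (continuous_const.mul ?_))
    exact continuous_iff_continuousAt.2 fun y => (hasDerivAt_integral_Iic hm hmi y).continuousAt
  refine Integrable.mono' ((hmi x).mul_const (Real.exp (2 * ∫ s in Set.Iic x, m s)))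
    hc.aestronglyMeasurable.restrict ?_
  refine (ae_restrict_iff' measurableSet_Iic).2 (ae_of_all _ fun y hy => ?_)
  rw [Real.norm_eq_abs, abs_of_nonneg (mul_nonneg (hm0 y) (Real.exp_pos _).le)]
  refine mul_le_mul_of_nonneg_left (Real.exp_le_exp.2 ?_) (hm0 y)
  refine mul_le_mul_of_nonneg_left ?_ (by norm_num)
  exact setIntegral_mono_set (hmi x) (ae_of_all _ hm0) (Set.Iic_subset_Iic.2 hy).eventuallyLE

/-- The integrand is the derivative of exp(2∫m)/2, whose limit at -∞ is 1/2. In the norm weighted by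
exp(2∫m), a Volterra operator with majorant m is therefore a contraction with constant 1/2, without
any smallness of m. -/
theorem integral_mul_exp_primitive_le (hm : Continuous m) (hmi : ∀ x, IntegrableOn m (Set.Iic x))
    (hm0 : ∀ x, 0 ≤ m x) (x : ℝ) :
    ∫ y in Set.Iic x, m y * Real.exp (2 * ∫ s in Set.Iic y, m s)
      ≤ Real.exp (2 * ∫ s in Set.Iic x, m s) / 2 := by
  have hd : ∀ y, HasDerivAt (fun y => Real.exp (2 * ∫ s in Set.Iic y, m s) / 2)
      (m y * Real.exp (2 * ∫ s in Set.Iic y, m s)) y := by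
    intro y
    have := (((hasDerivAt_integral_Iic hm hmi y).const_mul 2).exp).div_const 2
    refine this.congr_deriv ?_
    ring
  have hl : Tendsto (fun y => Real.exp (2 * ∫ s in Set.Iic y, m s) / 2) atBot (𝓝 (1 / 2)) := by
    have := (((tendsto_integral_Iic_atBot hmi).const_mul 2).rexp).div_const 2
    simpa using this
  rw [integral_Iic_of_hasDerivAt_of_tendsto' (fun y _ => hd y)
    (integrableOn_mul_exp_primitive hm hmi hm0 x) hl]
  linarith

/-- A Gronwall inequality on a half line. -/
theorem gronwall_Iic (hm : Continuous m) (hmi : ∀ x, IntegrableOn m (Set.Iic x))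
    (hm0 : ∀ x, 0 ≤ m x) {f : ℝ → ℝ} {x0 ε B : ℝ} (hε : 0 ≤ ε) (hf0 : ∀ x ≤ x0, 0 ≤ f x)
    (hfB : ∀ x ≤ x0, f x ≤ B)
    (hf : ∀ x ≤ x0, f x ≤ ε + ∫ y in Set.Iic x, m y * f y) (x : ℝ) (hx : x ≤ x0) :
    f x ≤ 2 * ε * Real.exp (2 * ∫ s in Set.Iic x, m s) := by
  set w : ℝ → ℝ := fun y => Real.exp (2 * ∫ s in Set.Iic y, m s) with hw
  have hw1 : ∀ y, 1 ≤ w y := fun y => Real.one_le_exp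
    (mul_nonneg (by norm_num) (integral_nonneg fun s => hm0 s))
  -- One use of the hypothesis halves the constant c in f ≤ c w. Since 1 ≤ w, the constant moves by
  -- c ↦ ε + c/2, whose fixed point is the 2ε of the conclusion.
  have step : ∀ c : ℝ, (∀ y ≤ x0, f y ≤ c * w y) → ∀ y ≤ x0, f y ≤ ε + c / 2 * w y := by
    intro c hc y hy
    refine (hf y hy).trans ?_
    have h1 : ∫ s in Set.Iic y, m s * f s ≤ ∫ s in Set.Iic y, c * (m s * w s) := by
      apply integral_mono_of_nonneg
      · refine (ae_restrict_iff' measurableSet_Iic).2 (ae_of_all _ fun s hs => ?_)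
        exact mul_nonneg (hm0 s) (hf0 s (le_trans hs hy))
      · exact (integrableOn_mul_exp_primitive hm hmi hm0 y).const_mul c
      · refine (ae_restrict_iff' measurableSet_Iic).2 (ae_of_all _ fun s hs => ?_)
        have := mul_le_mul_of_nonneg_left (hc s (le_trans hs hy)) (hm0 s)
        simp only
        linarith
    rw [integral_const_mul] at h1
    have h2 := integral_mul_exp_primitive_le hm hmi hm0 y
    have hc0 : 0 ≤ c := by
      have := (hf0 y hy).trans (hc y hy)
      exact nonneg_of_mul_nonneg_left this (lt_of_lt_of_le one_pos (hw1 y))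
    have h3 := mul_le_mul_of_nonneg_left h2 hc0
    have h4 : Real.exp (2 * ∫ s in Set.Iic y, m s) = w y := rfl
    rw [h4] at h3
    linarith
  have hB0 : 0 ≤ B := (hf0 x hx).trans (hfB x hx)
  have iter : ∀ n : ℕ, ∀ y ≤ x0, f y ≤ (2 * ε + B / 2 ^ n) * w y := by
    intro n
    induction n with
    | zero =>
      intro y hy
      have := hfB y hy
      have h1 := hw1 y
      simp only [pow_zero, div_one]
      nlinarith
    | succ n ih =>
      intro y hy
      have h := step _ ih y hy
      have h1 := hw1 y
      have : (2 * ε + B / 2 ^ (n + 1)) * w y = ε * w y + (ε + B / 2 ^ n / 2) * w y := by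
        rw [pow_succ]; field_simp; ring
      rw [this]
      have : (2 * ε + B / 2 ^ n) / 2 * w y = (ε + B / 2 ^ n / 2) * w y := by ring
      nlinarith
  have hlim : Tendsto (fun n : ℕ => (2 * ε + B / 2 ^ n) * w x) atTop (𝓝 ((2 * ε + 0) * w x)) := by
    refine Tendsto.mul_const _ (tendsto_const_nhds.add ?_)
    exact tendsto_const_nhds.div_atTop (tendsto_pow_atTop_atTop_of_one_lt one_lt_two)
  rw [add_zero] at hlim
  exact ge_of_tendsto' hlim fun n => iter n x hx

variable {E : Type*} [NormedAddCommGroup E] [NormedSpace ℂ E] [CompleteSpace E]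
  [MeasurableSpace E] [BorelSpace E] [SecondCountableTopology E]

/-- Data of a Volterra equation `u x = Y + ∫ y ≤ x, N x y (u y)` for parameters `z ∈ Z`. -/
structure VolterraData (Z : Set ℂ) (x0 : ℝ) (m : ℝ → ℝ) (N : ℂ → ℝ → ℝ → E → E) (Y : ℂ → E)
    (C0 : ℝ) : Prop where
  cont : Continuous m
  integrable : ∀ x, IntegrableOn m (Set.Iic x)
  nonneg : ∀ x, 0 ≤ m x
  bound : ∀ z ∈ Z, ∀ x ≤ x0, ∀ y ≤ x, ∀ v w, ‖N z x y v - N z x y w‖ ≤ m y * ‖v - w‖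
  map_zero : ∀ z x y, N z x y 0 = 0
  meas : ∀ z, ∀ f : ℝ → E, Measurable f → Measurable fun p : ℝ × ℝ => N z p.1 p.2 (f p.2)
  source : ∀ z ∈ Z, ‖Y z‖ ≤ C0

/-- Picard iterates of a Volterra equation. -/
def picard (N : ℂ → ℝ → ℝ → E → E) (Y : ℂ → E) : ℕ → ℂ → ℝ → E
  | 0, _, _ => 0
  | n + 1, z, x => Y z + ∫ y in Set.Iic x, N z x y (picard N Y n z y)

namespace VolterraData

variable {Z : Set ℂ} {x0 : ℝ} {m : ℝ → ℝ} {N : ℂ → ℝ → ℝ → E → E} {Y : ℂ → E} {C0 : ℝ}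

omit [NormedSpace ℂ E] [CompleteSpace E] [BorelSpace E] [SecondCountableTopology E] in
theorem bound' (h : VolterraData Z x0 m N Y C0) {z : ℂ} (hz : z ∈ Z) {x : ℝ} (hx : x ≤ x0) {y : ℝ}
    (hy : y ≤ x) (v : E) : ‖N z x y v‖ ≤ m y * ‖v‖ := by
  simpa [h.map_zero] using h.bound z hz x hx y hy v 0

-- The moving domain y ≤ x is put into an indicator on the plane, so that measurability in x is that
-- of a parametric integral. Only measurability of the iterates is ever needed.
omit [CompleteSpace E] in
theorem measurable_picard (h : VolterraData Z x0 m N Y C0) (n : ℕ) (z : ℂ) :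
    Measurable (picard N Y n z) := by
  induction n with
  | zero => exact measurable_const
  | succ n ih =>
    have h1 := h.meas z _ ih
    have h2 : Measurable fun p : ℝ × ℝ => Set.indicator {p : ℝ × ℝ | p.2 ≤ p.1}
        (fun p => N z p.1 p.2 (picard N Y n z p.2)) p :=
      h1.indicator (measurableSet_le measurable_snd measurable_fst)
    have h3 := (h2.stronglyMeasurable.integral_prod_right' (ν := volume)).measurable
    have h4 : picard N Y (n + 1) z = fun x => Y z + ∫ y, Set.indicator {p : ℝ × ℝ | p.2 ≤ p.1}
        (fun p => N z p.1 p.2 (picard N Y n z p.2)) (x, y) := by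
      funext x
      simp only [picard]
      rw [← integral_indicator measurableSet_Iic]
      rfl
    rw [h4]
    exact measurable_const.add h3

omit [NormedSpace ℂ E] [CompleteSpace E] in
theorem integrableOn_kernel (h : VolterraData Z x0 m N Y C0) {f : ℝ → E} (hf : Measurable f) {B : ℝ} {z : ℂ} (hz : z ∈ Z) {x : ℝ}
    (hx : x ≤ x0) (hB : ∀ y ≤ x, ‖f y‖ ≤ B) :
    IntegrableOn (fun y => N z x y (f y)) (Set.Iic x) := by
  have hmeas : Measurable fun y => N z x y (f y) := (h.meas z f hf).comp measurable_prodMk_left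
  refine Integrable.mono' ((h.integrable x).mul_const B) hmeas.aestronglyMeasurable ?_
  refine (ae_restrict_iff' measurableSet_Iic).2 (ae_of_all _ fun y hy => ?_)
  exact (h.bound' hz hx hy _).trans (mul_le_mul_of_nonneg_left (hB y hy) (h.nonneg y))

variable {u : ℂ → ℝ → E} (h : VolterraData Z x0 m N Y C0)
  (hu : ∀ z ∈ Z, Measurable (u z))
  (hub : ∀ z ∈ Z, ∃ B, ∀ x ≤ x0, ‖u z x‖ ≤ B)
  (heq : ∀ z ∈ Z, ∀ x ≤ x0, u z x = Y z + ∫ y in Set.Iic x, N z x y (u z y))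
include h hu hub heq

-- The bound assumed of u may depend on z; it only starts the Gronwall iteration, and the resulting
-- bound is uniform in Z. With C0 = 0 this is uniqueness.
omit [CompleteSpace E] [SecondCountableTopology E] in
theorem norm_le {z : ℂ} (hz : z ∈ Z) {x : ℝ} (hx : x ≤ x0) :
    ‖u z x‖ ≤ 2 * C0 * Real.exp (2 * ∫ s in Set.Iic x, m s) := by
  obtain ⟨B, hB⟩ := hub z hz
  refine gronwall_Iic h.cont h.integrable h.nonneg (f := fun x => ‖u z x‖) (B := B)
    ((norm_nonneg _).trans (h.source z hz)) (fun _ _ => norm_nonneg _) hB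
    (fun x hx => ?_) x hx
  rw [heq z hz x hx]
  refine (norm_add_le _ _).trans (add_le_add (h.source z hz) ?_)
  refine norm_integral_le_of_norm_le ?_ ((ae_restrict_iff' measurableSet_Iic).2 (ae_of_all _
    fun y hy => h.bound' hz hx hy (u z y)))
  refine Integrable.mono' ((h.integrable x).mul_const B)
    ((h.cont.measurable.mul (hu z hz).norm).aestronglyMeasurable) ?_
  refine (ae_restrict_iff' measurableSet_Iic).2 (ae_of_all _ fun y hy => ?_)
  rw [Real.norm_eq_abs, abs_of_nonneg (mul_nonneg (h.nonneg y) (norm_nonneg _))]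
  exact mul_le_mul_of_nonneg_left (hB y (le_trans hy hx)) (h.nonneg y)

-- Each iteration gains the contraction factor 1/2 in the weighted norm. Existence of u is part of
-- the data: the iterates serve only to transfer regularity in z to a solution that is given.
omit [CompleteSpace E] in
theorem norm_sub_picard_le (n : ℕ) {z : ℂ} (hz : z ∈ Z) {x : ℝ} (hx : x ≤ x0) :
    ‖u z x - picard N Y n z x‖ ≤
      2 * C0 * Real.exp (2 * ∫ s in Set.Iic x0, m s) / 2 ^ n *
        Real.exp (2 * ∫ s in Set.Iic x, m s) := by
  have hC0 : 0 ≤ C0 := (norm_nonneg _).trans (h.source z hz)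
  set K := 2 * C0 * Real.exp (2 * ∫ s in Set.Iic x0, m s) with hK
  have hK0 : 0 ≤ K := by positivity
  have hmono : ∀ y ≤ x0, Real.exp (2 * ∫ s in Set.Iic y, m s) ≤
      Real.exp (2 * ∫ s in Set.Iic x0, m s) := fun y hy => by
    refine Real.exp_le_exp.2 (mul_le_mul_of_nonneg_left ?_ (by norm_num))
    exact setIntegral_mono_set (h.integrable x0) (ae_of_all _ h.nonneg)
      (Set.Iic_subset_Iic.2 hy).eventuallyLE
  have hone : ∀ y, 1 ≤ Real.exp (2 * ∫ s in Set.Iic y, m s) := fun y => Real.one_le_exp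
    (mul_nonneg (by norm_num) (integral_nonneg fun s => h.nonneg s))
  have hubd : ∀ y ≤ x0, ‖u z y‖ ≤ K := fun y hy =>
    (h.norm_le hu hub heq hz hy).trans
      (mul_le_mul_of_nonneg_left (hmono y hy) (by positivity))
  induction n generalizing x with
  | zero =>
    simp only [picard, sub_zero, pow_zero, div_one]
    exact (hubd x hx).trans (le_mul_of_one_le_right hK0 (hone x))
  | succ n ih =>
    have hpb : ∀ y ≤ x, ‖picard N Y n z y‖ ≤
        K + K / 2 ^ n * Real.exp (2 * ∫ s in Set.Iic x0, m s) := by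
      intro y hy
      have h1 := ih (hy.trans hx)
      have h2 := hubd y (hy.trans hx)
      have h3 : ‖picard N Y n z y‖ ≤ ‖u z y‖ + ‖u z y - picard N Y n z y‖ := by
        have := norm_sub_norm_le (picard N Y n z y) (u z y)
        rw [norm_sub_rev] at this
        linarith
      have h4 := mul_le_mul_of_nonneg_left (hmono y (hy.trans hx))
        (show 0 ≤ K / 2 ^ n by positivity)
      linarith
    have i1 := h.integrableOn_kernel (hu z hz) hz hx (fun y hy => hubd y (hy.trans hx))
    have i2 := h.integrableOn_kernel (h.measurable_picard n z) hz hx hpb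
    rw [heq z hz x hx, picard, add_sub_add_left_eq_sub, ← integral_sub i1 i2]
    have h5 : ‖∫ y in Set.Iic x, (N z x y (u z y) - N z x y (picard N Y n z y))‖ ≤
        ∫ y in Set.Iic x, K / 2 ^ n * (m y * Real.exp (2 * ∫ s in Set.Iic y, m s)) := by
      refine norm_integral_le_of_norm_le
        ((integrableOn_mul_exp_primitive h.cont h.integrable h.nonneg x).const_mul _) ?_
      refine (ae_restrict_iff' measurableSet_Iic).2 (ae_of_all _ fun y hy => ?_)
      refine (h.bound z hz x hx y hy _ _).trans ?_
      refine (mul_le_mul_of_nonneg_left (ih (le_trans hy hx)) (h.nonneg y)).trans (le_of_eq ?_)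
      ring
    refine h5.trans ?_
    rw [integral_const_mul]
    refine (mul_le_mul_of_nonneg_left (integral_mul_exp_primitive_le h.cont h.integrable h.nonneg x)
      (by positivity)).trans (le_of_eq ?_)
    rw [pow_succ]
    field_simp

theorem tendstoUniformlyOn_picard {x : ℝ} (hx : x ≤ x0) :
    TendstoUniformlyOn (fun n z => picard N Y n z x) (fun z => u z x) atTop Z := by
  rw [Metric.tendstoUniformlyOn_iff]
  intro ε hε
  have hlim : Tendsto (fun n : ℕ => 2 * C0 * Real.exp (2 * ∫ s in Set.Iic x0, m s) / 2 ^ n *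
        Real.exp (2 * ∫ s in Set.Iic x, m s)) atTop (𝓝 0) := by
    have : Tendsto (fun n : ℕ => 2 * C0 * Real.exp (2 * ∫ s in Set.Iic x0, m s) / 2 ^ n)
        atTop (𝓝 0) :=
      tendsto_const_nhds.div_atTop (tendsto_pow_atTop_atTop_of_one_lt one_lt_two)
    simpa using this.mul_const (Real.exp (2 * ∫ s in Set.Iic x, m s))
  filter_upwards [hlim.eventually (gt_mem_nhds hε)] with n hn z hz
  rw [dist_eq_norm]
  exact (h.norm_sub_picard_le hu hub heq n hz hx).trans_lt hn

theorem picard_bounded (n : ℕ) : ∃ B, ∀ z ∈ Z, ∀ x ≤ x0, ‖picard N Y n z x‖ ≤ B := by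
  set W := Real.exp (2 * ∫ s in Set.Iic x0, m s)
  refine ⟨2 * C0 * W + 2 * C0 * W / 2 ^ n * W, fun z hz x hx => ?_⟩
  have hC0 : 0 ≤ C0 := (norm_nonneg _).trans (h.source z hz)
  have h1 := h.norm_sub_picard_le hu hub heq n hz hx
  have h2 := h.norm_le hu hub heq hz hx
  have h3 : ‖picard N Y n z x‖ ≤ ‖u z x‖ + ‖u z x - picard N Y n z x‖ := by
    have := norm_sub_norm_le (picard N Y n z x) (u z x)
    rw [norm_sub_rev] at this
    linarith
  have hmono : Real.exp (2 * ∫ s in Set.Iic x, m s) ≤ W := by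
    refine Real.exp_le_exp.2 (mul_le_mul_of_nonneg_left ?_ (by norm_num))
    exact setIntegral_mono_set (h.integrable x0) (ae_of_all _ h.nonneg)
      (Set.Iic_subset_Iic.2 hx).eventuallyLE
  have h4 := mul_le_mul_of_nonneg_left hmono (show 0 ≤ 2 * C0 by positivity)
  have h5 := mul_le_mul_of_nonneg_left hmono (show 0 ≤ 2 * C0 * W / 2 ^ n by positivity)
  linarith

theorem continuousOn (hY : ContinuousOn Y Z)
    (hN : ∀ x y, ∀ f : ℂ → E, ContinuousOn f Z → ContinuousOn (fun z => N z x y (f z)) Z)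
    {x : ℝ} (hx : x ≤ x0) : ContinuousOn (fun z => u z x) Z := by
  refine (h.tendstoUniformlyOn_picard hu hub heq hx).continuousOn (Frequently.of_forall fun n => ?_)
  induction n generalizing x with
  | zero => exact continuousOn_const
  | succ n ih =>
    obtain ⟨B, hB⟩ := h.picard_bounded hu hub heq n
    refine hY.add ?_
    refine continuousOn_of_dominated (bound := fun y => m y * B) (fun z _ => ?_) (fun z hz => ?_)
      ((h.integrable x).mul_const B) ?_
    · exact ((h.meas z _ (h.measurable_picard n z)).comp
        measurable_prodMk_left).aestronglyMeasurable
    · refine (ae_restrict_iff' measurableSet_Iic).2 (ae_of_all _ fun y hy => ?_)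
      exact (h.bound' hz hx hy _).trans
        (mul_le_mul_of_nonneg_left (hB z hz y (le_trans hy hx)) (h.nonneg y))
    · refine (ae_restrict_iff' measurableSet_Iic).2 (ae_of_all _ fun y hy => ?_)
      exact hN x y _ (ih (le_trans hy hx))

theorem differentiableOn (hZ : IsOpen Z) (hY : DifferentiableOn ℂ Y Z)
    (hN : ∀ x y, ∀ f : ℂ → E, DifferentiableOn ℂ f Z →
      DifferentiableOn ℂ (fun z => N z x y (f z)) Z)
    {x : ℝ} (hx : x ≤ x0) : DifferentiableOn ℂ (fun z => u z x) Z := by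
  refine ((h.tendstoUniformlyOn_picard hu hub heq hx).tendstoLocallyUniformlyOn).differentiableOn
    (Eventually.of_forall fun n => ?_) hZ
  induction n generalizing x with
  | zero => exact differentiableOn_const _
  | succ n ih =>
    obtain ⟨B, hB⟩ := h.picard_bounded hu hub heq n
    refine hY.add ?_
    -- `differentiableOn_integral_of_dominated` asks for its bound at every point, not almost
    -- everywhere; the indicator makes it hold beyond x as well.
    have hind : (fun z => ∫ y in Set.Iic x, N z x y (picard N Y n z y)) = fun z =>
        ∫ y, Set.indicator (Set.Iic x) (fun y => N z x y (picard N Y n z y)) y := by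
      funext z
      rw [integral_indicator measurableSet_Iic]
    rw [hind]
    have hb : ∀ y, ∀ z ∈ Z, ‖Set.indicator (Set.Iic x) (fun y => N z x y (picard N Y n z y)) y‖ ≤
        Set.indicator (Set.Iic x) (fun y => m y * B) y := by
      intro y z hz
      by_cases hy : y ∈ Set.Iic x
      · rw [Set.indicator_of_mem hy, Set.indicator_of_mem hy]
        exact (h.bound' hz hx hy _).trans
          (mul_le_mul_of_nonneg_left (hB z hz y (le_trans hy hx)) (h.nonneg y))
      · rw [Set.indicator_of_notMem hy, Set.indicator_of_notMem hy, norm_zero]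
    refine differentiableOn_integral_of_dominated hZ
      (bound := Set.indicator (Set.Iic x) (fun y => m y * B)) (fun z _ => ?_)
      (fun z hz => ae_of_all _ fun y => hb y z hz) ?_ (fun y => ?_) hb
    · exact (((h.meas z _ (h.measurable_picard n z)).comp
        measurable_prodMk_left).indicator measurableSet_Iic).aestronglyMeasurable
    · exact (integrable_indicator_iff measurableSet_Iic).2 ((h.integrable x).mul_const B)
    · by_cases hy : y ∈ Set.Iic x
      · simp only [Set.indicator_of_mem hy]
        exact hN x y _ (ih (le_trans hy hx))
      · simp only [Set.indicator_of_notMem hy]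
        exact differentiableOn_const _

end VolterraData
end Volterra

/-! ## The model column -/

theorem exists_norm_le_Iic {E : Type*} [SeminormedAddCommGroup E] {f : ℝ → E} {l : E}
    (hf : Continuous f) (hl : Tendsto f atBot (𝓝 l)) (x0 : ℝ) : ∃ B, ∀ x ≤ x0, ‖f x‖ ≤ B := by
  have h1 := hl.norm.eventually (gt_mem_nhds (lt_add_one ‖l‖))
  obtain ⟨L, hL⟩ := eventually_atBot.1 h1
  obtain ⟨C, hC⟩ := (isCompact_Icc (a := L) (b := x0)).exists_bound_of_continuousOn hf.continuousOn
  refine ⟨max C (‖l‖ + 1), fun x hx => ?_⟩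
  rcases le_total x L with h | h
  · exact (hL x h).le.trans (le_max_right _ _)
  · exact (hC x ⟨h, hx⟩).trans (le_max_left _ _)

/-- `2 λ(z)`. -/
def mu (q0 : ℝ) (z : ℂ) : ℂ := z + (q0 : ℂ) ^ 2 / z

theorem mu_im (q0 : ℝ) (z : ℂ) : (mu q0 z).im = z.im * (1 - q0 ^ 2 / ‖z‖ ^ 2) := by
  have h : (q0 : ℂ) ^ 2 / z = ((q0 ^ 2 : ℝ) : ℂ) * z⁻¹ := by push_cast; rw [div_eq_mul_inv]
  rw [mu, h, add_im, Complex.im_ofReal_mul, Complex.inv_im, Complex.normSq_eq_norm_sq]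
  ring

/-- Im μ has the sign of (|z|² - q₀²) Im z, so exp(iμs) is bounded for s ≥ 0 on this set. As zμ = (z
- iq₀)(z + iq₀), μ vanishes only at the branch points, which Σ₀ omits. -/
theorem mem_DS {q0 : ℝ} {z : ℂ} (hz : z ∈ Dplus q0 ∪ Sigma0 q0) :
    z ≠ 0 ∧ mu q0 z ≠ 0 ∧ 0 ≤ (mu q0 z).im := by
  have hz0 : z ≠ 0 := by
    rintro rfl
    rcases hz with hz | hz
    · simp [Dplus] at hz
    · exact hz.2.1 rfl
  have hn : 0 < ‖z‖ := norm_pos_iff.2 hz0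
  have him : (mu q0 z).im = ((‖z‖ ^ 2 - q0 ^ 2) * z.im) / ‖z‖ ^ 2 := by
    rw [mu_im]; field_simp
  rcases hz with hz | ⟨h1, _, h3, h4⟩
  · have h : 0 < (mu q0 z).im := by rw [him]; exact div_pos hz (by positivity)
    exact ⟨hz0, fun h0 => by rw [h0] at h; simp at h, h.le⟩
  · refine ⟨hz0, fun h0 => ?_, ?_⟩
    · have : (z - I * q0) * (z + I * q0) = 0 := by
        have h5 : z * mu q0 z = 0 := by rw [h0, mul_zero]
        rw [mu, mul_add, mul_div_cancel₀ _ hz0] at h5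
        linear_combination h5 - (q0 : ℂ) ^ 2 * I_sq
      rcases mul_eq_zero.1 this with h | h
      · exact h3 (sub_eq_zero.1 h)
      · exact h4 (eq_neg_of_add_eq_zero_left h)
    · rw [him]
      rcases h1 with h | h <;> simp [h]

theorem isOpen_Dplus (q0 : ℝ) : IsOpen (Dplus q0) :=
  isOpen_lt continuous_const (by fun_prop)

theorem isOpen_Dminus (q0 : ℝ) : IsOpen (Dminus q0) :=
  isOpen_lt (by fun_prop) continuous_const

/-- A potential on the line with a limit `rm` at `-∞`. -/
structure Potential (q0 : ℝ) (r : ℝ → ℂ) (rm : ℂ) : Prop where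
  pos : 0 < q0
  norm_rm : ‖rm‖ = q0
  contDiff : ContDiff ℝ 2 r
  tendsto : Tendsto r atBot (𝓝 rm)
  weighted : IntegrableOn (fun x : ℝ => (1 + |x|) * ‖r x - rm‖) (Set.Iic 0)
  deriv_one : Integrable (deriv r)
  deriv_two : Integrable (iteratedDeriv 2 r)

theorem Potential.mul_conj {q0 : ℝ} {r : ℝ → ℂ} {rm : ℂ} (h : Potential q0 r rm) :
    rm * conj rm = (q0 : ℂ) ^ 2 := by
  rw [Complex.mul_conj, Complex.normSq_eq_norm_sq, h.norm_rm]; push_cast; ring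

/-- The first column of the modified Jost matrix for the potential `r`. -/
structure IsModel (q0 : ℝ) (r : ℝ → ℂ) (rm : ℂ) (z : ℂ) (a b : ℝ → ℂ) : Prop where
  deriv_a : ∀ x, HasDerivAt a (I * q0 ^ 2 / z * a x + r x * b x) x
  deriv_b : ∀ x, HasDerivAt b (-conj (r x) * a x + I * z * b x) x
  tendsto_a : Tendsto a atBot (𝓝 1)
  tendsto_b : Tendsto b atBot (𝓝 (-(I / z) * conj rm))

/-- `(exp (i μ s) - 1) / (i μ)`. -/
def kerE (q0 : ℝ) (z : ℂ) (s : ℝ) : ℂ := (exp (I * mu q0 z * s) - 1) / (I * mu q0 z)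

/-- Mean value inequality on the left half plane, which is convex and where |exp| ≤ 1. -/
theorem norm_exp_sub_one_le {w : ℂ} (hw : w.re ≤ 0) : ‖exp w - 1‖ ≤ ‖w‖ := by
  have h := (convex_halfSpace_re_le (0 : ℝ)).norm_image_sub_le_of_norm_hasDerivWithin_le
    (f := exp) (f' := exp) (C := 1) (fun x _ => (hasDerivAt_exp x).hasDerivWithinAt)
    (fun x hx => by rw [norm_exp]; exact Real.exp_le_one_iff.2 hx) (x := 0) (y := w) (by simp) hw
  simpa using h

/-- This bound does not degenerate as μ → 0, hence is uniform up to the branch points. Its price is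
the factor s, for which the weight 1 + |x| in the integrability hypothesis pays. -/
theorem norm_kerE_le {q0 : ℝ} {z : ℂ} (hm : mu q0 z ≠ 0) (him : 0 ≤ (mu q0 z).im) {s : ℝ}
    (hs : 0 ≤ s) : ‖kerE q0 z s‖ ≤ s := by
  have h1 : ‖exp (I * mu q0 z * s) - 1‖ ≤ ‖I * mu q0 z * s‖ := by
    refine norm_exp_sub_one_le ?_
    have : (I * mu q0 z * s).re = -((mu q0 z).im * s) := by simp [mul_assoc]
    rw [this]
    have := mul_nonneg him hs
    linarith
  have h0 : 0 < ‖I * mu q0 z‖ := norm_pos_iff.2 (mul_ne_zero I_ne_zero hm)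
  rw [kerE, norm_div, div_le_iff₀ h0]
  refine h1.trans (le_of_eq ?_)
  rw [norm_mul _ (s : ℂ), Complex.norm_real, Real.norm_eq_abs, abs_of_nonneg hs, mul_comm]

/-- For fixed z, a bound independent of s; it kills the boundary term at -∞ in the derivation of the
Volterra equation. -/
theorem norm_kerE_le' {q0 : ℝ} {z : ℂ} (him : 0 ≤ (mu q0 z).im) {s : ℝ}
    (hs : 0 ≤ s) : ‖kerE q0 z s‖ ≤ 2 / ‖mu q0 z‖ := by
  have h1 : ‖exp (I * mu q0 z * s)‖ ≤ 1 := by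
    rw [norm_exp]
    refine Real.exp_le_one_iff.2 ?_
    have : (I * mu q0 z * s).re = -((mu q0 z).im * s) := by simp [mul_assoc]
    rw [this]
    have := mul_nonneg him hs
    linarith
  rw [kerE, norm_div, norm_mul, norm_I, one_mul]
  refine div_le_div_of_nonneg_right ?_ (norm_nonneg _)
  refine (norm_sub_le _ _).trans ?_
  rw [norm_one]; linarith

/-- The kernel of the Volterra equation of the model column. -/
def modelKer (q0 : ℝ) (r : ℝ → ℂ) (rm : ℂ) (z : ℂ) (x y : ℝ) (v : ℂ × ℂ) : ℂ × ℂ :=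
  ((r y - rm) * v.2 + kerE q0 z (x - y) *
      (I * q0 ^ 2 / z * ((r y - rm) * v.2) - rm * (conj (r y - rm) * v.1)),
   -(conj (r y - rm) * v.1) - kerE q0 z (x - y) *
      (conj rm * ((r y - rm) * v.2) + I * z * (conj (r y - rm) * v.1)))

/-- The source term of the Volterra equation of the model column. -/
def modelSrc (rm : ℂ) (z : ℂ) : ℂ × ℂ := (1, -(I / z) * conj rm)

theorem modelKer_sub (q0 : ℝ) (r : ℝ → ℂ) (rm z : ℂ) (x y : ℝ) (v w : ℂ × ℂ) :
    modelKer q0 r rm z x y v - modelKer q0 r rm z x y w = modelKer q0 r rm z x y (v - w) := by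
  ext <;> simp [modelKer] <;> ring

namespace Potential

variable {q0 : ℝ} {r : ℝ → ℂ} {rm : ℂ} (h : Potential q0 r rm)
include h

theorem continuous : Continuous r := h.contDiff.continuous

theorem weighted' (x : ℝ) : IntegrableOn (fun x : ℝ => (1 + |x|) * ‖r x - rm‖) (Set.Iic x) := by
  have hc : Continuous fun x : ℝ => (1 + |x|) * ‖r x - rm‖ := by
    have := h.continuous
    fun_prop
  rcases le_total x 0 with hx | hx
  · exact h.weighted.mono_set (Set.Iic_subset_Iic.2 hx)
  · rw [← Set.Iic_union_Icc_eq_Iic hx]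
    exact h.weighted.union hc.integrableOn_Icc

/-- The majorant of the kernel. -/
theorem integrable_majorant (A B x : ℝ) :
    IntegrableOn (fun y : ℝ => (1 + A * (B + |y|)) * ‖r y - rm‖) (Set.Iic x) := by
  have hc : Continuous fun y : ℝ => (1 + A * (B + |y|)) * ‖r y - rm‖ := by
    have := h.continuous
    fun_prop
  refine Integrable.mono' ((h.weighted' x).const_mul (1 + |A| * (|B| + 1)))
    hc.aestronglyMeasurable (ae_of_all _ fun y => ?_)
  rw [norm_mul, norm_norm, ← mul_assoc]
  refine mul_le_mul_of_nonneg_right ?_ (norm_nonneg _)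
  rw [Real.norm_eq_abs]
  refine (abs_add_le _ _).trans ?_
  rw [abs_one, abs_mul]
  have h1 : abs (B + |y|) ≤ |B| + |y| := (abs_add_le _ _).trans (by rw [abs_abs])
  have h2 := mul_le_mul_of_nonneg_left h1 (abs_nonneg A)
  have := abs_nonneg A
  have := abs_nonneg B
  have := abs_nonneg y
  have := mul_nonneg (abs_nonneg A) (mul_nonneg (abs_nonneg B) (abs_nonneg y))
  nlinarith

/-- The annulus ρ1 ≤ |z| ≤ ρ2 bounds the coefficients q₀²/z and z of the background matrix, and |x0|
+ |y| bounds x - y. The majorant no longer contains z or x. -/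
theorem norm_modelKer_le {z : ℂ} (hz : z ∈ Dplus q0 ∪ Sigma0 q0) {ρ1 ρ2 : ℝ} (hρ : 0 < ρ1)
    (h1 : ρ1 ≤ ‖z‖) (h2 : ‖z‖ ≤ ρ2) {x0 x y : ℝ} (hx : x ≤ x0) (hy : y ≤ x) (v : ℂ × ℂ) :
    ‖modelKer q0 r rm z x y v‖ ≤
      (1 + (q0 ^ 2 / ρ1 + q0 + ρ2) * (|x0| + |y|)) * ‖r y - rm‖ * ‖v‖ := by
  obtain ⟨hz0, hm, him⟩ := mem_DS hz
  have hE : ‖kerE q0 z (x - y)‖ ≤ |x0| + |y| := by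
    refine (norm_kerE_le hm him (sub_nonneg.2 hy)).trans ?_
    have := le_abs_self x0
    have := neg_abs_le y
    linarith
  have hq := h.pos
  have hz1 : ‖I * (q0 : ℂ) ^ 2 / z‖ ≤ q0 ^ 2 / ρ1 := by
    rw [norm_div, norm_mul, norm_I, one_mul, norm_pow, Complex.norm_real, Real.norm_eq_abs,
      abs_of_pos hq]
    gcongr
  have hd : ‖(r y - rm) * v.2‖ ≤ ‖r y - rm‖ * ‖v‖ := by
    rw [norm_mul]; gcongr; exact norm_snd_le v
  have hd' : ‖conj (r y - rm) * v.1‖ ≤ ‖r y - rm‖ * ‖v‖ := by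
    rw [norm_mul, RCLike.norm_conj]; gcongr; exact norm_fst_le v
  set D := ‖r y - rm‖ * ‖v‖ with hD
  have hD0 : 0 ≤ D := by positivity
  have hρ2 : 0 ≤ ρ2 := (norm_nonneg _).trans h2
  have hq1 : 0 ≤ q0 ^ 2 / ρ1 := by positivity
  set e := |x0| + |y| with he
  have he0 : 0 ≤ e := by positivity
  have fin : ∀ A : ℝ, A ≤ q0 ^ 2 / ρ1 + q0 + ρ2 → D + e * (A * D) ≤
      (1 + (q0 ^ 2 / ρ1 + q0 + ρ2) * e) * ‖r y - rm‖ * ‖v‖ := by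
    intro A hA
    have : (1 + (q0 ^ 2 / ρ1 + q0 + ρ2) * e) * ‖r y - rm‖ * ‖v‖ =
      D + e * ((q0 ^ 2 / ρ1 + q0 + ρ2) * D) := by rw [hD]; ring
    rw [this]
    gcongr
  refine norm_prod_le_iff.2 ⟨?_, ?_⟩
  · refine le_trans ?_ (fin (q0 ^ 2 / ρ1 + q0) (by linarith))
    refine (norm_add_le _ _).trans (add_le_add hd ?_)
    rw [norm_mul]
    refine mul_le_mul hE ?_ (norm_nonneg _) he0
    refine (norm_sub_le _ _).trans ?_
    rw [norm_mul, norm_mul rm, h.norm_rm, add_mul]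
    gcongr
  · refine le_trans ?_ (fin (q0 + ρ2) (by linarith))
    refine (norm_sub_le _ _).trans (add_le_add (by rwa [norm_neg]) ?_)
    rw [norm_mul]
    refine mul_le_mul hE ?_ (norm_nonneg _) he0
    refine (norm_add_le _ _).trans ?_
    rw [norm_mul, norm_mul (I * z), norm_mul I, norm_I, one_mul, RCLike.norm_conj, h.norm_rm,
      add_mul]
    gcongr

theorem volterraData {Z : Set ℂ} {ρ1 ρ2 : ℝ} (hρ : 0 < ρ1)
    (hZ : ∀ z ∈ Z, z ∈ Dplus q0 ∪ Sigma0 q0 ∧ ρ1 ≤ ‖z‖ ∧ ‖z‖ ≤ ρ2) (x0 : ℝ) {Y : ℂ → ℂ × ℂ}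
    {C0 : ℝ} (hY : ∀ z ∈ Z, ‖Y z‖ ≤ C0) (hρ2 : 0 ≤ ρ2) :
    VolterraData Z x0 (fun y => (1 + (q0 ^ 2 / ρ1 + q0 + ρ2) * (|x0| + |y|)) * ‖r y - rm‖)
      (modelKer q0 r rm) Y C0 where
  cont := by have := h.continuous; fun_prop
  integrable := h.integrable_majorant _ _
  nonneg y := by have := h.pos; positivity
  bound z hz x hx y hy v w := by
    rw [modelKer_sub]
    exact h.norm_modelKer_le (hZ z hz).1 hρ (hZ z hz).2.1 (hZ z hz).2.2 hx hy _
  map_zero z x y := by simp [modelKer]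
  meas z f hf := by
    have hr := h.continuous.measurable
    have hk : Measurable fun p : ℝ × ℝ => kerE q0 z (p.1 - p.2) := by
      unfold kerE
      fun_prop
    have hf2 : Measurable fun p : ℝ × ℝ => f p.2 := hf.comp measurable_snd
    have hrc : Measurable fun p : ℝ × ℝ => conj (r p.2 - rm) :=
      Complex.continuous_conj.measurable.comp (by fun_prop)
    unfold modelKer
    fun_prop
  source := hY

end Potential

namespace IsModel

variable {q0 : ℝ} {r : ℝ → ℂ} {rm : ℂ} {z : ℂ} {a b : ℝ → ℂ}

theorem continuous_a (hM : IsModel q0 r rm z a b) : Continuous a :=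
  continuous_iff_continuousAt.2 fun x => (hM.deriv_a x).continuousAt

theorem continuous_b (hM : IsModel q0 r rm z a b) : Continuous b :=
  continuous_iff_continuousAt.2 fun x => (hM.deriv_b x).continuousAt

theorem exists_bound (hM : IsModel q0 r rm z a b) (x0 : ℝ) :
    ∃ B, ∀ x ≤ x0, ‖((a x, b x) : ℂ × ℂ)‖ ≤ B := by
  obtain ⟨B1, h1⟩ := exists_norm_le_Iic hM.continuous_a hM.tendsto_a x0
  obtain ⟨B2, h2⟩ := exists_norm_le_Iic hM.continuous_b hM.tendsto_b x0
  exact ⟨max B1 B2, fun x hx => norm_prod_le_iff.2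
    ⟨(h1 x hx).trans (le_max_left _ _), (h2 x hx).trans (le_max_right _ _)⟩⟩

/-- Variation of constants about the background matrix L = [[iq₀²/z, rm], [-rm*, iz]]. It has trace
iμ and determinant 0, so L² = iμL and exp(sL) = 1 + `kerE`(s) L. The function g below is exp((x -
y)L) applied to (a, b)(y), and its derivative contains only the perturbation r - rm. -/
theorem volterra (hM : IsModel q0 r rm z a b) (h : Potential q0 r rm)
    (hz : z ∈ Dplus q0 ∪ Sigma0 q0) (x : ℝ) :
    ((a x, b x) : ℂ × ℂ) = modelSrc rm z + ∫ y in Set.Iic x, modelKer q0 r rm z x y (a y, b y) := by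
  obtain ⟨hz0, hm, him⟩ := mem_DS hz
  set g : ℝ → ℂ × ℂ := fun y =>
    (a y + kerE q0 z (x - y) * (I * q0 ^ 2 / z * a y + rm * b y),
     b y + kerE q0 z (x - y) * (-conj rm * a y + I * z * b y)) with hg
  have hEd : ∀ y : ℝ, HasDerivAt (fun y : ℝ => kerE q0 z (x - y))
      (-(1 + I * mu q0 z * kerE q0 z (x - y))) y := by
    intro y
    have h1 : HasDerivAt (fun y : ℝ => I * mu q0 z * ((x - y : ℝ) : ℂ)) (-(I * mu q0 z)) y := by
      have := (((hasDerivAt_id y).const_sub x).ofReal_comp).const_mul (I * mu q0 z)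
      simpa using this
    have h2 := (h1.cexp.sub_const 1).div_const (I * mu q0 z)
    refine h2.congr_deriv ?_
    have : I * mu q0 z ≠ 0 := mul_ne_zero I_ne_zero hm
    simp only [kerE]
    field_simp
    ring
  have hmu : I * mu q0 z = I * q0 ^ 2 / z + I * z := by simp only [mu]; ring
  -- This is det L = 0.
  have hcc : I * q0 ^ 2 / z * (I * z) = - (rm * conj rm) := by
    rw [h.mul_conj]; field_simp; rw [I_sq]; ring
  have hgd : ∀ y, HasDerivAt g (modelKer q0 r rm z x y (a y, b y)) y := by
    intro y
    have ha := hM.deriv_a y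
    have hb := hM.deriv_b y
    have hE := hEd y
    have d1 := ha.add (hE.mul ((ha.const_mul (I * q0 ^ 2 / z)).add (hb.const_mul rm)))
    have d2 := hb.add (hE.mul ((ha.const_mul (-conj rm)).add (hb.const_mul (I * z))))
    refine (d1.prodMk d2).congr_deriv ?_
    simp only [modelKer, Pi.add_apply]
    rw [hmu]
    set c1 := I * q0 ^ 2 / z
    set c2 := I * z
    ext
    · simp only [map_sub]
      linear_combination (-kerE q0 z (x - y) * a y) * hcc
    · simp only [map_sub]
      linear_combination (-kerE q0 z (x - y) * b y) * hcc
  -- The boundary vector lies in the kernel of L, so L(a, b) → 0 at -∞, and the bounded factor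
  -- `kerE` leaves no contribution there.
  have hAa : Tendsto (fun y => I * q0 ^ 2 / z * a y + rm * b y) atBot (𝓝 0) := by
    have := (hM.tendsto_a.const_mul (I * q0 ^ 2 / z)).add (hM.tendsto_b.const_mul rm)
    convert this using 2
    linear_combination (I / z) * h.mul_conj
  have hAb : Tendsto (fun y => -conj rm * a y + I * z * b y) atBot (𝓝 0) := by
    have := (hM.tendsto_a.const_mul (-conj rm)).add (hM.tendsto_b.const_mul (I * z))
    convert this using 2
    field_simp
    rw [I_sq]; ring
  have hEb : ∀ᶠ y in atBot, ‖kerE q0 z (x - y)‖ ≤ 2 / ‖mu q0 z‖ := by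
    filter_upwards [eventually_le_atBot x] with y hy
    exact norm_kerE_le' him (sub_nonneg.2 hy)
  have hEA : ∀ f : ℝ → ℂ, Tendsto f atBot (𝓝 0) →
      Tendsto (fun y => kerE q0 z (x - y) * f y) atBot (𝓝 0) := fun f hf =>
    squeeze_zero_norm' (a := fun y => 2 / ‖mu q0 z‖ * ‖f y‖) (hEb.mono fun y hy => by
      rw [norm_mul]; exact mul_le_mul_of_nonneg_right hy (norm_nonneg _))
      (by simpa using hf.norm.const_mul (2 / ‖mu q0 z‖))
  have hglim : Tendsto g atBot (𝓝 (modelSrc rm z)) := by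
    refine Tendsto.prodMk_nhds ?_ ?_
    · simpa using hM.tendsto_a.add (hEA _ hAa)
    · simpa using hM.tendsto_b.add (hEA _ hAb)
  obtain ⟨B, hB⟩ := hM.exists_bound x
  have vd := h.volterraData (Z := {z}) (norm_pos_iff.2 hz0) (ρ2 := ‖z‖)
    (fun w hw => by rw [Set.mem_singleton_iff.1 hw]; exact ⟨hz, le_rfl, le_rfl⟩) x
    (Y := modelSrc rm) (C0 := ‖modelSrc rm z‖)
    (fun w hw => by rw [Set.mem_singleton_iff.1 hw]) (norm_nonneg _)
  have hint := vd.integrableOn_kernel (f := fun y => (a y, b y))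
    (hM.continuous_a.measurable.prodMk hM.continuous_b.measurable) (Set.mem_singleton z) le_rfl hB
  rw [integral_Iic_of_hasDerivAt_of_tendsto' (fun y _ => hgd y) hint hglim]
  ext <;> simp [hg, kerE]

/-- The difference of two solutions satisfies the homogeneous Volterra equation, so the Gronwall
bound with vanishing source applies. -/
theorem unique {a' b' : ℝ → ℂ} (h : Potential q0 r rm) (hz : z ∈ Dplus q0 ∪ Sigma0 q0)
    (hM : IsModel q0 r rm z a b) (hM' : IsModel q0 r rm z a' b') : a = a' ∧ b = b' := by
  obtain ⟨hz0, hm, him⟩ := mem_DS hz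
  have key : ∀ x, ((a x - a' x, b x - b' x) : ℂ × ℂ) = 0 := by
    intro x
    have vd := h.volterraData (Z := {z}) (norm_pos_iff.2 hz0) (ρ2 := ‖z‖)
      (fun w hw => by rw [Set.mem_singleton_iff.1 hw]; exact ⟨hz, le_rfl, le_rfl⟩) x
      (Y := fun _ => 0) (C0 := 0) (fun w hw => by simp) (norm_nonneg _)
    obtain ⟨B, hB⟩ := hM.exists_bound x
    obtain ⟨B', hB'⟩ := hM'.exists_bound x
    have := vd.norm_le (u := fun _ y => ((a y, b y) : ℂ × ℂ) - (a' y, b' y))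
      (fun _ _ => (hM.continuous_a.measurable.prodMk hM.continuous_b.measurable).sub
        (hM'.continuous_a.measurable.prodMk hM'.continuous_b.measurable))
      (fun _ _ => ⟨B + B', fun y hy => (norm_sub_le _ _).trans (add_le_add (hB y hy) (hB' y hy))⟩)
      (fun w hw y hy => by
        rw [Set.mem_singleton_iff.1 hw, hM.volterra h hz y, hM'.volterra h hz y,
          add_sub_add_left_eq_sub, zero_add, ← integral_sub]
        · refine integral_congr_ae (ae_of_all _ fun s => ?_)
          exact modelKer_sub q0 r rm z y s _ _
        · exact vd.integrableOn_kernel (f := fun y => (a y, b y))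
            (hM.continuous_a.measurable.prodMk hM.continuous_b.measurable)
            (Set.mem_singleton z) hy (fun s hs => hB s (hs.trans hy))
        · exact vd.integrableOn_kernel (f := fun y => (a' y, b' y))
            (hM'.continuous_a.measurable.prodMk hM'.continuous_b.measurable)
            (Set.mem_singleton z) hy (fun s hs => hB' s (hs.trans hy)))
      (Set.mem_singleton z) (le_refl x)
    simpa using this
  refine ⟨funext fun x => ?_, funext fun x => ?_⟩
  · exact sub_eq_zero.1 (congrArg Prod.fst (key x))
  · exact sub_eq_zero.1 (congrArg Prod.snd (key x))

end IsModel

/-- A family of model columns, one for each `z ∈ D⁺ ∪ Σ₀`. -/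
def ModelFamily (q0 : ℝ) (r : ℝ → ℂ) (rm : ℂ) (a b : ℂ → ℝ → ℂ) : Prop :=
  ∀ z ∈ Dplus q0 ∪ Sigma0 q0, IsModel q0 r rm z (a z) (b z)

namespace ModelFamily

variable {q0 : ℝ} {r : ℝ → ℂ} {rm : ℂ} {a b : ℂ → ℝ → ℂ} (hF : ModelFamily q0 r rm a b)
  (h : Potential q0 r rm)

theorem norm_modelSrc_le {rm z : ℂ} {ρ1 : ℝ} (hρ : 0 < ρ1) (hz : ρ1 ≤ ‖z‖) :
    ‖modelSrc rm z‖ ≤ 1 + ‖rm‖ / ρ1 := by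
  have h1 : 0 ≤ ‖rm‖ / ρ1 := by positivity
  refine norm_prod_le_iff.2 ⟨by simp only [modelSrc, norm_one]; linarith, ?_⟩
  simp only [modelSrc]
  rw [norm_mul, norm_neg, norm_div, norm_I, RCLike.norm_conj, one_div_mul_eq_div]
  have : ‖rm‖ / ‖z‖ ≤ ‖rm‖ / ρ1 := by gcongr
  linarith

include hF h

/-- The constant is uniform over a whole annulus of D⁺ ∪ Σ₀. An annulus around |z| = q₀ thus gives
boundedness near ±iq₀, although these points themselves are excluded. -/
theorem exists_bound {ρ1 ρ2 : ℝ} (hρ : 0 < ρ1) (x : ℝ) :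
    ∃ C, ∀ z ∈ Dplus q0 ∪ Sigma0 q0, ρ1 ≤ ‖z‖ → ‖z‖ ≤ ρ2 → ‖a z x‖ ≤ C ∧ ‖b z x‖ ≤ C := by
  by_cases hρ2 : 0 ≤ ρ2
  swap
  · exact ⟨0, fun z _ _ h2 => absurd ((norm_nonneg z).trans h2) hρ2⟩
  set Z : Set ℂ := {z | z ∈ Dplus q0 ∪ Sigma0 q0 ∧ ρ1 ≤ ‖z‖ ∧ ‖z‖ ≤ ρ2}
  have vd := h.volterraData (Z := Z) hρ (fun z hz => hz) x
    (Y := modelSrc rm) (fun z hz => norm_modelSrc_le hρ hz.2.1) hρ2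
  have := fun z (hz : z ∈ Z) => vd.norm_le (u := fun z y => (a z y, b z y))
    (fun z hz => (hF z hz.1).continuous_a.measurable.prodMk (hF z hz.1).continuous_b.measurable)
    (fun z hz => (hF z hz.1).exists_bound x) (fun z hz y _ => (hF z hz.1).volterra h hz.1 y) hz
    (le_refl x)
  exact ⟨_, fun z hz h1 h2 => norm_prod_le_iff.1 (this z ⟨hz, h1, h2⟩)⟩

theorem continuousOn (x : ℝ) :
    ContinuousOn (fun z => a z x) (Dplus q0 ∪ Sigma0 q0) ∧
    ContinuousOn (fun z => b z x) (Dplus q0 ∪ Sigma0 q0) := by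
  have key : ContinuousOn (fun z => (a z x, b z x)) (Dplus q0 ∪ Sigma0 q0) := by
    intro z0 hz0
    have hn : 0 < ‖z0‖ := norm_pos_iff.2 (mem_DS hz0).1
    -- A relative neighbourhood of z0 inside an annulus, on which the Volterra majorant is uniform.
    set Z : Set ℂ := (Dplus q0 ∪ Sigma0 q0) ∩ {z | ‖z0‖ / 2 < ‖z‖ ∧ ‖z‖ < 2 * ‖z0‖} with hZ
    have vd := h.volterraData (Z := Z) (half_pos hn) (ρ2 := 2 * ‖z0‖)
      (fun z hz => ⟨hz.1, hz.2.1.le, hz.2.2.le⟩) x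
      (Y := modelSrc rm) (fun z hz => norm_modelSrc_le (half_pos hn) hz.2.1.le) (by positivity)
    have hne : ∀ z ∈ Z, z ≠ 0 ∧ mu q0 z ≠ 0 := fun z hz =>
      ⟨(mem_DS hz.1).1, (mem_DS hz.1).2.1⟩
    have hc := vd.continuousOn (u := fun z y => (a z y, b z y))
      (fun z hz => (hF z hz.1).continuous_a.measurable.prodMk (hF z hz.1).continuous_b.measurable)
      (fun z hz => (hF z hz.1).exists_bound x) (fun z hz y _ => (hF z hz.1).volterra h hz.1 y)
      (by
        unfold modelSrc
        fun_prop (disch := exact fun z hz => (hne z hz).1))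
      (by
        intro s y f hf
        have hmu : ContinuousOn (mu q0) Z := by
          unfold mu
          fun_prop (disch := exact fun z hz => (hne z hz).1)
        have hk : ContinuousOn (fun z => kerE q0 z (s - y)) Z := by
          unfold kerE
          fun_prop (disch := exact fun z hz => mul_ne_zero I_ne_zero (hne z hz).2)
        have hq : ContinuousOn (fun z => I * (q0 : ℂ) ^ 2 / z) Z := by
          fun_prop (disch := exact fun z hz => (hne z hz).1)
        unfold modelKer
        fun_prop)
      (le_refl x)
    refine (hc z0 ⟨hz0, by simp only [Set.mem_ofPred_eq]; constructor <;> linarith⟩).mono_of_mem_nhdsWithin ?_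
    rw [hZ]
    refine inter_mem_nhdsWithin _ (IsOpen.mem_nhds ?_ (by
      simp only [Set.mem_ofPred_eq]; constructor <;> linarith))
    exact (isOpen_lt continuous_const continuous_norm).inter
      (isOpen_lt continuous_norm continuous_const)
  exact ⟨continuous_fst.comp_continuousOn key, continuous_snd.comp_continuousOn key⟩

theorem differentiableOn (x : ℝ) :
    DifferentiableOn ℂ (fun z => a z x) (Dplus q0) ∧
    DifferentiableOn ℂ (fun z => b z x) (Dplus q0) := by
  have key : DifferentiableOn ℂ (fun z => (a z x, b z x)) (Dplus q0) := by
    intro z0 hz0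
    have hn : 0 < ‖z0‖ := norm_pos_iff.2 (mem_DS (Or.inl hz0)).1
    set Z : Set ℂ := Dplus q0 ∩ {z | ‖z0‖ / 2 < ‖z‖ ∧ ‖z‖ < 2 * ‖z0‖} with hZ
    have hZo : IsOpen Z := (isOpen_Dplus q0).inter
      ((isOpen_lt continuous_const continuous_norm).inter
      (isOpen_lt continuous_norm continuous_const))
    have vd := h.volterraData (Z := Z) (half_pos hn) (ρ2 := 2 * ‖z0‖)
      (fun z hz => ⟨Or.inl hz.1, hz.2.1.le, hz.2.2.le⟩) x
      (Y := modelSrc rm) (fun z hz => norm_modelSrc_le (half_pos hn) hz.2.1.le) (by positivity)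
    have hne : ∀ z ∈ Z, z ≠ 0 ∧ mu q0 z ≠ 0 := fun z hz =>
      ⟨(mem_DS (Or.inl hz.1)).1, (mem_DS (Or.inl hz.1)).2.1⟩
    have hc := vd.differentiableOn (u := fun z y => (a z y, b z y))
      (fun z hz => (hF z (Or.inl hz.1)).continuous_a.measurable.prodMk
        (hF z (Or.inl hz.1)).continuous_b.measurable)
      (fun z hz => (hF z (Or.inl hz.1)).exists_bound x)
      (fun z hz y _ => (hF z (Or.inl hz.1)).volterra h (Or.inl hz.1) y) hZo
      (by
        unfold modelSrc
        fun_prop (disch := exact fun z hz => (hne z hz).1))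
      (by
        intro s y f hf
        have hmu : DifferentiableOn ℂ (mu q0) Z := by
          unfold mu
          fun_prop (disch := exact fun z hz => (hne z hz).1)
        have hk : DifferentiableOn ℂ (fun z => kerE q0 z (s - y)) Z := by
          exact ((((hmu.const_mul I).mul_const _).cexp).sub_const 1).div (hmu.const_mul I)
            fun z hz => mul_ne_zero I_ne_zero (hne z hz).2
        have hq : DifferentiableOn ℂ (fun z => I * (q0 : ℂ) ^ 2 / z) Z := by
          fun_prop (disch := exact fun z hz => (hne z hz).1)
        unfold modelKer
        fun_prop)
      (le_refl x)
    have hmem : z0 ∈ Z := ⟨hz0, by simp only [Set.mem_ofPred_eq]; constructor <;> linarith⟩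
    exact (hc.differentiableAt (hZo.mem_nhds hmem)).differentiableWithinAt
  exact ⟨key.fst, key.snd⟩

end ModelFamily

/-! ## Behaviour of the model column for large `z` -/

/-- The least bounds of |v₁| and |v₂| on the half line satisfy inequalities in terms of each other;
being least, they may be absorbed into the left sides. -/
theorem exists_least_bound {f : ℝ → ℝ} {x B : ℝ} (hB : ∀ y ≤ x, f y ≤ B) :
    ∃ V, (∀ y ≤ x, f y ≤ V) ∧ ∀ c, (∀ y ≤ x, f y ≤ c) → V ≤ c := by
  refine ⟨sSup (f '' Set.Iic x), fun y hy => ?_, fun c hc => ?_⟩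
  · exact le_csSup ⟨B, by rintro _ ⟨s, hs, rfl⟩; exact hB s hs⟩ ⟨y, hy, rfl⟩
  · exact csSup_le ⟨f x, x, le_refl x, rfl⟩ (by rintro _ ⟨s, hs, rfl⟩; exact hc s hs)

/-- A scalar equation `c' = ν c + f` with `Re ν ≤ 0` and `c → 0` at `-∞`. -/
theorem norm_le_integral_of_damped {c f : ℝ → ℂ} {ν : ℂ} (hν : ν.re ≤ 0)
    (hc : ∀ y, HasDerivAt c (ν * c y + f y) y) (hc0 : Tendsto c atBot (𝓝 0)) (hf : Continuous f)
    {F : ℝ → ℝ} {x : ℝ} (hF : IntegrableOn F (Set.Iic x)) (hfF : ∀ y ≤ x, ‖f y‖ ≤ F y) :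
    ‖c x‖ ≤ ∫ y in Set.Iic x, F y := by
  -- Integrating factor of the equation, normalized to be 1 at y = x and of modulus at most 1 to the
  -- left of x.
  set p : ℝ → ℂ := fun y => exp (ν * ((x - y : ℝ) : ℂ)) with hp
  have hp1 : ∀ y ≤ x, ‖p y‖ ≤ 1 := fun y hy => by
    rw [hp, norm_exp]
    refine Real.exp_le_one_iff.2 ?_
    rw [Complex.re_mul_ofReal]
    exact mul_nonpos_of_nonpos_of_nonneg hν (sub_nonneg.2 hy)
  have hpd : ∀ y, HasDerivAt p (-ν * p y) y := by
    intro y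
    have h1 : HasDerivAt (fun y : ℝ => ν * ((x - y : ℝ) : ℂ)) (-ν) y := by
      simpa using (((hasDerivAt_id y).const_sub x).ofReal_comp).const_mul ν
    refine h1.cexp.congr_deriv ?_
    rw [hp]; ring
  have hpc : Continuous p := continuous_iff_continuousAt.2 fun y => (hpd y).continuousAt
  have hd : ∀ y, HasDerivAt (fun y => p y * c y) (p y * f y) y := fun y => by
    refine ((hpd y).mul (hc y)).congr_deriv ?_
    ring
  have hb : ∀ y ∈ Set.Iic x, ‖p y * f y‖ ≤ F y := fun y hy => by
    rw [norm_mul]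
    exact (mul_le_of_le_one_left (norm_nonneg _) (hp1 y hy)).trans (hfF y hy)
  have hint : IntegrableOn (fun y => p y * f y) (Set.Iic x) :=
    Integrable.mono' hF (hpc.mul hf).aestronglyMeasurable
      ((ae_restrict_iff' measurableSet_Iic).2 (ae_of_all _ hb))
  have hlim : Tendsto (fun y => p y * c y) atBot (𝓝 0) := by
    refine squeeze_zero_norm' ?_ (by simpa using hc0.norm)
    filter_upwards [eventually_le_atBot x] with y hy
    rw [norm_mul]
    exact mul_le_of_le_one_left (norm_nonneg _) (hp1 y hy)
  have h1 := integral_Iic_of_hasDerivAt_of_tendsto' (fun y _ => hd y) hint hlim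
  have h2 : c x = ∫ y in Set.Iic x, p y * f y := by rw [h1]; simp [hp]
  rw [h2]
  exact norm_integral_le_of_norm_le hF ((ae_restrict_iff' measurableSet_Iic).2 (ae_of_all _ hb))

/-- A system `v₁' = -ε v₁ + κ̃ v₂`, `v₂' = ν v₂ + κ v₁ + ε v₂` whose coefficients are small for
large `w`. -/
structure DiagonalSystem (x K w : ℝ) (ν : ℂ) (v1 v2 ε κ κt κ1 κ2 : ℝ → ℂ) (D0 D1 D2 : ℝ → ℝ) :
    Prop where
  one_le : 1 ≤ K
  large : 440 * K ^ 3 ≤ w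
  re_nonpos : ν.re ≤ 0
  norm_nu : w / 2 ≤ ‖ν‖
  deriv_v1 : ∀ y, HasDerivAt v1 (-ε y * v1 y + κt y * v2 y) y
  deriv_v2 : ∀ y, HasDerivAt v2 (ν * v2 y + κ y * v1 y + ε y * v2 y) y
  deriv_κ : ∀ y, HasDerivAt κ (κ1 y) y
  deriv_κ1 : ∀ y, HasDerivAt κ1 (κ2 y) y
  cont_ε : Continuous ε
  cont_κt : Continuous κt
  cont_κ2 : Continuous κ2
  le_ε : ∀ y ≤ x, ‖ε y‖ ≤ 4 * K / w * D0 y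
  le_κ : ∀ y ≤ x, ‖κ y‖ ≤ 3 * D0 y
  le_κt : ∀ y ≤ x, ‖κt y‖ ≤ 3 * D0 y
  le_κ1 : ∀ y ≤ x, ‖κ1 y‖ ≤ 3 * D1 y
  le_κ2 : ∀ y ≤ x, ‖κ2 y‖ ≤ 3 * D2 y
  nonneg0 : ∀ y, 0 ≤ D0 y
  nonneg1 : ∀ y, 0 ≤ D1 y
  nonneg2 : ∀ y, 0 ≤ D2 y
  D0_le : ∀ y ≤ x, D0 y ≤ K
  D1_le : ∀ y ≤ x, D1 y ≤ K
  int0 : IntegrableOn D0 (Set.Iic x)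
  int1 : IntegrableOn D1 (Set.Iic x)
  int2 : IntegrableOn D2 (Set.Iic x)
  integral0 : ∫ y in Set.Iic x, D0 y ≤ K
  integral1 : ∫ y in Set.Iic x, D1 y ≤ K
  integral2 : ∫ y in Set.Iic x, D2 y ≤ K
  tendsto_v1 : Tendsto v1 atBot (𝓝 1)
  tendsto_v2 : Tendsto v2 atBot (𝓝 0)
  tendsto_κ : Tendsto κ atBot (𝓝 0)
  tendsto_κ1 : Tendsto κ1 atBot (𝓝 0)

namespace DiagonalSystem

variable {x K w : ℝ} {ν : ℂ} {v1 v2 ε κ κt κ1 κ2 : ℝ → ℂ} {D0 D1 D2 : ℝ → ℝ}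
  (h : DiagonalSystem x K w ν v1 v2 ε κ κt κ1 κ2 D0 D1 D2)
include h

theorem damped {c f : ℝ → ℂ} {ν' : ℂ} (hν : ν'.re ≤ 0)
    (hc : ∀ y, HasDerivAt c (ν' * c y + f y) y) (hc0 : Tendsto c atBot (𝓝 0)) (hf : Continuous f)
    {A B C : ℝ} (hA : 0 ≤ A) (hB : 0 ≤ B) (hC : 0 ≤ C)
    (hfF : ∀ y ≤ x, ‖f y‖ ≤ A * D0 y + B * D1 y + C * D2 y) {y : ℝ} (hy : y ≤ x) :
    ‖c y‖ ≤ (A + B + C) * K := by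
  have hs : Set.Iic y ⊆ Set.Iic x := Set.Iic_subset_Iic.2 hy
  have i0 := (h.int0.mono_set hs).const_mul A
  have i1 := (h.int1.mono_set hs).const_mul B
  have i2 := (h.int2.mono_set hs).const_mul C
  refine (norm_le_integral_of_damped hν hc hc0 hf ((i0.add i1).add i2)
    (fun s hs => hfF s (hs.trans hy))).trans ?_
  have m : ∀ {D : ℝ → ℝ}, (∀ y, 0 ≤ D y) → IntegrableOn D (Set.Iic x) →
      ∫ y in Set.Iic x, D y ≤ K → ∫ s in Set.Iic y, D s ≤ K := fun h0 hi hK =>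
    (setIntegral_mono_set hi (ae_of_all _ h0) hs.eventuallyLE).trans hK
  have e : ∫ s in Set.Iic y, ((fun s => A * D0 s) + (fun s => B * D1 s) + fun s => C * D2 s) s =
      A * (∫ s in Set.Iic y, D0 s) + B * (∫ s in Set.Iic y, D1 s) + C * ∫ s in Set.Iic y, D2 s := by
    rw [integral_add' (i0.add i1) i2, integral_add' i0 i1, integral_const_mul, integral_const_mul,
      integral_const_mul]
  rw [e]
  have := mul_le_mul_of_nonneg_left (m h.nonneg0 h.int0 h.integral0) hA
  have := mul_le_mul_of_nonneg_left (m h.nonneg1 h.int1 h.integral1) hB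
  have := mul_le_mul_of_nonneg_left (m h.nonneg2 h.int2 h.integral2) hC
  linarith

theorem cont_v1 : Continuous v1 := continuous_iff_continuousAt.2 fun y => (h.deriv_v1 y).continuousAt
theorem cont_v2 : Continuous v2 := continuous_iff_continuousAt.2 fun y => (h.deriv_v2 y).continuousAt
theorem cont_κ : Continuous κ := continuous_iff_continuousAt.2 fun y => (h.deriv_κ y).continuousAt
theorem cont_κ1 : Continuous κ1 := continuous_iff_continuousAt.2 fun y => (h.deriv_κ1 y).continuousAt

theorem w_pos : 0 < w := by
  have := h.one_le
  have := h.large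
  have : (0 : ℝ) < 440 * K ^ 3 := by positivity
  linarith

theorem nu_ne : ν ≠ 0 := by
  have := h.w_pos
  have := h.norm_nu
  exact norm_pos_iff.1 (by linarith)

theorem inv_nu_le : ‖ν‖⁻¹ ≤ 2 / w := by
  have := h.w_pos
  have := h.norm_nu
  rw [← inv_div]
  exact inv_anti₀ (by positivity) (by assumption)

theorem norm_v1'_le {V W : ℝ} {y : ℝ} (hy : y ≤ x) (hV : ‖v1 y‖ ≤ V) (hW : ‖v2 y‖ ≤ W) :
    ‖-ε y * v1 y + κt y * v2 y‖ ≤ (4 * K / w * V + 3 * W) * D0 y := by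
  have hw := h.w_pos
  have hK := h.one_le
  have h0 := h.nonneg0 y
  have hV0 := (norm_nonneg _).trans hV
  have hW0 := (norm_nonneg _).trans hW
  refine (norm_add_le _ _).trans ?_
  rw [norm_mul, norm_neg, norm_mul]
  have t1 : ‖ε y‖ * ‖v1 y‖ ≤ (4 * K / w * D0 y) * V :=
    mul_le_mul (h.le_ε y hy) hV (norm_nonneg _) (by positivity)
  have t2 : ‖κt y‖ * ‖v2 y‖ ≤ (3 * D0 y) * W :=
    mul_le_mul (h.le_κt y hy) hW (norm_nonneg _) (by positivity)
  linarith

theorem v1_sub_one_le {V W : ℝ} (hV : ∀ y ≤ x, ‖v1 y‖ ≤ V) (hW : ∀ y ≤ x, ‖v2 y‖ ≤ W) {y : ℝ}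
    (hy : y ≤ x) : ‖v1 y - 1‖ ≤ (4 * K / w * V + 3 * W) * K := by
  have hw := h.w_pos
  have hK := h.one_le
  have hV0 := (norm_nonneg _).trans (hV y hy)
  have hW0 := (norm_nonneg _).trans (hW y hy)
  have := h.cont_v1
  have := h.cont_v2
  have := h.cont_ε
  have := h.cont_κt
  have := h.damped (c := fun y => v1 y - 1) (ν' := 0) (f := fun y => -ε y * v1 y + κt y * v2 y)
    (A := 4 * K / w * V + 3 * W) (B := 0) (C := 0) (by simp)
    (fun y => by simpa using (h.deriv_v1 y).sub_const 1)
    (by simpa using h.tendsto_v1.sub_const 1) (by fun_prop) (by positivity) le_rfl le_rfl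
    (fun s hs => by simpa using h.norm_v1'_le hs (hV s hs) (hW s hs)) hy
  simpa using this

/-- Integration by parts in differential form: the correction κv₁/ν cancels the forcing term κv₁,
which is not small, and leaves terms that carry a factor ε or 1/ν. -/
theorem hasDerivAt_d (y : ℝ) : HasDerivAt (fun y => v2 y + κ y * v1 y / ν)
    (ν * (v2 y + κ y * v1 y / ν) + (ε y * v2 y +
      (κ1 y * v1 y + κ y * (-ε y * v1 y + κt y * v2 y)) / ν)) y := by
  have hν := h.nu_ne
  refine ((h.deriv_v2 y).add (((h.deriv_κ y).mul (h.deriv_v1 y)).div_const ν)).congr_deriv ?_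
  field_simp
  ring

theorem tendsto_d : Tendsto (fun y => v2 y + κ y * v1 y / ν) atBot (𝓝 0) := by
  simpa using h.tendsto_v2.add ((h.tendsto_κ.mul h.tendsto_v1).div_const ν)

theorem v2_le {V W : ℝ} (hV : ∀ y ≤ x, ‖v1 y‖ ≤ V) (hW : ∀ y ≤ x, ‖v2 y‖ ≤ W) {y : ℝ}
    (hy : y ≤ x) : ‖v2 y‖ ≤ 36 * K ^ 2 / w * (V + W) := by
  have hw := h.w_pos
  have hK := h.one_le
  have hV0 := (norm_nonneg _).trans (hV y hy)
  have hW0 := (norm_nonneg _).trans (hW y hy)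
  have hKw : K ≤ w := by
    have := h.large
    have : K ≤ 440 * K ^ 3 := by nlinarith [sq_nonneg K]
    linarith
  have := h.cont_v1
  have := h.cont_v2
  have := h.cont_κ
  have := h.cont_κ1
  have := h.cont_ε
  have := h.cont_κt
  have key := h.damped (c := fun y => v2 y + κ y * v1 y / ν) (ν' := ν)
    (f := fun y => ε y * v2 y + (κ1 y * v1 y + κ y * (-ε y * v1 y + κt y * v2 y)) / ν)
    -- With ‖ν‖⁻¹ ≤ 2/w the terms in D0 add up to 4KW + 2·3K(4V + 3W) = 22KW + 24KV, and the term in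
    -- D1 is 2·3V.
    (A := (22 * K * W + 24 * K * V) / w) (B := 6 * V / w) (C := 0) h.re_nonpos h.hasDerivAt_d
    h.tendsto_d (by fun_prop) (by positivity) (by positivity) le_rfl
    (fun s hs => by
      have h0 := h.nonneg0 s
      have h1 := h.nonneg1 s
      have hD := h.D0_le s hs
      refine (norm_add_le _ _).trans ?_
      rw [norm_mul, norm_div, div_eq_mul_inv _ ‖ν‖]
      have t1 : ‖ε s‖ * ‖v2 s‖ ≤ (4 * K / w * D0 s) * W :=
        mul_le_mul (h.le_ε s hs) (hW s hs) (norm_nonneg _) (by positivity)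
      have t2 : ‖κ1 s * v1 s + κ s * (-ε s * v1 s + κt s * v2 s)‖ ≤
          3 * D1 s * V + 3 * K * ((4 * V + 3 * W) * D0 s) := by
        refine (norm_add_le _ _).trans (add_le_add ?_ ?_)
        · rw [norm_mul]
          exact mul_le_mul (h.le_κ1 s hs) (hV s hs) (norm_nonneg _) (by positivity)
        · rw [norm_mul]
          refine mul_le_mul ((h.le_κ s hs).trans (by linarith)) ?_ (norm_nonneg _) (by positivity)
          refine (h.norm_v1'_le hs (hV s hs) (hW s hs)).trans (mul_le_mul_of_nonneg_right ?_ h0)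
          have : 4 * K / w ≤ 4 := by rw [div_le_iff₀ hw]; linarith
          have := mul_le_mul_of_nonneg_right this hV0
          linarith
      have t3 := mul_le_mul t2 h.inv_nu_le (by positivity) (by positivity)
      have e : 4 * K / w * D0 s * W + (3 * D1 s * V + 3 * K * ((4 * V + 3 * W) * D0 s)) * (2 / w) =
        (22 * K * W + 24 * K * V) / w * D0 s + 6 * V / w * D1 s + 0 * D2 s := by ring
      linarith) hy
  have h5 : ‖κ y * v1 y / ν‖ ≤ (3 * K * V) * (2 / w) := by
    rw [norm_div, norm_mul, div_eq_mul_inv]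
    refine mul_le_mul (mul_le_mul ((h.le_κ y hy).trans ?_) (hV y hy) (norm_nonneg _) (by positivity))
      h.inv_nu_le (by positivity) (by positivity)
    have := h.D0_le y hy
    linarith
  have h6 : ‖v2 y‖ ≤ ‖v2 y + κ y * v1 y / ν‖ + ‖κ y * v1 y / ν‖ := by
    have := norm_sub_le (v2 y + κ y * v1 y / ν) (κ y * v1 y / ν)
    simpa using this
  refine h6.trans ((add_le_add key h5).trans ?_)
  have e : ((22 * K * W + 24 * K * V) / w + 6 * V / w + 0) * K + 3 * K * V * (2 / w) =
    (22 * K ^ 2 * W + 24 * K ^ 2 * V + 12 * K * V) / w := by ring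
  have e' : 36 * K ^ 2 / w * (V + W) = (36 * K ^ 2 * (V + W)) / w := by ring
  rw [e, e']
  gcongr
  have : K * V ≤ K ^ 2 * V := by
    rw [sq]; nlinarith [mul_nonneg (by linarith : 0 ≤ K) hV0]
  have : 0 ≤ K ^ 2 * W := by positivity
  nlinarith

/-- With V and W the suprema of |v₁| and |v₂|, W ≤ 72K²V/w after absorption, and then V ≤ 1 + (4K² +
3K·72K²)V/w. As 4K² + 216K³ ≤ 220K³, the threshold w ≥ 440K³ lets half of V be absorbed, whence V ≤
2. -/
theorem bounds : (∀ y ≤ x, ‖v1 y‖ ≤ 2) ∧ (∀ y ≤ x, ‖v2 y‖ ≤ 144 * K ^ 2 / w) := by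
  have hw := h.w_pos
  have hK := h.one_le
  have hL := h.large
  obtain ⟨B1, hB1⟩ := exists_norm_le_Iic h.cont_v1 h.tendsto_v1 x
  obtain ⟨B2, hB2⟩ := exists_norm_le_Iic h.cont_v2 h.tendsto_v2 x
  obtain ⟨V, hV, hV'⟩ := exists_least_bound hB1
  obtain ⟨W, hW, hW'⟩ := exists_least_bound hB2
  have hV0 := (norm_nonneg _).trans (hV x le_rfl)
  have hW0 := (norm_nonneg _).trans (hW x le_rfl)
  have e1 : W ≤ 36 * K ^ 2 / w * (V + W) := hW' _ fun y hy => h.v2_le hV hW hy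
  have e2 : V ≤ 1 + (4 * K / w * V + 3 * W) * K := hV' _ fun y hy => by
    have := h.v1_sub_one_le hV hW hy
    have h2 := norm_add_le (v1 y - 1) 1
    rw [sub_add_cancel, norm_one] at h2
    linarith
  have hK2 : K ^ 2 ≤ K ^ 3 := pow_le_pow_right₀ hK (by norm_num)
  have hK1 : K ≤ K ^ 3 := le_self_pow₀ hK (by norm_num)
  have e3 : W * w ≤ 36 * K ^ 2 * (V + W) := by
    rw [div_mul_eq_mul_div, le_div_iff₀ hw] at e1; exact e1
  have e4 : W * w ≤ 72 * K ^ 2 * V := by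
    have : 72 * K ^ 2 * W ≤ W * w := by
      rw [mul_comm W]; apply mul_le_mul_of_nonneg_right _ hW0
      have : 0 ≤ K ^ 3 := by positivity
      linarith
    linarith
  have e5 : V * w ≤ w + 4 * K ^ 2 * V + 3 * K * (W * w) := by
    have := mul_le_mul_of_nonneg_right e2 hw.le
    have e : (1 + (4 * K / w * V + 3 * W) * K) * w = w + 4 * K ^ 2 * V + 3 * K * (W * w) := by
      field_simp
      ring
    linarith
  have e6 : V ≤ 2 := by
    have h1 : 3 * K * (W * w) ≤ 3 * K * (72 * K ^ 2 * V) := by gcongr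
    have h2 : 4 * K ^ 2 * V ≤ 4 * K ^ 3 * V := by gcongr
    have h3 : 220 * K ^ 3 * V ≤ w / 2 * V := by
      apply mul_le_mul_of_nonneg_right _ hV0; linarith
    have : V * w ≤ 2 * w := by nlinarith
    exact le_of_mul_le_mul_right this hw
  refine ⟨fun y hy => (hV y hy).trans e6, fun y hy => (hW y hy).trans ?_⟩
  rw [le_div_iff₀ hw]
  have : 72 * K ^ 2 * V ≤ 72 * K ^ 2 * 2 := by gcongr
  linarith

theorem v1_estimate : ‖v1 x - 1‖ ≤ 440 * K ^ 3 / w := by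
  have hw := h.w_pos
  have hK := h.one_le
  refine (h.v1_sub_one_le h.bounds.1 h.bounds.2 le_rfl).trans ?_
  have e : (4 * K / w * 2 + 3 * (144 * K ^ 2 / w)) * K = (8 * K ^ 2 + 432 * K ^ 3) / w := by ring
  rw [e]
  gcongr
  have hK2 : K ^ 2 ≤ K ^ 3 := pow_le_pow_right₀ hK (by norm_num)
  linarith

/-- A second integration by parts: adding κ₁v₁/ν² removes the remaining term κ₁v₁/ν of order 1/w.
What is left is of order 1/w², but contains κ₂; this is where integrability of the second derivative
of the potential enters. -/
theorem v2_estimate : ‖v2 x + κ x * v1 x / ν‖ ≤ 9000 * K ^ 4 / w ^ 2 := by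
  have hw := h.w_pos
  have hK := h.one_le
  have hν := h.nu_ne
  have hL := h.large
  have hKw : K ≤ w := by
    have : K ≤ 440 * K ^ 3 := by nlinarith [sq_nonneg K]
    linarith
  have hw1 : 1 ≤ w := hK.trans hKw
  obtain ⟨hV, hW⟩ := h.bounds
  have := h.cont_v1
  have := h.cont_v2
  have := h.cont_κ
  have := h.cont_κ1
  have := h.cont_ε
  have := h.cont_κt
  have := h.cont_κ2
  have hp : ∀ y ≤ x, ‖-ε y * v1 y + κt y * v2 y‖ ≤ 440 * K ^ 2 / w * D0 y := fun y hy => by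
    refine (h.norm_v1'_le hy (hV y hy) (hW y hy)).trans
      (mul_le_mul_of_nonneg_right ?_ (h.nonneg0 y))
    have e : 4 * K / w * 2 + 3 * (144 * K ^ 2 / w) = (8 * K + 432 * K ^ 2) / w := by ring
    rw [e]
    gcongr
    nlinarith
  have hinv := h.inv_nu_le
  have hinv2 : ‖ν ^ 2‖⁻¹ ≤ 4 / w ^ 2 := by
    rw [norm_pow, ← inv_pow]
    calc (‖ν‖⁻¹) ^ 2 ≤ (2 / w) ^ 2 := by gcongr
      _ = 4 / w ^ 2 := by ring
  have key := h.damped (c := fun y => (v2 y + κ y * v1 y / ν) + κ1 y * v1 y / ν ^ 2) (ν' := ν)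
    (f := fun y => ε y * v2 y + κ y * (-ε y * v1 y + κt y * v2 y) / ν +
      (κ2 y * v1 y + κ1 y * (-ε y * v1 y + κt y * v2 y)) / ν ^ 2)
    -- The coefficient of D0 is 3216K³ = (4·144 + 2·3·440)K³ plus 5280K³/w with 5280 = 4·3·440; here
    -- w ≥ 1. The coefficient 24 of D2 is 3·2·4.
    (A := 8500 * K ^ 3 / w ^ 2) (B := 0) (C := 24 / w ^ 2) h.re_nonpos
    (fun y => by
      refine ((h.hasDerivAt_d y).add
        (((h.deriv_κ1 y).mul (h.deriv_v1 y)).div_const (ν ^ 2))).congr_deriv ?_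
      field_simp
      ring)
    (by simpa using h.tendsto_d.add ((h.tendsto_κ1.mul h.tendsto_v1).div_const (ν ^ 2)))
    (by fun_prop) (by positivity) le_rfl (by positivity)
    (fun s hs => by
      have h0 := h.nonneg0 s
      have h1 := h.nonneg1 s
      have h2 := h.nonneg2 s
      have hD := h.D0_le s hs
      have hD1 := h.D1_le s hs
      have t1 : ‖ε s * v2 s‖ ≤ (4 * K / w * D0 s) * (144 * K ^ 2 / w) := by
        rw [norm_mul]
        exact mul_le_mul (h.le_ε s hs) (hW s hs) (norm_nonneg _) (by positivity)
      have t2 : ‖κ s * (-ε s * v1 s + κt s * v2 s) / ν‖ ≤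
          ((3 * K) * (440 * K ^ 2 / w * D0 s)) * (2 / w) := by
        rw [norm_div, norm_mul, div_eq_mul_inv]
        refine mul_le_mul (mul_le_mul ((h.le_κ s hs).trans (by linarith)) (hp s hs) (norm_nonneg _)
          (by positivity)) hinv (by positivity) (by positivity)
      have t3 : ‖(κ2 s * v1 s + κ1 s * (-ε s * v1 s + κt s * v2 s)) / ν ^ 2‖ ≤
          ((3 * D2 s) * 2 + (3 * K) * (440 * K ^ 2 / w * D0 s)) * (4 / w ^ 2) := by
        rw [norm_div, div_eq_mul_inv]
        refine mul_le_mul ((norm_add_le _ _).trans (add_le_add ?_ ?_)) hinv2 (by positivity)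
          (by positivity)
        · rw [norm_mul]
          exact mul_le_mul (h.le_κ2 s hs) (hV s hs) (norm_nonneg _) (by positivity)
        · rw [norm_mul]
          exact mul_le_mul ((h.le_κ1 s hs).trans (by linarith)) (hp s hs) (norm_nonneg _)
            (by positivity)
      refine (norm_add_le _ _).trans ((add_le_add ((norm_add_le _ _).trans (add_le_add t1 t2))
        t3).trans ?_)
      have e : 4 * K / w * D0 s * (144 * K ^ 2 / w) + 3 * K * (440 * K ^ 2 / w * D0 s) * (2 / w) +
          (3 * D2 s * 2 + 3 * K * (440 * K ^ 2 / w * D0 s)) * (4 / w ^ 2) =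
          (3216 * K ^ 3 + 5280 * K ^ 3 / w) / w ^ 2 * D0 s + 24 / w ^ 2 * D2 s := by
        field_simp; ring
      rw [e]
      have e' : 3216 * K ^ 3 + 5280 * K ^ 3 / w ≤ 8500 * K ^ 3 := by
        have : 5280 * K ^ 3 / w ≤ 5280 * K ^ 3 := div_le_self (by positivity) hw1
        have : 0 ≤ K ^ 3 := by positivity
        linarith
      have : (3216 * K ^ 3 + 5280 * K ^ 3 / w) / w ^ 2 * D0 s ≤ 8500 * K ^ 3 / w ^ 2 * D0 s := by
        gcongr
      linarith) (le_refl x)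
  have t4 : ‖κ1 x * v1 x / ν ^ 2‖ ≤ (3 * K * 2) * (4 / w ^ 2) := by
    rw [norm_div, norm_mul, div_eq_mul_inv]
    have := h.D1_le x le_rfl
    exact mul_le_mul (mul_le_mul ((h.le_κ1 x le_rfl).trans (by linarith)) (hV x le_rfl)
      (norm_nonneg _) (by positivity)) hinv2 (by positivity) (by positivity)
  have t5 : ‖v2 x + κ x * v1 x / ν‖ ≤
      ‖(v2 x + κ x * v1 x / ν) + κ1 x * v1 x / ν ^ 2‖ + ‖κ1 x * v1 x / ν ^ 2‖ := by
    have := norm_sub_le ((v2 x + κ x * v1 x / ν) + κ1 x * v1 x / ν ^ 2) (κ1 x * v1 x / ν ^ 2)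
    simpa using this
  refine t5.trans ((add_le_add key t4).trans ?_)
  have e : (8500 * K ^ 3 / w ^ 2 + 0 + 24 / w ^ 2) * K + 3 * K * 2 * (4 / w ^ 2) =
    (8500 * K ^ 4 + 48 * K) / w ^ 2 := by ring
  rw [e]
  gcongr
  have : K ≤ K ^ 4 := le_self_pow₀ hK (by norm_num)
  linarith

end DiagonalSystem

/-! ## Reflections of the spectral plane -/

/-- The involution `z ↦ -q0^2 / z`, which exchanges the two sheets. -/
def hat (q0 : ℝ) (z : ℂ) : ℂ := -(q0 : ℂ) ^ 2 / z

section Geometry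

variable {q0 : ℝ} {z : ℂ}

theorem norm_hat : ‖hat q0 z‖ = q0 ^ 2 / ‖z‖ := by
  rw [hat, norm_div, norm_neg, norm_pow, Complex.norm_real, Real.norm_eq_abs, sq_abs]

theorem hat_im : (hat q0 z).im = q0 ^ 2 * z.im / ‖z‖ ^ 2 := by
  have h : hat q0 z = ((-q0 ^ 2 : ℝ) : ℂ) * z⁻¹ := by rw [hat, div_eq_mul_inv]; push_cast; ring
  rw [h, Complex.im_ofReal_mul, Complex.inv_im, Complex.normSq_eq_norm_sq]
  ring

theorem hat_ne_zero (hq : 0 < q0) (hz : z ≠ 0) : hat q0 z ≠ 0 :=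
  div_ne_zero (neg_ne_zero.2 (pow_ne_zero _ (ofReal_ne_zero.2 hq.ne'))) hz

theorem hat_hat (hq : 0 < q0) : hat q0 (hat q0 z) = z := by
  have hq' : (q0 : ℂ) ≠ 0 := ofReal_ne_zero.2 hq.ne'
  by_cases hz : z = 0
  · simp [hat, hz]
  · rw [hat, hat]; field_simp

theorem mul_hat (hz : z ≠ 0) : z * hat q0 z = -(q0 : ℂ) ^ 2 := by rw [hat]; field_simp

theorem hat_conj : hat q0 (conj z) = conj (hat q0 z) := by simp [hat]

theorem hat_neg : hat q0 (-z) = -hat q0 z := by simp [hat, div_neg]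

theorem ne_zero_of_mem_Dplus (h : z ∈ Dplus q0) : z ≠ 0 := by
  rintro rfl; simp [Dplus] at h

theorem ne_zero_of_mem_Dminus (h : z ∈ Dminus q0) : z ≠ 0 := by
  rintro rfl; simp [Dminus] at h

theorem neg_mem_Dplus : -z ∈ Dplus q0 ↔ z ∈ Dminus q0 := by
  simp only [Dplus, Dminus, Set.mem_ofPred_eq, norm_neg, neg_im]
  rw [mul_neg, Left.neg_pos_iff]

theorem conj_mem_Dplus : conj z ∈ Dplus q0 ↔ z ∈ Dminus q0 := by
  simp only [Dplus, Dminus, Set.mem_ofPred_eq, RCLike.norm_conj, conj_im]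
  rw [mul_neg, Left.neg_pos_iff]

theorem neg_mem_Dminus : -z ∈ Dminus q0 ↔ z ∈ Dplus q0 := by
  rw [← neg_mem_Dplus, neg_neg]

theorem conj_mem_Dminus : conj z ∈ Dminus q0 ↔ z ∈ Dplus q0 := by
  rw [← conj_mem_Dplus, conj_conj]

theorem hat_mem_Dminus (hq : 0 < q0) : hat q0 z ∈ Dminus q0 ↔ z ∈ Dplus q0 := by
  by_cases hz : z = 0
  · subst hz; simp [hat, Dminus, Dplus]
  have hn : 0 < ‖z‖ := norm_pos_iff.2 hz
  simp only [Dplus, Dminus, Set.mem_ofPred_eq]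
  rw [norm_hat, hat_im]
  have e : ((q0 ^ 2 / ‖z‖) ^ 2 - q0 ^ 2) * (q0 ^ 2 * z.im / ‖z‖ ^ 2) =
      -(q0 ^ 4 / ‖z‖ ^ 4) * ((‖z‖ ^ 2 - q0 ^ 2) * z.im) := by field_simp; ring
  rw [e, neg_mul, Left.neg_neg_iff, mul_pos_iff_of_pos_left (by positivity)]

theorem hat_mem_Dplus (hq : 0 < q0) : hat q0 z ∈ Dplus q0 ↔ z ∈ Dminus q0 := by
  rw [← hat_mem_Dminus hq, hat_hat hq]

theorem neg_mem_Sigma0 : -z ∈ Sigma0 q0 ↔ z ∈ Sigma0 q0 := by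
  simp only [Sigma0, Set.mem_ofPred_eq, norm_neg, neg_im, neg_eq_zero, ne_eq, neg_inj]
  rw [neg_eq_iff_eq_neg]
  tauto

theorem conj_mem_Sigma0 : conj z ∈ Sigma0 q0 ↔ z ∈ Sigma0 q0 := by
  have h : ∀ w : ℂ, conj z = w ↔ z = conj w := fun w =>
    ⟨fun h => by rw [← h, conj_conj], fun h => by rw [h, conj_conj]⟩
  simp only [Sigma0, Set.mem_ofPred_eq, RCLike.norm_conj, conj_im, neg_eq_zero, ne_eq, h]
  simp
  tauto

theorem hat_mem_Sigma0_of (hq : 0 < q0) (h : z ∈ Sigma0 q0) : hat q0 z ∈ Sigma0 q0 := by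
  obtain ⟨h1, h2, h3, h4⟩ := h
  have hn : 0 < ‖z‖ := norm_pos_iff.2 h2
  have hq' : (q0 : ℂ) ≠ 0 := ofReal_ne_zero.2 hq.ne'
  refine ⟨?_, hat_ne_zero hq h2, fun h => h3 ?_, fun h => h4 ?_⟩
  · rw [norm_hat, hat_im]
    rcases h1 with h1 | h1
    · left; simp [h1]
    · right; rw [h1]; field_simp
  · rw [← hat_hat hq (z := z), h, hat]
    field_simp
    rw [I_sq]
  · rw [← hat_hat hq (z := z), h, hat]
    field_simp
    rw [I_sq]; ring_nf

theorem hat_mem_Sigma0 (hq : 0 < q0) : hat q0 z ∈ Sigma0 q0 ↔ z ∈ Sigma0 q0 :=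
  ⟨fun h => by simpa [hat_hat hq] using hat_mem_Sigma0_of hq h, hat_mem_Sigma0_of hq⟩

theorem neg_mem_DS : -z ∈ Dplus q0 ∪ Sigma0 q0 ↔ z ∈ Dminus q0 ∪ Sigma0 q0 := by
  rw [Set.mem_union, Set.mem_union, neg_mem_Dplus, neg_mem_Sigma0]

theorem conj_mem_DS : conj z ∈ Dplus q0 ∪ Sigma0 q0 ↔ z ∈ Dminus q0 ∪ Sigma0 q0 := by
  rw [Set.mem_union, Set.mem_union, conj_mem_Dplus, conj_mem_Sigma0]

theorem hat_mem_DS (hq : 0 < q0) :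
    hat q0 z ∈ Dplus q0 ∪ Sigma0 q0 ↔ z ∈ Dminus q0 ∪ Sigma0 q0 := by
  rw [Set.mem_union, Set.mem_union, hat_mem_Dplus hq, hat_mem_Sigma0 hq]

theorem neg_mem_DmS : -z ∈ Dminus q0 ∪ Sigma0 q0 ↔ z ∈ Dplus q0 ∪ Sigma0 q0 := by
  rw [Set.mem_union, Set.mem_union, neg_mem_Dminus, neg_mem_Sigma0]

theorem conj_mem_DmS : conj z ∈ Dminus q0 ∪ Sigma0 q0 ↔ z ∈ Dplus q0 ∪ Sigma0 q0 := by
  rw [Set.mem_union, Set.mem_union, conj_mem_Dminus, conj_mem_Sigma0]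

theorem hat_mem_DmS (hq : 0 < q0) :
    hat q0 z ∈ Dminus q0 ∪ Sigma0 q0 ↔ z ∈ Dplus q0 ∪ Sigma0 q0 := by
  rw [Set.mem_union, Set.mem_union, hat_mem_Dminus hq, hat_mem_Sigma0 hq]

theorem ofReal_mem_Sigma0 (hq : 0 < q0) {s : ℝ} (hs : s ≠ 0) : (s : ℂ) ∈ Sigma0 q0 := by
  refine ⟨Or.inl (ofReal_im s), ofReal_ne_zero.2 hs, fun h => ?_, fun h => ?_⟩
  · have := congrArg im h
    simp at this
    exact hq.ne this
  · have := congrArg im h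
    simp at this
    exact hq.ne' this

theorem mem_DS_of_im_nonneg (hq : 0 < q0) (h1 : q0 < ‖z‖) (h2 : 0 ≤ z.im) :
    z ∈ Dplus q0 ∪ Sigma0 q0 := by
  rcases h2.eq_or_lt with h | h
  · right
    have : z = (z.re : ℂ) := by apply Complex.ext <;> simp [← h]
    rw [this]
    apply ofReal_mem_Sigma0 hq
    rintro h0
    rw [this, h0] at h1
    simp at h1
    linarith
  · left
    exact mul_pos (by nlinarith) h

theorem im_nonneg_of_mem_DS (hq : 0 < q0) (h1 : q0 < ‖z‖) (hz : z ∈ Dplus q0 ∪ Sigma0 q0) :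
    0 ≤ z.im := by
  rcases hz with hz | hz
  · exact (pos_of_mul_pos_right hz (by nlinarith)).le
  · rcases hz.1 with h | h
    · exact h.ge
    · exact absurd h h1.ne'

end Geometry

/-! ## The model column for large `z`, and its behaviour under the involution -/

section

variable {q0 : ℝ} {r : ℝ → ℂ} {rm : ℂ}

theorem Potential.hasDerivAt (h : Potential q0 r rm) (y : ℝ) : HasDerivAt r (deriv r y) y :=
  (h.contDiff.differentiable (by norm_num) y).hasDerivAt

theorem Potential.hasDerivAt_deriv (h : Potential q0 r rm) (y : ℝ) :
    HasDerivAt (deriv r) (iteratedDeriv 2 r y) y := by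
  have h1 : ContDiff ℝ 1 (deriv r) := ((contDiff_succ_iff_deriv (n := 1)).1 h.contDiff).2.2
  have := (h1.differentiable one_ne_zero y).hasDerivAt
  rwa [iteratedDeriv_succ, iteratedDeriv_one]

theorem Potential.integrable_sub (h : Potential q0 r rm) (x : ℝ) :
    IntegrableOn (fun y => ‖r y - rm‖) (Set.Iic x) := by
  have := h.continuous
  refine Integrable.mono' (h.weighted' x) (by fun_prop) (ae_of_all _ fun y => ?_)
  rw [norm_norm]
  have := abs_nonneg y
  exact le_mul_of_one_le_left (norm_nonneg _) (by linarith)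

theorem hasDerivAt_conj {f : ℝ → ℂ} {f' : ℂ} {x : ℝ} (h : HasDerivAt f f' x) :
    HasDerivAt (fun y => conj (f y)) (conj f') x := h.star

/-- Constants of the potential on a half line. -/
theorem Potential.exists_const (h : Potential q0 r rm) (x : ℝ) : ∃ K, 1 ≤ K ∧ q0 ≤ K ∧
    (∀ y ≤ x, ‖r y - rm‖ ≤ K) ∧ (∀ y ≤ x, ‖deriv r y‖ ≤ K) ∧
    ∫ y in Set.Iic x, ‖r y - rm‖ ≤ K ∧ ∫ y in Set.Iic x, ‖deriv r y‖ ≤ K ∧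
    ∫ y in Set.Iic x, ‖iteratedDeriv 2 r y‖ ≤ K ∧ Tendsto (deriv r) atBot (𝓝 0) := by
  have hd0 : Tendsto (deriv r) atBot (𝓝 0) := tendsto_zero_of_hasDerivAt_of_integrableOn_Iic (a := 0)
    (fun y _ => h.hasDerivAt_deriv y) h.deriv_two.integrableOn h.deriv_one.integrableOn
  have hc1 : Continuous (deriv r) :=
    continuous_iff_continuousAt.2 fun y => (h.hasDerivAt_deriv y).continuousAt
  obtain ⟨B0, h0⟩ := exists_norm_le_Iic (h.continuous.sub continuous_const)
    (h.tendsto.sub_const rm) x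
  obtain ⟨B1, h1⟩ := exists_norm_le_Iic hc1 hd0 x
  set I0 := ∫ y in Set.Iic x, ‖r y - rm‖
  set I1 := ∫ y in Set.Iic x, ‖deriv r y‖
  set I2 := ∫ y in Set.Iic x, ‖iteratedDeriv 2 r y‖
  have := abs_nonneg B0
  have := abs_nonneg B1
  have p0 : 0 ≤ I0 := integral_nonneg fun _ => norm_nonneg _
  have p1 : 0 ≤ I1 := integral_nonneg fun _ => norm_nonneg _
  have p2 : 0 ≤ I2 := integral_nonneg fun _ => norm_nonneg _
  have := h.pos
  refine ⟨1 + q0 + |B0| + |B1| + I0 + I1 + I2, by linarith, by linarith, fun y hy => ?_,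
    fun y hy => ?_, by linarith, by linarith, by linarith, hd0⟩
  · have : ‖r y - rm‖ ≤ |B0| := (h0 y hy).trans (le_abs_self _)
    linarith
  · have := (h1 y hy).trans (le_abs_self _)
    linarith

variable {z : ℂ} {a b : ℝ → ℂ}

theorem inv_gamma_facts {γ : ℂ} {t : ℝ} (hγ : ‖γ - 1‖ ≤ t) (ht : t ≤ 1 / 2) :
    γ ≠ 0 ∧ 1 / 2 ≤ ‖γ‖ ∧ ‖γ⁻¹‖ ≤ 2 := by
  have h1 : 1 / 2 ≤ ‖γ‖ := by
    have := norm_sub_norm_le 1 (1 - γ)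
    rw [norm_sub_rev 1 γ, norm_one, sub_sub_cancel] at this
    linarith
  refine ⟨norm_pos_iff.1 (by linarith), h1, ?_⟩
  rw [norm_inv]
  exact (inv_anti₀ (by norm_num) h1).trans (by norm_num)

/-- The model column in the frame of the eigenvectors of the constant background. -/
theorem IsModel.diagonalSystem (hM : IsModel q0 r rm z a b) (h : Potential q0 r rm) {x K : ℝ}
    (hK1 : 1 ≤ K) (hKq : q0 ≤ K)
    (hD0 : ∀ y ≤ x, ‖r y - rm‖ ≤ K) (hD1 : ∀ y ≤ x, ‖deriv r y‖ ≤ K)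
    (hI0 : ∫ y in Set.Iic x, ‖r y - rm‖ ≤ K) (hI1 : ∫ y in Set.Iic x, ‖deriv r y‖ ≤ K)
    (hI2 : ∫ y in Set.Iic x, ‖iteratedDeriv 2 r y‖ ≤ K) (hl : Tendsto (deriv r) atBot (𝓝 0))
    (hz : 440 * K ^ 3 ≤ ‖z‖) (him : 0 ≤ (mu q0 z).im) (hγ : ‖gam q0 z - 1‖ ≤ 1 / 2) :
    DiagonalSystem x K ‖z‖ (I * (z * gam q0 z))
      (fun y => (a y + I * rm / z * b y) / gam q0 z)
      (fun y => (b y + I * conj rm / z * a y) / gam q0 z)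
      (fun y => I / (z * gam q0 z) * ((r y - rm) * conj rm + conj (r y - rm) * rm))
      (fun y => ((r y - rm) * (conj rm ^ 2 / z ^ 2) - conj (r y - rm)) / gam q0 z)
      (fun y => ((r y - rm) - rm ^ 2 / z ^ 2 * conj (r y - rm)) / gam q0 z)
      (fun y => (deriv r y * (conj rm ^ 2 / z ^ 2) - conj (deriv r y)) / gam q0 z)
      (fun y => (iteratedDeriv 2 r y * (conj rm ^ 2 / z ^ 2) - conj (iteratedDeriv 2 r y)) /
        gam q0 z)
      (fun y => ‖r y - rm‖) (fun y => ‖deriv r y‖) (fun y => ‖iteratedDeriv 2 r y‖) := by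
  have hK3 : K ≤ K ^ 3 := le_self_pow₀ hK1 (by norm_num)
  have hq := h.pos
  have hzK : 4 * K ≤ ‖z‖ := by linarith
  have hzp : 0 < ‖z‖ := by linarith
  have hz0 : z ≠ 0 := norm_pos_iff.1 hzp
  obtain ⟨hg0, hg1, hg2⟩ := inv_gamma_facts hγ le_rfl
  have hmu : mu q0 z = z * gam q0 z := by rw [mu, gam]; field_simp
  have hqq := h.mul_conj
  have hgam : gam q0 z * z ^ 2 = z ^ 2 + rm * conj rm := by rw [gam, hqq]; field_simp
  -- With p = i/z kept opaque all coefficients are rational in p, and both differential equations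
  -- follow from the single relation `hgp`.
  obtain ⟨p, hp⟩ : ∃ p, p = I / z := ⟨_, rfl⟩
  have hp0 : p ≠ 0 := by rw [hp]; exact div_ne_zero I_ne_zero hz0
  have a1 : I * (q0 : ℂ) ^ 2 / z = p * (rm * conj rm) := by rw [hqq, hp]; ring
  have a2 : I * z = -1 / p := by rw [hp]; field_simp; rw [I_sq]
  have a3 : I * rm / z = p * rm := by rw [hp]; ring
  have a4 : I * conj rm / z = p * conj rm := by rw [hp]; ring
  have a5 : I / (z * gam q0 z) = p / gam q0 z := by rw [hp]; field_simp
  have hp2 : 1 / z ^ 2 = -p ^ 2 := by rw [hp, div_pow, I_sq]; ring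
  have a6 : rm ^ 2 / z ^ 2 = -p ^ 2 * rm ^ 2 := by rw [← hp2]; ring
  have a7 : conj rm ^ 2 / z ^ 2 = -p ^ 2 * conj rm ^ 2 := by rw [← hp2]; ring
  have hgp : gam q0 z = 1 - p ^ 2 * (rm * conj rm) := by
    rw [gam, ← hqq, sub_eq_add_neg, ← neg_mul, ← hp2]; ring
  have a8 : I * (z * gam q0 z) = -1 / p * gam q0 z := by rw [← a2]; ring
  have hrm : ‖rm‖ / ‖z‖ ≤ 1 / 2 := by
    rw [h.norm_rm, div_le_iff₀ hzp]; linarith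
  have hrm2 : ‖rm‖ ^ 2 / ‖z‖ ^ 2 ≤ 1 / 4 := by
    rw [← div_pow]
    calc (‖rm‖ / ‖z‖) ^ 2 ≤ (1 / 2) ^ 2 := by gcongr
      _ = 1 / 4 := by norm_num
  have est : ∀ v : ℂ, ‖(v * (conj rm ^ 2 / z ^ 2) - conj v) / gam q0 z‖ ≤ 3 * ‖v‖ := by
    intro v
    rw [div_eq_mul_inv, norm_mul]
    have : ‖v * (conj rm ^ 2 / z ^ 2) - conj v‖ ≤ ‖v‖ * (1 / 4) + ‖v‖ := by
      refine (norm_sub_le _ _).trans ?_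
      rw [norm_mul, norm_div, norm_pow, norm_pow, RCLike.norm_conj, RCLike.norm_conj]
      gcongr
    have := mul_le_mul this hg2 (norm_nonneg _) (by positivity)
    have := norm_nonneg v
    linarith
  have est' : ∀ v : ℂ, ‖(v - rm ^ 2 / z ^ 2 * conj v) / gam q0 z‖ ≤ 3 * ‖v‖ := by
    intro v
    rw [div_eq_mul_inv, norm_mul]
    have : ‖v - rm ^ 2 / z ^ 2 * conj v‖ ≤ ‖v‖ + 1 / 4 * ‖v‖ := by
      refine (norm_sub_le _ _).trans ?_
      rw [norm_mul, norm_div, norm_pow, norm_pow, RCLike.norm_conj]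
      gcongr
    have := mul_le_mul this hg2 (norm_nonneg _) (by positivity)
    have := norm_nonneg v
    linarith
  have hrc := h.continuous
  have hrc2 : Continuous (iteratedDeriv 2 r) := h.contDiff.continuous_iteratedDeriv 2 le_rfl
  have tδ : Tendsto (fun y => r y - rm) atBot (𝓝 0) := by simpa using h.tendsto.sub_const rm
  have tconj : ∀ {f : ℝ → ℂ}, Tendsto f atBot (𝓝 0) → Tendsto (fun y => conj (f y)) atBot (𝓝 0) :=
    fun hf => by simpa [Function.comp_def] using (Complex.continuous_conj.tendsto 0).comp hf
  refine
    { one_le := hK1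
      large := hz
      re_nonpos := ?_
      norm_nu := ?_
      deriv_v1 := fun y => ?_
      deriv_v2 := fun y => ?_
      deriv_κ := fun y => ?_
      deriv_κ1 := fun y => ?_
      cont_ε := by fun_prop
      cont_κt := by fun_prop
      cont_κ2 := by fun_prop
      le_ε := fun y _ => ?_
      le_κ := fun y _ => est _
      le_κt := fun y _ => est' _
      le_κ1 := fun y _ => est _
      le_κ2 := fun y _ => est _
      nonneg0 := fun y => norm_nonneg _
      nonneg1 := fun y => norm_nonneg _
      nonneg2 := fun y => norm_nonneg _
      D0_le := hD0
      D1_le := hD1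
      int0 := h.integrable_sub x
      int1 := h.deriv_one.norm.integrableOn
      int2 := h.deriv_two.norm.integrableOn
      integral0 := hI0
      integral1 := hI1
      integral2 := hI2
      tendsto_v1 := ?_
      tendsto_v2 := ?_
      tendsto_κ := ?_
      tendsto_κ1 := ?_ }
  · rw [← hmu]; simpa using him
  · rw [norm_mul, norm_I, one_mul, norm_mul]
    have := mul_le_mul_of_nonneg_left hg1 hzp.le
    linarith
  · refine (((hM.deriv_a y).add ((hM.deriv_b y).const_mul (I * rm / z))).div_const
      (gam q0 z)).congr_deriv ?_
    simp only [map_sub, a1, a2, a3, a4, a5, a6]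
    field_simp
    linear_combination (p * (rm * conj rm) * a y + r y * b y - p * rm * conj (r y) * a y -
      rm * b y) * hgp
  · refine (((hM.deriv_b y).add ((hM.deriv_a y).const_mul (I * conj rm / z))).div_const
      (gam q0 z)).congr_deriv ?_
    simp only [map_sub, a1, a2, a3, a4, a5, a7, a8]
    field_simp
    linear_combination (p * (-conj (r y) * a y + p * conj rm * (p * (rm * conj rm) * a y +
      r y * b y)) + p * conj rm * a y +
      (b y + a y * p * conj rm) * (gam q0 z - p ^ 2 * (rm * conj rm))) * hgp
  · refine ((((h.hasDerivAt y).sub_const rm).mul_const _).sub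
      (hasDerivAt_conj ((h.hasDerivAt y).sub_const rm))).div_const _
  · exact (((h.hasDerivAt_deriv y).mul_const _).sub
      (hasDerivAt_conj (h.hasDerivAt_deriv y))).div_const _
  · rw [norm_mul, norm_div, norm_I, norm_mul, one_div, mul_inv, ← norm_inv (gam q0 z)]
    have h1 : ‖(r y - rm) * conj rm + conj (r y - rm) * rm‖ ≤ 2 * q0 * ‖r y - rm‖ := by
      refine (norm_add_le _ _).trans (le_of_eq ?_)
      rw [norm_mul, norm_mul, RCLike.norm_conj, RCLike.norm_conj, h.norm_rm]; ring
    calc ‖z‖⁻¹ * ‖(gam q0 z)⁻¹‖ * ‖(r y - rm) * conj rm + conj (r y - rm) * rm‖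
        ≤ ‖z‖⁻¹ * 2 * (2 * K * ‖r y - rm‖) := by
          gcongr
          exact h1.trans (by gcongr)
      _ = _ := by ring
  · have := (hM.tendsto_a.add (hM.tendsto_b.const_mul (I * rm / z))).div_const (gam q0 z)
    convert this using 2
    rw [eq_div_iff hg0, gam, ← hqq]
    field_simp
    rw [I_sq]; ring
  · have := (hM.tendsto_b.add (hM.tendsto_a.const_mul (I * conj rm / z))).div_const (gam q0 z)
    convert this using 2
    ring
  · have := ((tδ.mul_const (conj rm ^ 2 / z ^ 2)).sub (tconj tδ)).div_const (gam q0 z)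
    simpa using this
  · have := ((hl.mul_const (conj rm ^ 2 / z ^ 2)).sub (tconj hl)).div_const (gam q0 z)
    simpa using this

end

namespace ModelFamily

variable {q0 : ℝ} {r : ℝ → ℂ} {rm : ℂ} {a b : ℂ → ℝ → ℂ} (hF : ModelFamily q0 r rm a b)
  (h : Potential q0 r rm)
include hF h

/-- Uniform expansion of the model column at `z = ∞`. -/
theorem asymptotics (x : ℝ) : ∃ C R, 0 ≤ C ∧ q0 < R ∧ ∀ z, R ≤ ‖z‖ → 0 ≤ z.im →
    ‖a z x - 1‖ ≤ C / ‖z‖ ∧ ‖b z x + I / z * conj (r x)‖ ≤ C / ‖z‖ ^ 2 := by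
  obtain ⟨K, hK1, hKq, hD0, hD1, hI0, hI1, hI2, hl⟩ := h.exists_const x
  have hK3 : K ≤ K ^ 3 := le_self_pow₀ hK1 (by norm_num)
  have hK4 : K ^ 3 ≤ K ^ 4 := pow_le_pow_right₀ hK1 (by norm_num)
  refine ⟨13000 * K ^ 4, 440 * K ^ 3, by positivity, by linarith, fun z hz him => ?_⟩
  have hq := h.pos
  have hzq : q0 < ‖z‖ := by linarith
  have hw1 : 1 ≤ ‖z‖ := by linarith
  have hw : 0 < ‖z‖ := by linarith
  have hz0 : z ≠ 0 := norm_pos_iff.1 hw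
  have hDS : z ∈ Dplus q0 ∪ Sigma0 q0 := mem_DS_of_im_nonneg hq hzq him
  obtain ⟨-, -, hmu⟩ := mem_DS hDS
  have hM := hF z hDS
  have hγ1 : ‖gam q0 z - 1‖ ≤ K ^ 2 / ‖z‖ ^ 2 := by
    rw [gam, add_sub_cancel_left, norm_div, norm_pow, norm_pow, Complex.norm_real,
      Real.norm_eq_abs, abs_of_pos hq]
    gcongr
  have hγ2 : K ^ 2 / ‖z‖ ^ 2 ≤ 1 / 2 := by
    rw [div_le_iff₀ (by positivity)]
    have : 4 * K ≤ ‖z‖ := by linarith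
    nlinarith
  have sys := hM.diagonalSystem h hK1 hKq hD0 hD1 hI0 hI1 hI2 hl hz hmu (hγ1.trans hγ2)
  obtain ⟨hg0, hg1, hg2⟩ := inv_gamma_facts hγ1 hγ2
  have e1 := sys.v1_estimate
  have e2 := sys.v2_estimate
  have e3 := sys.bounds.2 x le_rfl
  have eκ := sys.le_κ x le_rfl
  have eν := sys.inv_nu_le
  obtain ⟨p, hp⟩ : ∃ p, p = I / z := ⟨_, rfl⟩
  have hqq := h.mul_conj
  have hp0 : p ≠ 0 := by rw [hp]; exact div_ne_zero I_ne_zero hz0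
  have hpn : ‖p‖ = ‖z‖⁻¹ := by rw [hp, norm_div, norm_I, one_div]
  have hp2 : 1 / z ^ 2 = -p ^ 2 := by rw [hp, div_pow, I_sq]; ring
  have a2 : I * z = -1 / p := by rw [hp]; field_simp; rw [I_sq]
  have a3 : I * rm / z = p * rm := by rw [hp]; ring
  have a4 : I * conj rm / z = p * conj rm := by rw [hp]; ring
  have a7 : conj rm ^ 2 / z ^ 2 = -p ^ 2 * conj rm ^ 2 := by rw [← hp2]; ring
  have a8 : I * (z * gam q0 z) = -1 / p * gam q0 z := by rw [← a2]; ring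
  have hgp : gam q0 z = 1 - p ^ 2 * (rm * conj rm) := by
    rw [gam, hqq, sub_eq_add_neg, ← neg_mul, ← hp2]; ring
  rw [a3] at e1 e2
  rw [a4] at e2 e3
  rw [a8] at e2 eν
  rw [a7] at e2 eκ
  set v1 := (a z x + p * rm * b z x) / gam q0 z with hv1
  set v2 := (b z x + p * conj rm * a z x) / gam q0 z with hv2
  set δ := r x - rm with hδ
  set κ := (δ * (-p ^ 2 * conj rm ^ 2) - conj δ) / gam q0 z with hκ
  set ν := -1 / p * gam q0 z with hν
  have hδK : ‖δ‖ ≤ K := hD0 x le_rfl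
  have ea : a z x = v1 - p * rm * v2 := by
    rw [hv1, hv2]; field_simp
    linear_combination (a z x) * hgp
  have eb : b z x = v2 - p * conj rm * v1 := by
    rw [hv1, hv2]; field_simp
    linear_combination (b z x) * hgp
  constructor
  · have : a z x - 1 = (v1 - 1) - p * rm * v2 := by rw [ea]; ring
    rw [this]
    refine (norm_sub_le _ _).trans ?_
    rw [norm_mul, norm_mul, hpn, h.norm_rm]
    have t : ‖z‖⁻¹ * q0 * ‖v2‖ ≤ ‖z‖⁻¹ * K * (144 * K ^ 2 / 1) := by
      gcongr
      refine e3.trans ?_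
      gcongr
    refine (add_le_add e1 t).trans ?_
    rw [div_eq_mul_inv, div_eq_mul_inv (13000 * K ^ 4)]
    have : 440 * K ^ 3 * ‖z‖⁻¹ + ‖z‖⁻¹ * K * (144 * K ^ 2 / 1) = (584 * K ^ 3) * ‖z‖⁻¹ := by ring
    rw [this]
    gcongr
    linarith
  · have hrx : conj (r x) = conj rm + conj δ := by rw [hδ, map_sub]; ring
    -- The limit rm contributes -p rm* through v₁ ≈ 1, and r - rm contributes -p(r - rm)* through v₂
    -- ≈ -κv₁/ν. Together they are -(i/z)r*, and each remaining summand is of order |z|⁻².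
    have hdec : b z x + I / z * conj (r x) = (v2 + κ * v1 / ν) - p * conj rm * (v1 - 1)
        - κ / ν * (v1 - 1) + p * (conj δ * ((gam q0 z - 1) * (gam q0 z + 1)) -
          p ^ 2 * conj rm ^ 2 * δ) * ((gam q0 z)⁻¹ * (gam q0 z)⁻¹) := by
      rw [← hp, hrx, eb, hκ, hν]
      field_simp
      ring
    rw [hdec]
    have t1 : ‖p * conj rm * (v1 - 1)‖ ≤ ‖z‖⁻¹ * K * (440 * K ^ 3 / ‖z‖) := by
      rw [norm_mul, norm_mul, hpn, RCLike.norm_conj, h.norm_rm]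
      gcongr
    have t2 : ‖κ / ν * (v1 - 1)‖ ≤ (3 * K) * (2 / ‖z‖) * (440 * K ^ 3 / ‖z‖) := by
      rw [norm_mul, norm_div, div_eq_mul_inv]
      gcongr
      exact eκ.trans (by linarith)
    have hγ3 : ‖gam q0 z + 1‖ ≤ 3 := by
      have : gam q0 z + 1 = (gam q0 z - 1) + 2 := by ring
      rw [this]
      refine (norm_add_le _ _).trans ?_
      have : ‖(2 : ℂ)‖ = 2 := by simp
      linarith
    have t3 : ‖p * (conj δ * ((gam q0 z - 1) * (gam q0 z + 1)) -
          p ^ 2 * conj rm ^ 2 * δ) * ((gam q0 z)⁻¹ * (gam q0 z)⁻¹)‖ ≤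
        ‖z‖⁻¹ * (K * (K ^ 2 / ‖z‖ ^ 2 * 3) + (‖z‖⁻¹) ^ 2 * K ^ 2 * K) * (2 * 2) := by
      rw [norm_mul, norm_mul p, hpn, norm_mul]
      gcongr
      refine (norm_sub_le _ _).trans ?_
      rw [norm_mul, norm_mul, norm_mul, norm_mul, norm_pow, norm_pow, RCLike.norm_conj,
        RCLike.norm_conj, hpn, h.norm_rm]
      gcongr
    refine (norm_add_le _ _).trans ((add_le_add ((norm_sub_le _ _).trans (add_le_add
      ((norm_sub_le _ _).trans (add_le_add e2 t1)) t2)) t3).trans ?_)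
    have e : 9000 * K ^ 4 / ‖z‖ ^ 2 + ‖z‖⁻¹ * K * (440 * K ^ 3 / ‖z‖) +
        3 * K * (2 / ‖z‖) * (440 * K ^ 3 / ‖z‖) +
        ‖z‖⁻¹ * (K * (K ^ 2 / ‖z‖ ^ 2 * 3) + ‖z‖⁻¹ ^ 2 * K ^ 2 * K) * (2 * 2) =
        (12080 * K ^ 4 + 16 * K ^ 3 / ‖z‖) / ‖z‖ ^ 2 := by field_simp; ring
    rw [e]
    gcongr
    have : 16 * K ^ 3 / ‖z‖ ≤ 16 * K ^ 3 := div_le_self (by positivity) hw1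
    have : 0 ≤ K ^ 4 := by positivity
    linarith

/-- The symmetry `z ↦ -q0^2 / z^*` of the model column. -/
theorem symm {z : ℂ} (hz : z ∈ Dplus q0 ∪ Sigma0 q0) (x : ℝ) :
    a z x = I / z * conj rm * conj (b (hat q0 (conj z)) x) ∧
    b z x = -(I / z) * conj rm * conj (a (hat q0 (conj z)) x) := by
  have hq := h.pos
  have hz0 := (mem_DS hz).1
  have hz' : hat q0 (conj z) ∈ Dplus q0 ∪ Sigma0 q0 := by
    rw [hat_mem_DS hq, conj_mem_DmS]; exact hz
  have hq' : (q0 : ℂ) ≠ 0 := ofReal_ne_zero.2 hq.ne'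
  have hM := hF _ hz'
  have hcz : conj (hat q0 (conj z)) = hat q0 z := by rw [hat_conj, conj_conj]
  have tconj : ∀ {f : ℝ → ℂ} {l : ℂ}, Tendsto f atBot (𝓝 l) →
      Tendsto (fun y => conj (f y)) atBot (𝓝 (conj l)) := fun hf =>
    (Complex.continuous_conj.tendsto _).comp hf
  -- Conjugation at the reflected point, with the two entries exchanged, maps the system at `hat q0
  -- (conj z)` to the system at z. The prefactor is fixed by the normalization at -∞; uniqueness
  -- does the rest.
  have hM' : IsModel q0 r rm z (fun x => I / z * conj rm * conj (b (hat q0 (conj z)) x))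
      (fun x => -(I / z) * conj rm * conj (a (hat q0 (conj z)) x)) := by
    refine ⟨fun y => ?_, fun y => ?_, ?_, ?_⟩
    · refine ((hasDerivAt_conj (hM.deriv_b y)).const_mul (I / z * conj rm)).congr_deriv ?_
      simp only [map_add, map_mul, map_neg, conj_conj, conj_I, hcz]
      rw [show hat q0 z = -(q0 : ℂ) ^ 2 / z from rfl]
      field_simp
      ring
    · refine ((hasDerivAt_conj (hM.deriv_a y)).const_mul (-(I / z) * conj rm)).congr_deriv ?_
      simp only [map_add, map_mul, map_div₀, map_pow, conj_I, hcz, conj_ofReal]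
      rw [show hat q0 z = -(q0 : ℂ) ^ 2 / z from rfl]
      field_simp
      ring
    · have := (tconj hM.tendsto_b).const_mul (I / z * conj rm)
      convert this using 2
      simp only [map_mul, map_neg, map_div₀, conj_conj, conj_I, hcz]
      rw [show hat q0 z = -(q0 : ℂ) ^ 2 / z from rfl]
      field_simp
      linear_combination I ^ 2 * h.mul_conj + (q0 : ℂ) ^ 2 * I_sq
    · have := (tconj hM.tendsto_a).const_mul (-(I / z) * conj rm)
      simpa using this
  obtain ⟨h1, h2⟩ := (hF z hz).unique h hz hM'
  exact ⟨congrFun h1 x, congrFun h2 x⟩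

end ModelFamily

/-! ## Cauchy's theorem for half annuli -/

/-- The integral of `f` over the upper half circle of radius `ρ`, counterclockwise. -/
def arc (f : ℂ → ℂ) (ρ : ℝ) : ℂ :=
  ∫ φ in (0 : ℝ)..Real.pi, f (ρ * exp (I * φ)) * (I * ρ * exp (I * φ))

/-- The closed upper half annulus. -/
def halfAnnulus (r R : ℝ) : Set ℂ := {z | r ≤ ‖z‖ ∧ ‖z‖ ≤ R ∧ 0 ≤ z.im}

theorem isCompact_halfAnnulus (r R : ℝ) : IsCompact (halfAnnulus r R) := by
  refine Metric.isCompact_of_isClosed_isBounded ?_ ?_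
  · exact (isClosed_le continuous_const continuous_norm).inter
      ((isClosed_le continuous_norm continuous_const).inter
        (isClosed_le continuous_const continuous_im))
  · refine (Metric.isBounded_closedBall (x := (0 : ℂ)) (r := R)).subset fun z hz => ?_
    simpa using hz.2.1

theorem norm_circle {ρ : ℝ} (hρ : 0 ≤ ρ) (φ : ℝ) : ‖(ρ : ℂ) * exp (I * φ)‖ = ρ := by
  rw [norm_mul, Complex.norm_real, Real.norm_eq_abs, abs_of_nonneg hρ, mul_comm I,
    norm_exp_ofReal_mul_I, mul_one]

theorem im_circle (ρ φ : ℝ) : ((ρ : ℂ) * exp (I * φ)).im = ρ * Real.sin φ := by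
  rw [Complex.im_ofReal_mul, mul_comm I, exp_ofReal_mul_I_im]

theorem circle_mem_halfAnnulus {r R ρ : ℝ} (hr : 0 < r) (hρ : ρ ∈ Set.Icc r R) {φ : ℝ}
    (hφ : φ ∈ Set.Icc 0 Real.pi) : (ρ : ℂ) * exp (I * φ) ∈ halfAnnulus r R := by
  have hρ0 : 0 ≤ ρ := hr.le.trans hρ.1
  refine ⟨?_, ?_, ?_⟩
  · rw [norm_circle hρ0]; exact hρ.1
  · rw [norm_circle hρ0]; exact hρ.2
  · rw [im_circle]; exact mul_nonneg hρ0 (Real.sin_nonneg_of_mem_Icc hφ)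

theorem ofReal_mem_halfAnnulus {r R s : ℝ} (hr : 0 < r) (hs : s ∈ Set.Icc r R) :
    (s : ℂ) ∈ halfAnnulus r R ∧ (-(s : ℂ)) ∈ halfAnnulus r R := by
  have h0 : 0 ≤ s := hr.le.trans hs.1
  have : ‖(s : ℂ)‖ = s := by rw [Complex.norm_real, Real.norm_eq_abs, abs_of_nonneg h0]
  refine ⟨⟨by rw [this]; exact hs.1, by rw [this]; exact hs.2, by simp⟩,
    ⟨by rw [norm_neg, this]; exact hs.1, by rw [norm_neg, this]; exact hs.2, by simp⟩⟩

/-- Cauchy's theorem for a half annulus. -/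
theorem integral_halfAnnulus {f : ℂ → ℂ} {r R : ℝ} (hr : 0 < r) (hrR : r ≤ R)
    (hc : ContinuousOn f (halfAnnulus r R))
    (hd : DifferentiableOn ℂ f {z | r < ‖z‖ ∧ ‖z‖ < R ∧ 0 < z.im}) :
    ∫ s in r..R, (f s + f (-(s : ℂ))) = arc f r - arc f R := by
  have hR : 0 < R := hr.trans_le hrR
  have hlog : Real.log r ≤ Real.log R := Real.log_le_log hr hrR
  -- The exponential maps the rectangle [log r, log R] × [0, π] onto the half annulus, so Cauchy's
  -- theorem for rectangles applies to the pulled back form.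
  set g : ℂ → ℂ := fun w => f (exp w) * exp w with hg
  have hmaps : Set.MapsTo exp (Set.uIcc (Real.log r) (Real.log R) ×ℂ Set.uIcc 0 Real.pi) (halfAnnulus r R) := by
    intro w hw
    rw [mem_reProdIm, Set.uIcc_of_le hlog, Set.uIcc_of_le Real.pi_pos.le] at hw
    refine ⟨?_, ?_, ?_⟩
    · rw [norm_exp, ← Real.exp_log hr]; exact Real.exp_le_exp.2 hw.1.1
    · rw [norm_exp, ← Real.exp_log hR]; exact Real.exp_le_exp.2 hw.1.2
    · rw [exp_im]; exact mul_nonneg (Real.exp_pos _).le (Real.sin_nonneg_of_mem_Icc hw.2)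
  have hmaps' : Set.MapsTo exp (Set.Ioo (Real.log r) (Real.log R) ×ℂ Set.Ioo 0 Real.pi)
      {z | r < ‖z‖ ∧ ‖z‖ < R ∧ 0 < z.im} := by
    intro w hw
    rw [mem_reProdIm] at hw
    refine ⟨?_, ?_, ?_⟩
    · rw [norm_exp, ← Real.exp_log hr]; exact Real.exp_lt_exp.2 hw.1.1
    · rw [norm_exp, ← Real.exp_log hR]; exact Real.exp_lt_exp.2 hw.1.2
    · rw [exp_im]; exact mul_pos (Real.exp_pos _) (Real.sin_pos_of_mem_Ioo hw.2)
  have key := Complex.integral_boundary_rect_eq_zero_of_continuousOn_of_differentiableOn g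
    ⟨Real.log r, 0⟩ ⟨Real.log R, Real.pi⟩
    ((hc.comp continuous_exp.continuousOn hmaps).mul continuous_exp.continuousOn)
    (by
      simp only [min_eq_left hlog, max_eq_right hlog, min_eq_left Real.pi_pos.le,
        max_eq_right Real.pi_pos.le]
      exact (hd.comp differentiable_exp.differentiableOn hmaps').mul
        differentiable_exp.differentiableOn)
  have hsub : ∀ G : ℝ → ℂ, ContinuousOn G (Set.Icc r R) →
      ∫ x in Real.log r..Real.log R, ((Real.exp x : ℝ) : ℂ) * G (Real.exp x) =
        ∫ s in r..R, G s := by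
    intro G hG
    have := intervalIntegral.integral_deriv_smul_comp'' (a := Real.log r) (b := Real.log R)
      (f := Real.exp) (f' := Real.exp) (g := G) Real.continuous_exp.continuousOn
      (fun x _ => (Real.hasDerivAt_exp x).hasDerivWithinAt) Real.continuous_exp.continuousOn
      (hG.mono (by
        rintro _ ⟨x, hx, rfl⟩
        rw [Set.uIcc_of_le hlog] at hx
        constructor
        · rw [← Real.exp_log hr]; exact Real.exp_le_exp.2 hx.1
        · rw [← Real.exp_log hR]; exact Real.exp_le_exp.2 hx.2))
    rw [Real.exp_log hr, Real.exp_log hR] at this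
    rw [← this]
    simp
  have c1 : ContinuousOn (fun s : ℝ => f s) (Set.Icc r R) :=
    hc.comp continuous_ofReal.continuousOn fun s hs => (ofReal_mem_halfAnnulus hr hs).1
  have c2 : ContinuousOn (fun s : ℝ => f (-(s : ℂ))) (Set.Icc r R) :=
    hc.comp continuous_ofReal.neg.continuousOn fun s hs => (ofReal_mem_halfAnnulus hr hs).2
  have e1 : ∫ x in Real.log r..Real.log R, g (x + ((0 : ℝ) : ℂ) * I) = ∫ s in r..R, f s := by
    rw [← hsub _ c1]
    refine intervalIntegral.integral_congr fun x _ => ?_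
    simp [hg, mul_comm]
  have e2 : ∫ x in Real.log r..Real.log R, g (x + ((Real.pi : ℝ) : ℂ) * I) =
      - ∫ s in r..R, f (-(s : ℂ)) := by
    rw [← hsub _ c2, ← intervalIntegral.integral_neg]
    refine intervalIntegral.integral_congr fun x _ => ?_
    have : exp ((x : ℂ) + Real.pi * I) = -exp x := by rw [exp_add, exp_pi_mul_I]; ring
    simp only [hg, this, ofReal_exp]
    ring
  have e3 : ∀ ρ : ℝ, 0 < ρ → I • ∫ y in (0 : ℝ)..Real.pi, g (((Real.log ρ : ℝ) : ℂ) + y * I) =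
      arc f ρ := by
    intro ρ hρ
    rw [arc, smul_eq_mul, ← intervalIntegral.integral_const_mul]
    refine intervalIntegral.integral_congr fun y _ => ?_
    have : exp (((Real.log ρ : ℝ) : ℂ) + y * I) = ρ * exp (I * y) := by
      rw [exp_add, ← ofReal_exp, Real.exp_log hρ, mul_comm I]
    simp only [hg, this]
    ring
  simp only [e1, e2, e3 r hr, e3 R hR] at key
  rw [intervalIntegral.integral_add]
  · linear_combination key
  · exact (c1.mono (by rw [Set.uIcc_of_le hrR])).intervalIntegrable
  · exact (c2.mono (by rw [Set.uIcc_of_le hrR])).intervalIntegrable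

theorem circle_ne_of_ne {ρ q0 : ℝ} (hρ : 0 < ρ) {φ : ℝ} (hφ : φ ∈ Set.Ioc 0 Real.pi)
    (h : φ ≠ Real.pi / 2) : (ρ : ℂ) * exp (I * φ) ≠ I * q0 := by
  intro he
  have := congrArg re he
  rw [Complex.re_ofReal_mul, mul_comm I, exp_ofReal_mul_I_re] at this
  simp at this
  rcases this with h1 | h1
  · exact hρ.ne' h1
  · apply h
    exact Real.injOn_cos ⟨hφ.1.le, hφ.2⟩ ⟨by positivity, by linarith [Real.pi_pos]⟩
      (by rw [h1, Real.cos_pi_div_two])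

/-- The arc integral is continuous in the radius, even if `f` is only bounded at one point. -/
theorem continuousOn_arc {f : ℂ → ℂ} {r R q0 B : ℝ} (hr : 0 < r)
    (hc : ContinuousOn f (halfAnnulus r R \ {I * (q0 : ℂ)}))
    (hB : ∀ z ∈ halfAnnulus r R \ {I * (q0 : ℂ)}, ‖f z‖ ≤ B) :
    ContinuousOn (arc f) (Set.Icc r R) := by
  -- An arc can meet iq₀ only at the angle π/2, so one null set of angles serves for all radii at
  -- once.
  have hae : ∀ᵐ φ : ℝ, φ ≠ Real.pi / 2 := by
    simp [ae_iff]
  have hmem : ∀ ρ ∈ Set.Icc r R, ∀ φ ∈ Set.Ioc 0 Real.pi, φ ≠ Real.pi / 2 →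
      (ρ : ℂ) * exp (I * φ) ∈ halfAnnulus r R \ {I * (q0 : ℂ)} := fun ρ hρ φ hφ h =>
    ⟨circle_mem_halfAnnulus hr hρ ⟨hφ.1.le, hφ.2⟩, circle_ne_of_ne (hr.trans_le hρ.1) hφ h⟩
  intro ρ0 hρ0
  refine intervalIntegral.continuousWithinAt_of_dominated_interval
    (bound := fun _ => |B| * R) ?_ ?_ intervalIntegrable_const ?_
  · refine eventually_mem_nhdsWithin.mono fun ρ hρ => ?_
    rw [Set.uIoc_of_le Real.pi_pos.le]
    have hs : volume.restrict (Set.Ioc 0 Real.pi) =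
        volume.restrict (Set.Ioc 0 Real.pi \ {Real.pi / 2}) := by
      refine Measure.restrict_congr_set ?_
      exact (sdiff_null_ae_eq_self (by simp)).symm
    rw [hs]
    refine ContinuousOn.aestronglyMeasurable ?_ (measurableSet_Ioc.diff (measurableSet_singleton _))
    refine ContinuousOn.mul (hc.comp (by fun_prop) fun φ hφ => hmem ρ hρ φ hφ.1 hφ.2) (by fun_prop)
  · refine eventually_mem_nhdsWithin.mono fun ρ hρ => ?_
    filter_upwards [hae] with φ h1 h2
    rw [Set.uIoc_of_le Real.pi_pos.le] at h2
    rw [norm_mul, mul_assoc I, norm_mul I, norm_I, one_mul, norm_circle (hr.le.trans hρ.1)]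
    exact mul_le_mul ((hB _ (hmem ρ hρ φ h2 h1)).trans (le_abs_self B)) hρ.2 (hr.le.trans hρ.1)
      (abs_nonneg B)
  · filter_upwards [hae] with φ h1 h2
    rw [Set.uIoc_of_le Real.pi_pos.le] at h2
    have : ContinuousOn (fun ρ : ℝ => f (ρ * exp (I * φ)) * (I * ρ * exp (I * φ)))
        (Set.Icc r R) :=
      ContinuousOn.mul (hc.comp (by fun_prop) fun ρ hρ => hmem ρ hρ φ h2 h1) (by fun_prop)
    exact this ρ0 hρ0

/-- Cauchy's theorem for a half annulus with a bounded singularity on the boundary. -/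
theorem integral_halfAnnulus_of_bounded {f : ℂ → ℂ} {r R q0 B : ℝ} (hr : 0 < r) (hrR : r < R)
    (hq : q0 ≤ r ∨ R ≤ q0)
    (hc : ContinuousOn f (halfAnnulus r R \ {I * (q0 : ℂ)}))
    (hB : ∀ z ∈ halfAnnulus r R \ {I * (q0 : ℂ)}, ‖f z‖ ≤ B) (hq0 : 0 < q0)
    (hd : DifferentiableOn ℂ f {z | r < ‖z‖ ∧ ‖z‖ < R ∧ 0 < z.im}) :
    ∫ s in r..R, (f s + f (-(s : ℂ))) = arc f r - arc f R := by
  have hne : ∀ s : ℝ, (s : ℂ) ≠ I * q0 := fun s h => by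
    have := congrArg im h
    simp at this
    exact hq0.ne this
  have c1 : ContinuousOn (fun s : ℝ => f s + f (-(s : ℂ))) (Set.Icc r R) := by
    refine ContinuousOn.add ?_ ?_
    · exact hc.comp continuous_ofReal.continuousOn fun s hs =>
        ⟨(ofReal_mem_halfAnnulus hr hs).1, hne s⟩
    · exact hc.comp continuous_ofReal.neg.continuousOn fun s hs =>
        ⟨(ofReal_mem_halfAnnulus hr hs).2, by simpa using hne (-s)⟩
  have hi : IntervalIntegrable (fun s : ℝ => f s + f (-(s : ℂ))) volume r R :=
    (c1.mono (by rw [Set.uIcc_of_le hrR.le])).intervalIntegrable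
  set ρ0 := (r + R) / 2 with hρ0
  have hm : ρ0 ∈ Set.Ioo r R := ⟨by rw [hρ0]; linarith, by rw [hρ0]; linarith⟩
  -- This function of the radius is constant on the open interval by Cauchy's theorem, because the
  -- circle through iq₀ can only be at an end; continuity extends the constancy to the closed
  -- interval.
  set h : ℝ → ℂ := fun ρ => (∫ s in r..ρ, (f s + f (-(s : ℂ)))) + arc f ρ with hh
  have hcont : ContinuousOn h (Set.Icc r R) := by
    refine ContinuousOn.add ?_ (continuousOn_arc hr hc hB)
    have := intervalIntegral.continuousOn_primitive_interval' hi (a := r) (by simp)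
    rwa [Set.uIcc_of_le hrR.le] at this
  have hII : ∀ u ∈ Set.Icc r R, ∀ v ∈ Set.Icc r R,
      IntervalIntegrable (fun s : ℝ => f s + f (-(s : ℂ))) volume u v := fun u hu v hv =>
    hi.mono_set (by
      rw [Set.uIcc_of_le hrR.le]
      exact Set.uIcc_subset_Icc hu hv)
  have hstep : ∀ u v, r < u → u ≤ v → v < R → h u = h v := by
    intro u v hu huv hv
    have hsub : halfAnnulus u v ⊆ halfAnnulus r R \ {I * (q0 : ℂ)} := by
      rintro z ⟨h1, h2, h3⟩
      refine ⟨⟨hu.le.trans h1, h2.trans hv.le, h3⟩, fun he => ?_⟩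
      rw [Set.mem_singleton_iff] at he
      have : ‖z‖ = q0 := by rw [he]; simp [hq0.le]
      rcases hq with hq | hq <;> linarith
    have := integral_halfAnnulus (hr.trans hu) huv (hc.mono hsub)
      (hd.mono fun z hz => ⟨hu.trans hz.1, hz.2.1.trans hv, hz.2.2⟩)
    have h2 := intervalIntegral.integral_add_adjacent_intervals
      (hII r ⟨le_rfl, hrR.le⟩ u ⟨hu.le, (huv.trans hv.le)⟩)
      (hII u ⟨hu.le, (huv.trans hv.le)⟩ v ⟨hu.le.trans huv, hv.le⟩)
    simp only [hh]
    rw [← h2, this]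
    ring
  have hEq : Set.EqOn h (fun _ => h ρ0) (Set.Ioo r R) := by
    intro ρ hρ
    rcases le_total ρ ρ0 with hle | hle
    · exact hstep _ _ hρ.1 hle hm.2
    · exact (hstep _ _ hm.1 hle hρ.2).symm
  have hEq' : Set.EqOn h (fun _ => h ρ0) (Set.Icc r R) :=
    hEq.of_subset_closure hcont continuousOn_const Set.Ioo_subset_Icc_self
      (by rw [closure_Ioo hrR.ne])
  have e1 := hEq' (Set.left_mem_Icc.2 hrR.le)
  have e2 := hEq' (Set.right_mem_Icc.2 hrR.le)
  simp only at e1 e2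
  have e3 : h R = h r := e2.trans e1.symm
  simp only [hh, intervalIntegral.integral_same] at e3
  linear_combination e3

/-- If z f(z) → a along the arcs, the half circle contributes half a residue. -/
theorem tendsto_arc {f : ℂ → ℂ} {l : Filter ℝ} {a : ℂ}
    (hc : ∀ᶠ ρ : ℝ in l, ContinuousOn (fun φ : ℝ => f (ρ * exp (I * φ))) (Set.Icc 0 Real.pi))
    (hl : ∀ ε > 0, ∀ᶠ ρ : ℝ in l, ∀ φ ∈ Set.Icc 0 Real.pi,
      ‖(ρ * exp (I * φ)) * f (ρ * exp (I * φ)) - a‖ ≤ ε) :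
    Tendsto (arc f) l (𝓝 (I * Real.pi * a)) := by
  rw [Metric.tendsto_nhds]
  intro ε hε
  have hpi := Real.pi_pos
  filter_upwards [hc, hl (ε / (2 * Real.pi)) (by positivity)] with ρ h1 h2
  have e : arc f ρ - I * Real.pi * a = ∫ φ in (0 : ℝ)..Real.pi,
      (f (ρ * exp (I * φ)) * (I * ρ * exp (I * φ)) - I * a) := by
    rw [intervalIntegral.integral_sub, arc, intervalIntegral.integral_const]
    · simp; ring
    · refine ContinuousOn.intervalIntegrable ?_
      rw [Set.uIcc_of_le hpi.le]
      exact h1.mul (by fun_prop)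
    · exact intervalIntegrable_const
  rw [dist_eq_norm, e]
  refine (intervalIntegral.norm_integral_le_of_norm_le_const (C := ε / (2 * Real.pi))
    fun φ hφ => ?_).trans_lt ?_
  · rw [Set.uIoc_of_le hpi.le] at hφ
    have := h2 φ ⟨hφ.1.le, hφ.2⟩
    have e2 : f (ρ * exp (I * φ)) * (I * ρ * exp (I * φ)) - I * a =
      I * ((ρ * exp (I * φ)) * f (ρ * exp (I * φ)) - a) := by ring
    rw [e2, norm_mul, norm_I, one_mul]
    exact this
  · rw [sub_zero, abs_of_pos hpi]
    have : ε / (2 * Real.pi) * Real.pi = ε / 2 := by field_simp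
    rw [this]
    linarith

/-! ## Functions on one side of the contour -/

/-- `f` is holomorphic in `D`, continuous up to the contour and bounded near the branch points. -/
structure HalfRegular (q0 : ℝ) (D : Set ℂ) (f : ℂ → ℂ) : Prop where
  diff : DifferentiableOn ℂ f D
  cont : ContinuousOn f (D ∪ Sigma0 q0)
  bdd : ∃ C, ∃ ε > 0, ∀ z ∈ D ∪ Sigma0 q0, (‖z - I * q0‖ < ε ∨ ‖z + I * q0‖ < ε) → ‖f z‖ ≤ C

/-- `f` is moreover such that `z f(z)` tends to `a` at infinity and to `c` at the origin. -/
structure Admissible (q0 : ℝ) (D : Set ℂ) (f : ℂ → ℂ) (a c : ℂ) : Prop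
    extends HalfRegular q0 D f where
  infty : Tendsto (fun z => z * f z) (Bornology.cobounded ℂ ⊓ 𝓟 (D ∪ Sigma0 q0)) (𝓝 a)
  zero : Tendsto (fun z => z * f z) (𝓝[D ∪ Sigma0 q0] 0) (𝓝 c)

/-! ### Half annuli that exhaust the upper half plane outside and inside the circle. -/

section

variable {q0 : ℝ} {f : ℂ → ℂ} {a c : ℂ}

theorem HalfRegular.exists_bound {D : Set ℂ} (hf : HalfRegular q0 D f) {r R : ℝ}
    (hD : halfAnnulus r R \ {I * (q0 : ℂ)} ⊆ D ∪ Sigma0 q0) :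
    ∃ B, ∀ z ∈ halfAnnulus r R \ {I * (q0 : ℂ)}, ‖f z‖ ≤ B := by
  obtain ⟨C, ε, hε, hC⟩ := hf.bdd
  have hcomp : IsCompact (halfAnnulus r R \ Metric.ball (I * (q0 : ℂ)) ε) :=
    (isCompact_halfAnnulus r R).diff Metric.isOpen_ball
  have hsub : halfAnnulus r R \ Metric.ball (I * (q0 : ℂ)) ε ⊆
      halfAnnulus r R \ {I * (q0 : ℂ)} := by
    refine Set.sdiff_subset_sdiff_right ?_
    rintro _ rfl
    exact Metric.mem_ball_self hε
  obtain ⟨C', hC'⟩ := hcomp.exists_bound_of_continuousOn (hf.cont.mono (hsub.trans hD))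
  refine ⟨max C C', fun z hz => ?_⟩
  by_cases hb : z ∈ Metric.ball (I * (q0 : ℂ)) ε
  · exact (hC z (hD hz) (Or.inl (by simpa [dist_eq_norm] using hb))).trans (le_max_left _ _)
  · exact (hC' z ⟨hz.1, hb⟩).trans (le_max_right _ _)

theorem halfAnnulus_outer_subset (hq : 0 < q0) {r R : ℝ} (hr : q0 ≤ r) :
    halfAnnulus r R \ {I * (q0 : ℂ)} ⊆ Dplus q0 ∪ Sigma0 q0 := by
  rintro z ⟨⟨h1, h2, h3⟩, h4⟩
  rcases (hr.trans h1).eq_or_lt with h | h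
  · refine Or.inr ⟨Or.inr h.symm, ?_, h4, ?_⟩
    · rintro rfl; simp at h; exact hq.ne' h
    · rintro rfl; simp at h3; linarith
  · exact mem_DS_of_im_nonneg hq h h3

theorem halfAnnulus_inner_subset (hq : 0 < q0) {r R : ℝ} (hr : 0 < r) (hR : R ≤ q0) :
    halfAnnulus r R \ {I * (q0 : ℂ)} ⊆ Dminus q0 ∪ Sigma0 q0 := by
  rintro z ⟨⟨h1, h2, h3⟩, h4⟩
  have hz0 : z ≠ 0 := norm_pos_iff.1 (hr.trans_le h1)
  have hS : z.im = 0 ∨ ‖z‖ = q0 → z ∈ Dminus q0 ∪ Sigma0 q0 := fun h =>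
    Or.inr ⟨h, hz0, h4, by rintro rfl; simp at h3; linarith⟩
  rcases (h2.trans hR).eq_or_lt with h | h
  · exact hS (Or.inr h)
  rcases h3.eq_or_lt with h' | h'
  · exact hS (Or.inl h'.symm)
  left
  have : ‖z‖ ^ 2 - q0 ^ 2 < 0 := by have := norm_nonneg z; nlinarith
  exact mul_neg_of_neg_of_pos this h'

theorem continuousOn_circle {S : Set ℂ} (hf : ContinuousOn f S) {ρ : ℝ}
    (h : ∀ φ ∈ Set.Icc 0 Real.pi, (ρ : ℂ) * exp (I * φ) ∈ S) :
    ContinuousOn (fun φ : ℝ => f (ρ * exp (I * φ))) (Set.Icc 0 Real.pi) :=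
  hf.comp (by fun_prop) h

/-- In the upper half plane, D⁺ is the exterior of the circle. The integral over the real axis is
kept as f(s) + f(-s) over truncations, since z f(z) → a does not make the two halves converge
separately. -/
theorem Admissible.tendsto_outer (hq : 0 < q0) (hf : Admissible q0 (Dplus q0) f a c) :
    Tendsto (fun R : ℝ => ∫ s in q0..R, (f s + f (-(s : ℂ)))) atTop
      (𝓝 (arc f q0 - I * Real.pi * a)) := by
  have hmem : ∀ ρ > q0, ∀ φ ∈ Set.Icc 0 Real.pi, (ρ : ℂ) * exp (I * φ) ∈ Dplus q0 ∪ Sigma0 q0 :=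
    fun ρ hρ φ hφ => halfAnnulus_outer_subset hq (r := ρ) (R := ρ) hρ.le
      ⟨circle_mem_halfAnnulus (hq.trans hρ) ⟨le_rfl, le_rfl⟩ hφ, fun he => by
        have h1 := norm_circle (hq.trans hρ).le φ
        rw [Set.mem_singleton_iff.1 he] at h1
        simp at h1
        rw [abs_of_pos hq] at h1
        exact hρ.ne h1⟩
  have h1 : Tendsto (arc f) atTop (𝓝 (I * Real.pi * a)) := by
    refine tendsto_arc ?_ ?_
    · filter_upwards [eventually_gt_atTop q0] with ρ hρ
      exact continuousOn_circle hf.cont (hmem ρ hρ)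
    · intro ε hε
      have h2 := (Metric.tendsto_nhds.1 hf.infty) ε hε
      rw [eventually_inf_principal] at h2
      obtain ⟨R, -, hR⟩ := (Metric.hasBasis_cobounded_compl_closedBall (0 : ℂ)).eventually_iff.1 h2
      filter_upwards [eventually_gt_atTop q0, eventually_gt_atTop R] with ρ hρ hρR φ hφ
      have := hR (x := (ρ : ℂ) * exp (I * φ)) (by
        simp only [Set.mem_compl_iff, Metric.mem_closedBall, dist_zero_right, not_le]
        rwa [norm_circle (hq.trans hρ).le]) (hmem ρ hρ φ hφ)
      rw [dist_eq_norm] at this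
      exact this.le
  refine (tendsto_const_nhds.sub h1).congr' ?_
  filter_upwards [eventually_gt_atTop q0] with R hR
  obtain ⟨B, hB⟩ := hf.toHalfRegular.exists_bound (halfAnnulus_outer_subset hq (R := R) le_rfl)
  refine (integral_halfAnnulus_of_bounded hq hR (Or.inl le_rfl)
    (hf.cont.mono (halfAnnulus_outer_subset hq le_rfl)) hB hq (hf.diff.mono fun z hz => ?_)).symm
  exact mul_pos (by nlinarith [hz.1]) hz.2.2

theorem Admissible.tendsto_inner (hq : 0 < q0) (hf : Admissible q0 (Dminus q0) f a c) :
    Tendsto (fun r : ℝ => ∫ s in r..q0, (f s + f (-(s : ℂ)))) (𝓝[>] 0)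
      (𝓝 (I * Real.pi * c - arc f q0)) := by
  have hmem : ∀ ρ ∈ Set.Ioo 0 q0, ∀ φ ∈ Set.Icc 0 Real.pi,
      (ρ : ℂ) * exp (I * φ) ∈ Dminus q0 ∪ Sigma0 q0 :=
    fun ρ hρ φ hφ => halfAnnulus_inner_subset hq (r := ρ) (R := ρ) hρ.1 hρ.2.le
      ⟨circle_mem_halfAnnulus hρ.1 ⟨le_rfl, le_rfl⟩ hφ, fun he => by
        have h1 := norm_circle hρ.1.le φ
        rw [Set.mem_singleton_iff.1 he] at h1
        simp at h1
        rw [abs_of_pos hq] at h1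
        exact hρ.2.ne' h1⟩
  have hev : ∀ᶠ ρ : ℝ in 𝓝[>] 0, ρ ∈ Set.Ioo 0 q0 := Ioo_mem_nhdsGT hq
  have h1 : Tendsto (arc f) (𝓝[>] 0) (𝓝 (I * Real.pi * c)) := by
    refine tendsto_arc ?_ ?_
    · filter_upwards [hev] with ρ hρ
      exact continuousOn_circle hf.cont (hmem ρ hρ)
    · intro ε hε
      have h2 := (Metric.tendsto_nhds.1 hf.zero) ε hε
      obtain ⟨R, hRpos, hR⟩ := Metric.mem_nhdsWithin_iff.1 h2
      filter_upwards [hev, Ioo_mem_nhdsGT hRpos] with ρ hρ hρR φ hφ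
      have := hR (a := (ρ : ℂ) * exp (I * φ)) ⟨by
        rw [Metric.mem_ball, dist_zero_right, norm_circle hρ.1.le]; exact hρR.2, hmem ρ hρ φ hφ⟩
      simp only [Set.mem_ofPred_eq, dist_eq_norm] at this
      exact this.le
  refine (h1.sub tendsto_const_nhds).congr' ?_
  filter_upwards [hev] with r hr
  obtain ⟨B, hB⟩ := hf.toHalfRegular.exists_bound (halfAnnulus_inner_subset hq (R := q0) hr.1 le_rfl)
  refine (integral_halfAnnulus_of_bounded hr.1 hr.2 (Or.inr le_rfl)
    (hf.cont.mono (halfAnnulus_inner_subset hq hr.1 le_rfl)) hB hq (hf.diff.mono fun z hz => ?_)).symm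
  have : ‖z‖ ^ 2 - q0 ^ 2 < 0 := by have := norm_nonneg z; nlinarith [hz.2.1]
  exact mul_neg_of_neg_of_pos this hz.2.2

end

/-! ### Contour integrals of jumps, and Liouville's theorem for sectionally holomorphic functions.
-/

section

variable {q0 : ℝ} {D : Set ℂ} {f g : ℂ → ℂ} {a c : ℂ}

theorem tendsto_neg_within {S T : Set ℂ} (h : ∀ z ∈ S, -z ∈ T) :
    Tendsto (fun z : ℂ => -z) (𝓝[S] 0) (𝓝[T] 0) := by
  refine tendsto_nhdsWithin_iff.2 ⟨?_, eventually_mem_nhdsWithin.mono h⟩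
  have : Tendsto (fun z : ℂ => -z) (𝓝 0) (𝓝 0) := by simpa using (continuous_neg.tendsto (0 : ℂ))
  exact this.mono_left nhdsWithin_le_nhds

theorem tendsto_neg_cobounded_within {S T : Set ℂ} (h : ∀ z ∈ S, -z ∈ T) :
    Tendsto (fun z : ℂ => -z) (Bornology.cobounded ℂ ⊓ 𝓟 S) (Bornology.cobounded ℂ ⊓ 𝓟 T) :=
  tendsto_inf.2 ⟨tendsto_neg_cobounded.mono_left inf_le_left,
    tendsto_principal.2 (eventually_inf_principal.2 (Eventually.of_forall h))⟩

/-- z ↦ -z exchanges D⁺ and D⁻ and preserves Σ₀. The lower half plane is in this way reduced to half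
annuli in the upper one. -/
theorem HalfRegular.comp_neg {D' : Set ℂ} (hf : HalfRegular q0 D f)
    (h : ∀ z ∈ D', -z ∈ D) : HalfRegular q0 D' fun z => f (-z) := by
  have h' : ∀ z ∈ D' ∪ Sigma0 q0, -z ∈ D ∪ Sigma0 q0 := by
    rintro z (hz | hz)
    · exact Or.inl (h z hz)
    · exact Or.inr (neg_mem_Sigma0.2 hz)
  refine ⟨hf.diff.comp differentiable_neg.differentiableOn h,
    hf.cont.comp continuous_neg.continuousOn h', ?_⟩
  obtain ⟨C, ε, hε, hC⟩ := hf.bdd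
  refine ⟨C, ε, hε, fun z hz hzε => hC _ (h' z hz) ?_⟩
  rw [← norm_neg, ← norm_neg (-z + _), or_comm, neg_sub, neg_add, neg_neg, sub_neg_eq_add,
    ← sub_eq_add_neg, add_comm]
  exact hzε

theorem Admissible.comp_neg {D' : Set ℂ} (hf : Admissible q0 D f a c)
    (h : ∀ z ∈ D', -z ∈ D) : Admissible q0 D' (fun z => f (-z)) (-a) (-c) := by
  have h' : ∀ z ∈ D' ∪ Sigma0 q0, -z ∈ D ∪ Sigma0 q0 := by
    rintro z (hz | hz)
    · exact Or.inl (h z hz)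
    · exact Or.inr (neg_mem_Sigma0.2 hz)
  refine ⟨hf.toHalfRegular.comp_neg h, ?_, ?_⟩
  · refine ((hf.infty.comp (tendsto_neg_cobounded_within h')).neg).congr fun z => ?_
    simp
  · refine ((hf.zero.comp (tendsto_neg_within h')).neg).congr fun z => ?_
    simp

/-- The points of the circle, except for the two branch points, belong to the continuous
spectrum. -/
theorem circle_mem_Sigma0 (hq : 0 < q0) {φ : ℝ}
    (hφ : φ ∈ Set.Ioc (-Real.pi) Real.pi \ {Real.pi / 2, -(Real.pi / 2)}) :
    (q0 : ℂ) * exp (I * φ) ∈ Sigma0 q0 := by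
  have hpi := Real.pi_pos
  have key : Real.cos φ ≠ 0 := by
    intro h0
    rw [Real.cos_eq_zero_iff] at h0
    obtain ⟨k, hk⟩ := h0
    have h1 : -1 ≤ k := by
      by_contra hcon
      have : (k : ℝ) ≤ -2 := by exact_mod_cast (by omega : k ≤ -2)
      have := hφ.1.1
      nlinarith
    have h2 : k ≤ 0 := by
      by_contra hcon
      have : (1 : ℝ) ≤ k := by exact_mod_cast (by omega : 1 ≤ k)
      have := hφ.1.2
      nlinarith
    apply hφ.2
    obtain rfl | rfl : k = 0 ∨ k = -1 := by omega
    · left; rw [hk]; push_cast; ring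
    · right; rw [Set.mem_singleton_iff, hk]; push_cast; ring
  have hre : ((q0 : ℂ) * exp (I * φ)).re ≠ 0 := by
    rw [Complex.re_ofReal_mul, mul_comm I, exp_ofReal_mul_I_re]
    exact mul_ne_zero hq.ne' key
  refine ⟨Or.inr (norm_circle hq.le φ), ?_, ?_, ?_⟩
  · intro h; rw [h] at hre; simp at hre
  · intro h; rw [h] at hre; simp at hre
  · intro h; rw [h] at hre; simp at hre

theorem circle_ae_eq : (Set.Ioc (-Real.pi) Real.pi \ {Real.pi / 2, -(Real.pi / 2)} : Set ℝ)
    =ᵐ[volume] Set.Ioc (-Real.pi) Real.pi :=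
  sdiff_null_ae_eq_self ((Set.toFinite _).measure_zero _)

/-- Near the branch points the function is bounded by hypothesis, on the rest of the circle by
compactness; the two omitted angles form a null set. -/
theorem HalfRegular.integrableOn_circle (hq : 0 < q0) (hf : HalfRegular q0 D f) :
    IntegrableOn (fun φ : ℝ => f (q0 * exp (I * φ))) (Set.Ioc (-Real.pi) Real.pi) := by
  obtain ⟨C, ε, hε, hC⟩ := hf.bdd
  set K : Set ℂ := Metric.sphere 0 q0 \ (Metric.ball (I * (q0 : ℂ)) ε ∪
    Metric.ball (-(I * (q0 : ℂ))) ε) with hK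
  have hKc : IsCompact K := (isCompact_sphere _ _).diff (Metric.isOpen_ball.union
    Metric.isOpen_ball)
  have hKs : K ⊆ D ∪ Sigma0 q0 := by
    rintro z ⟨h1, h2⟩
    have h1' : ‖z‖ = q0 := by simpa using h1
    refine Or.inr ⟨Or.inr h1', ?_, ?_, ?_⟩
    · rintro rfl; simp at h1'; exact hq.ne h1'
    · rintro rfl; exact h2 (Or.inl (Metric.mem_ball_self hε))
    · rintro rfl; exact h2 (Or.inr (Metric.mem_ball_self hε))
  obtain ⟨C', hC'⟩ := hKc.exists_bound_of_continuousOn (hf.cont.mono hKs)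
  have hb : ∀ φ ∈ Set.Ioc (-Real.pi) Real.pi \ {Real.pi / 2, -(Real.pi / 2)},
      ‖f (q0 * exp (I * φ))‖ ≤ max C C' := by
    intro φ hφ
    by_cases hm : (q0 : ℂ) * exp (I * φ) ∈ K
    · exact (hC' _ hm).trans (le_max_right _ _)
    · refine (hC _ (Or.inr (circle_mem_Sigma0 hq hφ)) ?_).trans (le_max_left _ _)
      by_contra hcon
      refine hm ⟨by simpa using norm_circle hq.le φ, fun h => hcon ?_⟩
      rcases h with h | h
      · left; simpa [dist_eq_norm] using h
      · right; simpa [dist_eq_norm] using h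
  rw [← integrableOn_congr_set_ae circle_ae_eq]
  have hms : MeasurableSet (Set.Ioc (-Real.pi) Real.pi \ {Real.pi / 2, -(Real.pi / 2)} : Set ℝ) :=
    measurableSet_Ioc.diff (Set.toFinite _).measurableSet
  refine Integrable.mono' (g := fun _ => max C C') (integrableOn_const
    ((measure_mono Set.sdiff_subset).trans_lt measure_Ioc_lt_top).ne) ?_ ?_
  · have := (hf.cont.comp (by fun_prop)
      fun φ hφ => Or.inr (circle_mem_Sigma0 hq hφ)).aestronglyMeasurable (μ := volume) hms
    exact this
  · exact (ae_restrict_iff' hms).2 (Eventually.of_forall hb)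

theorem arc_eq_of_eqOn (hq : 0 < q0) (h : Set.EqOn f g (Sigma0 q0)) : arc f q0 = arc g q0 := by
  refine intervalIntegral.integral_congr_ae ?_
  have h0 : ∀ᵐ φ : ℝ, φ ∉ ({Real.pi / 2, -(Real.pi / 2)} : Set ℝ) :=
    (Set.toFinite _).countable.ae_notMem _
  filter_upwards [h0] with φ h1 h2
  rw [Set.uIoc_of_le Real.pi_pos.le] at h2
  rw [h (circle_mem_Sigma0 hq ⟨⟨by linarith [h2.1, Real.pi_pos], h2.2⟩, h1⟩)]

theorem arc_sub (hf : IntegrableOn (fun φ : ℝ => f (q0 * exp (I * φ))) (Set.Ioc (-Real.pi) Real.pi))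
    (hg : IntegrableOn (fun φ : ℝ => g (q0 * exp (I * φ))) (Set.Ioc (-Real.pi) Real.pi)) :
    arc (fun z => f z - g z) q0 = arc f q0 - arc g q0 := by
  have key : ∀ {F : ℂ → ℂ},
      IntegrableOn (fun φ : ℝ => F (q0 * exp (I * φ))) (Set.Ioc (-Real.pi) Real.pi) →
      IntervalIntegrable (fun φ : ℝ => F (q0 * exp (I * φ)) * (I * q0 * exp (I * φ))) volume
        0 Real.pi := by
    intro F hF
    refine IntervalIntegrable.mul_continuousOn ?_ (by fun_prop)
    rw [intervalIntegrable_iff_integrableOn_Ioc_of_le Real.pi_pos.le]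
    exact hF.mono_set (Set.Ioc_subset_Ioc_left (by linarith [Real.pi_pos]))
  rw [arc, arc, arc, ← intervalIntegral.integral_sub (key hf) (key hg)]
  simp only [sub_mul]

theorem arc_comp_neg (f : ℂ → ℂ) (ρ : ℝ) :
    ∫ φ in (-Real.pi)..0, f (ρ * exp (I * φ)) * (I * ρ * exp (I * φ)) =
      -arc (fun z => f (-z)) ρ := by
  have := intervalIntegral.integral_comp_sub_right (a := 0) (b := Real.pi)
    (fun φ : ℝ => f (ρ * exp (I * φ)) * (I * ρ * exp (I * φ))) Real.pi
  rw [zero_sub, sub_self] at this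
  rw [← this, arc, ← intervalIntegral.integral_neg]
  refine intervalIntegral.integral_congr fun φ _ => ?_
  have e : exp (I * ((φ - Real.pi : ℝ) : ℂ)) = -exp (I * φ) := by
    rw [ofReal_sub, mul_sub, mul_comm I (Real.pi : ℂ), exp_sub, exp_pi_mul_I]; ring
  simp only [e, mul_neg]

/-- The contour integral as integrals over half lines, segments and upper half circles. -/
theorem sigmaIntegral_eq (hq : 0 < q0) (h : Integrable fun s : ℝ => f s) :
    sigmaIntegral q0 f = (∫ s in Set.Ioi q0, (f (s : ℂ) + f (-(s : ℂ))))
      - (∫ s in (0 : ℝ)..q0, (f (s : ℂ) + f (-(s : ℂ)))) - arc (fun z => f (-z)) q0 - arc f q0 := by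
  have hn : Integrable fun s : ℝ => f (-(s : ℂ)) := by simpa using h.comp_neg
  have e1 : ∫ s in {s : ℝ | q0 < |s|}, f s = ∫ s in Set.Ioi q0, (f (s : ℂ) + f (-(s : ℂ))) := by
    have hs : {s : ℝ | q0 < |s|} = Set.Ioi q0 ∪ Set.Iio (-q0) := by
      ext s
      simp only [Set.mem_ofPred_eq, lt_abs, Set.mem_union, Set.mem_Ioi, Set.mem_Iio]
      refine or_congr Iff.rfl ⟨fun h => by linarith, fun h => by linarith⟩
    rw [hs, setIntegral_union (Set.disjoint_left.2 fun s h1 h2 => ?_) measurableSet_Iio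
      h.integrableOn h.integrableOn, ← integral_Iic_eq_integral_Iio,
      ← integral_comp_neg_Ioi (f := fun s : ℝ => f s),
      ← integral_add h.integrableOn]
    · simp
    · simp only [ofReal_neg]
      exact hn.integrableOn
    · have h1 : q0 < s := h1
      have h2 : s < -q0 := h2
      linarith
  have e2 : ∫ s in (-q0)..q0, f (s : ℂ) = ∫ s in (0 : ℝ)..q0, (f (s : ℂ) + f (-(s : ℂ))) := by
    rw [intervalIntegral.integral_add h.intervalIntegrable hn.intervalIntegrable,
      ← intervalIntegral.integral_add_adjacent_intervals (b := 0) h.intervalIntegrable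
        h.intervalIntegrable, add_comm]
    congr 1
    have := intervalIntegral.integral_comp_neg (a := 0) (b := q0) (fun s : ℝ => f s)
    simp only [neg_zero] at this
    rw [← this]
    simp
  rw [sigmaIntegral, e1, e2, arc_comp_neg, arc.eq_1 f, ← sub_eq_add_neg]

/-- The contour integral of the jump of a sectionally holomorphic function. -/
theorem sigmaIntegral_jump {gp gm h : ℂ → ℂ} (hq : 0 < q0)
    (hp : Admissible q0 (Dplus q0) gp a c) (hm : Admissible q0 (Dminus q0) gm a c)
    (hh : ∀ z ∈ Sigma0 q0, h z = gm z - gp z) (hi : Integrable fun s : ℝ => h s) :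
    sigmaIntegral q0 h = 2 * Real.pi * I * (a - c) := by
  have hp' := hp.comp_neg (D' := Dminus q0) fun z hz => neg_mem_Dplus.2 hz
  have hm' := hm.comp_neg (D' := Dplus q0) fun z hz => neg_mem_Dminus.2 hz
  have hn : Integrable fun s : ℝ => h (-(s : ℂ)) := by simpa using hi.comp_neg
  have hsum : Integrable fun s : ℝ => h (s : ℂ) + h (-(s : ℂ)) := hi.add hn
  have hS : ∀ s : ℝ, s ≠ 0 → h (s : ℂ) + h (-(s : ℂ)) =
      (gm s + gm (-(s : ℂ))) - (gp s + gp (-(s : ℂ))) := by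
    intro s hs
    rw [hh _ (ofReal_mem_Sigma0 hq hs), hh _ (neg_mem_Sigma0.2 (ofReal_mem_Sigma0 hq hs))]
    ring
  have II : ∀ {D : Set ℂ} {g : ℂ → ℂ}, HalfRegular q0 D g → ∀ u v : ℝ, 0 < u → u ≤ v →
      IntervalIntegrable (fun s : ℝ => g s + g (-(s : ℂ))) volume u v := by
    intro D g hg u v hu huv
    refine ContinuousOn.intervalIntegrable ?_
    have hne : ∀ s ∈ Set.uIcc u v, (s : ℂ) ∈ Sigma0 q0 := fun s hs => by
      rw [Set.uIcc_of_le huv] at hs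
      exact ofReal_mem_Sigma0 hq (hu.trans_le hs.1).ne'
    refine ContinuousOn.add ?_ ?_
    · exact hg.cont.comp continuous_ofReal.continuousOn fun s hs => Or.inr (hne s hs)
    · exact hg.cont.comp continuous_ofReal.neg.continuousOn
        fun s hs => Or.inr (neg_mem_Sigma0.2 (hne s hs))
  have hsplit : ∀ u v : ℝ, 0 < u → u ≤ v → ∫ s in u..v, (h (s : ℂ) + h (-(s : ℂ))) =
      (∫ s in u..v, (gm s + gm (-(s : ℂ)))) - ∫ s in u..v, (gp s + gp (-(s : ℂ))) := by
    intro u v hu huv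
    rw [← intervalIntegral.integral_sub (II hm.toHalfRegular u v hu huv)
      (II hp.toHalfRegular u v hu huv)]
    refine intervalIntegral.integral_congr fun s hs => hS s ?_
    rw [Set.uIcc_of_le huv] at hs
    exact (hu.trans_le hs.1).ne'
  -- Only h is absolutely integrable. The integrals of gm and gp are taken over truncations, where
  -- they can be separated, and the limit is taken for the symmetric sums. The function gm, which
  -- lives in the lower half plane outside the circle, enters through gm(-z).
  have outer : ∫ s in Set.Ioi q0, (h (s : ℂ) + h (-(s : ℂ))) =
      (arc (fun z => gm (-z)) q0 - I * Real.pi * (-a)) - (arc gp q0 - I * Real.pi * a) := by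
    refine tendsto_nhds_unique
      (intervalIntegral_tendsto_integral_Ioi q0 hsum.integrableOn tendsto_id) ?_
    have h1 := (hm'.tendsto_outer hq).sub (hp.tendsto_outer hq)
    refine h1.congr' ?_
    filter_upwards [eventually_ge_atTop q0] with R hR
    rw [id, hsplit _ _ hq hR]
    simp only [neg_neg, add_comm]
  have inner : ∫ s in (0 : ℝ)..q0, (h (s : ℂ) + h (-(s : ℂ))) =
      (I * Real.pi * c - arc gm q0) - (I * Real.pi * (-c) - arc (fun z => gp (-z)) q0) := by
    have hlim : Tendsto (fun r : ℝ => ∫ s in r..q0, (h (s : ℂ) + h (-(s : ℂ)))) (𝓝[>] 0)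
        (𝓝 (∫ s in (0 : ℝ)..q0, (h (s : ℂ) + h (-(s : ℂ))))) := by
      have h1 : Continuous fun r : ℝ => ∫ s in q0..r, (h (s : ℂ) + h (-(s : ℂ))) :=
        intervalIntegral.continuous_primitive (fun _ _ => hsum.intervalIntegrable) q0
      have h2 := (h1.neg.tendsto 0).mono_left (nhdsWithin_le_nhds (s := Set.Ioi 0))
      rw [Pi.neg_apply, ← intervalIntegral.integral_symm] at h2
      exact h2.congr fun r => (intervalIntegral.integral_symm _ _).symm
    refine tendsto_nhds_unique hlim ?_
    have h1 := (hm.tendsto_inner hq).sub (hp'.tendsto_inner hq)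
    refine h1.congr' ?_
    filter_upwards [Ioo_mem_nhdsGT hq] with r hr
    rw [hsplit _ _ hr.1 hr.2.le]
    simp only [neg_neg, add_comm]
  have a1 : arc h q0 = arc gm q0 - arc gp q0 := by
    rw [arc_eq_of_eqOn hq hh, arc_sub (hm.toHalfRegular.integrableOn_circle hq)
      (hp.toHalfRegular.integrableOn_circle hq)]
  have a2 : arc (fun z => h (-z)) q0 = arc (fun z => gm (-z)) q0 - arc (fun z => gp (-z)) q0 := by
    rw [← arc_sub (hm'.toHalfRegular.integrableOn_circle hq)
      (hp'.toHalfRegular.integrableOn_circle hq)]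
    exact arc_eq_of_eqOn hq fun z hz => hh (-z) (neg_mem_Sigma0.2 hz)
  -- All arcs over |z| = q₀ cancel. Two half residues at infinity and two at the origin remain.
  rw [sigmaIntegral_eq hq hi, outer, inner, a1, a2]
  ring

/-- On the circle each side is integrable by boundedness; on the real axis only the difference is,
which is why its decay is a separate hypothesis. -/
theorem sigmaIntegrable_jump {gp gm h : ℂ → ℂ} {C : ℝ} (hq : 0 < q0)
    (hp : HalfRegular q0 (Dplus q0) gp) (hm : HalfRegular q0 (Dminus q0) gm)
    (hh : ∀ z ∈ Sigma0 q0, h z = gm z - gp z)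
    (hb : ∀ s : ℝ, s ≠ 0 → ‖h s‖ ≤ C * (1 + s ^ 2)⁻¹) : SigmaIntegrable q0 h := by
  constructor
  · have hms : MeasurableSet ({0}ᶜ : Set ℝ) := (measurableSet_singleton 0).compl
    have hcont : ContinuousOn (fun s : ℝ => h s) {0}ᶜ := by
      have : ContinuousOn (fun s : ℝ => gm s - gp s) {0}ᶜ :=
        (hm.cont.comp continuous_ofReal.continuousOn
          fun s hs => Or.inr (ofReal_mem_Sigma0 hq hs)).sub
        (hp.cont.comp continuous_ofReal.continuousOn
          fun s hs => Or.inr (ofReal_mem_Sigma0 hq hs))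
      exact this.congr fun s hs => hh _ (ofReal_mem_Sigma0 hq hs)
    have : IntegrableOn (fun s : ℝ => h s) {0}ᶜ := by
      refine Integrable.mono' (integrable_inv_one_add_sq.const_mul C).integrableOn
        (hcont.aestronglyMeasurable hms) ?_
      exact (ae_restrict_iff' hms).2 (Eventually.of_forall hb)
    rwa [IntegrableOn, Measure.restrict_eq_self_of_ae_mem] at this
    simp [ae_iff]
  · have h1 := (hm.integrableOn_circle hq).sub (hp.integrableOn_circle hq)
    rw [← integrableOn_congr_set_ae circle_ae_eq]
    refine IntegrableOn.congr_fun (h1.mono_set Set.sdiff_subset) (fun φ hφ => ?_)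
      (measurableSet_Ioc.diff (Set.toFinite _).measurableSet)
    exact (hh _ (circle_mem_Sigma0 hq hφ)).symm

theorem branch_notMem : I * (q0 : ℂ) ∉ Dplus q0 ∪ Sigma0 q0 ∧ -(I * (q0 : ℂ)) ∉ Dplus q0 ∪ Sigma0 q0
    ∧ I * (q0 : ℂ) ∉ Dminus q0 ∪ Sigma0 q0 ∧ -(I * (q0 : ℂ)) ∉ Dminus q0 ∪ Sigma0 q0 := by
  refine ⟨?_, ?_, ?_, ?_⟩ <;> rintro (h | h) <;>
    simp [Dplus, Dminus, Sigma0] at h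

/-- Dividing out a zero at z0 keeps holomorphy. Near ±iq₀ the denominator stays away from 0, since
z0 lies at distance at least δ from both branch points. -/
theorem HalfRegular.dslope (hf : HalfRegular q0 D f) (hD : IsOpen D) (hb : I * (q0 : ℂ) ∉ D)
    (hb' : -(I * (q0 : ℂ)) ∉ D) {z0 : ℂ} (hz0 : z0 ∈ D) : HalfRegular q0 D (dslope f z0) := by
  have hn : D ∈ 𝓝 z0 := hD.mem_nhds hz0
  refine ⟨(Complex.differentiableOn_dslope hn).2 hf.diff,
    (continuousOn_dslope (mem_of_superset hn Set.subset_union_left)).2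
      ⟨hf.cont, (hf.diff z0 hz0).differentiableAt hn⟩, ?_⟩
  obtain ⟨C, ε, hε, hC⟩ := hf.bdd
  set δ := min ‖z0 - I * q0‖ ‖z0 + I * q0‖ with hδ
  have hδ0 : 0 < δ := by
    refine lt_min (norm_pos_iff.2 (sub_ne_zero.2 ?_)) (norm_pos_iff.2 ?_)
    · rintro rfl; exact hb hz0
    · intro h; rw [add_eq_zero_iff_eq_neg.1 h] at hz0; exact hb' hz0
  refine ⟨(|C| + ‖f z0‖) / (δ / 2), min ε (δ / 2), lt_min hε (by positivity), fun z hz hzε => ?_⟩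
  have hd : δ / 2 ≤ ‖z - z0‖ := by
    rcases hzε with h | h
    · have h1 := norm_sub_le_norm_sub_add_norm_sub z0 z (I * q0)
      have h2 : δ ≤ ‖z0 - I * q0‖ := min_le_left _ _
      have h3 := h.trans_le (min_le_right _ _)
      rw [norm_sub_rev z0 z] at h1
      linarith
    · have h1 := norm_sub_le_norm_sub_add_norm_sub z0 z (-(I * q0))
      have h2 : δ ≤ ‖z0 + I * q0‖ := min_le_right _ _
      have h3 := h.trans_le (min_le_right _ _)
      rw [norm_sub_rev z0 z, sub_neg_eq_add, sub_neg_eq_add] at h1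
      linarith
  have hne : z ≠ z0 := by
    rintro rfl
    rw [sub_self, norm_zero] at hd
    linarith
  rw [dslope_of_ne _ hne, slope_def_field, norm_div]
  have hCz : ‖f z‖ ≤ C := hC z hz (hzε.imp (fun h => h.trans_le (min_le_left _ _))
    fun h => h.trans_le (min_le_left _ _))
  refine div_le_div₀ (by positivity) ((norm_sub_le _ _).trans ?_) (by positivity) hd
  exact add_le_add (hCz.trans (le_abs_self C)) le_rfl

theorem HalfRegular.div_sub (hf : HalfRegular q0 D f) {z0 : ℂ} (hz0 : z0 ∉ D ∪ Sigma0 q0)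
    (hb : I * (q0 : ℂ) ≠ z0) (hb' : -(I * (q0 : ℂ)) ≠ z0) :
    HalfRegular q0 D fun z => f z / (z - z0) := by
  refine ⟨hf.diff.div (by fun_prop) fun z hz => sub_ne_zero.2 fun h => hz0 (Or.inl (h ▸ hz)),
    hf.cont.div (by fun_prop) fun z hz => sub_ne_zero.2 fun h => hz0 (h ▸ hz), ?_⟩
  obtain ⟨C, ε, hε, hC⟩ := hf.bdd
  set δ := min ‖z0 - I * q0‖ ‖z0 + I * q0‖ with hδ
  have hδ0 : 0 < δ := by
    refine lt_min (norm_pos_iff.2 (sub_ne_zero.2 hb.symm)) (norm_pos_iff.2 ?_)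
    intro h; exact hb' (add_eq_zero_iff_eq_neg.1 h).symm
  refine ⟨|C| / (δ / 2), min ε (δ / 2), lt_min hε (by positivity), fun z hz hzε => ?_⟩
  have hd : δ / 2 ≤ ‖z - z0‖ := by
    rcases hzε with h | h
    · have h1 := norm_sub_le_norm_sub_add_norm_sub z0 z (I * q0)
      have h2 : δ ≤ ‖z0 - I * q0‖ := min_le_left _ _
      have h3 := h.trans_le (min_le_right _ _)
      rw [norm_sub_rev z0 z] at h1
      linarith
    · have h1 := norm_sub_le_norm_sub_add_norm_sub z0 z (-(I * q0))
      have h2 : δ ≤ ‖z0 + I * q0‖ := min_le_right _ _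
      have h3 := h.trans_le (min_le_right _ _)
      rw [norm_sub_rev z0 z, sub_neg_eq_add, sub_neg_eq_add] at h1
      linarith
  rw [norm_div]
  have hCz : ‖f z‖ ≤ C := hC z hz (hzε.imp (fun h => h.trans_le (min_le_left _ _))
    fun h => h.trans_le (min_le_left _ _))
  exact div_le_div₀ (by positivity) (hCz.trans (le_abs_self C)) (by positivity) hd

theorem HalfRegular.sub (hf : HalfRegular q0 D f) (hg : HalfRegular q0 D g) :
    HalfRegular q0 D fun z => f z - g z := by
  refine ⟨hf.diff.sub hg.diff, hf.cont.sub hg.cont, ?_⟩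
  obtain ⟨C, ε, hε, hC⟩ := hf.bdd
  obtain ⟨C', ε', hε', hC'⟩ := hg.bdd
  refine ⟨C + C', min ε ε', lt_min hε hε', fun z hz h => (norm_sub_le _ _).trans (add_le_add
    (hC z hz (h.imp (fun h => h.trans_le (min_le_left _ _)) fun h => h.trans_le (min_le_left _ _)))
    (hC' z hz (h.imp (fun h => h.trans_le (min_le_right _ _))
      fun h => h.trans_le (min_le_right _ _))))⟩

theorem HalfRegular.mul (hf : HalfRegular q0 D f) (hg : HalfRegular q0 D g) :
    HalfRegular q0 D fun z => f z * g z := by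
  refine ⟨hf.diff.mul hg.diff, hf.cont.mul hg.cont, ?_⟩
  obtain ⟨C, ε, hε, hC⟩ := hf.bdd
  obtain ⟨C', ε', hε', hC'⟩ := hg.bdd
  refine ⟨|C| * |C'|, min ε ε', lt_min hε hε', fun z hz h => ?_⟩
  rw [norm_mul]
  exact mul_le_mul ((hC z hz (h.imp (fun h => h.trans_le (min_le_left _ _))
      fun h => h.trans_le (min_le_left _ _))).trans (le_abs_self _))
    ((hC' z hz (h.imp (fun h => h.trans_le (min_le_right _ _))
      fun h => h.trans_le (min_le_right _ _))).trans (le_abs_self _)) (norm_nonneg _) (abs_nonneg _)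

theorem HalfRegular.const (k : ℂ) : HalfRegular q0 D fun _ => k :=
  ⟨differentiableOn_const k, continuousOn_const, ‖k‖, 1, one_pos, fun _ _ _ => le_rfl⟩

theorem HalfRegular.congr (hf : HalfRegular q0 D f) (h : ∀ z ∈ D ∪ Sigma0 q0, g z = f z) :
    HalfRegular q0 D g := by
  refine ⟨hf.diff.congr fun z hz => h z (Or.inl hz), hf.cont.congr h, ?_⟩
  obtain ⟨C, ε, hε, hC⟩ := hf.bdd
  exact ⟨C, ε, hε, fun z hz hzε => by rw [h z hz]; exact hC z hz hzε⟩

theorem HalfRegular.sum {ι : Type*} (s : Finset ι) {F : ι → ℂ → ℂ}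
    (h : ∀ n ∈ s, HalfRegular q0 D (F n)) : HalfRegular q0 D fun z => ∑ n ∈ s, F n z := by
  classical
  induction s using Finset.induction_on with
  | empty => simpa using HalfRegular.const 0
  | insert n s hn ih =>
    have h1 := (h n (Finset.mem_insert_self n s)).sub ((HalfRegular.const 0).sub
      (ih fun m hm => h m (Finset.mem_insert_of_mem hm)))
    refine h1.congr fun z _ => ?_
    rw [Finset.sum_insert hn]; ring

theorem tendsto_inv_sub_cobounded (z0 : ℂ) :
    Tendsto (fun z : ℂ => (z - z0)⁻¹) (Bornology.cobounded ℂ) (𝓝 0) := by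
  refine tendsto_inv₀_cobounded.comp ?_
  simpa only [sub_eq_add_neg] using tendsto_add_const_cobounded (-z0)

theorem tendsto_div_sub_cobounded (z0 : ℂ) :
    Tendsto (fun z : ℂ => z / (z - z0)) (Bornology.cobounded ℂ) (𝓝 1) := by
  have h1 := ((tendsto_inv_sub_cobounded z0).const_mul z0).const_add 1
  rw [mul_zero, add_zero] at h1
  refine h1.congr' ?_
  have : ∀ᶠ z : ℂ in Bornology.cobounded ℂ, z ≠ z0 := by
    exact Bornology.isBounded_def.1 (Bornology.isBounded_singleton (x := z0))
  filter_upwards [this] with z hz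
  have := sub_ne_zero.2 hz
  field_simp
  ring

/-- Subtracting k and dividing by z - z0 turns decay at infinity into z g → -k, while a simple pole
of f at the origin with coefficient c gives z g → -c/z0. -/
theorem admissible_of_quotient {k c z0 : ℂ} {g : ℂ → ℂ} (hg : HalfRegular q0 D g) (hz0 : z0 ≠ 0)
    (hne : ∀ z ∈ D ∪ Sigma0 q0, z ≠ z0 → g z = (f z - k) / (z - z0))
    (hinf : Tendsto f (Bornology.cobounded ℂ ⊓ 𝓟 (D ∪ Sigma0 q0)) (𝓝 0))
    (hzero : Tendsto (fun z => z * f z) (𝓝[D ∪ Sigma0 q0] 0) (𝓝 c)) :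
    Admissible q0 D g (-k) (-(c / z0)) := by
  refine ⟨hg, ?_, ?_⟩
  · have h1 := ((tendsto_div_sub_cobounded z0).mono_left
      (inf_le_left (b := 𝓟 (D ∪ Sigma0 q0)))).mul (hinf.sub_const k)
    rw [one_mul, zero_sub] at h1
    refine h1.congr' ?_
    have : ∀ᶠ z : ℂ in Bornology.cobounded ℂ, z ≠ z0 :=
      Bornology.isBounded_def.1 (Bornology.isBounded_singleton (x := z0))
    filter_upwards [this.filter_mono inf_le_left,
      eventually_inf_principal.2 (Eventually.of_forall fun z hz => hz)] with z hz hzD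
    rw [hne z hzD hz]; ring
  · have hid : Tendsto (fun z : ℂ => z) (𝓝[D ∪ Sigma0 q0] 0) (𝓝 0) :=
      tendsto_id.mono_left nhdsWithin_le_nhds
    have h1 := (hzero.sub (hid.mul_const k)).div (hid.sub_const z0) (by simpa using hz0)
    rw [zero_mul, sub_zero, zero_sub, div_neg] at h1
    refine h1.congr' ?_
    have : ∀ᶠ z : ℂ in 𝓝[D ∪ Sigma0 q0] 0, z ≠ z0 :=
      (continuousAt_id.eventually_ne hz0.symm).filter_mono nhdsWithin_le_nhds
    filter_upwards [this, eventually_mem_nhdsWithin] with z hz hzD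
    rw [hne z hzD hz]; simp only [Pi.div_apply]; ring

theorem sigmaIntegral_zero : sigmaIntegral q0 (fun _ => 0) = 0 := by
  simp [sigmaIntegral]

/-- The jump formula is applied to (f - fp(z0))/(z - z0) on both sides. There is no jump, so the
limits at infinity and at the origin agree: fp(z0) = c/z0. -/
theorem liouville_plus {fp fm : ℂ → ℂ} (hq : 0 < q0) (hp : HalfRegular q0 (Dplus q0) fp)
    (hm : HalfRegular q0 (Dminus q0) fm) (heq : ∀ z ∈ Sigma0 q0, fp z = fm z)
    (pinf : Tendsto fp (Bornology.cobounded ℂ ⊓ 𝓟 (Dplus q0 ∪ Sigma0 q0)) (𝓝 0))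
    (minf : Tendsto fm (Bornology.cobounded ℂ ⊓ 𝓟 (Dminus q0 ∪ Sigma0 q0)) (𝓝 0))
    (pzero : Tendsto (fun z => z * fp z) (𝓝[Dplus q0 ∪ Sigma0 q0] 0) (𝓝 c))
    (mzero : Tendsto (fun z => z * fm z) (𝓝[Dminus q0 ∪ Sigma0 q0] 0) (𝓝 c))
    {z0 : ℂ} (hz0 : z0 ∈ Dplus q0) : fp z0 = c / z0 := by
  have hb := branch_notMem (q0 := q0)
  have hz0' : z0 ≠ 0 := ne_zero_of_mem_Dplus hz0
  have hnm : z0 ∉ Dminus q0 ∪ Sigma0 q0 := by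
    rintro (h | h)
    · exact lt_asymm (show 0 < (‖z0‖ ^ 2 - q0 ^ 2) * z0.im from hz0) h
    · have h1 : 0 < (‖z0‖ ^ 2 - q0 ^ 2) * z0.im := hz0
      rcases h.1 with h | h <;> simp [h] at h1
  have nb1 : I * (q0 : ℂ) ≠ z0 := fun h => hb.1 (Or.inl (h ▸ hz0))
  have nb2 : -(I * (q0 : ℂ)) ≠ z0 := fun h => hb.2.1 (Or.inl (h ▸ hz0))
  have gp := hp.dslope (isOpen_Dplus q0) (fun h => hb.1 (Or.inl h)) (fun h => hb.2.1 (Or.inl h)) hz0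
  have gm := (hm.sub (HalfRegular.const (fp z0))).div_sub hnm nb1 nb2
  have ap := admissible_of_quotient (f := fp) (k := fp z0) gp hz0' (fun z _ hz => by
    rw [dslope_of_ne _ hz, slope_def_field]) pinf pzero
  have am := admissible_of_quotient (f := fm) (k := fp z0) gm hz0' (fun z _ hz => rfl) minf mzero
  have := sigmaIntegral_jump (h := fun _ => 0) hq ap am (fun z hz => by
    have hne : z ≠ z0 := by rintro rfl; exact hnm (Or.inr hz)
    rw [dslope_of_ne _ hne, slope_def_field, heq z hz, sub_self]) (by simp)
  rw [sigmaIntegral_zero, eq_comm, mul_eq_zero] at this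
  rcases this with h | h
  · simp [Real.pi_ne_zero] at h
  · linear_combination -h

theorem liouville_minus {fp fm : ℂ → ℂ} (hq : 0 < q0) (hp : HalfRegular q0 (Dplus q0) fp)
    (hm : HalfRegular q0 (Dminus q0) fm) (heq : ∀ z ∈ Sigma0 q0, fp z = fm z)
    (pinf : Tendsto fp (Bornology.cobounded ℂ ⊓ 𝓟 (Dplus q0 ∪ Sigma0 q0)) (𝓝 0))
    (minf : Tendsto fm (Bornology.cobounded ℂ ⊓ 𝓟 (Dminus q0 ∪ Sigma0 q0)) (𝓝 0))
    (pzero : Tendsto (fun z => z * fp z) (𝓝[Dplus q0 ∪ Sigma0 q0] 0) (𝓝 c))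
    (mzero : Tendsto (fun z => z * fm z) (𝓝[Dminus q0 ∪ Sigma0 q0] 0) (𝓝 c))
    {z0 : ℂ} (hz0 : z0 ∈ Dminus q0) : fm z0 = c / z0 := by
  have hpm : ∀ z ∈ Dminus q0, -z ∈ Dplus q0 := fun z hz => neg_mem_Dplus.2 hz
  have hmp : ∀ z ∈ Dplus q0, -z ∈ Dminus q0 := fun z hz => neg_mem_Dminus.2 hz
  have hpm' : ∀ z ∈ Dminus q0 ∪ Sigma0 q0, -z ∈ Dplus q0 ∪ Sigma0 q0 := fun z hz => neg_mem_DS.2 hz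
  have hmp' : ∀ z ∈ Dplus q0 ∪ Sigma0 q0, -z ∈ Dminus q0 ∪ Sigma0 q0 := fun z hz => neg_mem_DmS.2 hz
  have := liouville_plus (c := -c) hq (hm.comp_neg hmp) (hp.comp_neg hpm)
    (fun z hz => (heq _ (neg_mem_Sigma0.2 hz)).symm)
    (minf.comp (tendsto_neg_cobounded_within hmp')) (pinf.comp (tendsto_neg_cobounded_within hpm'))
    ((mzero.comp (tendsto_neg_within hmp')).neg.congr fun z => by simp)
    ((pzero.comp (tendsto_neg_within hpm')).neg.congr fun z => by simp)
    (hpm z0 hz0)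
  simpa [neg_div_neg_eq] using this

end

/-! ## Modified Jost matrices -/

/-- The properties of a modified Jost matrix `V z` at a point where the potential equals `qx`; `rm`
is the boundary value of the potential and the columns are holomorphic in `D₁` and `D₂`. -/
structure Sided (q0 : ℝ) (D₁ D₂ : Set ℂ) (rm qx : ℂ) (V : ℂ → Matrix (Fin 2) (Fin 2) ℂ) :
    Prop where
  reg₁ : ∀ i, HalfRegular q0 D₁ fun z => V z i 0
  reg₂ : ∀ i, HalfRegular q0 D₂ fun z => V z i 1
  conj₁₁ : ∀ z ∈ D₂ ∪ Sigma0 q0, V z 1 1 = conj (V (conj z) 0 0)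
  conj₀₁ : ∀ z ∈ D₂ ∪ Sigma0 q0, V z 0 1 = -conj (V (conj z) 1 0)
  symm₁ : ∀ z ∈ D₁ ∪ Sigma0 q0, ∀ i, V z i 0 = -(I / z) * conj rm * V (hat q0 z) i 1
  symm₂ : ∀ z ∈ D₂ ∪ Sigma0 q0, ∀ i, V z i 1 = -(I / z) * rm * V (hat q0 z) i 0
  det : ∀ z ∈ Sigma0 q0, V z 0 0 * V z 1 1 - V z 0 1 * V z 1 0 = gam q0 z
  infty : ∃ C R, 0 ≤ C ∧ q0 < R ∧ ∀ z, R ≤ ‖z‖ →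
    (z ∈ D₁ ∪ Sigma0 q0 → ‖V z 0 0 - 1‖ ≤ C / ‖z‖ ∧ ‖V z 1 0 + I / z * conj qx‖ ≤ C / ‖z‖ ^ 2) ∧
    (z ∈ D₂ ∪ Sigma0 q0 → ‖V z 1 1 - 1‖ ≤ C / ‖z‖ ∧ ‖V z 0 1 + I / z * qx‖ ≤ C / ‖z‖ ^ 2)

/-- `U x z` is the modified Jost matrix of the potential `r`, normalized at `-∞`. -/
structure ModifiedJost (q0 : ℝ) (r : ℝ → ℂ) (rm : ℂ) (U : ℝ → ℂ → Matrix (Fin 2) (Fin 2) ℂ) :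
    Prop where
  one : ModelFamily q0 r rm (fun z x => U x z 0 0) (fun z x => U x z 1 0)
  two : ModelFamily q0 r rm (fun z x => conj (U x (conj z) 1 1)) (fun z x => -conj (U x (conj z) 0 1))

section

variable {q0 : ℝ} {r : ℝ → ℂ} {rm : ℂ}

theorem differentiableOn_conj_conj {f : ℂ → ℂ} {s t : Set ℂ} (hs : IsOpen s)
    (hf : DifferentiableOn ℂ f s) (h : ∀ z ∈ t, conj z ∈ s) :
    DifferentiableOn ℂ (fun z => conj (f (conj z))) t := by
  intro z hz
  have h1 : DifferentiableAt ℂ f (conj z) := (hf _ (h z hz)).differentiableAt (hs.mem_nhds (h z hz))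
  have := (differentiableAt_conj_conj_iff (f := f) (x := z)).2 h1
  exact this.differentiableWithinAt

theorem HalfRegular.conj_conj {f : ℂ → ℂ} {D D' : Set ℂ} (hf : HalfRegular q0 D f) (hD : IsOpen D)
    (h : ∀ z ∈ D', conj z ∈ D) : HalfRegular q0 D' fun z => conj (f (conj z)) := by
  have h' : ∀ z ∈ D' ∪ Sigma0 q0, conj z ∈ D ∪ Sigma0 q0 := by
    rintro z (hz | hz)
    · exact Or.inl (h z hz)
    · exact Or.inr (conj_mem_Sigma0.2 hz)
  refine ⟨differentiableOn_conj_conj hD hf.diff h,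
    continuous_conj.comp_continuousOn (hf.cont.comp continuous_conj.continuousOn h'), ?_⟩
  obtain ⟨C, ε, hε, hC⟩ := hf.bdd
  refine ⟨C, ε, hε, fun z hz hzε => ?_⟩
  rw [RCLike.norm_conj]
  refine hC _ (h' z hz) ?_
  rw [← RCLike.norm_conj, ← RCLike.norm_conj (conj z + _), or_comm]
  simpa [sub_eq_add_neg] using hzε

theorem ModelFamily.halfRegular {a b : ℂ → ℝ → ℂ} (hF : ModelFamily q0 r rm a b)
    (h : Potential q0 r rm) (x : ℝ) :
    HalfRegular q0 (Dplus q0) (fun z => a z x) ∧ HalfRegular q0 (Dplus q0) (fun z => b z x) := by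
  have hq := h.pos
  obtain ⟨C, hC⟩ := hF.exists_bound h (ρ1 := q0 / 2) (ρ2 := 2 * q0) (by positivity) x
  have key : ∀ z : ℂ, (‖z - I * q0‖ < q0 / 2 ∨ ‖z + I * q0‖ < q0 / 2) →
      q0 / 2 ≤ ‖z‖ ∧ ‖z‖ ≤ 2 * q0 := by
    have hn : ‖I * (q0 : ℂ)‖ = q0 := by simp [hq.le]
    rintro z (hz | hz)
    · have h1 := norm_sub_norm_le (I * (q0 : ℂ)) z
      have h2 := norm_sub_norm_le z (I * (q0 : ℂ))
      rw [norm_sub_rev] at h1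
      constructor <;> linarith
    · have h1 := norm_sub_norm_le (-(I * (q0 : ℂ))) z
      have h2 := norm_sub_norm_le z (-(I * (q0 : ℂ)))
      rw [norm_sub_rev] at h1
      rw [sub_neg_eq_add, norm_neg] at h1 h2
      constructor <;> linarith
  exact ⟨⟨(hF.differentiableOn h x).1, (hF.continuousOn h x).1, C, q0 / 2, by positivity,
    fun z hz hzε => (hC z hz (key z hzε).1 (key z hzε).2).1⟩,
    ⟨(hF.differentiableOn h x).2, (hF.continuousOn h x).2, C, q0 / 2, by positivity,
    fun z hz hzε => (hC z hz (key z hzε).1 (key z hzε).2).2⟩⟩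

/-- The pairing of the column at z with the conjugate of the column at z* is independent of x, and
its value is found at -∞. By the conjugation symmetry it is the determinant of the modified Jost
matrix. -/
theorem IsModel.wronskian {z : ℂ} {a b a' b' : ℝ → ℂ} (hM : IsModel q0 r rm z a b)
    (hM' : IsModel q0 r rm (conj z) a' b') (hr : rm * conj rm = (q0 : ℂ) ^ 2) (hz : z ≠ 0) (x : ℝ) :
    a x * conj (a' x) + conj (b' x) * b x = gam q0 z := by
  set W : ℝ → ℂ := fun x => a x * conj (a' x) + conj (b' x) * b x with hW
  have hd : ∀ x, HasDerivAt W 0 x := by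
    intro x
    have := ((hM.deriv_a x).mul (hasDerivAt_conj (hM'.deriv_a x))).add
      ((hasDerivAt_conj (hM'.deriv_b x)).mul (hM.deriv_b x))
    refine this.congr_deriv ?_
    simp only [map_add, map_mul, map_div₀, map_neg, conj_conj, conj_I, map_pow, conj_ofReal]
    field_simp
    ring
  have hc : ∀ y, W y = W x := fun y => is_const_of_deriv_eq_zero
    (fun y => (hd y).differentiableAt) (fun y => (hd y).deriv) y x
  have hlim : Tendsto W atBot (𝓝 (gam q0 z)) := by
    have := (hM.tendsto_a.mul ((continuous_conj.tendsto _).comp hM'.tendsto_a)).add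
      (((continuous_conj.tendsto _).comp hM'.tendsto_b).mul hM.tendsto_b)
    have e : gam q0 z = 1 * conj (1 : ℂ) + conj (-(I / conj z) * conj rm) * (-(I / z) * conj rm) := by
      simp only [map_one, map_mul, map_div₀, map_neg, conj_conj, conj_I]
      rw [gam]
      field_simp
      rw [I_sq]
      linear_combination -hr
    rw [e]
    exact this
  exact tendsto_nhds_unique (tendsto_const_nhds.congr fun y => (hc y).symm) hlim

theorem ModifiedJost.conj_eq {U : ℝ → ℂ → Matrix (Fin 2) (Fin 2) ℂ}
    (hU : ModifiedJost q0 r rm U) (h : Potential q0 r rm) {z : ℂ}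
    (hz : z ∈ Dminus q0 ∪ Sigma0 q0) (x : ℝ) :
    U x z 1 1 = conj (U x (conj z) 0 0) ∧ U x z 0 1 = -conj (U x (conj z) 1 0) := by
  have hz' := conj_mem_DS.2 hz
  obtain ⟨e1, e2⟩ := IsModel.unique h hz' (hU.two _ hz') (hU.one _ hz')
  have e1 := congrFun e1 x
  have e2 := congrFun e2 x
  simp only [conj_conj] at e1 e2
  constructor
  · rw [← e1, conj_conj]
  · rw [← e2, map_neg, conj_conj, neg_neg]

/-- Everything about the second column is the conjugate of a statement about the first. The
involution symmetry of the columns combines `ModelFamily.symm` with this conjugation. -/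
theorem ModifiedJost.sided {U : ℝ → ℂ → Matrix (Fin 2) (Fin 2) ℂ}
    (hU : ModifiedJost q0 r rm U) (h : Potential q0 r rm) (x : ℝ) :
    Sided q0 (Dplus q0) (Dminus q0) rm (r x) (U x) := by
  have hq := h.pos
  have reg := hU.one.halfRegular h x
  have hcD : ∀ z ∈ Dminus q0, conj z ∈ Dplus q0 := fun z hz => conj_mem_Dplus.2 hz
  have sym1 : ∀ z ∈ Dplus q0 ∪ Sigma0 q0, ∀ i, U x z i 0 = -(I / z) * conj rm * U x (hat q0 z) i 1 := by
    intro z hz i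
    obtain ⟨s1, s2⟩ := hU.one.symm h hz x
    obtain ⟨c1, c2⟩ := hU.conj_eq h ((hat_mem_DmS hq).2 hz) x
    rw [hat_conj] at s1 s2
    fin_cases i
    · simp only [Fin.zero_eta, s1, c2]; ring
    · simp only [Fin.mk_one, s2, c1]
  refine ⟨?_, ?_, fun z hz => (hU.conj_eq h hz x).1, fun z hz => (hU.conj_eq h hz x).2, sym1,
    ?_, ?_, ?_⟩
  · intro i
    fin_cases i
    · exact reg.1
    · exact reg.2
  · intro i
    fin_cases i
    · refine ((HalfRegular.const 0).sub (reg.2.conj_conj (isOpen_Dplus q0) hcD)).congr fun z hz => ?_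
      simp only [Fin.zero_eta, (hU.conj_eq h hz x).2]; ring
    · exact (reg.1.conj_conj (isOpen_Dplus q0) hcD).congr fun z hz => (hU.conj_eq h hz x).1
  · intro z hz i
    have hz0 : z ≠ 0 := by
      rintro rfl
      rcases hz with hz | hz
      · exact ne_zero_of_mem_Dminus hz rfl
      · exact hz.2.1 rfl
    rw [sym1 _ ((hat_mem_DS hq).2 hz) i, hat_hat hq]
    have hqq := h.mul_conj
    have hm := mul_hat (q0 := q0) hz0
    have hh := hat_ne_zero hq hz0
    have hqc : (q0 : ℂ) ≠ 0 := ofReal_ne_zero.2 hq.ne'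
    have : -(I / z) * rm * (-(I / hat q0 z) * conj rm) = 1 := by
      have : -(I / z) * rm * (-(I / hat q0 z) * conj rm) = I ^ 2 * (rm * conj rm) / (z * hat q0 z) := by
        field_simp
      rw [this, hqq, hm, I_sq]
      field_simp
    linear_combination -(U x z i 1) * this
  · intro z hz
    obtain ⟨c1, c2⟩ := hU.conj_eq h (Or.inr hz) x
    have := (hU.one z (Or.inr hz)).wronskian (hU.one (conj z) (Or.inr (conj_mem_Sigma0.2 hz)))
      h.mul_conj hz.2.1 x
    rw [c1, c2, ← this]; ring
  · obtain ⟨C, R, hC, hR, hb⟩ := hU.one.asymptotics h x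
    refine ⟨C, R, hC, hR, fun z hz => ⟨fun hD => hb z hz (im_nonneg_of_mem_DS hq (hR.trans_le hz) hD),
      fun hD => ?_⟩⟩
    obtain ⟨c1, c2⟩ := hU.conj_eq h hD x
    have hcn : ‖conj z‖ = ‖z‖ := RCLike.norm_conj z
    obtain ⟨b1, b2⟩ := hb (conj z) (by rwa [hcn]) (im_nonneg_of_mem_DS hq (by rw [hcn]; exact hR.trans_le hz)
      (conj_mem_DS.2 hD))
    rw [hcn] at b1 b2
    constructor
    · rw [c1, ← RCLike.norm_conj, map_sub, conj_conj, map_one]; exact b1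
    · rw [c2, ← RCLike.norm_conj, ← norm_neg]
      refine le_trans (le_of_eq ?_) b2
      congr 1
      simp; ring

theorem Sided.comp_neg {D₁ D₂ D₁' D₂' : Set ℂ} {qx : ℂ} {V : ℂ → Matrix (Fin 2) (Fin 2) ℂ}
    (h : Sided q0 D₁ D₂ rm qx V) (h1 : ∀ z ∈ D₁', -z ∈ D₁) (h2 : ∀ z ∈ D₂', -z ∈ D₂) :
    Sided q0 D₁' D₂' (-rm) (-qx) fun z => V (-z) := by
  have h1' : ∀ z ∈ D₁' ∪ Sigma0 q0, -z ∈ D₁ ∪ Sigma0 q0 := by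
    rintro z (hz | hz)
    · exact Or.inl (h1 z hz)
    · exact Or.inr (neg_mem_Sigma0.2 hz)
  have h2' : ∀ z ∈ D₂' ∪ Sigma0 q0, -z ∈ D₂ ∪ Sigma0 q0 := by
    rintro z (hz | hz)
    · exact Or.inl (h2 z hz)
    · exact Or.inr (neg_mem_Sigma0.2 hz)
  refine ⟨fun i => (h.reg₁ i).comp_neg h1, fun i => (h.reg₂ i).comp_neg h2,
    fun z hz => ?_, fun z hz => ?_, fun z hz i => ?_, fun z hz i => ?_, fun z hz => ?_, ?_⟩
  · rw [h.conj₁₁ _ (h2' z hz), map_neg]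
  · rw [h.conj₀₁ _ (h2' z hz), map_neg]
  · rw [h.symm₁ _ (h1' z hz), hat_neg, map_neg, div_neg]; ring
  · rw [h.symm₂ _ (h2' z hz), hat_neg, div_neg]; ring
  · rw [h.det _ (neg_mem_Sigma0.2 hz), gam, gam, neg_sq]
  · obtain ⟨C, R, hC, hR, hb⟩ := h.infty
    refine ⟨C, R, hC, hR, fun z hz => ?_⟩
    obtain ⟨b1, b2⟩ := hb (-z) (by rwa [norm_neg])
    rw [norm_neg] at b1 b2
    refine ⟨fun hD => ?_, fun hD => ?_⟩
    · have := b1 (h1' z hD)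
      rw [map_neg, mul_neg, ← neg_mul, ← div_neg]
      exact this
    · have := b2 (h2' z hD)
      rw [mul_neg, ← neg_mul, ← div_neg]
      exact this

theorem kz_neg (z : ℂ) : kz q0 (-z) = -kz q0 z := by simp [kz, div_neg]; ring

theorem theta_neg (x t : ℝ) (z : ℂ) : theta q0 (-x) t (-z) = theta q0 x t z := by
  simp [theta, kz_neg, lam, div_neg]; ring

theorem theta_conj (x t : ℝ) (z : ℂ) : theta q0 x t (conj z) = conj (theta q0 x t z) := by
  simp [theta, kz, lam, map_ofNat]

theorem kz_conj (z : ℂ) : kz q0 (conj z) = conj (kz q0 z) := by simp [kz, map_ofNat]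

theorem hasDerivAt_theta_x (x t : ℝ) (z : ℂ) :
    HasDerivAt (fun y : ℝ => theta q0 y t z) (lam q0 z) x := by
  have := (((hasDerivAt_id x).ofReal_comp.add_const (kz q0 z * t)).const_mul (lam q0 z))
  rw [ofReal_one, mul_one] at this
  exact this

/-- A solution of the scattering equation, multiplied by `exp (i θ)`. -/
theorem isModel_of_scattering {z : ℂ} (hz : z ≠ 0) {v w : ℝ → ℂ} {t : ℝ}
    (hv : ∀ x, HasDerivAt v (-(I * kz q0 z) * v x + r x * w x) x)
    (hw : ∀ x, HasDerivAt w (-conj (r x) * v x + I * kz q0 z * w x) x)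
    (tv : Tendsto (fun x => v x * exp (I * theta q0 x t z)) atBot (𝓝 1))
    (tw : Tendsto (fun x => w x * exp (I * theta q0 x t z)) atBot (𝓝 (-(I / z) * conj rm))) :
    IsModel q0 r rm z (fun x => v x * exp (I * theta q0 x t z))
      (fun x => w x * exp (I * theta q0 x t z)) := by
  have he : ∀ x, HasDerivAt (fun x : ℝ => exp (I * theta q0 x t z))
      (exp (I * theta q0 x t z) * (I * lam q0 z)) x := fun x =>
    ((hasDerivAt_theta_x x t z).const_mul I).cexp
  refine ⟨fun x => ((hv x).mul (he x)).congr_deriv ?_, fun x => ((hw x).mul (he x)).congr_deriv ?_,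
    tv, tw⟩
  · simp only [lam, kz]; field_simp; ring
  · simp only [lam, kz]; field_simp; ring

end

/-! ### From the Lax pair to the model columns. -/

section

variable {q0 : ℝ} {q : ℝ → ℝ → ℂ} {qm qp : ℂ} {ψ ψm ψp : ℝ → ℝ → ℂ → Matrix (Fin 2) (Fin 2) ℂ}
  {x t : ℝ} {z : ℂ}

theorem laxX_mul_zero (A : Matrix (Fin 2) (Fin 2) ℂ) (j : Fin 2) :
    (laxX q0 q x t z * A) 0 j = -(I * kz q0 z) * A 0 j + q x t * A 1 j := by
  simp [laxX, sigma3, Qmat, Matrix.mul_apply, Fin.sum_univ_two]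

theorem laxX_mul_one (A : Matrix (Fin 2) (Fin 2) ℂ) (j : Fin 2) :
    (laxX q0 q x t z * A) 1 j = -conj (q x t) * A 0 j + I * kz q0 z * A 1 j := by
  simp [laxX, sigma3, Qmat, Matrix.mul_apply, Fin.sum_univ_two]

theorem modified_zero (i : Fin 2) :
    modified q0 ψ x t z i 0 = ψ x t z i 0 * exp (I * theta q0 x t z) := by
  simp [modified]

theorem modified_one (i : Fin 2) :
    modified q0 ψ x t z i 1 = ψ x t z i 1 * exp (-(I * theta q0 x t z)) := by
  simp [modified]

theorem Ymat_apply (q z : ℂ) : Ymat q z 0 0 = 1 ∧ Ymat q z 0 1 = -(I / z) * q ∧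
    Ymat q z 1 0 = -(I / z) * conj q ∧ Ymat q z 1 1 = 1 := by
  simp [Ymat, sigma3, Qmat]

theorem conj_exp_theta (x t : ℝ) (z : ℂ) :
    conj (exp (-(I * theta q0 x t (conj z)))) = exp (I * theta q0 x t z) := by
  rw [← exp_conj, theta_conj]; simp

/-- Multiplication by exp(iθ) adds iλ to the diagonal entries ∓ik, which become iq₀²/z and iz. The
second column is treated through its conjugate at z*. -/
theorem modifiedJost_minus (hψ : IsJostMinus q0 q qm ψ) (t : ℝ) :
    ModifiedJost q0 (fun x => q x t) qm fun x z => modified q0 ψ x t z := by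
  constructor
  · intro z hz
    have h0 := hψ 0 z hz 0
    have h1 := hψ 0 z hz 1
    have T0 := h0.2.2 t
    have T1 := h1.2.2 t
    simp only [modified_zero, Ymat_apply] at T0 T1 ⊢
    refine isModel_of_scattering (mem_DS hz).1 (fun x => ?_) (fun x => ?_) T0 T1
    · simpa only [laxX_mul_zero] using h0.1 x t
    · simpa only [laxX_mul_one] using h1.1 x t
  · intro z hz
    have hz' := conj_mem_DmS.2 hz
    have h0 := hψ 1 _ hz' 0
    have h1 := hψ 1 _ hz' 1
    have T0 := (continuous_conj.tendsto _).comp (h1.2.2 t)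
    have T1 := ((continuous_conj.tendsto _).comp (h0.2.2 t)).neg
    simp only [modified_one, Ymat_apply, Function.comp_def, map_mul, conj_exp_theta, map_one] at T0 T1 ⊢
    simp only [← neg_mul] at T1 ⊢
    refine isModel_of_scattering (mem_DS hz).1 (fun x => ?_) (fun x => ?_) T0 ?_
    · refine (hasDerivAt_conj (h1.1 x t)).congr_deriv ?_
      simp only [laxX_mul_one, kz_conj, map_add, map_mul, map_neg, conj_conj, conj_I]; ring
    · refine (hasDerivAt_conj (h0.1 x t)).neg.congr_deriv ?_
      simp only [laxX_mul_zero, kz_conj, map_add, map_mul, map_neg, conj_conj, conj_I]; ring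
    · convert T1 using 2
      simp [neg_div]

/-- The substitution x → -x, z → -z, q → -q(-x) preserves the scattering equation and θ, and
exchanges the ends of the line as well as D⁺ and D⁻. Hence ψ₊ is a solution of the type of ψ₋ for
the reflected potential. -/
theorem modifiedJost_plus (hψ : IsJostPlus q0 q qp ψ) (t : ℝ) :
    ModifiedJost q0 (fun x => -q (-x) t) (-qp) fun x z => modified q0 ψ (-x) t (-z) := by
  have hneg : ∀ {f : ℝ → ℂ} {f' : ℂ} {x : ℝ}, HasDerivAt f f' (-x) →
      HasDerivAt (fun y => f (-y)) (-f') x := fun {f f' x} h => by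
    have := h.scomp x (hasDerivAt_neg x)
    simpa [Function.comp_def] using this
  constructor
  · intro z hz
    have hz' := neg_mem_DmS.2 hz
    have h0 := hψ 0 _ hz' 0
    have h1 := hψ 0 _ hz' 1
    have T0 := (h0.2.2 t).comp tendsto_neg_atBot_atTop
    have T1 := (h1.2.2 t).comp tendsto_neg_atBot_atTop
    simp only [modified_zero, Ymat_apply, Function.comp_def, theta_neg] at T0 T1 ⊢
    refine isModel_of_scattering (mem_DS hz).1 (fun x => ?_) (fun x => ?_) T0 ?_
    · refine (hneg (h0.1 (-x) t)).congr_deriv ?_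
      simp only [laxX_mul_zero, kz_neg]; ring
    · refine (hneg (h1.1 (-x) t)).congr_deriv ?_
      simp only [laxX_mul_one, kz_neg, map_neg]; ring
    · convert T1 using 2
      simp [div_neg]
  · intro z hz
    have hz' : -conj z ∈ Dplus q0 ∪ Sigma0 q0 := neg_mem_DS.2 (conj_mem_DmS.2 hz)
    have h0 := hψ 1 _ hz' 0
    have h1 := hψ 1 _ hz' 1
    have T0 := (continuous_conj.tendsto _).comp ((h1.2.2 t).comp tendsto_neg_atBot_atTop)
    have T1 := ((continuous_conj.tendsto _).comp ((h0.2.2 t).comp tendsto_neg_atBot_atTop)).neg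
    simp only [modified_one, Ymat_apply, Function.comp_def, map_mul, theta_neg, conj_exp_theta,
      map_one] at T0 T1 ⊢
    simp only [← neg_mul] at T1 ⊢
    refine isModel_of_scattering (mem_DS hz).1 (fun x => ?_) (fun x => ?_) T0 ?_
    · refine (hasDerivAt_conj (hneg (h1.1 (-x) t))).congr_deriv ?_
      simp only [laxX_mul_one, kz_conj, kz_neg, map_add, map_mul, map_neg, conj_conj, conj_I]; ring
    · refine (hasDerivAt_conj (hneg (h0.1 (-x) t))).neg.congr_deriv ?_
      simp only [laxX_mul_zero, kz_conj, kz_neg, map_add, map_mul, map_neg, conj_conj, conj_I]; ring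
    · convert T1 using 2
      simp [div_neg, neg_div]

/-- The hypotheses on the reduced potential and the two Jost solutions. -/
structure JostPair (q0 : ℝ) (q : ℝ → ℝ → ℂ) (qm qp : ℂ)
    (ψm ψp : ℝ → ℝ → ℂ → Matrix (Fin 2) (Fin 2) ℂ) : Prop where
  pos : 0 < q0
  norm_qm : ‖qm‖ = q0
  norm_qp : ‖qp‖ = q0
  bv : HasBoundaryValues q qm qp
  minus : IsJostMinus q0 q qm ψm
  plus : IsJostPlus q0 q qp ψp

theorem potential_minus (hq0 : 0 < q0) (hqm : ‖qm‖ = q0) (h : HasBoundaryValues q qm qp) (t : ℝ) :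
    Potential q0 (fun x => q x t) qm :=
  ⟨hq0, hqm, h.contDiff_x t, h.tendsto_minus t, h.integrable_minus t, h.integrable_deriv t,
    h.integrable_deriv_two t⟩

theorem deriv_neg_comp_neg (f : ℝ → ℂ) : deriv (fun x => -f (-x)) = fun x => deriv f (-x) := by
  funext x
  have : (fun x => -f (-x)) = -fun x => f (-x) := rfl
  rw [this, deriv.neg, deriv_comp_neg, neg_neg]

theorem potential_plus (hq0 : 0 < q0) (hqp : ‖qp‖ = q0) (h : HasBoundaryValues q qm qp) (t : ℝ) :
    Potential q0 (fun x => -q (-x) t) (-qp) := by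
  refine ⟨hq0, by rwa [norm_neg], ((h.contDiff_x t).comp contDiff_neg).neg,
    ((h.tendsto_plus t).comp tendsto_neg_atBot_atTop).neg, ?_, ?_, ?_⟩
  · have h1 := (h.integrable_plus t).integrable_indicator measurableSet_Ici
    have h2 := h1.comp_neg
    have h3 : (fun x : ℝ => (Set.Ici (0 : ℝ)).indicator (fun x => (1 + |x|) * ‖q x t - qp‖) (-x)) =
        (Set.Iic (0 : ℝ)).indicator fun x => (1 + |x|) * ‖-q (-x) t - -qp‖ := by
      funext x
      by_cases hx : x ≤ 0
      · rw [Set.indicator_of_mem (by simpa using hx), Set.indicator_of_mem (by simpa using hx),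
          abs_neg, ← norm_neg]
        congr 2; ring
      · rw [Set.indicator_of_notMem (by simpa using hx), Set.indicator_of_notMem (by simpa using hx)]
    rw [h3] at h2
    exact (integrable_indicator_iff measurableSet_Iic).1 h2
  · rw [deriv_neg_comp_neg (fun x => q x t)]
    exact (h.integrable_deriv t).comp_neg
  · have : iteratedDeriv 2 (fun x => -q (-x) t) = fun x => -iteratedDeriv 2 (fun x => q x t) (-x) := by
      simp only [iteratedDeriv_succ', iteratedDeriv_zero, deriv_neg_comp_neg (fun x => q x t)]
      exact funext fun x => deriv_comp_neg (deriv fun x => q x t) x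
    rw [this]
    exact (h.integrable_deriv_two t).comp_neg.neg

namespace JostPair

variable (h : JostPair q0 q qm qp ψm ψp)
include h

theorem sided_minus (x t : ℝ) :
    Sided q0 (Dplus q0) (Dminus q0) qm (q x t) (modified q0 ψm x t) :=
  (modifiedJost_minus h.minus t).sided (potential_minus h.pos h.norm_qm h.bv t) x

theorem sided_plus (x t : ℝ) :
    Sided q0 (Dminus q0) (Dplus q0) qp (q x t) (modified q0 ψp x t) := by
  have := ((modifiedJost_plus h.plus t).sided (potential_plus h.pos h.norm_qp h.bv t) (-x)).comp_neg
    (D₁' := Dminus q0) (D₂' := Dplus q0) (fun z hz => neg_mem_Dplus.2 hz)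
    (fun z hz => neg_mem_Dminus.2 hz)
  simpa only [neg_neg] using this

end JostPair

end

/-! ## Scattering coefficients -/

theorem gam_ne_zero_DS {q0 : ℝ} {z : ℂ} (hz : z ∈ Dplus q0 ∪ Sigma0 q0) : gam q0 z ≠ 0 := by
  obtain ⟨h0, h1, -⟩ := mem_DS hz
  have : gam q0 z = mu q0 z / z := by rw [gam, mu]; field_simp
  rw [this]
  exact div_ne_zero h1 h0

theorem gam_ne_zero_DmS {q0 : ℝ} {z : ℂ} (hz : z ∈ Dminus q0 ∪ Sigma0 q0) : gam q0 z ≠ 0 := by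
  have := gam_ne_zero_DS (neg_mem_DS.2 hz)
  rwa [gam, neg_sq] at this

theorem ne_zero_of_mem_DmS {q0 : ℝ} {z : ℂ} (hz : z ∈ Dminus q0 ∪ Sigma0 q0) : z ≠ 0 := by
  rcases hz with hz | hz
  · exact ne_zero_of_mem_Dminus hz
  · exact hz.2.1

theorem ne_zero_of_mem_DS {q0 : ℝ} {z : ℂ} (hz : z ∈ Dplus q0 ∪ Sigma0 q0) : z ≠ 0 :=
  (mem_DS hz).1

theorem laxT_trace (q0 : ℝ) (q : ℝ → ℝ → ℂ) (x t : ℝ) (z : ℂ) :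
    laxT q0 q x t z 1 1 = -laxT q0 q x t z 0 0 := by
  simp [laxT, sigma3, Qmat, Matrix.mul_apply, Fin.sum_univ_two]
  ring

theorem laxX_trace (q0 : ℝ) (q : ℝ → ℝ → ℂ) (x t : ℝ) (z : ℂ) :
    laxX q0 q x t z 1 1 = -laxX q0 q x t z 0 0 := by
  simp [laxX, sigma3, Qmat]

theorem hasDerivAt_wr_zero {A B : ℝ → Matrix (Fin 2) (Fin 2) ℂ} {M : Matrix (Fin 2) (Fin 2) ℂ}
    {j l : Fin 2} {x : ℝ} (hM : M 1 1 = -M 0 0)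
    (hA : ∀ i, HasDerivAt (fun y => A y i j) ((M * A x) i j) x)
    (hB : ∀ i, HasDerivAt (fun y => B y i l) ((M * B x) i l) x) :
    HasDerivAt (fun y => wr (A y) j (B y) l) 0 x := by
  have := ((hA 0).mul (hB 1)).sub ((hA 1).mul (hB 0))
  refine this.congr_deriv ?_
  simp only [Matrix.mul_apply, Fin.sum_univ_two, hM]
  ring

/-- The Wronskian of two simultaneous solutions of the Lax pair is constant. -/
theorem wr_eq_wr_zero {q0 : ℝ} {q : ℝ → ℝ → ℂ} {A B : ℝ → ℝ → ℂ → Matrix (Fin 2) (Fin 2) ℂ} {z : ℂ}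
    {j l : Fin 2}
    (hA : ∀ i, (∀ x t, HasDerivAt (fun y => A y t z i j) ((laxX q0 q x t z * A x t z) i j) x) ∧
      ∀ x t, HasDerivAt (fun s => A x s z i j) ((laxT q0 q x t z * A x t z) i j) t)
    (hB : ∀ i, (∀ x t, HasDerivAt (fun y => B y t z i l) ((laxX q0 q x t z * B x t z) i l) x) ∧
      ∀ x t, HasDerivAt (fun s => B x s z i l) ((laxT q0 q x t z * B x t z) i l) t) (x t : ℝ) :
    wr (A x t z) j (B x t z) l = wr (A 0 0 z) j (B 0 0 z) l := by
  have hx : ∀ y, HasDerivAt (fun y => wr (A y t z) j (B y t z) l) 0 y := fun y =>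
    hasDerivAt_wr_zero (laxX_trace q0 q y t z) (fun i => (hA i).1 y t) (fun i => (hB i).1 y t)
  have ht : ∀ s, HasDerivAt (fun s => wr (A 0 s z) j (B 0 s z) l) 0 s := fun s =>
    hasDerivAt_wr_zero (laxT_trace q0 q 0 s z) (fun i => (hA i).2 0 s) (fun i => (hB i).2 0 s)
  rw [is_const_of_deriv_eq_zero (fun y => (hx y).differentiableAt) (fun y => (hx y).deriv) x 0,
    is_const_of_deriv_eq_zero (fun y => (ht y).differentiableAt) (fun y => (ht y).deriv) t 0]

/-! ### Behaviour at infinity and at the origin. -/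

/-- Neighbourhoods of infinity in the closure of `D`. -/
def atInf (q0 : ℝ) (D : Set ℂ) : Filter ℂ := Bornology.cobounded ℂ ⊓ 𝓟 (D ∪ Sigma0 q0)

/-- Neighbourhoods of the origin in the closure of `D`. -/
def atZero (q0 : ℝ) (D : Set ℂ) : Filter ℂ := 𝓝[D ∪ Sigma0 q0] 0

section

variable {q0 : ℝ} {D D₁ D₂ : Set ℂ}

theorem eventually_atInf_mem : ∀ᶠ z in atInf q0 D, z ∈ D ∪ Sigma0 q0 :=
  eventually_inf_principal.2 (Eventually.of_forall fun _ h => h)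

theorem eventually_atInf_norm (R : ℝ) : ∀ᶠ z in atInf q0 D, R ≤ ‖z‖ := by
  have := (tendsto_norm_cobounded_atTop (E := ℂ)).eventually_ge_atTop R
  exact this.filter_mono inf_le_left

theorem eventually_atZero_mem : ∀ᶠ z in atZero q0 D, z ∈ D ∪ Sigma0 q0 := eventually_mem_nhdsWithin

theorem tendsto_id_atZero : Tendsto (fun z : ℂ => z) (atZero q0 D) (𝓝 0) :=
  tendsto_id.mono_left nhdsWithin_le_nhds

theorem tendsto_inv_atInf : Tendsto (fun z : ℂ => z⁻¹) (atInf q0 D) (𝓝 0) :=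
  tendsto_inv₀_cobounded.mono_left inf_le_left

theorem tendsto_hat_atZero (hq : 0 < q0) (h0 : (0 : ℂ) ∉ D ∪ Sigma0 q0)
    (hD : ∀ z ∈ D ∪ Sigma0 q0, hat q0 z ∈ D₁ ∪ Sigma0 q0) :
    Tendsto (hat q0) (atZero q0 D) (atInf q0 D₁) := by
  refine tendsto_inf.2 ⟨?_, tendsto_principal.2 (eventually_atZero_mem.mono hD)⟩
  have h1 : Tendsto (fun z : ℂ => z⁻¹) (atZero q0 D) (Bornology.cobounded ℂ) :=
    tendsto_inv₀_nhdsNE_zero.mono_left (nhdsWithin_mono _ fun z hz => by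
      rintro rfl; exact h0 hz)
  rw [← tendsto_norm_atTop_iff_cobounded] at h1 ⊢
  have h2 : (fun z => ‖hat q0 z‖) = fun z => q0 ^ 2 * ‖z⁻¹‖ := by
    funext z; rw [norm_hat, norm_inv]; rfl
  rw [h2]
  exact h1.const_mul_atTop (by positivity)

theorem isBigO_of_eventually_le {l : Filter ℂ} {f g : ℂ → ℂ} {C : ℝ}
    (h : ∀ᶠ z in l, ‖f z‖ ≤ C * ‖g z‖) : f =O[l] g := Asymptotics.IsBigO.of_bound C h

namespace Sided

variable {rm qx : ℂ} {V : ℂ → Matrix (Fin 2) (Fin 2) ℂ} (h : Sided q0 D₁ D₂ rm qx V)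
include h

theorem isBigO₁ : (fun z => V z 0 0 - 1) =O[atInf q0 D₁] (fun z => z⁻¹) ∧
    (fun z => V z 1 0 + I / z * conj qx) =O[atInf q0 D₁] (fun z => (z ^ 2)⁻¹) := by
  obtain ⟨C, R, hC, hR, hb⟩ := h.infty
  constructor
  · refine isBigO_of_eventually_le (C := C) ?_
    filter_upwards [eventually_atInf_mem, eventually_atInf_norm R] with z h1 h2
    rw [norm_inv, ← div_eq_mul_inv]
    exact ((hb z h2).1 h1).1
  · refine isBigO_of_eventually_le (C := C) ?_
    filter_upwards [eventually_atInf_mem, eventually_atInf_norm R] with z h1 h2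
    rw [norm_inv, norm_pow, ← div_eq_mul_inv]
    exact ((hb z h2).1 h1).2

theorem isBigO₂ : (fun z => V z 1 1 - 1) =O[atInf q0 D₂] (fun z => z⁻¹) ∧
    (fun z => V z 0 1 + I / z * qx) =O[atInf q0 D₂] (fun z => (z ^ 2)⁻¹) := by
  obtain ⟨C, R, hC, hR, hb⟩ := h.infty
  constructor
  · refine isBigO_of_eventually_le (C := C) ?_
    filter_upwards [eventually_atInf_mem, eventually_atInf_norm R] with z h1 h2
    rw [norm_inv, ← div_eq_mul_inv]
    exact ((hb z h2).2 h1).1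
  · refine isBigO_of_eventually_le (C := C) ?_
    filter_upwards [eventually_atInf_mem, eventually_atInf_norm R] with z h1 h2
    rw [norm_inv, norm_pow, ← div_eq_mul_inv]
    exact ((hb z h2).2 h1).2

/-- The involution exchanges the origin and infinity, so the leading term at 0 is the 1 of the
diagonal entry at infinity times the prefactor of the symmetry. -/
theorem isBigO_zero (hq : 0 < q0) (h0 : (0 : ℂ) ∉ D₂ ∪ Sigma0 q0)
    (hD : ∀ z ∈ D₂ ∪ Sigma0 q0, hat q0 z ∈ D₁ ∪ Sigma0 q0) :
    (fun z => z * V z 0 1 + I * rm) =O[atZero q0 D₂] (fun z => z) := by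
  have h1 := (h.isBigO₁.1.comp_tendsto (tendsto_hat_atZero hq h0 hD)).const_mul_left (-(I * rm))
  have h2 : (fun z => (hat q0 z)⁻¹) =O[atZero q0 D₂] (fun z => z) := by
    refine isBigO_of_eventually_le (C := (q0 ^ 2)⁻¹) (Eventually.of_forall fun z => ?_)
    rw [norm_inv, norm_hat, inv_div, div_eq_inv_mul]
  refine (h1.trans h2).congr' ?_ (EventuallyEq.refl _ _)
  filter_upwards [eventually_atZero_mem] with z hz
  have hz0 : z ≠ 0 := by rintro rfl; exact h0 hz
  rw [h.symm₂ z hz 0]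
  simp only [Function.comp_def]
  field_simp
  ring

end Sided

end

theorem isBigO_inv_sq_inv {q0 : ℝ} {D : Set ℂ} :
    (fun z : ℂ => (z ^ 2)⁻¹) =O[atInf q0 D] (fun z => z⁻¹) := by
  refine isBigO_of_eventually_le (C := 1) ?_
  filter_upwards [eventually_atInf_norm 1] with z hz
  rw [norm_inv, norm_inv, norm_pow, one_mul]
  exact inv_anti₀ (by linarith) (by nlinarith)

theorem isBigO_inv_one {q0 : ℝ} {D : Set ℂ} :
    (fun z : ℂ => z⁻¹) =O[atInf q0 D] (fun _ => (1 : ℂ)) := tendsto_inv_atInf.isBigO_one ℂ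

/-- If `a - 1` is dominated by `g`, which tends to `0`, so is `a⁻¹ - 1`. -/
theorem isBigO_inv_sub_one {l : Filter ℂ} {a g : ℂ → ℂ} (h : (fun z => a z - 1) =O[l] g)
    (hg : Tendsto g l (𝓝 0)) : (fun z => (a z)⁻¹ - 1) =O[l] g := by
  have h1 : Tendsto a l (𝓝 1) := by
    have := (h.trans_tendsto hg).add_const 1
    simpa using this
  have h2 : (fun z => (a z)⁻¹) =O[l] (fun _ => (1 : ℂ)) := (h1.inv₀ one_ne_zero).isBigO_one ℂ
  have h3 := (h.mul h2).neg_left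
  simp only [mul_one] at h3
  refine h3.congr' ?_ (EventuallyEq.refl _ _)
  filter_upwards [h1.eventually_ne one_ne_zero] with z hz
  field_simp
  ring

namespace JostPair

variable {q0 : ℝ} {q : ℝ → ℝ → ℂ} {qm qp : ℂ} {ψm ψp : ℝ → ℝ → ℂ → Matrix (Fin 2) (Fin 2) ℂ}
  (h : JostPair q0 q qm qp ψm ψp) {z : ℂ}
include h

/-- The two exponentials of the modified columns cancel in this Wronskian, and constancy in (x,t)
lets it be evaluated anywhere. -/
theorem s11_mul_gam (hz : z ∈ Dminus q0 ∪ Sigma0 q0) (x t : ℝ) :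
    s11 q0 ψm ψp z * gam q0 z = modified q0 ψp x t z 0 0 * modified q0 ψm x t z 1 1
      - modified q0 ψp x t z 1 0 * modified q0 ψm x t z 0 1 := by
  rw [s11, div_mul_cancel₀ _ (gam_ne_zero_DmS hz),
    ← wr_eq_wr_zero (fun i => ⟨(h.plus 0 z hz i).1, (h.plus 0 z hz i).2.1⟩)
      (fun i => ⟨(h.minus 1 z hz i).1, (h.minus 1 z hz i).2.1⟩) x t, wr]
  have : exp (I * theta q0 x t z) * exp (-(I * theta q0 x t z)) = 1 := by
    rw [← exp_add, add_neg_cancel, exp_zero]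
  simp only [modified_zero, modified_one]
  linear_combination (ψp x t z 1 0 * ψm x t z 0 1 - ψp x t z 0 0 * ψm x t z 1 1) * this

theorem s22_mul_gam (hz : z ∈ Dplus q0 ∪ Sigma0 q0) (x t : ℝ) :
    s22 q0 ψm ψp z * gam q0 z = modified q0 ψm x t z 0 0 * modified q0 ψp x t z 1 1
      - modified q0 ψm x t z 1 0 * modified q0 ψp x t z 0 1 := by
  rw [s22, div_mul_cancel₀ _ (gam_ne_zero_DS hz),
    ← wr_eq_wr_zero (fun i => ⟨(h.minus 0 z hz i).1, (h.minus 0 z hz i).2.1⟩)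
      (fun i => ⟨(h.plus 1 z hz i).1, (h.plus 1 z hz i).2.1⟩) x t, wr]
  have : exp (I * theta q0 x t z) * exp (-(I * theta q0 x t z)) = 1 := by
    rw [← exp_add, add_neg_cancel, exp_zero]
  simp only [modified_zero, modified_one]
  linear_combination (ψm x t z 1 0 * ψp x t z 0 1 - ψm x t z 0 0 * ψp x t z 1 1) * this

theorem s12_mul_gam (hz : z ∈ Sigma0 q0) (x t : ℝ) :
    s12 q0 ψm ψp z * exp (-2 * I * theta q0 x t z) * gam q0 z =
      modified q0 ψp x t z 0 1 * modified q0 ψm x t z 1 1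
      - modified q0 ψp x t z 1 1 * modified q0 ψm x t z 0 1 := by
  rw [mul_right_comm, s12, div_mul_cancel₀ _ (gam_ne_zero_DS (Or.inr hz)),
    ← wr_eq_wr_zero (fun i => ⟨(h.plus 1 z (Or.inr hz) i).1, (h.plus 1 z (Or.inr hz) i).2.1⟩)
      (fun i => ⟨(h.minus 1 z (Or.inr hz) i).1, (h.minus 1 z (Or.inr hz) i).2.1⟩) x t, wr]
  have : exp (-2 * I * theta q0 x t z) = exp (-(I * theta q0 x t z)) * exp (-(I * theta q0 x t z)) := by
    rw [← exp_add]; ring_nf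
  simp only [modified_one, this]
  ring

theorem s21_mul_gam (hz : z ∈ Sigma0 q0) (x t : ℝ) :
    s21 q0 ψm ψp z * exp (2 * I * theta q0 x t z) * gam q0 z =
      modified q0 ψm x t z 0 0 * modified q0 ψp x t z 1 0
      - modified q0 ψm x t z 1 0 * modified q0 ψp x t z 0 0 := by
  rw [mul_right_comm, s21, div_mul_cancel₀ _ (gam_ne_zero_DS (Or.inr hz)),
    ← wr_eq_wr_zero (fun i => ⟨(h.minus 0 z (Or.inr hz) i).1, (h.minus 0 z (Or.inr hz) i).2.1⟩)
      (fun i => ⟨(h.plus 0 z (Or.inr hz) i).1, (h.plus 0 z (Or.inr hz) i).2.1⟩) x t, wr]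
  have : exp (2 * I * theta q0 x t z) = exp (I * theta q0 x t z) * exp (I * theta q0 x t z) := by
    rw [← exp_add]; ring_nf
  simp only [modified_zero, this]
  ring

/-- The scattering relation for the second column. -/
theorem modified_plus_one (hz : z ∈ Sigma0 q0) (x t : ℝ) (i : Fin 2) :
    modified q0 ψp x t z i 1 =
      s12 q0 ψm ψp z * exp (-2 * I * theta q0 x t z) * modified q0 ψm x t z i 0
      + s22 q0 ψm ψp z * modified q0 ψm x t z i 1 := by
  have hg := gam_ne_zero_DS (Or.inr hz)
  have d := (h.sided_minus x t).det z hz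
  have e1 := h.s12_mul_gam hz x t
  have e2 := h.s22_mul_gam (Or.inr hz) x t
  apply mul_right_cancel₀ hg
  fin_cases i <;> simp only [Fin.zero_eta, Fin.mk_one]
  · linear_combination (-modified q0 ψp x t z 0 1) * d - modified q0 ψm x t z 0 0 * e1
      - modified q0 ψm x t z 0 1 * e2
  · linear_combination (-modified q0 ψp x t z 1 1) * d - modified q0 ψm x t z 1 0 * e1
      - modified q0 ψm x t z 1 1 * e2

/-- The scattering relation for the first column. -/
theorem modified_plus_zero (hz : z ∈ Sigma0 q0) (x t : ℝ) (i : Fin 2) :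
    modified q0 ψp x t z i 0 = s11 q0 ψm ψp z * modified q0 ψm x t z i 0
      + s21 q0 ψm ψp z * exp (2 * I * theta q0 x t z) * modified q0 ψm x t z i 1 := by
  have hg := gam_ne_zero_DS (Or.inr hz)
  have d := (h.sided_minus x t).det z hz
  have e1 := h.s21_mul_gam hz x t
  have e2 := h.s11_mul_gam (Or.inr hz) x t
  apply mul_right_cancel₀ hg
  fin_cases i <;> simp only [Fin.zero_eta, Fin.mk_one]
  · linear_combination (-modified q0 ψp x t z 0 0) * d - modified q0 ψm x t z 0 1 * e1
      - modified q0 ψm x t z 0 0 * e2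
  · linear_combination (-modified q0 ψp x t z 1 0) * d - modified q0 ψm x t z 1 1 * e1
      - modified q0 ψm x t z 1 0 * e2

theorem s22_eq_conj (hz : z ∈ Dplus q0 ∪ Sigma0 q0) :
    s22 q0 ψm ψp z = conj (s11 q0 ψm ψp (conj z)) := by
  have hz' := conj_mem_DmS.2 hz
  have hg := gam_ne_zero_DS hz
  have e1 := h.s22_mul_gam hz 0 0
  have e2 := congrArg conj (h.s11_mul_gam hz' 0 0)
  have m := h.sided_minus 0 0
  have p := h.sided_plus 0 0
  have hgc : conj (gam q0 (conj z)) = gam q0 z := by simp [gam]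
  rw [map_mul, hgc, m.conj₁₁ _ hz', m.conj₀₁ _ hz', conj_conj] at e2
  rw [p.conj₁₁ _ hz, p.conj₀₁ _ hz] at e1
  apply mul_right_cancel₀ hg
  rw [e1, e2]
  simp only [map_sub, map_mul, map_neg, conj_conj]
  ring

theorem qm_ne_zero : qm ≠ 0 := norm_pos_iff.1 (by rw [h.norm_qm]; exact h.pos)

theorem qp_ne_zero : qp ≠ 0 := norm_pos_iff.1 (by rw [h.norm_qp]; exact h.pos)

theorem qm_mul_conj : qm * conj qm = (q0 : ℂ) ^ 2 := by
  rw [Complex.mul_conj, Complex.normSq_eq_norm_sq, h.norm_qm]; push_cast; ring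

theorem q0_ne_zero : (q0 : ℂ) ≠ 0 := ofReal_ne_zero.2 h.pos.ne'

/-- The prefactors of the two column symmetries multiply to -q₊q₋*/z², and γ(ẑ) = (z²/q₀²)γ(z); with
|q₋| = q₀ only q₊/q₋ survives. -/
theorem s22_eq_hat (hz : z ∈ Dplus q0 ∪ Sigma0 q0) :
    s22 q0 ψm ψp z = qp / qm * s11 q0 ψm ψp (hat q0 z) := by
  have hz' := (hat_mem_DmS h.pos).2 hz
  have hg := gam_ne_zero_DS hz
  have hz0 := ne_zero_of_mem_DS hz
  have e1 := h.s22_mul_gam hz 0 0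
  have e2 := h.s11_mul_gam hz' 0 0
  have m := (h.sided_minus 0 0).symm₁ z hz
  have p := (h.sided_plus 0 0).symm₂ z hz
  rw [m 0, m 1, p 0, p 1] at e1
  have hgh : gam q0 (hat q0 z) = z ^ 2 / q0 ^ 2 * gam q0 z := by
    have := h.q0_ne_zero
    simp only [gam, hat]; field_simp; ring
  have hqq := h.qm_mul_conj
  have hq0 := h.q0_ne_zero
  have hqm := h.qm_ne_zero
  apply mul_right_cancel₀ hg
  have e3 : s22 q0 ψm ψp z * gam q0 z =
      qp * conj qm / z ^ 2 * (s11 q0 ψm ψp (hat q0 z) * gam q0 (hat q0 z)) := by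
    rw [e1, e2]; field_simp; rw [I_sq]; ring
  rw [e3, hgh]
  have : conj qm = q0 ^ 2 / qm := by field_simp; linear_combination hqq
  rw [this]
  field_simp

theorem differentiableOn_s22 : DifferentiableOn ℂ (s22 q0 ψm ψp) (Dplus q0) := by
  have m := (h.sided_minus 0 0).reg₁
  have p := (h.sided_plus 0 0).reg₂
  have : DifferentiableOn ℂ (fun z => (modified q0 ψm 0 0 z 0 0 * modified q0 ψp 0 0 z 1 1
      - modified q0 ψm 0 0 z 1 0 * modified q0 ψp 0 0 z 0 1) / gam q0 z) (Dplus q0) := by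
    refine (((m 0).diff.mul (p 1).diff).sub ((m 1).diff.mul (p 0).diff)).div ?_
      fun z hz => gam_ne_zero_DS (Or.inl hz)
    unfold gam
    exact (differentiableOn_const _).add ((differentiableOn_const _).div (by fun_prop)
      fun z hz => pow_ne_zero _ (ne_zero_of_mem_Dplus hz))
  exact this.congr fun z hz => by
    rw [← h.s22_mul_gam (Or.inl hz) 0 0, mul_div_cancel_right₀ _ (gam_ne_zero_DS (Or.inl hz))]

theorem continuousOn_s22 : ContinuousOn (s22 q0 ψm ψp) (Dplus q0 ∪ Sigma0 q0) := by
  have m := (h.sided_minus 0 0).reg₁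
  have p := (h.sided_plus 0 0).reg₂
  have : ContinuousOn (fun z => (modified q0 ψm 0 0 z 0 0 * modified q0 ψp 0 0 z 1 1
      - modified q0 ψm 0 0 z 1 0 * modified q0 ψp 0 0 z 0 1) / gam q0 z) (Dplus q0 ∪ Sigma0 q0) := by
    refine (((m 0).cont.mul (p 1).cont).sub ((m 1).cont.mul (p 0).cont)).div ?_
      fun z hz => gam_ne_zero_DS hz
    unfold gam
    exact continuousOn_const.add (continuousOn_const.div (by fun_prop)
      fun z hz => pow_ne_zero _ (ne_zero_of_mem_DS hz))
  exact this.congr fun z hz => by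
    beta_reduce
    rw [← h.s22_mul_gam hz 0 0, mul_div_cancel_right₀ _ (gam_ne_zero_DS hz)]

/-- The off-diagonal entries are O(1/z), so their product is negligible. The diagonal entries and γ
each differ from 1 by O(1/z). -/
theorem s22_isBigO : (fun z => s22 q0 ψm ψp z - 1) =O[atInf q0 (Dplus q0)] (fun z => z⁻¹) := by
  obtain ⟨m0, m1⟩ := (h.sided_minus 0 0).isBigO₁
  obtain ⟨p1, p0⟩ := (h.sided_plus 0 0).isBigO₂
  have hsmall : ∀ c : ℂ, (fun z : ℂ => I / z * c) =O[atInf q0 (Dplus q0)] (fun z => z⁻¹) := fun c => by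
    refine isBigO_of_eventually_le (C := ‖c‖) (Eventually.of_forall fun z => ?_)
    rw [norm_mul, norm_div, norm_I, norm_inv, one_div, mul_comm]
  have m1' := ((m1.trans isBigO_inv_sq_inv).sub (hsmall (conj (q 0 0))))
  have p0' := ((p0.trans isBigO_inv_sq_inv).sub (hsmall (q 0 0)))
  simp only [add_sub_cancel_right] at m1' p0'
  have hm0 : (fun z => modified q0 ψm 0 0 z 0 0) =O[atInf q0 (Dplus q0)] (fun _ => (1 : ℂ)) := by
    have := (m0.trans isBigO_inv_one).add (Asymptotics.isBigO_refl (fun _ => (1 : ℂ)) _)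
    simpa using this
  have hw : (fun z => (s22 q0 ψm ψp z * gam q0 z) - 1) =O[atInf q0 (Dplus q0)] (fun z => z⁻¹) := by
    have t1 := hm0.mul p1
    have t2 := m1'.mul (p0'.trans isBigO_inv_one)
    simp only [one_mul, mul_one] at t1 t2
    refine ((t1.add m0).sub t2).congr' ?_ (EventuallyEq.refl _ _)
    filter_upwards [eventually_atInf_mem] with z hz
    rw [h.s22_mul_gam hz 0 0]
    ring
  have hg : (fun z => gam q0 z - 1) =O[atInf q0 (Dplus q0)] (fun z => z⁻¹) := by
    refine Asymptotics.IsBigO.trans ?_ isBigO_inv_sq_inv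
    refine isBigO_of_eventually_le (C := q0 ^ 2) (Eventually.of_forall fun z => ?_)
    rw [gam, add_sub_cancel_left, norm_div, norm_pow, Complex.norm_real, Real.norm_eq_abs, sq_abs,
      norm_inv, div_eq_mul_inv]
  have hgi := isBigO_inv_sub_one hg tendsto_inv_atInf
  have hgi1 : (fun z => (gam q0 z)⁻¹) =O[atInf q0 (Dplus q0)] (fun _ => (1 : ℂ)) := by
    have := (hgi.trans isBigO_inv_one).add (Asymptotics.isBigO_refl (fun _ => (1 : ℂ)) _)
    simpa using this
  have := (hw.mul hgi1).add (by simpa using hgi)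
  simp only [mul_one] at this
  refine this.congr' ?_ (EventuallyEq.refl _ _)
  filter_upwards [eventually_atInf_mem] with z hz
  have := gam_ne_zero_DS hz
  field_simp
  ring

/-- Conjugation after the involution maps D⁺ near 0 to D⁺ near infinity. The two symmetries of s₂₂
together therefore carry its limit 1 at infinity to the limit q₊/q₋ at the origin. -/
theorem s22_zero_isBigO :
    (fun z => qm / qp * s22 q0 ψm ψp z - 1) =O[atZero q0 (Dplus q0)] (fun z => z) := by
  have h0 : (0 : ℂ) ∉ Dplus q0 ∪ Sigma0 q0 := fun h => ne_zero_of_mem_DS h rfl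
  have ht : Tendsto (fun z => conj (hat q0 z)) (atZero q0 (Dplus q0)) (atInf q0 (Dplus q0)) := by
    have h1 := tendsto_hat_atZero (D := Dplus q0) (D₁ := Dminus q0) h.pos h0
      fun z hz => (hat_mem_DmS h.pos).2 hz
    refine Tendsto.comp (g := conj) ?_ h1
    refine tendsto_inf.2 ⟨Tendsto.mono_left ?_ inf_le_left,
      tendsto_principal.2 (eventually_atInf_mem.mono fun z hz => conj_mem_DS.2 hz)⟩
    rw [← tendsto_norm_atTop_iff_cobounded]
    simpa only [RCLike.norm_conj] using tendsto_norm_cobounded_atTop (E := ℂ)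
  have h1 := h.s22_isBigO.comp_tendsto ht
  have h2 : (fun z => (conj (hat q0 z))⁻¹) =O[atZero q0 (Dplus q0)] (fun z => z) := by
    refine isBigO_of_eventually_le (C := (q0 ^ 2)⁻¹) (Eventually.of_forall fun z => ?_)
    rw [norm_inv, RCLike.norm_conj, norm_hat, inv_div, div_eq_inv_mul]
  have h3 := h1.trans h2
  rw [← Asymptotics.isBigO_norm_left] at h3 ⊢
  refine h3.congr' ?_ (EventuallyEq.refl _ _)
  filter_upwards [eventually_atZero_mem] with z hz
  have hz' := (hat_mem_DmS h.pos).2 hz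
  simp only [Function.comp_def]
  rw [h.s22_eq_conj (conj_mem_DS.2 hz'), conj_conj, h.s22_eq_hat hz, ← RCLike.norm_conj]
  have := h.qm_ne_zero
  have := h.qp_ne_zero
  congr 1
  rw [map_sub, conj_conj, map_one]
  field_simp

/-- The `(1,2)` entry of the jump. -/
theorem jump (hs : NoSpectralSingularity q0 ψm ψp) (hz : z ∈ Sigma0 q0) (x t : ℝ) :
    (Mminus q0 ψm ψp x t z * Gmat q0 ψm ψp x t z) 0 1 =
      modified q0 ψm x t z 0 1 - modified q0 ψp x t z 0 1 / s22 q0 ψm ψp z := by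
  have n11 : s11 q0 ψm ψp z ≠ 0 := hs.1 z hz
  have n22 : s22 q0 ψm ψp z ≠ 0 := by
    rw [h.s22_eq_conj (Or.inr hz)]
    exact (map_ne_zero _).2 (hs.1 _ (conj_mem_Sigma0.2 hz))
  have e1 := h.modified_plus_one hz x t 0
  have e2 := h.modified_plus_zero hz x t 0
  have he : exp (-2 * I * theta q0 x t z) * exp (2 * I * theta q0 x t z) = 1 := by
    rw [← exp_add]; ring_nf; exact exp_zero
  have m0 : Mminus q0 ψm ψp x t z 0 0 = modified q0 ψp x t z 0 0 / s11 q0 ψm ψp z := rfl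
  have m1 : Mminus q0 ψm ψp x t z 0 1 = modified q0 ψm x t z 0 1 := rfl
  have g0 : Gmat q0 ψm ψp x t z 0 1 = -rhoT q0 ψm ψp z * exp (-2 * I * theta q0 x t z) := rfl
  have g1 : Gmat q0 ψm ψp x t z 1 1 = rho q0 ψm ψp z * rhoT q0 ψm ψp z := rfl
  rw [Matrix.mul_apply, Fin.sum_univ_two, m0, m1, g0, g1, rho, rhoT, e1, e2]
  generalize exp (-2 * I * theta q0 x t z) = E at *
  generalize exp (2 * I * theta q0 x t z) = F at *
  field_simp
  linear_combination (-(s21 q0 ψm ψp z * s12 q0 ψm ψp z * modified q0 ψm x t z 0 1)) * he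

theorem s22_ne_zero (hs : NoSpectralSingularity q0 ψm ψp) (hz : z ∈ Sigma0 q0) :
    s22 q0 ψm ψp z ≠ 0 := by
  rw [h.s22_eq_conj (Or.inr hz)]
  exact (map_ne_zero _).2 (hs.1 _ (conj_mem_Sigma0.2 hz))

/-- In the reflectionless case there is no jump. -/
theorem no_jump (hs : NoSpectralSingularity q0 ψm ψp) (hz : z ∈ Sigma0 q0) {x t : ℝ}
    (hG : Gmat q0 ψm ψp x t z = 0) (i : Fin 2) :
    modified q0 ψp x t z i 1 / s22 q0 ψm ψp z = modified q0 ψm x t z i 1 ∧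
    modified q0 ψp x t z i 0 / s11 q0 ψm ψp z = modified q0 ψm x t z i 0 := by
  have n11 : s11 q0 ψm ψp z ≠ 0 := hs.1 z hz
  have n22 := h.s22_ne_zero hs hz
  have g1 := congrFun (congrFun hG 0) 1
  have g2 := congrFun (congrFun hG 1) 0
  simp [Gmat, rho, rhoT, n11, n22, exp_ne_zero] at g1 g2
  rw [h.modified_plus_one hz, h.modified_plus_zero hz, g1, g2]
  constructor <;> field_simp <;> ring

end JostPair

/-! ## Norming constants -/

theorem norm_le_of_norm_deriv_le {E : Type*} [NormedAddCommGroup E] [NormedSpace ℝ E]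
    {y y' : ℝ → E} {K L : ℝ} (hy : ∀ s, HasDerivAt y (y' s) s)
    (hb : ∀ s ∈ Set.Icc (-L) L, ‖y' s‖ ≤ K * ‖y s‖) {s : ℝ} (hs : s ∈ Set.Icc (-L) L) :
    ‖y s‖ ≤ ‖y 0‖ * Real.exp (K * |s|) := by
  have hL : 0 ≤ L := by linarith [hs.1, hs.2]
  have key : ∀ {y y' : ℝ → E}, (∀ s, HasDerivAt y (y' s) s) →
      (∀ s ∈ Set.Icc (-L) L, ‖y' s‖ ≤ K * ‖y s‖) → ∀ s ∈ Set.Icc 0 L,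
      ‖y s‖ ≤ ‖y 0‖ * Real.exp (K * s) := by
    intro y y' hy hb s hs
    have := norm_le_gronwallBound_of_norm_deriv_right_le (f := y) (f' := y') (δ := ‖y 0‖) (K := K)
      (ε := 0) (a := 0) (b := L) (fun s _ => (hy s).continuousAt.continuousWithinAt)
      (fun s _ => (hy s).hasDerivWithinAt) le_rfl
      (fun s hs => by rw [add_zero]; exact hb s ⟨by linarith [hs.1], hs.2.le⟩) s hs
    rwa [gronwallBound_ε0, sub_zero] at this
  rcases le_total 0 s with h | h
  · rw [abs_of_nonneg h]
    exact key hy hb s ⟨h, hs.2⟩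
  · rw [abs_of_nonpos h]
    have := key (y := fun s => y (-s)) (y' := fun s => -y' (-s)) (fun s => by
      have := (hy (-s)).scomp s (hasDerivAt_neg s)
      simpa [Function.comp_def] using this) (fun s hs => by
        rw [norm_neg]; exact hb (-s) ⟨by linarith [hs.2], by linarith [hs.1]⟩) (-s)
        ⟨by linarith, by linarith [hs.1]⟩
    simpa using this

/-- Smallness of solutions of a family of linear systems propagates along a curve.  The
coefficients `M₀` need not be continuous: only `M - M₀` has to be bounded. -/
theorem isLittleO_propagate {w δ : ℂ} {e : ℂ → ℝ → Fin 2 → ℂ} {Ψ M₀ : ℝ → Matrix (Fin 2) (Fin 2) ℂ}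
    {M : ℂ → ℝ → Matrix (Fin 2) (Fin 2) ℂ}
    (hΨ : ∀ s i j, HasDerivAt (fun s => Ψ s i j) ((M₀ s * Ψ s) i j) s) (hδ : δ ≠ 0)
    (hdet : ∀ s, Ψ s 0 0 * Ψ s 1 1 - Ψ s 1 0 * Ψ s 0 1 = δ)
    (htr : ∀ s, M₀ s 1 1 = -M₀ s 0 0)
    (he : ∀ᶠ z in 𝓝 w, ∀ s i,
      HasDerivAt (fun s => e z s i) (M z s i 0 * e z s 0 + M z s i 1 * e z s 1) s)
    (hN : ∀ L, ∃ C, ∀ᶠ z in 𝓝 w, ∀ s ∈ Set.Icc (-L) L, ∀ i j, ‖M z s i j - M₀ s i j‖ ≤ C)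
    (h0 : ∀ i, (fun z => e z 0 i) =o[𝓝 w] (fun z => z - w)) (s : ℝ) (i : Fin 2) :
    (fun z => e z s i) =o[𝓝 w] (fun z => z - w) := by
  set L := |s| with hL
  have hsL : s ∈ Set.Icc (-L) L := abs_le.1 le_rfl
  have h0L : (0 : ℝ) ∈ Set.Icc (-L) L := ⟨by rw [hL]; linarith [abs_nonneg s], abs_nonneg s⟩
  obtain ⟨C, hC⟩ := hN L
  have hB : ∃ B, 0 ≤ B ∧ ∀ s ∈ Set.Icc (-L) L, ∀ i j, ‖Ψ s i j‖ ≤ B := by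
    have h1 : ∀ i j, ∃ B, ∀ s ∈ Set.Icc (-L) L, ‖Ψ s i j‖ ≤ B := fun i j =>
      isCompact_Icc.exists_bound_of_continuousOn fun s _ =>
        (hΨ s i j).continuousAt.continuousWithinAt
    choose B hB using h1
    refine ⟨∑ i, ∑ j, |B i j|, by positivity, fun s hs i j => (hB i j s hs).trans
      ((le_abs_self _).trans ?_)⟩
    refine (Finset.single_le_sum (f := fun j => |B i j|) (fun _ _ => abs_nonneg _)
      (Finset.mem_univ j)).trans ?_
    exact Finset.single_le_sum (f := fun i => ∑ j, |B i j|)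
      (fun _ _ => Finset.sum_nonneg fun _ _ => abs_nonneg _) (Finset.mem_univ i)
  obtain ⟨B, hB0, hB⟩ := hB
  have hδ' : 0 < ‖δ‖ := norm_pos_iff.2 hδ
  -- y is the adjugate of Ψ applied to e. As M₀ has trace 0, M₀ drops out of the equation for y,
  -- which involves only the bounded difference M - M₀.
  set y : ℂ → ℝ → ℂ × ℂ := fun z s =>
    (e z s 0 * Ψ s 1 1 - e z s 1 * Ψ s 0 1, Ψ s 0 0 * e z s 1 - Ψ s 1 0 * e z s 0) with hy
  have hey : ∀ z s, ∀ i, e z s i = ((y z s).1 * Ψ s i 0 + (y z s).2 * Ψ s i 1) / δ := by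
    intro z s i
    rw [eq_div_iff hδ, ← hdet s]
    fin_cases i <;> simp only [hy, Fin.zero_eta, Fin.mk_one] <;> ring
  have hen : ∀ z, ∀ s ∈ Set.Icc (-L) L, ∀ i, ‖e z s i‖ ≤ 2 * B / ‖δ‖ * ‖y z s‖ := by
    intro z s hs i
    rw [hey, norm_div, div_mul_eq_mul_div]
    refine div_le_div_of_nonneg_right ((norm_add_le _ _).trans ?_) hδ'.le
    rw [norm_mul, norm_mul]
    have h1 := mul_le_mul (norm_fst_le (y z s)) (hB s hs i 0) (norm_nonneg _) (norm_nonneg _)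
    have h2 := mul_le_mul (norm_snd_le (y z s)) (hB s hs i 1) (norm_nonneg _) (norm_nonneg _)
    linarith
  have hyd : ∀ᶠ z in 𝓝 w, ‖y z s‖ ≤ Real.exp (4 * B * (|C| * (2 * B / ‖δ‖)) * |s|) * ‖y z 0‖ := by
    filter_upwards [he, hC] with z hz hCz
    set n : ℝ → Fin 2 → ℂ := fun s i => (M z s i 0 - M₀ s i 0) * e z s 0
      + (M z s i 1 - M₀ s i 1) * e z s 1 with hn
    rw [mul_comm]
    refine norm_le_of_norm_deriv_le (y := y z) (y' := fun s => (n s 0 * Ψ s 1 1 - n s 1 * Ψ s 0 1,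
      Ψ s 0 0 * n s 1 - Ψ s 1 0 * n s 0)) (fun s => ?_) (fun s hs => ?_) hsL
    · refine HasDerivAt.prodMk ?_ ?_
      · refine (((hz s 0).mul (hΨ s 1 1)).sub ((hz s 1).mul (hΨ s 0 1))).congr_deriv ?_
        simp only [Matrix.mul_apply, Fin.sum_univ_two, htr, hn]
        ring
      · refine (((hΨ s 0 0).mul (hz s 1)).sub ((hΨ s 1 0).mul (hz s 0))).congr_deriv ?_
        simp only [Matrix.mul_apply, Fin.sum_univ_two, htr, hn]
        ring
    · have hni : ∀ i, ‖n s i‖ ≤ 2 * (|C| * (2 * B / ‖δ‖ * ‖y z s‖)) := by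
        intro i
        refine (norm_add_le _ _).trans ?_
        rw [norm_mul, norm_mul]
        have h1 := mul_le_mul ((hCz s hs i 0).trans (le_abs_self C)) (hen z s hs 0) (norm_nonneg _)
          (abs_nonneg C)
        have h2 := mul_le_mul ((hCz s hs i 1).trans (le_abs_self C)) (hen z s hs 1) (norm_nonneg _)
          (abs_nonneg C)
        linarith
      have hT : 0 ≤ 2 * (|C| * (2 * B / ‖δ‖ * ‖y z s‖)) := by positivity
      have e1 : ∀ i j k l m o, ‖n s i * Ψ s j k - n s l * Ψ s m o‖ ≤
          4 * B * (|C| * (2 * B / ‖δ‖)) * ‖y z s‖ := by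
        intro i j k l m o
        refine (norm_sub_le _ _).trans ?_
        rw [norm_mul, norm_mul]
        have h1 := mul_le_mul (hni i) (hB s hs j k) (norm_nonneg _) hT
        have h2 := mul_le_mul (hni l) (hB s hs m o) (norm_nonneg _) hT
        refine (add_le_add h1 h2).trans (le_of_eq ?_)
        ring
      rw [Prod.norm_def]
      refine max_le (e1 _ _ _ _ _ _) ?_
      rw [mul_comm (Ψ s 0 0), mul_comm (Ψ s 1 0)]
      exact e1 _ _ _ _ _ _
  have hy0 : (fun z => y z 0) =o[𝓝 w] (fun z => z - w) := by
    refine Asymptotics.IsLittleO.prod_left ?_ ?_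
    · simp only [mul_comm _ (Ψ 0 _ _)]
      exact ((h0 0).const_mul_left _).sub ((h0 1).const_mul_left _)
    · exact ((h0 1).const_mul_left _).sub ((h0 0).const_mul_left _)
  have hys : (fun z => y z s) =o[𝓝 w] (fun z => z - w) :=
    (Asymptotics.IsBigO.of_bound _ hyd).trans_isLittleO hy0
  exact (Asymptotics.IsBigO.of_bound _ (Eventually.of_forall fun z => hen z s hsL i)).trans_isLittleO
    hys

namespace JostPair

variable {q0 : ℝ} {q : ℝ → ℝ → ℂ} {qm qp : ℂ} {ψm ψp : ℝ → ℝ → ℂ → Matrix (Fin 2) (Fin 2) ℂ}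
  (h : JostPair q0 q qm qp ψm ψp) {w : ℂ}
include h

/-- The matrix `ψ₋(q₀)` is used as a gauge. -/
theorem gauge : (q0 : ℂ) ∈ Sigma0 q0 ∧ gam q0 q0 ≠ 0 ∧ ∀ x t, ψm x t q0 0 0 * ψm x t q0 1 1
    - ψm x t q0 1 0 * ψm x t q0 0 1 = gam q0 q0 := by
  have hS := ofReal_mem_Sigma0 h.pos h.pos.ne'
  refine ⟨hS, gam_ne_zero_DS (Or.inr hS), fun x t => ?_⟩
  have d := (h.sided_minus x t).det _ hS
  rw [← d]
  have : exp (I * theta q0 x t q0) * exp (-(I * theta q0 x t q0)) = 1 := by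
    rw [← exp_add, add_neg_cancel, exp_zero]
  simp only [modified_zero, modified_one]
  linear_combination (ψm x t q0 1 0 * ψm x t q0 0 1 - ψm x t q0 0 0 * ψm x t q0 1 1) * this

omit h in
theorem kz_bounded (hw : w ≠ 0) : ∃ C, ∀ᶠ z in 𝓝 w, ‖kz q0 z - kz q0 q0‖ ≤ C ∧
    ‖kz q0 z ^ 2 - kz q0 q0 ^ 2‖ ≤ C := by
  have hc : ContinuousAt (fun z => kz q0 z) w := by
    unfold kz
    exact (continuousAt_id.sub (continuousAt_const.div continuousAt_id hw)).div_const _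
  have c1 : ContinuousAt (fun z => ‖kz q0 z - kz q0 q0‖) w := (hc.sub continuousAt_const).norm
  have c2 : ContinuousAt (fun z => ‖kz q0 z ^ 2 - kz q0 q0 ^ 2‖) w :=
    ((hc.pow 2).sub continuousAt_const).norm
  have h1 := c1.eventually (gt_mem_nhds (lt_add_one _))
  have h2 := c2.eventually (gt_mem_nhds (lt_add_one _))
  refine ⟨max (‖kz q0 w - kz q0 q0‖ + 1) (‖kz q0 w ^ 2 - kz q0 q0 ^ 2‖ + 1), ?_⟩
  filter_upwards [h1, h2] with z h1 h2
  exact ⟨h1.le.trans (le_max_left _ _), h2.le.trans (le_max_right _ _)⟩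

theorem isLittleO_propagate_x (hw : w ≠ 0) {e : ℂ → ℝ → Fin 2 → ℂ} (t : ℝ)
    (he : ∀ᶠ z in 𝓝 w, ∀ s i, HasDerivAt (fun s => e z s i)
      (laxX q0 q s t z i 0 * e z s 0 + laxX q0 q s t z i 1 * e z s 1) s)
    (h0 : ∀ i, (fun z => e z 0 i) =o[𝓝 w] (fun z => z - w)) (x : ℝ) (i : Fin 2) :
    (fun z => e z x i) =o[𝓝 w] (fun z => z - w) := by
  obtain ⟨hS, hδ, hdet⟩ := h.gauge
  refine isLittleO_propagate (Ψ := fun s => ψm s t q0) (M₀ := fun s => laxX q0 q s t q0)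
    (M := fun z s => laxX q0 q s t z) (fun s i j => (h.minus j _ (Or.inr hS) i).1 s t) hδ
    (fun s => hdet s t) (fun s => laxX_trace q0 q s t q0) he (fun L => ?_) h0 x i
  obtain ⟨C, hC⟩ := kz_bounded (q0 := q0) hw
  refine ⟨C, hC.mono fun z hz s _ i j => ?_⟩
  have hC0 : 0 ≤ C := (norm_nonneg _).trans hz.1
  have hz1 := hz.1
  rw [← norm_neg] at hz1
  fin_cases i <;> fin_cases j <;> simp [laxX, sigma3, Qmat, hC0]
  · rw [neg_add_eq_sub, ← mul_sub, norm_mul, norm_I, one_mul, norm_sub_rev]; exact hz.1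
  · rw [← mul_sub, norm_mul, norm_I, one_mul]; exact hz.1

/-- The time equation contains q_x, about whose dependence on t nothing is assumed. In the
difference between its matrices at z and at q₀ only k and q occur, and q is continuous in t. -/
theorem isLittleO_propagate_t (hw : w ≠ 0) {e : ℂ → ℝ → Fin 2 → ℂ} (x : ℝ)
    (he : ∀ᶠ z in 𝓝 w, ∀ s i, HasDerivAt (fun s => e z s i)
      (laxT q0 q x s z i 0 * e z s 0 + laxT q0 q x s z i 1 * e z s 1) s)
    (h0 : ∀ i, (fun z => e z 0 i) =o[𝓝 w] (fun z => z - w)) (t : ℝ) (i : Fin 2) :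
    (fun z => e z t i) =o[𝓝 w] (fun z => z - w) := by
  obtain ⟨hS, hδ, hdet⟩ := h.gauge
  refine isLittleO_propagate (Ψ := fun s => ψm x s q0) (M₀ := fun s => laxT q0 q x s q0)
    (M := fun z s => laxT q0 q x s z) (fun s i j => (h.minus j _ (Or.inr hS) i).2.1 x s) hδ
    (fun s => hdet x s) (fun s => laxT_trace q0 q x s q0) he (fun L => ?_) h0 t i
  obtain ⟨C, hC⟩ := kz_bounded (q0 := q0) hw
  obtain ⟨B, hB⟩ := isCompact_Icc.exists_bound_of_continuousOn (s := Set.Icc (-L) L)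
    (h.bv.differentiable_t x).continuous.continuousOn
  refine ⟨|C| + |C| * |B|, hC.mono fun z hz s hs i j => ?_⟩
  have hC1 := hz.1.trans (le_abs_self C)
  have hC2 := hz.2.trans (le_abs_self C)
  have hBs := (hB s hs).trans (le_abs_self B)
  have hp : 0 ≤ |C| * |B| := by positivity
  have hC0 := abs_nonneg C
  have e1 : laxT q0 q x s z i j - laxT q0 q x s q0 i j =
      -(I * (kz q0 z ^ 2 - kz q0 q0 ^ 2)) * sigma3 i j
        + (kz q0 z - kz q0 q0) * Qmat (q x s) i j := by
    simp [laxT]; ring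
  rw [e1]
  refine (norm_add_le _ _).trans (add_le_add ?_ ?_)
  · rw [norm_mul, norm_neg, norm_mul, norm_I, one_mul]
    refine (mul_le_of_le_one_right (norm_nonneg _) ?_).trans hC2
    fin_cases i <;> fin_cases j <;> simp [sigma3]
  · rw [norm_mul]
    refine mul_le_mul hC1 ?_ (norm_nonneg _) hC0
    fin_cases i <;> fin_cases j <;> simp [Qmat, hBs]

/-- A column that solves the scattering equation and vanishes at `x = 0` vanishes. -/
theorem eq_zero_of_eq_zero {v : ℝ → Fin 2 → ℂ} (hw : w ≠ 0) (t : ℝ)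
    (hv : ∀ x i, HasDerivAt (fun x => v x i)
      (laxX q0 q x t w i 0 * v x 0 + laxX q0 q x t w i 1 * v x 1) x)
    (h0 : ∀ i, v 0 i = 0) (x : ℝ) (i : Fin 2) : v x i = 0 := by
  obtain ⟨hS, hδ, hdet⟩ := h.gauge
  have := isLittleO_propagate (w := w) (e := fun _ => v) (Ψ := fun s => ψm s t q0)
    (M₀ := fun s => laxX q0 q s t q0)
    (M := fun _ s => laxX q0 q s t w) (fun s i j => (h.minus j _ (Or.inr hS) i).1 s t) hδ
    (fun s => hdet s t) (fun s => laxX_trace q0 q s t q0) (Eventually.of_forall fun _ => hv)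
    (fun L => ?_) (fun i => by simp only [h0]; exact Asymptotics.isLittleO_zero _ _) x i
  · have h1 := this.def one_pos
    have h2 := h1.self_of_nhds
    simpa using h2
  · obtain ⟨C, hC⟩ := kz_bounded (q0 := q0) hw
    have hz := hC.self_of_nhds
    refine ⟨C, Eventually.of_forall fun _ s _ i j => ?_⟩
    have hC0 : 0 ≤ C := (norm_nonneg _).trans hz.1
    fin_cases i <;> fin_cases j <;> simp [laxX, sigma3, Qmat, hC0]
    · rw [neg_add_eq_sub, ← mul_sub, norm_mul, norm_I, one_mul, norm_sub_rev]; exact hz.1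
    · rw [← mul_sub, norm_mul, norm_I, one_mul]; exact hz.1

theorem minus_ne_zero (hw : w ∈ Dplus q0) : ∃ i, ψm 0 0 w i 0 ≠ 0 := by
  by_contra hcon
  push Not at hcon
  have hJ := h.minus 0 w (Or.inl hw)
  have hz := h.eq_zero_of_eq_zero (v := fun x i => ψm x 0 w i 0) (ne_zero_of_mem_Dplus hw) 0
    (fun x i => by
      have := (hJ i).1 x 0
      rwa [Matrix.mul_apply, Fin.sum_univ_two] at this) hcon
  have hT := (hJ 0).2.2 0
  simp only [modified_zero, (Ymat_apply _ _).1] at hT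
  simp only [hz, zero_mul] at hT
  exact zero_ne_one (tendsto_nhds_unique tendsto_const_nhds hT)

theorem plus_ne_zero (hw : w ∈ Dplus q0) : ∃ i, ψp 0 0 w i 1 ≠ 0 := by
  by_contra hcon
  push Not at hcon
  have hJ := h.plus 1 w (Or.inl hw)
  have hz := h.eq_zero_of_eq_zero (v := fun x i => ψp x 0 w i 1) (ne_zero_of_mem_Dplus hw) 0
    (fun x i => by
      have := (hJ i).1 x 0
      rwa [Matrix.mul_apply, Fin.sum_univ_two] at this) hcon
  have hT := (hJ 1).2.2 0
  simp only [modified_one, (Ymat_apply _ _).2.2.2] at hT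
  simp only [hz, zero_mul] at hT
  exact zero_ne_one (tendsto_nhds_unique tendsto_const_nhds hT)

omit h in
theorem differentiableOn_theta (x t : ℝ) : DifferentiableOn ℂ (theta q0 x t) {0}ᶜ := by
  have hne : ∀ z ∈ ({0}ᶜ : Set ℂ), z ≠ 0 := fun z hz => hz
  unfold theta lam kz
  fun_prop (disch := assumption)

theorem differentiableOn_minus (x t : ℝ) (i : Fin 2) :
    DifferentiableOn ℂ (fun z => ψm x t z i 0) (Dplus q0) := by
  have h1 := ((h.sided_minus x t).reg₁ i).diff
  have h2 : DifferentiableOn ℂ (theta q0 x t) (Dplus q0) :=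
    (differentiableOn_theta x t).mono fun z hz => ne_zero_of_mem_Dplus hz
  refine (h1.mul ((h2.const_mul I).neg.cexp)).congr fun z hz => ?_
  simp only [Pi.mul_apply, modified_zero]
  rw [mul_assoc, Pi.neg_apply, ← exp_add, add_neg_cancel, exp_zero, mul_one]

theorem differentiableOn_plus (x t : ℝ) (i : Fin 2) :
    DifferentiableOn ℂ (fun z => ψp x t z i 1) (Dplus q0) := by
  have h1 := ((h.sided_plus x t).reg₂ i).diff
  have h2 : DifferentiableOn ℂ (theta q0 x t) (Dplus q0) :=
    (differentiableOn_theta x t).mono fun z hz => ne_zero_of_mem_Dplus hz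
  refine (h1.mul ((h2.const_mul I).cexp)).congr fun z hz => ?_
  simp only [Pi.mul_apply, modified_one]
  rw [mul_assoc, ← exp_add, neg_add_cancel, exp_zero, mul_one]

end JostPair

/-- If `wr a p = 0` and `a ≠ 0` then `p` is a multiple of `a`. -/
theorem exists_smul_of_wr {a p : Fin 2 → ℂ} (ha : ∃ i, a i ≠ 0) (hw : a 0 * p 1 - a 1 * p 0 = 0) :
    ∃ b, ∀ i, p i = b * a i := by
  obtain ⟨i, hi⟩ := ha
  refine ⟨p i / a i, fun j => ?_⟩
  rw [div_mul_eq_mul_div, eq_div_iff hi]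
  fin_cases i <;> fin_cases j <;> simp only [Fin.zero_eta, Fin.mk_one]
  · linear_combination hw
  · linear_combination -hw

namespace JostPair

variable {q0 : ℝ} {q : ℝ → ℝ → ℂ} {qm qp : ℂ} {ψm ψp : ℝ → ℝ → ℂ → Matrix (Fin 2) (Fin 2) ℂ}
  (h : JostPair q0 q qm qp ψm ψp) {w : ℂ}
include h

/-- At a double zero of s₂₂ the Wronskian of ψ₋₁ and ψ₊₂ vanishes to second order in z. Its value
gives b, its derivative gives d, first at (0,0) only. -/
theorem exists_norming (hw : w ∈ Dplus q0) (h0 : s22 q0 ψm ψp w = 0)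
    (h1 : deriv (s22 q0 ψm ψp) w = 0) : ∃ b d, IsNorming ψm ψp w b d := by
  have hn := (isOpen_Dplus q0).mem_nhds hw
  have hw0 := ne_zero_of_mem_Dplus hw
  have dm : ∀ x t i, HasDerivAt (fun z => ψm x t z i 0) (deriv (fun z => ψm x t z i 0) w) w :=
    fun x t i => ((h.differentiableOn_minus x t i).differentiableAt hn).hasDerivAt
  have dp : ∀ x t i, HasDerivAt (fun z => ψp x t z i 1) (deriv (fun z => ψp x t z i 1) w) w :=
    fun x t i => ((h.differentiableOn_plus x t i).differentiableAt hn).hasDerivAt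
  have hs : HasDerivAt (s22 q0 ψm ψp) 0 w := by
    rw [← h1]; exact (h.differentiableOn_s22.differentiableAt hn).hasDerivAt
  have hW : (fun z => ψm 0 0 z 0 0 * ψp 0 0 z 1 1 - ψm 0 0 z 1 0 * ψp 0 0 z 0 1) =ᶠ[𝓝 w]
      fun z => s22 q0 ψm ψp z * gam q0 z := by
    filter_upwards [hn] with z hz
    rw [s22, div_mul_cancel₀ _ (gam_ne_zero_DS (Or.inl hz)), wr]
  have hgam : DifferentiableAt ℂ (gam q0) w := by
    unfold gam
    have := pow_ne_zero 2 hw0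
    fun_prop (disch := assumption)
  have W0 := hW.self_of_nhds
  simp only at W0
  rw [h0, zero_mul] at W0
  have W1 := (((dm 0 0 0).mul (dp 0 0 1)).sub ((dm 0 0 1).mul (dp 0 0 0))).unique
    ((hs.mul hgam.hasDerivAt).congr_of_eventuallyEq hW)
  rw [h0, zero_mul, zero_mul, add_zero] at W1
  obtain ⟨b, hb⟩ := exists_smul_of_wr (a := fun i => ψm 0 0 w i 0) (p := fun i => ψp 0 0 w i 1)
    (h.minus_ne_zero hw) W0
  obtain ⟨d, hd⟩ := exists_smul_of_wr (a := fun i => ψm 0 0 w i 0)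
    (p := fun i => deriv (fun z => ψp 0 0 z i 1) w - b * deriv (fun z => ψm 0 0 z i 0) w)
    (h.minus_ne_zero hw) (by
      have b0 := hb 0
      have b1 := hb 1
      rw [b0, b1] at W1
      linear_combination W1)
  refine ⟨b, d, ?_⟩
  -- Both norming relations together say that e = o(z - w). For fixed z this combination solves the
  -- Lax pair, so the estimate can be propagated without differentiating the equations in z.
  set e : ℝ → ℝ → ℂ → Fin 2 → ℂ := fun x t z i =>
    ψp x t z i 1 - (b + d * (z - w)) * ψm x t z i 0 with he
  have hde : ∀ x t i, HasDerivAt (fun z => e x t z i) (deriv (fun z => ψp x t z i 1) w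
      - (d * ψm x t w i 0 + b * deriv (fun z => ψm x t z i 0) w)) w := by
    intro x t i
    have hl : HasDerivAt (fun z : ℂ => b + d * (z - w)) d w := by
      simpa using (((hasDerivAt_id w).sub_const w).const_mul d).const_add b
    refine ((dp x t i).sub (hl.mul (dm x t i))).congr_deriv ?_
    simp
  have hstart : ∀ i, (fun z => e 0 0 z i) =o[𝓝 w] (fun z => z - w) := by
    intro i
    have e0 : e 0 0 w i = 0 := by
      have := hb i
      simp [he, this]
    have e1 := hde 0 0 i
    have hdi := hd i
    rw [show deriv (fun z => ψp 0 0 z i 1) w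
      - (d * ψm 0 0 w i 0 + b * deriv (fun z => ψm 0 0 z i 0) w) = 0 by linear_combination hdi,
      hasDerivAt_iff_isLittleO] at e1
    simpa [e0] using e1
  have hx : ∀ x i, (fun z => e x 0 z i) =o[𝓝 w] (fun z => z - w) := by
    intro x i
    refine h.isLittleO_propagate_x (e := fun z x => e x 0 z) hw0 0 ?_ hstart x i
    filter_upwards [hn] with z hz s i
    have h1 := (h.plus 1 z (Or.inl hz) i).1 s 0
    have h2 := (h.minus 0 z (Or.inl hz) i).1 s 0
    refine (h1.sub (h2.const_mul (b + d * (z - w)))).congr_deriv ?_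
    simp only [Matrix.mul_apply, Fin.sum_univ_two, he]
    ring
  have ht : ∀ x t i, (fun z => e x t z i) =o[𝓝 w] (fun z => z - w) := by
    intro x t i
    refine h.isLittleO_propagate_t (e := fun z t => e x t z) hw0 x ?_ (hx x) t i
    filter_upwards [hn] with z hz s i
    have h1 := (h.plus 1 z (Or.inl hz) i).2.1 x s
    have h2 := (h.minus 0 z (Or.inl hz) i).2.1 x s
    refine (h1.sub (h2.const_mul (b + d * (z - w)))).congr_deriv ?_
    simp only [Matrix.mul_apply, Fin.sum_univ_two, he]
    ring
  intro x t i
  have e0 : e x t w i = 0 := by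
    have := ((ht x t i).def one_pos).self_of_nhds
    simpa using this
  have e1 : HasDerivAt (fun z => e x t z i) 0 w := by
    rw [hasDerivAt_iff_isLittleO]
    simpa [e0] using ht x t i
  have e2 := (hde x t i).unique e1
  constructor
  · simp only [he, sub_self, mul_zero, add_zero] at e0
    linear_combination e0
  · linear_combination e2

theorem norming_unique (hw : w ∈ Dplus q0) {b d b' d' : ℂ} (h1 : IsNorming ψm ψp w b d)
    (h2 : IsNorming ψm ψp w b' d') : b = b' ∧ d = d' := by
  obtain ⟨i, hi⟩ := h.minus_ne_zero hw
  have a1 := h1 0 0 i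
  have a2 := h2 0 0 i
  have hb : b = b' := mul_right_cancel₀ hi (a1.1.symm.trans a2.1)
  subst hb
  exact ⟨rfl, mul_right_cancel₀ hi (add_right_cancel (a1.2.symm.trans a2.2))⟩

theorem norming_ne_zero (hw : w ∈ Dplus q0) {b d : ℂ} (h1 : IsNorming ψm ψp w b d) : b ≠ 0 := by
  rintro rfl
  obtain ⟨i, hi⟩ := h.plus_ne_zero hw
  exact hi (by rw [(h1 0 0 i).1, zero_mul])

end JostPair

/-! ## Discrete spectrum -/

theorem iteratedDeriv_two_eq (f : ℂ → ℂ) (z : ℂ) : iteratedDeriv 2 f z = deriv (deriv f) z := by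
  rw [iteratedDeriv_succ, iteratedDeriv_one]

theorem iteratedDeriv_three_eq (f : ℂ → ℂ) (z : ℂ) :
    iteratedDeriv 3 f z = deriv (deriv (deriv f)) z := by
  rw [iteratedDeriv_succ, iteratedDeriv_succ, iteratedDeriv_one]

theorem hasDerivAt_hat {q0 : ℝ} {z : ℂ} (hz : z ≠ 0) :
    HasDerivAt (hat q0) ((q0 : ℂ) ^ 2 / z ^ 2) z := by
  have := (hasDerivAt_inv hz).const_mul (-(q0 : ℂ) ^ 2)
  have e : hat q0 = fun z => -(q0 : ℂ) ^ 2 * z⁻¹ := by funext z; rw [hat, div_eq_mul_inv]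
  rw [e]
  refine this.congr_deriv ?_
  field_simp

theorem xiHat_inl {q0 : ℝ} {N : ℕ} (z : Fin N → ℂ) (n : Fin N) :
    xiHat q0 z (Sum.inl n) = hat q0 (z n) := rfl

theorem xiHat_inr {q0 : ℝ} (hq : 0 < q0) {N : ℕ} (z : Fin N → ℂ) (n : Fin N) :
    xiHat q0 z (Sum.inr n) = conj (z n) :=
  hat_hat hq (z := conj (z n))

theorem xiHat_eq_hat {q0 : ℝ} {N : ℕ} (z : Fin N → ℂ) (n : Idx N) :
    xiHat q0 z n = hat q0 (xi q0 z n) := rfl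

theorem notMem_Sigma0_of_Dplus {q0 : ℝ} {z : ℂ} (hz : z ∈ Dplus q0) : z ∉ Dminus q0 ∪ Sigma0 q0 := by
  have h1 : 0 < (‖z‖ ^ 2 - q0 ^ 2) * z.im := hz
  rintro (h | h)
  · exact lt_asymm h1 h
  · rcases h.1 with h | h <;> simp [h] at h1

namespace JostPair

variable {q0 : ℝ} {q : ℝ → ℝ → ℂ} {qm qp : ℂ} {ψm ψp : ℝ → ℝ → ℂ → Matrix (Fin 2) (Fin 2) ℂ}
  (h : JostPair q0 q qm qp ψm ψp) {N : ℕ} {z : Fin N → ℂ}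
include h

theorem s11_eq_conj {w : ℂ} (hw : w ∈ Dminus q0 ∪ Sigma0 q0) :
    s11 q0 ψm ψp w = conj (s22 q0 ψm ψp (conj w)) := by
  rw [h.s22_eq_conj (conj_mem_DS.2 hw), conj_conj, conj_conj]

theorem differentiableOn_s11 : DifferentiableOn ℂ (s11 q0 ψm ψp) (Dminus q0) :=
  (differentiableOn_conj_conj (isOpen_Dplus q0) h.differentiableOn_s22
    fun _ hz => conj_mem_Dplus.2 hz).congr fun _ hz => h.s11_eq_conj (Or.inl hz)

omit h in
theorem zero_mem (hz : HasDoubleZeros q0 ψm ψp z) (n : Fin N) :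
    z n ∈ Dminus q0 ∧ (z n).im < 0 ∧ s11 q0 ψm ψp (z n) = 0 := (hz.2.1 (z n)).2 ⟨n, rfl⟩

theorem xiHat_mem (hz : HasDoubleZeros q0 ψm ψp z) (n : Idx N) : xiHat q0 z n ∈ Dplus q0 := by
  rcases n with n | n
  · exact (hat_mem_Dplus h.pos).2 (zero_mem hz n).1
  · rw [xiHat_inr h.pos]
    exact conj_mem_Dplus.2 (zero_mem hz n).1

theorem xi_mem (hz : HasDoubleZeros q0 ψm ψp z) (n : Idx N) : xi q0 z n ∈ Dminus q0 := by
  have := h.xiHat_mem hz n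
  rwa [xiHat_eq_hat, hat_mem_Dplus h.pos] at this

/-- The two families of points are separated by the sign of the imaginary part: negative for the
reflections of z_n, positive for the conjugates. -/
theorem xiHat_injective (hz : HasDoubleZeros q0 ψm ψp z) : Function.Injective (xiHat q0 z) := by
  have him : ∀ n, (hat q0 (z n)).im < 0 := fun n => by
    have h0 := norm_pos_iff.2 (ne_zero_of_mem_Dminus (zero_mem hz n).1)
    have hq := h.pos
    rw [hat_im]
    exact div_neg_of_neg_of_pos (mul_neg_of_pos_of_neg (by positivity) (zero_mem hz n).2.1)
      (by positivity)
  have him' : ∀ n, 0 < (conj (z n)).im := fun n => by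
    rw [conj_im]; linarith [(zero_mem hz n).2.1]
  rintro (n | n) (m | m) hnm
  · rw [xiHat_inl, xiHat_inl] at hnm
    have := congrArg (hat q0) hnm
    rw [hat_hat h.pos, hat_hat h.pos] at this
    rw [hz.1 this]
  · rw [xiHat_inl, xiHat_inr h.pos] at hnm
    have h1 := him n
    have h2 := him' m
    rw [hnm] at h1
    linarith
  · rw [xiHat_inl, xiHat_inr h.pos] at hnm
    have h1 := him m
    have h2 := him' n
    rw [← hnm] at h1
    linarith
  · rw [xiHat_inr h.pos, xiHat_inr h.pos] at hnm
    rw [hz.1 ((starRingEnd ℂ).injective hnm)]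

/-- The zeros of `s₂₂` in `D⁺` are the points `ξ̂`. -/
theorem s22_eq_zero_iff (hz : HasDoubleZeros q0 ψm ψp z) {w : ℂ} (hw : w ∈ Dplus q0) :
    s22 q0 ψm ψp w = 0 ↔ w ∈ Set.range (xiHat q0 z) := by
  have hq := h.pos
  constructor
  · intro h0
    have hw' : 0 < (‖w‖ ^ 2 - q0 ^ 2) * w.im := hw
    -- Below the real axis the involution, above it the conjugation, takes w to a point of D⁻ in the
    -- lower half plane, where the zeros of s₁₁ are listed.
    rcases lt_or_ge w.im 0 with him | him
    · have h1 := h.s22_eq_hat (Or.inl hw)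
      rw [h0] at h1
      have h2 : s11 q0 ψm ψp (hat q0 w) = 0 :=
        (mul_eq_zero.1 h1.symm).resolve_left (div_ne_zero h.qp_ne_zero h.qm_ne_zero)
      have hn := norm_pos_iff.2 (ne_zero_of_mem_Dplus hw)
      obtain ⟨n, hn⟩ := (hz.2.1 (hat q0 w)).1 ⟨(hat_mem_Dminus hq).2 hw, by
        rw [hat_im]
        exact div_neg_of_neg_of_pos (mul_neg_of_pos_of_neg (by positivity) him) (by positivity), h2⟩
      exact ⟨Sum.inl n, by rw [xiHat_inl, ← hn, hat_hat hq]⟩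
    · have him : 0 < w.im := him.lt_of_ne fun h => by rw [← h] at hw'; simp at hw'
      have h1 := h.s22_eq_conj (Or.inl hw)
      rw [h0, eq_comm, map_eq_zero] at h1
      obtain ⟨n, hn⟩ := (hz.2.1 (conj w)).1 ⟨conj_mem_Dminus.2 hw, by rw [conj_im]; linarith, h1⟩
      exact ⟨Sum.inr n, by rw [xiHat_inr hq, ← hn, conj_conj]⟩
  · rintro ⟨n, rfl⟩
    rcases n with n | n
    · rw [h.s22_eq_hat (Or.inl hw), xiHat_inl, hat_hat hq, (zero_mem hz n).2.2, mul_zero]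
    · rw [h.s22_eq_conj (Or.inl hw), xiHat_inr hq, conj_conj, (zero_mem hz n).2.2, map_zero]

/-- The zeros of `s₂₂` are double. -/
theorem s22_double (hz : HasDoubleZeros q0 ψm ψp z) (n : Idx N) :
    deriv (s22 q0 ψm ψp) (xiHat q0 z n) = 0 ∧
    iteratedDeriv 2 (s22 q0 ψm ψp) (xiHat q0 z n) ≠ 0 := by
  have hq := h.pos
  have d11 := h.differentiableOn_s11
  have d11' : DifferentiableOn ℂ (deriv (s11 q0 ψm ψp)) (Dminus q0) := d11.deriv (isOpen_Dminus q0)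
  have hmem := h.xiHat_mem hz n
  have hnhds := (isOpen_Dplus q0).mem_nhds hmem
  rw [iteratedDeriv_two_eq]
  rcases n with n | n
  · obtain ⟨hd1, hd2⟩ := hz.2.2 n
    rw [iteratedDeriv_two_eq] at hd2
    set w := xiHat q0 z (Sum.inl n) with hw
    have hhat : hat q0 w = z n := by rw [hw, xiHat_inl, hat_hat hq]
    have e1 : ∀ y ∈ Dplus q0, deriv (s22 q0 ψm ψp) y =
        qp / qm * (deriv (s11 q0 ψm ψp) (hat q0 y) * ((q0 : ℂ) ^ 2 / y ^ 2)) := by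
      intro y hy
      have hy' := (hat_mem_Dminus hq).2 hy
      have h1 := (d11.differentiableAt ((isOpen_Dminus q0).mem_nhds hy')).hasDerivAt
      have h2 := (h1.comp y (hasDerivAt_hat (ne_zero_of_mem_Dplus hy))).const_mul (qp / qm)
      refine (h2.congr_of_eventuallyEq ?_).deriv
      filter_upwards [(isOpen_Dplus q0).mem_nhds hy] with u hu
      exact h.s22_eq_hat (Or.inl hu)
    refine ⟨by rw [e1 w hmem, hhat, hd1]; simp, ?_⟩
    have hw0 := ne_zero_of_mem_Dplus hmem
    have hy' := (hat_mem_Dminus hq).2 hmem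
    have h1 := (d11'.differentiableAt ((isOpen_Dminus q0).mem_nhds hy')).hasDerivAt
    have hr : DifferentiableAt ℂ (fun y : ℂ => (q0 : ℂ) ^ 2 / y ^ 2) w := by
      have := pow_ne_zero 2 hw0
      fun_prop (disch := assumption)
    have h2 := ((h1.comp w (hasDerivAt_hat hw0)).mul hr.hasDerivAt).const_mul (qp / qm)
    have h3 : deriv (deriv (s22 q0 ψm ψp)) w = _ := (h2.congr_of_eventuallyEq (by
      filter_upwards [hnhds] with u hu
      exact e1 u hu)).deriv
    rw [h3]
    -- As the first derivative of s₁₁ vanishes at z_n, the chain rule leaves only the term with the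
    -- second derivative.
    simp only [Function.comp_apply, hhat, hd1, zero_mul, add_zero]
    have hq' := h.q0_ne_zero
    exact mul_ne_zero (div_ne_zero h.qp_ne_zero h.qm_ne_zero) (mul_ne_zero (mul_ne_zero hd2
      (div_ne_zero (pow_ne_zero _ hq') (pow_ne_zero _ hw0)))
      (div_ne_zero (pow_ne_zero _ hq') (pow_ne_zero _ hw0)))
  · obtain ⟨hd1, hd2⟩ := hz.2.2 n
    rw [iteratedDeriv_two_eq] at hd2
    set w := xiHat q0 z (Sum.inr n) with hw
    have hhat : conj w = z n := by rw [hw, xiHat_inr hq, conj_conj]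
    have e1 : ∀ y ∈ Dplus q0, deriv (s22 q0 ψm ψp) y = conj (deriv (s11 q0 ψm ψp) (conj y)) := by
      intro y hy
      have h1 : deriv (s22 q0 ψm ψp) y = deriv (conj ∘ s11 q0 ψm ψp ∘ conj) y :=
        EventuallyEq.deriv_eq ?_
      · rw [h1, deriv_conj_conj, Function.comp_apply, Function.comp_apply]
      filter_upwards [(isOpen_Dplus q0).mem_nhds hy] with u hu
      exact h.s22_eq_conj (Or.inl hu)
    refine ⟨by rw [e1 w hmem, hhat, hd1, map_zero], ?_⟩
    have h3 : deriv (deriv (s22 q0 ψm ψp)) w =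
        deriv (conj ∘ deriv (s11 q0 ψm ψp) ∘ conj) w := EventuallyEq.deriv_eq (by
      filter_upwards [hnhds] with u hu
      exact e1 u hu)
    rw [h3, deriv_conj_conj, Function.comp_apply, Function.comp_apply, hhat]
    exact (map_ne_zero _).2 hd2

end JostPair

/-! ## Double poles -/

/-- The singular part `V / (z - w)^2 + W / (z - w)`. -/
def doublePole (V W w z : ℂ) : ℂ := V / (z - w) ^ 2 + W / (z - w)

/-- Taylor coefficients of s at a double zero. They account for the factors 2/s'' and s'''/(3s'') in
the principal part of a quotient by s. -/
theorem deriv_sq_mul {S s : ℂ → ℂ} {w : ℂ} (hS : AnalyticAt ℂ S w)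
    (hs : s =ᶠ[𝓝 w] fun z => (z - w) ^ 2 * S z) :
    iteratedDeriv 2 s w = 2 * S w ∧ iteratedDeriv 3 s w = 6 * deriv S w := by
  have a1 : ∀ᶠ z in 𝓝 w, DifferentiableAt ℂ S z :=
    hS.eventually_analyticAt.mono fun z h => h.differentiableAt
  have a2 : ∀ᶠ z in 𝓝 w, DifferentiableAt ℂ (deriv S) z :=
    hS.eventually_analyticAt.mono fun z h => h.deriv.differentiableAt
  have a3 : DifferentiableAt ℂ (deriv (deriv S)) w := hS.deriv.deriv.differentiableAt
  have hsub : ∀ z, HasDerivAt (fun z : ℂ => z - w) 1 z := fun z => (hasDerivAt_id z).sub_const w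
  have hsq : ∀ z, HasDerivAt (fun z : ℂ => (z - w) ^ 2) (2 * (z - w)) z := fun z => by
    refine ((hsub z).fun_pow 2).congr_deriv ?_
    simp
  have d1 : deriv s =ᶠ[𝓝 w] fun z => 2 * (z - w) * S z + (z - w) ^ 2 * deriv S z := by
    filter_upwards [hs.eventuallyEq_nhds, a1] with z h1 h2
    rw [h1.deriv_eq]
    exact ((hsq z).mul h2.hasDerivAt).deriv
  have d2 : deriv (deriv s) =ᶠ[𝓝 w] fun z =>
      2 * S z + 4 * (z - w) * deriv S z + (z - w) ^ 2 * deriv (deriv S) z := by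
    filter_upwards [d1.eventuallyEq_nhds, a1, a2] with z h1 h2 h3
    rw [h1.deriv_eq]
    refine (((((hsub z).const_mul 2).mul h2.hasDerivAt).add
      ((hsq z).mul h3.hasDerivAt)).congr_deriv ?_).deriv
    ring
  rw [iteratedDeriv_two_eq, iteratedDeriv_three_eq]
  refine ⟨by rw [d2.self_of_nhds]; simp, ?_⟩
  rw [d2.deriv_eq]
  refine ((((a1.self_of_nhds.hasDerivAt.const_mul 2).add (((hsub w).const_mul 4).mul
    a2.self_of_nhds.hasDerivAt)).add ((hsq w).mul a3.hasDerivAt)).congr_deriv ?_).deriv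
  simp
  ring

theorem analyticAt_dslope {f : ℂ → ℂ} {w : ℂ} (hf : AnalyticAt ℂ f w) :
    AnalyticAt ℂ (dslope f w) w := by
  obtain ⟨U, hU, hd⟩ := hf.exists_mem_nhds_analyticOnNhd
  exact ((Complex.differentiableOn_dslope hU).2 hd.differentiableOn).analyticAt hU

/-- Principal part at a double zero of the denominator. -/
theorem exists_principal_part {f s : ℂ → ℂ} {w : ℂ} (hf : AnalyticAt ℂ f w) (hs : AnalyticAt ℂ s w)
    (h0 : s w = 0) (h1 : deriv s w = 0) (h2 : iteratedDeriv 2 s w ≠ 0) :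
    ∃ G, AnalyticAt ℂ G w ∧ ∀ᶠ z in 𝓝[≠] w, f z / s z = G z +
      2 / iteratedDeriv 2 s w * doublePole (f w)
        (deriv f w - iteratedDeriv 3 s w / (3 * iteratedDeriv 2 s w) * f w) w z := by
  -- Second order expansion with an exact remainder; no regularity of F is involved in the identity
  -- itself.
  have key : ∀ (F : ℂ → ℂ) z, F z = F w + (z - w) * deriv F w
      + (z - w) ^ 2 * dslope (dslope F w) w z := by
    intro F z
    by_cases hz : z = w
    · subst hz; simp
    · have e1 := sub_smul_dslope F w z
      have e2 := sub_smul_dslope (dslope F w) w z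
      rw [smul_eq_mul] at e1 e2
      rw [dslope_same] at e2
      linear_combination -e1 - (z - w) * e2
  set S := dslope (dslope s w) w with hS
  have hSa : AnalyticAt ℂ S w := analyticAt_dslope (analyticAt_dslope hs)
  have hsS : ∀ z, s z = (z - w) ^ 2 * S z := fun z => by
    rw [key s z, h0, h1]; ring
  obtain ⟨i2, i3⟩ := deriv_sq_mul hSa (Eventually.of_forall hsS)
  rw [i2] at h2
  have hSw : S w ≠ 0 := fun h => h2 (by rw [h, mul_zero])
  set F : ℂ → ℂ := fun z => f z / S z with hF
  have hFa : AnalyticAt ℂ F w := hf.div hSa hSw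
  have hF1 : deriv F w = (deriv f w * S w - f w * deriv S w) / S w ^ 2 :=
    (hf.differentiableAt.hasDerivAt.div hSa.differentiableAt.hasDerivAt hSw).deriv
  refine ⟨dslope (dslope F w) w, analyticAt_dslope (analyticAt_dslope hFa), ?_⟩
  filter_upwards [self_mem_nhdsWithin] with z hz
  have hzw : z - w ≠ 0 := sub_ne_zero.2 hz
  have e : f z / s z = F z / (z - w) ^ 2 := by
    rw [hF, hsS z]; field_simp
  rw [e, key F z, hF1, i2, i3, doublePole]
  simp only [hF]
  generalize dslope (dslope (fun z => f z / S z) w) w z = G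
  field_simp
  ring

/-- `F` is holomorphic in `D` outside of `E`, continuous at the contour and bounded near the branch
points. -/
structure HalfRegularOff (q0 : ℝ) (D E : Set ℂ) (F : ℂ → ℂ) : Prop where
  diff : ∀ z ∈ D, z ∉ E → DifferentiableAt ℂ F z
  cont : ∀ z ∈ Sigma0 q0, ContinuousWithinAt F (D ∪ Sigma0 q0) z
  bdd : ∃ C, ∃ ε > 0, ∀ z ∈ D ∪ Sigma0 q0, z ∉ E →
    (‖z - I * q0‖ < ε ∨ ‖z + I * q0‖ < ε) → ‖F z‖ ≤ C

section

variable {q0 : ℝ} {D E : Set ℂ} {f g : ℂ → ℂ}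

theorem HalfRegular.off (hf : HalfRegular q0 D f) (hD : IsOpen D) : HalfRegularOff q0 D E f := by
  refine ⟨fun z hz _ => hf.diff.differentiableAt (hD.mem_nhds hz),
    fun z hz => hf.cont z (Or.inr hz), ?_⟩
  obtain ⟨C, ε, hε, hC⟩ := hf.bdd
  exact ⟨C, ε, hε, fun z hz _ => hC z hz⟩

theorem HalfRegularOff.sub (hf : HalfRegularOff q0 D E f) (hg : HalfRegularOff q0 D E g) :
    HalfRegularOff q0 D E fun z => f z - g z := by
  refine ⟨fun z hz hE => (hf.diff z hz hE).sub (hg.diff z hz hE),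
    fun z hz => (hf.cont z hz).sub (hg.cont z hz), ?_⟩
  obtain ⟨C, ε, hε, hC⟩ := hf.bdd
  obtain ⟨C', ε', hε', hC'⟩ := hg.bdd
  exact ⟨C + C', min ε ε', lt_min hε hε', fun z hz hE h => (norm_sub_le _ _).trans (add_le_add
    (hC z hz hE (h.imp (fun h => h.trans_le (min_le_left _ _))
      fun h => h.trans_le (min_le_left _ _)))
    (hC' z hz hE (h.imp (fun h => h.trans_le (min_le_right _ _))
      fun h => h.trans_le (min_le_right _ _))))⟩

theorem HalfRegularOff.mul (hf : HalfRegularOff q0 D E f) (hg : HalfRegularOff q0 D E g) :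
    HalfRegularOff q0 D E fun z => f z * g z := by
  refine ⟨fun z hz hE => (hf.diff z hz hE).mul (hg.diff z hz hE),
    fun z hz => (hf.cont z hz).mul (hg.cont z hz), ?_⟩
  obtain ⟨C, ε, hε, hC⟩ := hf.bdd
  obtain ⟨C', ε', hε', hC'⟩ := hg.bdd
  refine ⟨|C| * |C'|, min ε ε', lt_min hε hε', fun z hz hE h => ?_⟩
  rw [norm_mul]
  exact mul_le_mul ((hC z hz hE (h.imp (fun h => h.trans_le (min_le_left _ _))
      fun h => h.trans_le (min_le_left _ _))).trans (le_abs_self _))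
    ((hC' z hz hE (h.imp (fun h => h.trans_le (min_le_right _ _))
      fun h => h.trans_le (min_le_right _ _))).trans (le_abs_self _)) (norm_nonneg _) (abs_nonneg _)

/-- A function that is differentiable at all points but some in `E`. -/
theorem halfRegularOff_of_differentiableAt (hd : ∀ z ∈ D, z ∉ E → DifferentiableAt ℂ f z)
    (hs : ∀ z ∈ Sigma0 q0, DifferentiableAt ℂ f z) (hb : DifferentiableAt ℂ f (I * q0))
    (hb' : DifferentiableAt ℂ f (-(I * q0))) : HalfRegularOff q0 D E f := by
  refine ⟨hd, fun z hz => (hs z hz).continuousAt.continuousWithinAt, ?_⟩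
  have key : ∀ b : ℂ, DifferentiableAt ℂ f b → ∃ ε > 0, ∀ z, ‖z - b‖ < ε → ‖f z‖ ≤ ‖f b‖ + 1 := by
    intro b hb
    have := hb.continuousAt.norm.eventually (gt_mem_nhds (lt_add_one _))
    obtain ⟨ε, hε, h⟩ := Metric.mem_nhds_iff.1 this
    exact ⟨ε, hε, fun z hz => (h (by simpa [dist_eq_norm] using hz) : ‖f z‖ < _).le⟩
  obtain ⟨ε, hε, h1⟩ := key _ hb
  obtain ⟨ε', hε', h2⟩ := key _ hb'
  refine ⟨max (‖f (I * q0)‖ + 1) (‖f (-(I * q0))‖ + 1), min ε ε', lt_min hε hε',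
    fun z _ _ h => ?_⟩
  rcases h with h | h
  · exact (h1 z (h.trans_le (min_le_left _ _))).trans (le_max_left _ _)
  · exact (h2 z (by rw [sub_neg_eq_add]; exact h.trans_le (min_le_right _ _))).trans
      (le_max_right _ _)

end

/-- Riemann's theorem on removable singularities at finitely many points. -/
theorem HalfRegular.of_removable {q0 : ℝ} {D : Set ℂ} {ι : Type*} [Finite ι] {p : ι → ℂ}
    {F : ℂ → ℂ} (hp : ∀ n, p n ∈ D) (hDS : ∀ z ∈ D, z ∉ Sigma0 q0)
    (hb : I * (q0 : ℂ) ∉ D) (hb' : -(I * (q0 : ℂ)) ∉ D)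
    (hF : HalfRegularOff q0 D (Set.range p) F)
    (hr : ∀ n, ∃ G, DifferentiableAt ℂ G (p n) ∧ F =ᶠ[𝓝[≠] (p n)] G) :
    ∃ g, HalfRegular q0 D g ∧ ∀ z, z ∉ Set.range p → g z = F z := by
  classical
  -- At the exceptional points F has an arbitrary value, which is replaced by the limit along the
  -- punctured neighbourhood.
  set g : ℂ → ℂ := fun z => if z ∈ Set.range p then limUnder (𝓝[≠] z) F else F z with hg
  have hgF : ∀ z, z ∉ Set.range p → g z = F z := fun z hz => if_neg hz
  have hclosed : ∀ s : Set ℂ, s ⊆ Set.range p → IsClosed s := fun s hs =>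
    ((Set.finite_range p).subset hs).isClosed
  have hev : ∀ z, z ∉ Set.range p → g =ᶠ[𝓝 z] F := fun z hz => by
    filter_upwards [(hclosed _ le_rfl).isOpen_compl.mem_nhds hz] with u hu using hgF u hu
  have hdiff : ∀ z ∈ D, DifferentiableAt ℂ g z := by
    intro z hz
    by_cases hzp : z ∈ Set.range p
    · obtain ⟨n, rfl⟩ := hzp
      obtain ⟨G, hGd, hFG⟩ := hr n
      have hgw : g (p n) = G (p n) := by
        simp only [hg, if_pos (Set.mem_range_self n)]
        exact ((hGd.continuousAt.tendsto.mono_left nhdsWithin_le_nhds).congr' hFG.symm).limUnder_eq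
      refine hGd.congr_of_eventuallyEq ?_
      have h1 : ∀ᶠ u in 𝓝 (p n), u ≠ p n → F u = G u := eventually_nhdsWithin_iff.1 hFG
      have h2 : ∀ᶠ u in 𝓝 (p n), u ∉ Set.range p \ {p n} :=
        (hclosed _ Set.sdiff_subset).isOpen_compl.mem_nhds (by simp)
      filter_upwards [h1, h2] with u h1 h2
      by_cases hu : u = p n
      · rw [hu, hgw]
      · rw [hgF u fun h => h2 ⟨h, hu⟩, h1 hu]
    · exact (hF.diff z hz hzp).congr_of_eventuallyEq (hev z hzp)
  refine ⟨g, ⟨fun z hz => (hdiff z hz).differentiableWithinAt, ?_, ?_⟩, hgF⟩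
  · rintro z (hz | hz)
    · exact (hdiff z hz).continuousAt.continuousWithinAt
    · have hzp : z ∉ Set.range p := by rintro ⟨n, rfl⟩; exact hDS _ (hp n) hz
      exact (hF.cont z hz).congr_of_eventuallyEq ((hev z hzp).filter_mono nhdsWithin_le_nhds) (hgF z hzp)
  · obtain ⟨C, ε, hε, hC⟩ := hF.bdd
    have n1 : ∀ b : ℂ, b ∉ D → ∃ δ > 0, ∀ z, ‖z - b‖ < δ → z ∉ Set.range p := by
      intro b hbD
      have : (Set.range p)ᶜ ∈ 𝓝 b := (hclosed _ le_rfl).isOpen_compl.mem_nhds (by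
        rintro ⟨n, hn⟩; exact hbD (hn ▸ hp n))
      obtain ⟨δ, hδ, hs⟩ := Metric.mem_nhds_iff.1 this
      exact ⟨δ, hδ, fun z hz => hs (by simpa [dist_eq_norm] using hz)⟩
    obtain ⟨δ, hδ, h1⟩ := n1 _ hb
    obtain ⟨δ', hδ', h2⟩ := n1 _ hb'
    refine ⟨C, min ε (min δ δ'), by positivity, fun z hz hzε => ?_⟩
    have hzp : z ∉ Set.range p := by
      rcases hzε with h | h
      · exact h1 z (h.trans_le ((min_le_right _ _).trans (min_le_left _ _)))
      · exact h2 z (by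
          rw [sub_neg_eq_add]; exact h.trans_le ((min_le_right _ _).trans (min_le_right _ _)))
    rw [hgF z hzp]
    exact hC z hz hzp (hzε.imp (fun h => h.trans_le (min_le_left _ _))
      fun h => h.trans_le (min_le_left _ _))

/-! ## Sums of double poles -/

section

variable {V W w : ℂ}

theorem hasDerivAt_doublePole {z : ℂ} (hz : z ≠ w) : HasDerivAt (doublePole V W w)
    (-2 * V / (z - w) ^ 3 - W / (z - w) ^ 2) z := by
  have h0 : z - w ≠ 0 := sub_ne_zero.2 hz
  have h1 : HasDerivAt (fun z : ℂ => z - w) 1 z := (hasDerivAt_id z).sub_const w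
  have h2 := ((hasDerivAt_const z V).div (h1.fun_pow 2) (pow_ne_zero 2 h0)).add
    ((hasDerivAt_const z W).div h1 h0)
  refine h2.congr_deriv ?_
  field_simp
  ring

theorem tendsto_mul_doublePole_cobounded :
    Tendsto (fun z => z * doublePole V W w z) (Bornology.cobounded ℂ) (𝓝 W) := by
  have h1 := (tendsto_div_sub_cobounded w).const_mul V
  have h2 := (h1.mul (tendsto_inv_sub_cobounded w)).add ((tendsto_div_sub_cobounded w).const_mul W)
  rw [mul_zero, zero_add, mul_one] at h2
  refine h2.congr fun z => ?_
  simp only [doublePole, div_eq_mul_inv, ← inv_pow]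
  ring

theorem tendsto_mul_doublePole_zero (hw : w ≠ 0) :
    Tendsto (fun z => z * doublePole V W w z) (𝓝 0) (𝓝 0) := by
  have h1 := (hasDerivAt_doublePole (V := V) (W := W) hw.symm).continuousAt
  have h2 := (continuousAt_id (x := (0 : ℂ))).mul h1
  have h3 : Tendsto (fun z => z * doublePole V W w z) (𝓝 0) (𝓝 (0 * doublePole V W w 0)) := h2
  rwa [zero_mul] at h3

end

section

variable {ι : Type*} [Fintype ι] (V W p : ι → ℂ)

/-- A sum of double poles. -/
def doublePoles (z : ℂ) : ℂ := ∑ n, doublePole (V n) (W n) (p n) z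

variable {V W p}

theorem hasDerivAt_doublePoles {z : ℂ} (hz : z ∉ Set.range p) : HasDerivAt (doublePoles V W p)
    (∑ n, (-2 * V n / (z - p n) ^ 3 - W n / (z - p n) ^ 2)) z := by
  unfold doublePoles
  exact HasDerivAt.fun_sum fun n _ => hasDerivAt_doublePole fun h => hz ⟨n, h.symm⟩

theorem differentiableAt_doublePoles {z : ℂ} (hz : z ∉ Set.range p) :
    DifferentiableAt ℂ (doublePoles V W p) z := (hasDerivAt_doublePoles hz).differentiableAt

theorem tendsto_mul_doublePoles_cobounded :
    Tendsto (fun z => z * doublePoles V W p z) (Bornology.cobounded ℂ) (𝓝 (∑ n, W n)) := by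
  simp only [doublePoles, Finset.mul_sum]
  exact tendsto_finsetSum _ fun n _ => tendsto_mul_doublePole_cobounded

theorem tendsto_mul_doublePoles_zero (hp : ∀ n, p n ≠ 0) :
    Tendsto (fun z => z * doublePoles V W p z) (𝓝 0) (𝓝 0) := by
  simp only [doublePoles, Finset.mul_sum]
  simpa using tendsto_finsetSum Finset.univ fun n _ =>
    tendsto_mul_doublePole_zero (V := V n) (W := W n) (hp n)

/-- Near the point `p n`, only the pole at `p n` is not regular. -/
theorem exists_doublePoles_eq (hp : Function.Injective p) (n : ι) :
    ∃ G, DifferentiableAt ℂ G (p n) ∧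
      ∀ z, doublePoles V W p z = G z + doublePole (V n) (W n) (p n) z := by
  classical
  refine ⟨fun z => ∑ m ∈ Finset.univ.erase n, doublePole (V m) (W m) (p m) z, ?_, fun z => ?_⟩
  · refine DifferentiableAt.fun_sum fun m hm => ?_
    exact (hasDerivAt_doublePole fun h => (Finset.ne_of_mem_erase hm) (hp h).symm).differentiableAt
  · rw [doublePoles, ← Finset.sum_erase_add _ _ (Finset.mem_univ n)]

theorem halfRegular_doublePoles {q0 : ℝ} (hp : ∀ n, p n ∈ Dplus q0) :
    HalfRegular q0 (Dminus q0) (doublePoles V W p) := by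
  have hb := branch_notMem (q0 := q0)
  refine HalfRegular.sum _ fun n _ => ?_
  have n1 : p n ∉ Dminus q0 ∪ Sigma0 q0 := notMem_Sigma0_of_Dplus (hp n)
  have n2 : I * (q0 : ℂ) ≠ p n := fun h => hb.1 (Or.inl (h ▸ hp n))
  have n3 : -(I * (q0 : ℂ)) ≠ p n := fun h => hb.2.1 (Or.inl (h ▸ hp n))
  have h1 := ((HalfRegular.const (q0 := q0) (D := Dminus q0) (-V n)).div_sub n1 n2 n3).div_sub n1 n2 n3
  have h2 := (HalfRegular.const (q0 := q0) (D := Dminus q0) (W n)).div_sub n1 n2 n3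
  refine (h2.sub h1).congr fun z hz => ?_
  have : z - p n ≠ 0 := sub_ne_zero.2 fun h => n1 (h ▸ hz)
  rw [doublePole]
  field_simp
  ring

theorem halfRegularOff_doublePoles {q0 : ℝ} (hp : ∀ n, p n ∈ Dplus q0) :
    HalfRegularOff q0 (Dplus q0) (Set.range p) (doublePoles V W p) := by
  have hb := branch_notMem (q0 := q0)
  refine halfRegularOff_of_differentiableAt (fun z _ hz => differentiableAt_doublePoles hz)
    (fun z hz => differentiableAt_doublePoles ?_) (differentiableAt_doublePoles ?_)
    (differentiableAt_doublePoles ?_)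
  · rintro ⟨n, rfl⟩; exact notMem_Sigma0_of_Dplus (hp n) (Or.inr hz)
  · rintro ⟨n, hn⟩; exact hb.1 (Or.inl (hn ▸ hp n))
  · rintro ⟨n, hn⟩; exact hb.2.1 (Or.inl (hn ▸ hp n))

end

/-! ## The reconstruction formula -/

section Bound

variable {q0 : ℝ}

theorem atInf_mono {D D' : Set ℂ} (h : D ⊆ D') : atInf q0 D ≤ atInf q0 D' :=
  inf_le_inf_left _ (principal_mono.2 (Set.union_subset_union_left _ h))

theorem atZero_mono {D D' : Set ℂ} (h : D ⊆ D') : atZero q0 D ≤ atZero q0 D' :=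
  nhdsWithin_mono _ (Set.union_subset_union_left _ h)

/-- Decay z⁻² at infinity, boundedness at the origin, and compactness in between. With the empty set
in place of D both filters see Σ₀ alone. -/
theorem exists_bound_real {f : ℂ → ℂ} (hq : 0 < q0) (hc : ContinuousOn f (Sigma0 q0))
    (hi : f =O[atInf q0 ∅] fun z => (z ^ 2)⁻¹) (h0 : f =O[atZero q0 ∅] fun _ => (1 : ℂ)) :
    ∃ C, ∀ s : ℝ, s ≠ 0 → ‖f s‖ ≤ C * (1 + s ^ 2)⁻¹ := by
  obtain ⟨C1, h1⟩ := hi.bound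
  obtain ⟨C2, h2⟩ := h0.bound
  rw [atInf, eventually_inf_principal, Set.empty_union] at h1
  obtain ⟨R, -, hR⟩ := (Metric.hasBasis_cobounded_compl_closedBall (0 : ℂ)).eventually_iff.1 h1
  obtain ⟨δ, hδ, hd⟩ := Metric.mem_nhdsWithin_iff.1 h2
  have hcomp : IsCompact ({s : ℝ | δ ≤ |s|} ∩ Set.Icc (-R) R) :=
    isCompact_Icc.inter_left (isClosed_le continuous_const continuous_abs)
  obtain ⟨C3, h3⟩ := hcomp.exists_bound_of_continuousOn (f := fun s : ℝ => f s)
    (hc.comp continuous_ofReal.continuousOn fun s hs => ofReal_mem_Sigma0 hq (by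
      rintro rfl
      have h4 : δ ≤ |(0 : ℝ)| := hs.1
      rw [abs_zero] at h4
      linarith))
  have hnorm : ∀ s : ℝ, ‖(s : ℂ)‖ = |s| := fun s => by rw [Complex.norm_real, Real.norm_eq_abs]
  refine ⟨|C1| * (1 + (δ ^ 2)⁻¹) + |C2| * (1 + δ ^ 2) + |C3| * (1 + R ^ 2), fun s hs => ?_⟩
  have hpos : 0 < 1 + s ^ 2 := by positivity
  have hS := ofReal_mem_Sigma0 hq hs
  rw [← div_eq_mul_inv, le_div_iff₀ hpos]
  have p1 : 0 ≤ |C1| * (1 + (δ ^ 2)⁻¹) := by positivity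
  have p2 : 0 ≤ |C2| * (1 + δ ^ 2) := by positivity
  have p3 : 0 ≤ |C3| * (1 + R ^ 2) := by positivity
  rcases lt_or_ge |s| δ with hsδ | hsδ
  · have := hd (a := (s : ℂ)) ⟨by simpa using hsδ, Or.inr hS⟩
    simp only [Set.mem_ofPred_eq, norm_one, mul_one] at this
    have h5 : ‖f s‖ ≤ |C2| := this.trans (le_abs_self _)
    have h6 : s ^ 2 ≤ δ ^ 2 := by rw [← sq_abs s]; gcongr
    have := mul_le_mul h5 (add_le_add_right h6 1) hpos.le (abs_nonneg C2)
    linarith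
  rcases lt_or_ge R |s| with hsR | hsR
  · have := hR (x := (s : ℂ)) (by simpa using hsR) hS
    rw [norm_inv, norm_pow, hnorm, sq_abs] at this
    have h5 : ‖f s‖ ≤ |C1| * (s ^ 2)⁻¹ :=
      this.trans (mul_le_mul_of_nonneg_right (le_abs_self _) (by positivity))
    have h6 : δ ^ 2 ≤ s ^ 2 := by rw [← sq_abs s]; gcongr
    have h7 : (s ^ 2)⁻¹ ≤ (δ ^ 2)⁻¹ := inv_anti₀ (by positivity) h6
    have h8 := mul_le_mul_of_nonneg_right h5 hpos.le
    have hs2 : s ^ 2 ≠ 0 := pow_ne_zero _ hs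
    have h9 : |C1| * (s ^ 2)⁻¹ * (1 + s ^ 2) = |C1| * (1 + (s ^ 2)⁻¹) := by field_simp; ring
    have h10 : |C1| * (1 + (s ^ 2)⁻¹) ≤ |C1| * (1 + (δ ^ 2)⁻¹) := by gcongr
    linarith
  · have h5 := (h3 s ⟨hsδ, abs_le.1 hsR⟩).trans (le_abs_self _)
    have h6 : s ^ 2 ≤ R ^ 2 := by rw [← sq_abs s]; gcongr
    have := mul_le_mul h5 (add_le_add_right h6 1) hpos.le (abs_nonneg C3)
    linarith

end Bound

namespace Sided

variable {q0 : ℝ} {D₁ D₂ : Set ℂ} {rm qx : ℂ} {V : ℂ → Matrix (Fin 2) (Fin 2) ℂ}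
  (h : Sided q0 D₁ D₂ rm qx V)
include h

theorem isBigO_mul : (fun z => z * V z 0 1 + I * qx) =O[atInf q0 D₂] (fun z => z⁻¹) := by
  have h1 := (Asymptotics.isBigO_refl (fun z : ℂ => z) (atInf q0 D₂)).mul h.isBigO₂.2
  have h2 : (fun z : ℂ => z * (z ^ 2)⁻¹) = fun z => z⁻¹ := by
    funext z
    by_cases hz : z = 0
    · simp [hz]
    · field_simp
  rw [h2] at h1
  refine h1.congr' ?_ (EventuallyEq.refl _ _)
  filter_upwards [eventually_atInf_norm 1] with z hz
  have hz0 : z ≠ 0 := norm_pos_iff.1 (by linarith)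
  field_simp

theorem tendsto_infty : Tendsto (fun z => z * V z 0 1) (atInf q0 D₂) (𝓝 (-(I * qx))) := by
  have h1 := (h.isBigO_mul.trans_tendsto tendsto_inv_atInf).sub_const (I * qx)
  simpa using h1

theorem tendsto_zero (hq : 0 < q0) (h0 : (0 : ℂ) ∉ D₂ ∪ Sigma0 q0)
    (hD : ∀ z ∈ D₂ ∪ Sigma0 q0, hat q0 z ∈ D₁ ∪ Sigma0 q0) :
    Tendsto (fun z => z * V z 0 1) (atZero q0 D₂) (𝓝 (-(I * rm))) := by
  have h1 := ((h.isBigO_zero hq h0 hD).trans_tendsto tendsto_id_atZero).sub_const (I * rm)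
  simpa using h1

end Sided

/-- The data of the discrete spectrum. -/
structure DiscreteData (q0 : ℝ) (ψm ψp : ℝ → ℝ → ℂ → Matrix (Fin 2) (Fin 2) ℂ) {N : ℕ}
    (z : Fin N → ℂ) (A B : Idx N → ℂ) : Prop where
  sing : NoSpectralSingularity q0 ψm ψp
  zeros : HasDoubleZeros q0 ψm ψp z
  norming : ∀ n, ∃ b d, b ≠ 0 ∧ IsNorming ψm ψp (xiHat q0 z n) b d ∧
    A n = Aplus q0 ψm ψp (xiHat q0 z n) b ∧ B n = Bplus q0 ψm ψp (xiHat q0 z n) b d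

section

variable {q0 : ℝ} {q : ℝ → ℝ → ℂ} {qm qp : ℂ} {ψm ψp : ℝ → ℝ → ℂ → Matrix (Fin 2) (Fin 2) ℂ}
  (h : JostPair q0 q qm qp ψm ψp) {N : ℕ} {z : Fin N → ℂ} {A B : Idx N → ℂ}
  (hd : DiscreteData q0 ψm ψp z A B)
include h hd

theorem DiscreteData.zero_notMem : (0 : ℂ) ∉ Set.range (xiHat q0 z) := by
  rintro ⟨n, hn⟩
  exact ne_zero_of_mem_Dplus (h.xiHat_mem hd.zeros n) hn

theorem DiscreteData.notMem_of_Sigma0 {w : ℂ} (hw : w ∈ Sigma0 q0) :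
    w ∉ Set.range (xiHat q0 z) := by
  rintro ⟨n, rfl⟩
  exact notMem_Sigma0_of_Dplus (h.xiHat_mem hd.zeros n) (Or.inr hw)

theorem DiscreteData.s22_ne_zero {w : ℂ} (hw : w ∈ Dplus q0 ∪ Sigma0 q0)
    (hr : w ∉ Set.range (xiHat q0 z)) : s22 q0 ψm ψp w ≠ 0 := by
  rcases hw with hw | hw
  · exact fun h0 => hr ((h.s22_eq_zero_iff hd.zeros hw).1 h0)
  · exact h.s22_ne_zero hd.sing hw

/-- The lower bound on |s₁₁| near the branch points is transported to s₂₂ by conjugation, which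
exchanges iq₀ and -iq₀. -/
theorem DiscreteData.halfRegularOff_inv : HalfRegularOff q0 (Dplus q0) (Set.range (xiHat q0 z))
    fun w => (s22 q0 ψm ψp w)⁻¹ := by
  refine ⟨fun w hw hr => (h.differentiableOn_s22.differentiableAt
    ((isOpen_Dplus q0).mem_nhds hw)).inv (hd.s22_ne_zero h (Or.inl hw) hr),
    fun w hw => (h.continuousOn_s22 w (Or.inr hw)).inv₀ (h.s22_ne_zero hd.sing hw), ?_⟩
  obtain ⟨-, c, hc, ε, hε, hb⟩ := hd.sing
  refine ⟨c⁻¹, ε, hε, fun w hw _ hwε => ?_⟩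
  rw [norm_inv]
  refine inv_anti₀ hc ?_
  rw [h.s22_eq_conj hw, RCLike.norm_conj]
  refine hb _ (conj_mem_DmS.2 hw) ?_
  rw [← RCLike.norm_conj, ← RCLike.norm_conj (conj w + _), or_comm]
  simpa [sub_eq_add_neg] using hwε

theorem DiscreteData.halfRegularOff (x t : ℝ) (i : Fin 2) :
    HalfRegularOff q0 (Dplus q0) (Set.range (xiHat q0 z))
      fun w => modified q0 ψp x t w i 1 / s22 q0 ψm ψp w := by
  have := (((h.sided_plus x t).reg₂ i).off (E := Set.range (xiHat q0 z)) (isOpen_Dplus q0)).mul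
    (hd.halfRegularOff_inv h)
  simpa only [div_eq_mul_inv] using this

/-- The principal part of `u₊₂ / s₂₂` at `ξ̂_n`. -/
theorem DiscreteData.principal_part (x t : ℝ) (i : Fin 2) (n : Idx N) :
    ∃ G, DifferentiableAt ℂ G (xiHat q0 z n) ∧ ∀ᶠ w in 𝓝[≠] (xiHat q0 z n),
      modified q0 ψp x t w i 1 / s22 q0 ψm ψp w = G w +
        doublePole (Aexp q0 z A x t n * modified q0 ψm x t (xiHat q0 z n) i 0)
          (Aexp q0 z A x t n * (deriv (fun w => modified q0 ψm x t w i 0) (xiHat q0 z n)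
            + chi q0 z B x t n * modified q0 ψm x t (xiHat q0 z n) i 0)) (xiHat q0 z n) w := by
  obtain ⟨b, d, hb, hbd, hA, hB⟩ := hd.norming n
  have hmem := h.xiHat_mem hd.zeros n
  have hn := (isOpen_Dplus q0).mem_nhds hmem
  obtain ⟨hs1, hs2⟩ := h.s22_double hd.zeros n
  obtain ⟨G, hG, hev⟩ := exists_principal_part (f := fun w => modified q0 ψp x t w i 1)
    (((h.sided_plus x t).reg₂ i).diff.analyticAt hn) (h.differentiableOn_s22.analyticAt hn)
    ((h.s22_eq_zero_iff hd.zeros hmem).2 ⟨n, rfl⟩) hs1 hs2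
  refine ⟨G, hG.differentiableAt, hev.mono fun w hw => ?_⟩
  rw [hw]
  congr 1
  unfold Aexp chi
  rw [hA, hB]
  set p := xiHat q0 z n with hp
  have dθ : HasDerivAt (theta q0 x t) (deriv (theta q0 x t) p) p :=
    ((JostPair.differentiableOn_theta x t).differentiableAt
      (isOpen_compl_singleton.mem_nhds (ne_zero_of_mem_Dplus hmem))).hasDerivAt
  have dm := ((h.differentiableOn_minus x t i).differentiableAt hn).hasDerivAt
  have dp := ((h.differentiableOn_plus x t i).differentiableAt hn).hasDerivAt
  have e1 : deriv (fun w => modified q0 ψm x t w i 0) p =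
      deriv (fun w => ψm x t w i 0) p * exp (I * theta q0 x t p)
        + ψm x t p i 0 * (exp (I * theta q0 x t p) * (I * deriv (theta q0 x t) p)) := by
    simp only [modified_zero]
    exact (dm.mul (dθ.const_mul I).cexp).deriv
  have e2 : deriv (fun w => modified q0 ψp x t w i 1) p =
      deriv (fun w => ψp x t w i 1) p * exp (-(I * theta q0 x t p))
        + ψp x t p i 1 * (exp (-(I * theta q0 x t p)) * -(I * deriv (theta q0 x t) p)) := by
    simp only [modified_one]
    exact (dp.mul (dθ.const_mul I).neg.cexp).deriv
  have e3 : exp (-2 * I * theta q0 x t p) =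
      exp (-(I * theta q0 x t p)) * exp (-(I * theta q0 x t p)) := by
    rw [← exp_add]; ring_nf
  have e4 : exp (I * theta q0 x t p) * exp (-(I * theta q0 x t p)) = 1 := by
    rw [← exp_add, add_neg_cancel, exp_zero]
  have hb1 := (hbd x t i).1
  have hb2 := (hbd x t i).2
  rw [e2, hb2, e1, e3, modified_one, modified_zero, hb1, Aplus, Bplus]
  generalize exp (-(I * theta q0 x t p)) = E at *
  generalize exp (I * theta q0 x t p) = F at *
  generalize deriv (theta q0 x t) p = τ at *
  generalize deriv (fun w => ψm x t w i 0) p = m' at *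
  generalize ψm x t p i 0 = m at *
  generalize iteratedDeriv 3 (s22 q0 ψm ψp) p = s3 at *
  generalize iteratedDeriv 2 (s22 q0 ψm ψp) p = s2 at *
  -- At ξ̂_n one has ψ₊₂ = bψ₋₁, so u₊₂ = b exp(-2iθ)u₋₁; differentiating the exponential produces
  -- the -2iθ' in χ_n, and the norming relation for the derivative produces d/b.
  have v1 : 2 * b / s2 * (E * E) * (m * F) = 2 / s2 * (b * m * E) := by
    linear_combination (2 * b / s2 * E * m) * e4
  have v2 : 2 * b / s2 * (E * E) * (m' * F + m * (F * (I * τ))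
      + (d / b - s3 / (3 * s2) - 2 * I * τ) * (m * F)) =
      2 / s2 * ((d * m + b * m') * E + b * m * (E * -(I * τ)) - s3 / (3 * s2) * (b * m * E)) := by
    have : 2 * b / s2 * (E * E) * (m' * F + m * (F * (I * τ))
        + (d / b - s3 / (3 * s2) - 2 * I * τ) * (m * F)) =
        2 * b / s2 * E * (m' + m * (I * τ) + (d / b - s3 / (3 * s2) - 2 * I * τ) * m) := by
      linear_combination (2 * b / s2 * E * (m' + m * (I * τ)
        + (d / b - s3 / (3 * s2) - 2 * I * τ) * m)) * e4
    rw [this]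
    field_simp
    ring
  rw [v1, v2, doublePole, doublePole]
  ring

/-- The sum of the principal parts of `u₊₂ / s₂₂`. -/
def principalParts (q0 : ℝ) {N : ℕ} (z : Fin N → ℂ)
    (ψm : ℝ → ℝ → ℂ → Matrix (Fin 2) (Fin 2) ℂ) (A B : Idx N → ℂ) (x t : ℝ) : ℂ → ℂ :=
  doublePoles (fun n => Aexp q0 z A x t n * modified q0 ψm x t (xiHat q0 z n) 0 0)
    (fun n => Aexp q0 z A x t n * (deriv (fun w => modified q0 ψm x t w 0 0) (xiHat q0 z n)
      + chi q0 z B x t n * modified q0 ψm x t (xiHat q0 z n) 0 0)) (xiHat q0 z)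

theorem DiscreteData.exists_regular (x t : ℝ) : ∃ g, HalfRegular q0 (Dplus q0) g ∧
    ∀ w, w ∉ Set.range (xiHat q0 z) →
      g w = modified q0 ψp x t w 0 1 / s22 q0 ψm ψp w - principalParts q0 z ψm A B x t w := by
  have hb := branch_notMem (q0 := q0)
  refine HalfRegular.of_removable (h.xiHat_mem hd.zeros)
    (fun w hw hS => notMem_Sigma0_of_Dplus hw (Or.inr hS)) (fun h => hb.1 (Or.inl h))
    (fun h => hb.2.1 (Or.inl h))
    ((hd.halfRegularOff h x t 0).sub (halfRegularOff_doublePoles (h.xiHat_mem hd.zeros)))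
    fun n => ?_
  obtain ⟨G, hG, hev⟩ := hd.principal_part h x t 0 n
  obtain ⟨G', hG', hev'⟩ := exists_doublePoles_eq
    (V := fun n => Aexp q0 z A x t n * modified q0 ψm x t (xiHat q0 z n) 0 0)
    (W := fun n => Aexp q0 z A x t n * (deriv (fun w => modified q0 ψm x t w 0 0) (xiHat q0 z n)
      + chi q0 z B x t n * modified q0 ψm x t (xiHat q0 z n) 0 0)) (h.xiHat_injective hd.zeros) n
  refine ⟨fun w => G w - G' w, hG.sub hG', hev.mono fun w hw => ?_⟩
  change _ / _ - doublePoles _ _ _ w = G w - G' w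
  rw [hw, hev']
  ring

omit hd in
theorem tendsto_s22_inv_infty :
    Tendsto (fun w => (s22 q0 ψm ψp w)⁻¹) (atInf q0 (Dplus q0)) (𝓝 1) := by
  have := (h.s22_isBigO.trans_tendsto tendsto_inv_atInf).add_const 1
  simp only [sub_add_cancel, zero_add] at this
  simpa using this.inv₀ one_ne_zero

omit hd in
theorem tendsto_s22_inv_zero :
    Tendsto (fun w => (s22 q0 ψm ψp w)⁻¹) (atZero q0 (Dplus q0)) (𝓝 (qm / qp)) := by
  have := (h.s22_zero_isBigO.trans_tendsto tendsto_id_atZero).add_const 1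
  simp only [sub_add_cancel, zero_add] at this
  have h2 := (this.inv₀ one_ne_zero).mul_const (qm / qp)
  rw [inv_one, one_mul] at h2
  refine h2.congr fun w => ?_
  have := h.qm_ne_zero
  have := h.qp_ne_zero
  field_simp

/-- At infinity the limits are those of z u₊₁₂ and of the sum of the residues, s₂₂ tending to 1. At
the origin z u₊₁₂ → -iq₊ and s₂₂ → q₊/q₋ combine to -iq₋, the value found on the other side of the
contour. -/
theorem DiscreteData.admissible_plus {x t : ℝ} {g : ℂ → ℂ} (hg : HalfRegular q0 (Dplus q0) g)
    (hgr : ∀ w, w ∉ Set.range (xiHat q0 z) →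
      g w = modified q0 ψp x t w 0 1 / s22 q0 ψm ψp w - principalParts q0 z ψm A B x t w) :
    Admissible q0 (Dplus q0) g (-(I * q x t) - poleSum q0 z ψm A B x t) (-(I * qm)) := by
  have hfin : IsClosed (Set.range (xiHat q0 z)) := (Set.finite_range _).isClosed
  refine ⟨hg, ?_, ?_⟩
  · have h1 := ((h.sided_plus x t).tendsto_infty.mul (tendsto_s22_inv_infty h)).sub
      ((tendsto_mul_doublePoles_cobounded
        (V := fun n => Aexp q0 z A x t n * modified q0 ψm x t (xiHat q0 z n) 0 0)
        (W := fun n => Aexp q0 z A x t n * (deriv (fun w => modified q0 ψm x t w 0 0) (xiHat q0 z n)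
          + chi q0 z B x t n * modified q0 ψm x t (xiHat q0 z n) 0 0)) (p := xiHat q0 z)).mono_left
        (inf_le_left (b := 𝓟 (Dplus q0 ∪ Sigma0 q0))))
    rw [mul_one] at h1
    refine h1.congr' ?_
    have : ∀ᶠ w in Bornology.cobounded ℂ, w ∉ Set.range (xiHat q0 z) :=
      Bornology.isBounded_def.1 (Set.finite_range _).isBounded
    filter_upwards [this.filter_mono inf_le_left] with w hw
    rw [hgr w hw, principalParts]
    ring
  · have h1 := ((h.sided_plus x t).tendsto_zero h.pos (fun h => ne_zero_of_mem_DS h rfl)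
      (fun w hw => (hat_mem_DmS h.pos).2 hw)).mul (tendsto_s22_inv_zero h)
    have h2 := h1.sub ((tendsto_mul_doublePoles_zero
        (V := fun n => Aexp q0 z A x t n * modified q0 ψm x t (xiHat q0 z n) 0 0)
        (W := fun n => Aexp q0 z A x t n * (deriv (fun w => modified q0 ψm x t w 0 0) (xiHat q0 z n)
          + chi q0 z B x t n * modified q0 ψm x t (xiHat q0 z n) 0 0)) (p := xiHat q0 z)
          fun n hn => hd.zero_notMem h ⟨n, hn⟩).mono_left
        (nhdsWithin_le_nhds (s := Dplus q0 ∪ Sigma0 q0)))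
    have e : -(I * qp) * (qm / qp) - 0 = -(I * qm) := by
      have := h.qp_ne_zero
      field_simp
      ring
    rw [e] at h2
    refine h2.congr' ?_
    have : ∀ᶠ w in 𝓝 (0 : ℂ), w ∉ Set.range (xiHat q0 z) :=
      hfin.isOpen_compl.mem_nhds (hd.zero_notMem h)
    filter_upwards [this.filter_mono nhdsWithin_le_nhds] with w hw
    rw [hgr w hw, principalParts]
    ring

theorem DiscreteData.admissible_minus (x t : ℝ) :
    Admissible q0 (Dminus q0) (fun w => modified q0 ψm x t w 0 1 - principalParts q0 z ψm A B x t w)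
      (-(I * q x t) - poleSum q0 z ψm A B x t) (-(I * qm)) := by
  refine ⟨((h.sided_minus x t).reg₂ 0).sub (halfRegular_doublePoles (h.xiHat_mem hd.zeros)), ?_, ?_⟩
  · have h1 := (h.sided_minus x t).tendsto_infty.sub
      ((tendsto_mul_doublePoles_cobounded
        (V := fun n => Aexp q0 z A x t n * modified q0 ψm x t (xiHat q0 z n) 0 0)
        (W := fun n => Aexp q0 z A x t n * (deriv (fun w => modified q0 ψm x t w 0 0) (xiHat q0 z n)
          + chi q0 z B x t n * modified q0 ψm x t (xiHat q0 z n) 0 0)) (p := xiHat q0 z)).mono_left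
        (inf_le_left (b := 𝓟 (Dminus q0 ∪ Sigma0 q0))))
    refine h1.congr fun w => ?_
    rw [principalParts]
    ring
  · have h1 := ((h.sided_minus x t).tendsto_zero h.pos (fun h => ne_zero_of_mem_DmS h rfl)
      (fun w hw => (hat_mem_DS h.pos).2 hw))
    have h2 := h1.sub ((tendsto_mul_doublePoles_zero
        (V := fun n => Aexp q0 z A x t n * modified q0 ψm x t (xiHat q0 z n) 0 0)
        (W := fun n => Aexp q0 z A x t n * (deriv (fun w => modified q0 ψm x t w 0 0) (xiHat q0 z n)
          + chi q0 z B x t n * modified q0 ψm x t (xiHat q0 z n) 0 0)) (p := xiHat q0 z)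
          fun n hn => hd.zero_notMem h ⟨n, hn⟩).mono_left
        (nhdsWithin_le_nhds (s := Dminus q0 ∪ Sigma0 q0)))
    rw [sub_zero] at h2
    refine h2.congr fun w => ?_
    rw [principalParts]
    ring

/-- Each of the two terms is only O(1/s) at infinity and at the origin. The leading coefficients,
-iq(x,t) at infinity and -iq₋ at 0, agree and cancel in the difference. -/
theorem jump_bound (x t : ℝ) : ∃ C, ∀ s : ℝ, s ≠ 0 →
    ‖modified q0 ψm x t s 0 1 - modified q0 ψp x t s 0 1 / s22 q0 ψm ψp s‖ ≤ C * (1 + s ^ 2)⁻¹ := by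
  have Sm := h.sided_minus x t
  have Sp := h.sided_plus x t
  have hsub1 : (∅ : Set ℂ) ⊆ Dplus q0 := Set.empty_subset _
  have hsub2 : (∅ : Set ℂ) ⊆ Dminus q0 := Set.empty_subset _
  refine exists_bound_real (f := fun w => modified q0 ψm x t w 0 1
    - modified q0 ψp x t w 0 1 / s22 q0 ψm ψp w) h.pos ?_ ?_ ?_
  · exact ((Sm.reg₂ 0).cont.mono Set.subset_union_right).sub
      (((Sp.reg₂ 0).cont.mono Set.subset_union_right).div
        (h.continuousOn_s22.mono Set.subset_union_right) fun w hw => h.s22_ne_zero hd.sing hw)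
  · have i1 := Sm.isBigO₂.2.mono (atInf_mono hsub2)
    have i2 := (Sp.isBigO₂.2.mul ((tendsto_s22_inv_infty h).isBigO_one ℂ)).mono (atInf_mono hsub1)
    have hi : (fun w : ℂ => I / w * q x t) =O[atInf q0 (Dplus q0)] fun w => w⁻¹ := by
      refine isBigO_of_eventually_le (C := ‖q x t‖) (Eventually.of_forall fun w => ?_)
      rw [norm_mul, norm_div, norm_I, norm_inv, one_div, mul_comm]
    have i3 := (hi.mul (isBigO_inv_sub_one h.s22_isBigO tendsto_inv_atInf)).mono (atInf_mono hsub1)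
    have hsq : (fun w : ℂ => w⁻¹ * w⁻¹) = fun w => (w ^ 2)⁻¹ := by funext w; rw [sq, mul_inv]
    rw [hsq] at i3
    simp only [mul_one] at i2
    refine ((i1.sub i2).add i3).congr_left fun w => ?_
    ring
  · have z1 := (Sm.isBigO_zero h.pos (fun h => ne_zero_of_mem_DmS h rfl)
      (fun w hw => (hat_mem_DS h.pos).2 hw)).mono (atZero_mono hsub2)
    have z2 := ((Sp.isBigO_zero h.pos (fun h => ne_zero_of_mem_DS h rfl)
      (fun w hw => (hat_mem_DmS h.pos).2 hw)).mul
      ((tendsto_s22_inv_zero h).isBigO_one ℂ)).mono (atZero_mono hsub1)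
    have z3 := ((isBigO_inv_sub_one h.s22_zero_isBigO tendsto_id_atZero).const_mul_left
      (I * qm)).mono (atZero_mono hsub1)
    simp only [mul_one] at z2
    have z4 := (Asymptotics.isBigO_refl (fun w : ℂ => w⁻¹) (atZero q0 ∅)).mul ((z1.sub z2).add z3)
    have hne : ∀ᶠ w : ℂ in atZero q0 ∅, w ≠ 0 := by
      filter_upwards [eventually_atZero_mem] with w hw
      rw [Set.empty_union] at hw
      exact hw.2.1
    refine z4.congr' ?_ ?_
    · filter_upwards [hne] with w hw
      have := h.qm_ne_zero
      have := h.qp_ne_zero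
      by_cases hs : s22 q0 ψm ψp w = 0
      · rw [hs]; field_simp; simp
      · field_simp
        ring
    · filter_upwards [hne] with w hw
      exact inv_mul_cancel₀ hw

/-- The reconstruction formula. -/
theorem DiscreteData.reconstruction (x t : ℝ) :
    SigmaIntegrable q0 (fun ζ => (Mminus q0 ψm ψp x t ζ * Gmat q0 ψm ψp x t ζ) 0 1) ∧
    q x t = qm + I * poleSum q0 z ψm A B x t + 1 / (2 * (Real.pi : ℂ)) * sigmaIntegral q0
      (fun ζ => (Mminus q0 ψm ψp x t ζ * Gmat q0 ψm ψp x t ζ) 0 1) := by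
  obtain ⟨g, hg, hgr⟩ := hd.exists_regular h x t
  have ap := hd.admissible_plus h hg hgr
  have am := hd.admissible_minus h x t
  obtain ⟨C, hC⟩ := jump_bound h hd x t
  have hj : ∀ w ∈ Sigma0 q0, (Mminus q0 ψm ψp x t w * Gmat q0 ψm ψp x t w) 0 1 =
      (modified q0 ψm x t w 0 1 - principalParts q0 z ψm A B x t w) - g w := by
    intro w hw
    rw [h.jump hd.sing hw, hgr w (hd.notMem_of_Sigma0 h hw)]
    ring
  have hi := sigmaIntegrable_jump (C := C) h.pos hg am.toHalfRegular hj fun s hs => by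
    rw [h.jump hd.sing (ofReal_mem_Sigma0 h.pos hs)]
    exact hC s hs
  refine ⟨hi, ?_⟩
  rw [sigmaIntegral_jump h.pos ap am hj hi.1]
  have hpi : (Real.pi : ℂ) ≠ 0 := ofReal_ne_zero.2 Real.pi_ne_zero
  field_simp
  linear_combination (q x t - qm) * I_sq

end

/-! ## Uniqueness for the problem without jump -/

section

variable {q0 : ℝ} {D D' : Set ℂ} {f : ℂ → ℂ}

theorem hat_branch (hq : 0 < q0) : hat q0 (I * q0) = I * q0 := by
  have hq' : (q0 : ℂ) ≠ 0 := ofReal_ne_zero.2 hq.ne'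
  rw [hat]
  field_simp
  rw [I_sq]

theorem tendsto_of_tendsto_mul {k : ℂ → ℂ} {a : ℂ}
    (hk : Tendsto (fun z => z * k z) (atInf q0 D) (𝓝 a)) : Tendsto k (atInf q0 D) (𝓝 0) := by
  have h1 := hk.mul (tendsto_inv_atInf (q0 := q0) (D := D))
  rw [mul_zero] at h1
  refine h1.congr' ?_
  filter_upwards [eventually_atInf_norm 1] with z hz
  have hz0 : z ≠ 0 := norm_pos_iff.1 (by linarith)
  field_simp

theorem HalfRegular.comp_hat (hq : 0 < q0) (hf : HalfRegular q0 D f) (h0 : (0 : ℂ) ∉ D')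
    (h : ∀ z ∈ D', hat q0 z ∈ D) : HalfRegular q0 D' fun z => f (hat q0 z) := by
  have hne : ∀ z ∈ D' ∪ Sigma0 q0, z ≠ 0 := by
    rintro z (hz | hz) rfl
    · exact h0 hz
    · exact hz.2.1 rfl
  have h' : ∀ z ∈ D' ∪ Sigma0 q0, hat q0 z ∈ D ∪ Sigma0 q0 := by
    rintro z (hz | hz)
    · exact Or.inl (h z hz)
    · exact Or.inr ((hat_mem_Sigma0 hq).2 hz)
  refine ⟨hf.diff.comp (fun z hz => (hasDerivAt_hat (hne z (Or.inl hz))).differentiableAt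
      |>.differentiableWithinAt) h,
    hf.cont.comp (fun z hz => (hasDerivAt_hat (hne z hz)).continuousAt.continuousWithinAt) h', ?_⟩
  obtain ⟨C, ε, hε, hC⟩ := hf.bdd
  have hq' : (q0 : ℂ) ≠ 0 := ofReal_ne_zero.2 hq.ne'
  have key : ∀ b : ℂ, b ≠ 0 → hat q0 b = b →
      ∃ δ > 0, ∀ z, ‖z - b‖ < δ → ‖hat q0 z - b‖ < ε := by
    intro b hb hbb
    obtain ⟨δ, hδ, hs⟩ := Metric.continuousAt_iff.1 (hasDerivAt_hat (q0 := q0) hb).continuousAt ε hε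
    refine ⟨δ, hδ, fun z hz => ?_⟩
    have := hs (x := z) (by rwa [dist_eq_norm])
    rwa [hbb, dist_eq_norm] at this
  obtain ⟨δ, hδ, h1⟩ := key (I * q0) (mul_ne_zero I_ne_zero hq') (hat_branch hq)
  obtain ⟨δ', hδ', h2⟩ := key (-(I * q0)) (neg_ne_zero.2 (mul_ne_zero I_ne_zero hq'))
    (by rw [hat_neg, hat_branch hq])
  refine ⟨C, min δ δ', lt_min hδ hδ', fun z hz hzε => hC _ (h' z hz) ?_⟩
  rcases hzε with hz | hz
  · exact Or.inl (h1 z (hz.trans_le (min_le_left _ _)))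
  · refine Or.inr ?_
    have := h2 z (by rw [sub_neg_eq_add]; exact hz.trans_le (min_le_right _ _))
    rwa [sub_neg_eq_add] at this

theorem HalfRegular.div_id (hq : 0 < q0) (hf : HalfRegular q0 D f) (h0 : (0 : ℂ) ∉ D) :
    HalfRegular q0 D fun z => f z / z := by
  have hq' : I * (q0 : ℂ) ≠ 0 := mul_ne_zero I_ne_zero (ofReal_ne_zero.2 hq.ne')
  have := hf.div_sub (z0 := 0) (by
    rintro (h | h)
    · exact h0 h
    · exact h.2.1 rfl) hq' (neg_ne_zero.2 hq')
  exact this.congr fun z _ => by rw [sub_zero]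

/-- The boundary values on the circle are determined by the values in `D⁺`. -/
theorem HalfRegular.eq_on_circle (hq : 0 < q0) {g : ℂ → ℂ} (hf : HalfRegular q0 (Dplus q0) f)
    (hfg : ∀ z ∈ Dplus q0, f z = g z) {z : ℂ} (hz : z ∈ Sigma0 q0) (hn : ‖z‖ = q0)
    (him : z.im ≠ 0) (hg : ContinuousAt g z) : f z = g z := by
  -- The point is approached radially within D⁺, from outside the circle if Im z > 0 and from inside
  -- if Im z < 0.
  obtain ⟨l, hl, hl1, hlD⟩ : ∃ l : Filter ℝ, l.NeBot ∧ l ≤ 𝓝 1 ∧ ∀ᶠ s : ℝ in l, (s : ℂ) * z ∈ Dplus q0 := by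
    have hmem : ∀ s : ℝ, 0 < s → 0 < (s - 1) * z.im → (s : ℂ) * z ∈ Dplus q0 := by
      intro s hs h
      change 0 < (‖(s : ℂ) * z‖ ^ 2 - q0 ^ 2) * ((s : ℂ) * z).im
      rw [norm_mul, Complex.norm_real, Real.norm_of_nonneg hs.le, hn, Complex.im_ofReal_mul]
      have : ((s * q0) ^ 2 - q0 ^ 2) * (s * z.im) = q0 ^ 2 * (s + 1) * s * ((s - 1) * z.im) := by ring
      rw [this]
      positivity
    rcases him.lt_or_gt with h | h
    · refine ⟨𝓝[<] 1, inferInstance, nhdsWithin_le_nhds, ?_⟩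
      filter_upwards [self_mem_nhdsWithin, mem_nhdsWithin_of_mem_nhds (lt_mem_nhds one_pos)]
        with s hs1 hs0
      exact hmem s hs0 (mul_pos_of_neg_of_neg (sub_neg.2 hs1) h)
    · refine ⟨𝓝[>] 1, inferInstance, nhdsWithin_le_nhds, ?_⟩
      filter_upwards [self_mem_nhdsWithin] with s hs1
      exact hmem s (one_pos.trans hs1) (mul_pos (sub_pos.2 hs1) h)
  have ht : Tendsto (fun s : ℝ => (s : ℂ) * z) l (𝓝 z) := by
    have : Tendsto (fun s : ℝ => (s : ℂ) * z) (𝓝 1) (𝓝 ((1 : ℝ) * z)) :=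
      (continuous_ofReal.mul continuous_const).tendsto _
    rw [ofReal_one, one_mul] at this
    exact this.mono_left hl1
  have h1 : Tendsto (fun s : ℝ => f (s * z)) l (𝓝 (f z)) :=
    (hf.cont z (Or.inr hz)).tendsto.comp
      (tendsto_nhdsWithin_iff.2 ⟨ht, hlD.mono fun s hs => Or.inl hs⟩)
  have h2 : Tendsto (fun s : ℝ => g (s * z)) l (𝓝 (g z)) := hg.tendsto.comp ht
  exact tendsto_nhds_unique (h1.congr' (hlD.mono fun s hs => hfg _ hs)) h2

end

/-- Two functions with proportional principal parts. -/
theorem exists_cross_regular {u v : ℂ → ℂ} {w : ℂ} (hu : AnalyticAt ℂ u w) (hv : AnalyticAt ℂ v w)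
    (C χ : ℂ) : ∃ G, DifferentiableAt ℂ G w ∧ ∀ z, z ≠ w →
      u z * doublePole (C * v w) (C * (deriv v w + χ * v w)) w z
        - v z * doublePole (C * u w) (C * (deriv u w + χ * u w)) w z = G z := by
  set h : ℂ → ℂ := fun z => u z * v w - v z * u w with hh
  have ha : AnalyticAt ℂ h w := (hu.mul analyticAt_const).sub (hv.mul analyticAt_const)
  have hdh : deriv h w = deriv u w * v w - deriv v w * u w :=
    ((hu.differentiableAt.hasDerivAt.mul_const _).sub
      (hv.differentiableAt.hasDerivAt.mul_const _)).deriv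
  -- The coefficient of (z - w)⁻² is a difference that vanishes at w. One factor is divided out by
  -- `dslope`, and the remaining simple pole has coefficient k(w) = 0; the terms with χ cancel.
  set k : ℂ → ℂ := fun z => dslope h w z
    + (u z * (deriv v w + χ * v w) - v z * (deriv u w + χ * u w)) with hk
  have hka : AnalyticAt ℂ k w := (analyticAt_dslope ha).add
    ((hu.mul analyticAt_const).sub (hv.mul analyticAt_const))
  have hk0 : k w = 0 := by
    simp only [hk]
    rw [dslope_same, hdh]
    ring
  refine ⟨fun z => C * dslope k w z, (analyticAt_dslope hka).differentiableAt.const_mul C,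
    fun z hz => ?_⟩
  have hz' : z - w ≠ 0 := sub_ne_zero.2 hz
  have hhw : h w = 0 := by simp only [hh]; ring
  beta_reduce
  rw [dslope_of_ne _ hz, slope_def_field, hk0, sub_zero]
  simp only [hk]
  rw [dslope_of_ne _ hz, slope_def_field, hhw, sub_zero]
  simp only [hh, doublePole]
  field_simp
  ring

/-- The matrix `(f, g)`, holomorphic in `D⁺` but for double poles of `g` at the points `p n`, has no
jump and the symmetries of the modified Jost solutions. -/
structure NoJump (q0 : ℝ) (rm : ℂ) {ι : Type*} (p C χ : ι → ℂ) (f g : Fin 2 → ℂ → ℂ) : Prop where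
  pos : 0 < q0
  mul_conj : rm * conj rm = (q0 : ℂ) ^ 2
  mem : ∀ n, p n ∈ Dplus q0
  inj : Function.Injective p
  reg₁ : ∀ i, HalfRegular q0 (Dplus q0) (f i)
  reg₂ : ∀ i, HalfRegularOff q0 (Dplus q0) (Set.range p) (g i)
  pole : ∀ i n, ∃ G, DifferentiableAt ℂ G (p n) ∧ ∀ᶠ w in 𝓝[≠] (p n), g i w = G w +
    doublePole (C n * f i (p n)) (C n * (deriv (f i) (p n) + χ n * f i (p n))) (p n) w
  det : ∀ z ∈ Dplus q0 ∪ Sigma0 q0, z ∉ Set.range p → f 0 z * g 1 z - f 1 z * g 0 z = gam q0 z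
  symm₁ : ∀ z ∈ Sigma0 q0, ∀ i, f i z = -(I / z) * conj rm * g i (hat q0 z)
  symm₂ : ∀ z ∈ Sigma0 q0, ∀ i, g i z = -(I / z) * rm * f i (hat q0 z)
  conj₁₁ : ∀ z ∈ Sigma0 q0, g 1 z = conj (f 0 (conj z))
  conj₀₁ : ∀ z ∈ Sigma0 q0, g 0 z = -conj (f 1 (conj z))
  infty₁ : ∀ i, Tendsto (f i) (atInf q0 (Dplus q0)) (𝓝 (![1, 0] i))
  infty₂ : ∀ i, Tendsto (g i) (atInf q0 (Dplus q0)) (𝓝 (![0, 1] i))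
  zero₁ : ∀ i, Tendsto (fun z => z * f i z) (atZero q0 (Dplus q0)) (𝓝 (-(I * conj rm * ![0, 1] i)))
  zero₂ : ∀ i, Tendsto (fun z => z * g i z) (atZero q0 (Dplus q0)) (𝓝 (-(I * rm * ![1, 0] i)))

/-- The reflection `-(i r̄ / z) F(ẑ)`. -/
def reflect (q0 : ℝ) (rm : ℂ) (F : ℂ → ℂ) (z : ℂ) : ℂ := -(I * conj rm) * (F (hat q0 z) / z)

namespace NoJump

variable {q0 : ℝ} {rm : ℂ} {ι : Type*} [Fintype ι] {p C χ : ι → ℂ} {f g : Fin 2 → ℂ → ℂ}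
  (h : NoJump q0 rm p C χ f g)
include h

omit [Fintype ι] in
theorem notMem_range {z : ℂ} (hz : z ∉ Dplus q0) : z ∉ Set.range p := by
  rintro ⟨n, rfl⟩
  exact hz (h.mem n)

omit [Fintype ι] in
theorem notMem_of_Sigma0 {z : ℂ} (hz : z ∈ Sigma0 q0) : z ∉ Set.range p :=
  h.notMem_range fun h1 => notMem_Sigma0_of_Dplus h1 (Or.inr hz)

omit [Fintype ι] in
theorem zero_notMem : (0 : ℂ) ∉ Set.range p := h.notMem_range fun h1 => ne_zero_of_mem_Dplus h1 rfl

variable {V W : ι → ℂ}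

omit h in
theorem differentiableAt_reflect {z : ℂ} (hz : z ≠ 0) (hr : hat q0 z ∉ Set.range p) :
    DifferentiableAt ℂ (reflect q0 rm (doublePoles V W p)) z := by
  have h1 : DifferentiableAt ℂ (fun z => doublePoles V W p (hat q0 z)) z :=
    (differentiableAt_doublePoles hr).comp z (hasDerivAt_hat hz).differentiableAt
  exact (h1.div differentiableAt_id hz).const_mul _

theorem halfRegular_reflect : HalfRegular q0 (Dplus q0) (reflect q0 rm (doublePoles V W p)) := by
  have h0 : (0 : ℂ) ∉ Dplus q0 := fun h1 => ne_zero_of_mem_Dplus h1 rfl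
  exact (HalfRegular.const _).mul (((halfRegular_doublePoles h.mem).comp_hat h.pos h0
    fun z hz => (hat_mem_Dminus h.pos).2 hz).div_id h.pos h0)

theorem analyticAt_reflect (n : ι) : AnalyticAt ℂ (reflect q0 rm (doublePoles V W p)) (p n) :=
  h.halfRegular_reflect.diff.analyticAt ((isOpen_Dplus q0).mem_nhds (h.mem n))

/-- The two components of `(N₁, N₂) adj (f, g)`. -/
theorem exists_regular (hV : ∀ n, V n = C n * reflect q0 rm (doublePoles V W p) (p n))
    (hW : ∀ n, W n = C n * (deriv (reflect q0 rm (doublePoles V W p)) (p n)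
      + χ n * reflect q0 rm (doublePoles V W p) (p n))) (i : Fin 2) :
    ∃ P, HalfRegular q0 (Dplus q0) P ∧ ∀ z, z ∉ Set.range p →
      P z = reflect q0 rm (doublePoles V W p) z * g i z - f i z * doublePoles V W p z := by
  have hb := branch_notMem (q0 := q0)
  refine HalfRegular.of_removable h.mem (fun w hw hS => notMem_Sigma0_of_Dplus hw (Or.inr hS))
    (fun h => hb.1 (Or.inl h)) (fun h => hb.2.1 (Or.inl h))
    (((h.halfRegular_reflect.off (isOpen_Dplus q0)).mul (h.reg₂ i)).sub
      (((h.reg₁ i).off (isOpen_Dplus q0)).mul (halfRegularOff_doublePoles h.mem))) fun n => ?_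
  obtain ⟨G, hG, hev⟩ := h.pole i n
  obtain ⟨G', hG', hev'⟩ := exists_doublePoles_eq (V := V) (W := W) h.inj n
  have hf : AnalyticAt ℂ (f i) (p n) :=
    (h.reg₁ i).diff.analyticAt ((isOpen_Dplus q0).mem_nhds (h.mem n))
  have hN := h.analyticAt_reflect (V := V) (W := W) n
  -- By `hV` and `hW`, the poles of the row vector are formed from its first entry with the same C n
  -- and χ n as the poles of g from f. The singular parts of the two products therefore cancel.
  obtain ⟨H, hH, hcr⟩ := exists_cross_regular hN hf (C n) (χ n)
  refine ⟨fun z => reflect q0 rm (doublePoles V W p) z * G z - f i z * G' z + H z,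
    ((hN.differentiableAt.mul hG).sub (hf.differentiableAt.mul hG')).add hH, ?_⟩
  filter_upwards [hev, self_mem_nhdsWithin] with z hz hne
  rw [hev', hz, ← hcr z hne, ← hV, ← hW]
  ring

theorem tendsto_reflect_infty : Tendsto (fun z => z * reflect q0 rm (doublePoles V W p) z)
    (atInf q0 (Dplus q0)) (𝓝 (-(I * conj rm) * doublePoles V W p 0)) := by
  have h1 : Tendsto (hat q0) (atInf q0 (Dplus q0)) (𝓝 0) := by
    have := (tendsto_inv_atInf (q0 := q0) (D := Dplus q0)).const_mul (-(q0 : ℂ) ^ 2)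
    rw [mul_zero] at this
    exact this.congr fun z => by rw [hat, div_eq_mul_inv]
  have h2 := ((differentiableAt_doublePoles (V := V) (W := W)
    h.zero_notMem).continuousAt.tendsto.comp h1).const_mul (-(I * conj rm))
  refine h2.congr' ?_
  filter_upwards [eventually_atInf_norm 1] with z hz
  have hz0 : z ≠ 0 := norm_pos_iff.1 (by linarith)
  simp only [Function.comp_apply, reflect]
  field_simp

theorem tendsto_reflect_zero : Tendsto (fun z => reflect q0 rm (doublePoles V W p) z)
    (atZero q0 (Dplus q0)) (𝓝 (I * conj rm / (q0 : ℂ) ^ 2 * ∑ n, W n)) := by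
  have h1 : Tendsto (hat q0) (atZero q0 (Dplus q0)) (Bornology.cobounded ℂ) :=
    (tendsto_hat_atZero h.pos (fun h => ne_zero_of_mem_DS h rfl)
      fun w hw => (hat_mem_DmS h.pos).2 hw).mono_right inf_le_left
  have h2 := ((tendsto_mul_doublePoles_cobounded (V := V) (W := W) (p := p)).comp h1).const_mul
    (I * conj rm / (q0 : ℂ) ^ 2)
  refine h2.congr' ?_
  filter_upwards [eventually_atZero_mem] with z hz
  have hz0 : z ≠ 0 := ne_zero_of_mem_DS hz
  have hq : (q0 : ℂ) ≠ 0 := ofReal_ne_zero.2 h.pos.ne'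
  simp only [Function.comp_apply, reflect]
  have : hat q0 z = -(q0 : ℂ) ^ 2 / z := rfl
  generalize doublePoles V W p (hat q0 z) = F at *
  rw [this]
  field_simp

/-- On the contour the components are determined by a reflection. -/
theorem cross_symm {z : ℂ} (hz : z ∈ Sigma0 q0) (i : Fin 2) :
    reflect q0 rm (doublePoles V W p) z * g i z - f i z * doublePoles V W p z =
      (q0 : ℂ) ^ 2 / z ^ 2 * (reflect q0 rm (doublePoles V W p) (hat q0 z) * g i (hat q0 z)
        - f i (hat q0 z) * doublePoles V W p (hat q0 z)) := by
  have hz0 : z ≠ 0 := hz.2.1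
  have hq : (q0 : ℂ) ≠ 0 := ofReal_ne_zero.2 h.pos.ne'
  have hr := h.mul_conj
  rw [h.symm₁ z hz, h.symm₂ z hz, reflect, reflect, hat_hat h.pos]
  have e : hat q0 z = -(q0 : ℂ) ^ 2 / z := rfl
  generalize doublePoles V W p (hat q0 z) = F1 at *
  generalize doublePoles V W p z = F2 at *
  generalize f i (hat q0 z) = f1 at *
  generalize g i (hat q0 z) = g1 at *
  rw [e]
  field_simp
  linear_combination (-(F1 * f1)) * hr + (rm * conj rm * F1 * f1) * I_sq

/-- `(N₁, N₂) adj (f, g) = const / z`. -/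
theorem eq_div (hV : ∀ n, V n = C n * reflect q0 rm (doublePoles V W p) (p n))
    (hW : ∀ n, W n = C n * (deriv (reflect q0 rm (doublePoles V W p)) (p n)
      + χ n * reflect q0 rm (doublePoles V W p) (p n))) (i : Fin 2) :
    ∃ ρ, ∃ P, HalfRegular q0 (Dplus q0) P ∧ (∀ z ∈ Dplus q0, P z = ρ / z) ∧
      ∀ z, z ∉ Set.range p →
      P z = reflect q0 rm (doublePoles V W p) z * g i z - f i z * doublePoles V W p z := by
  obtain ⟨P, hP, hPe⟩ := h.exists_regular hV hW i
  set F := doublePoles V W p with hF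
  set N := reflect q0 rm F with hN
  have hq : (q0 : ℂ) ≠ 0 := ofReal_ne_zero.2 h.pos.ne'
  have hr := h.mul_conj
  -- ρ is the limit of z P at the origin; at infinity the limit is -ρ. For the Liouville argument
  -- only decay is used at infinity, and the continuation of P to D⁻ is its own reflection.
  set ρ := ![1, 0] i * (∑ n, W n) + I * conj rm * F 0 * ![0, 1] i with hρ
  have hfinI : ∀ᶠ w in atInf q0 (Dplus q0), w ∉ Set.range p :=
    Eventually.filter_mono inf_le_left (Bornology.isBounded_def.1 (Set.finite_range p).isBounded)
  have hfin0 : ∀ᶠ w in atZero q0 (Dplus q0), w ∉ Set.range p :=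
    Eventually.filter_mono nhdsWithin_le_nhds
      ((Set.finite_range p).isClosed.isOpen_compl.mem_nhds h.zero_notMem)
  have infP : Tendsto (fun z => z * P z) (atInf q0 (Dplus q0)) (𝓝 (-ρ)) := by
    have h1 := ((h.tendsto_reflect_infty (V := V) (W := W)).mul (h.infty₂ i)).sub ((h.infty₁ i).mul
      ((tendsto_mul_doublePoles_cobounded (V := V) (W := W) (p := p)).mono_left
        (inf_le_left (b := 𝓟 (Dplus q0 ∪ Sigma0 q0)))))
    have e : -(I * conj rm) * F 0 * ![0, 1] i - ![1, 0] i * ∑ n, W n = -ρ := by rw [hρ]; ring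
    rw [e] at h1
    refine h1.congr' ?_
    filter_upwards [hfinI] with z hz
    rw [hPe z hz]
    ring
  have zeroP : Tendsto (fun z => z * P z) (atZero q0 (Dplus q0)) (𝓝 ρ) := by
    have hF0 : Tendsto F (atZero q0 (Dplus q0)) (𝓝 (F 0)) :=
      (differentiableAt_doublePoles h.zero_notMem).continuousAt.tendsto.mono_left nhdsWithin_le_nhds
    have h1 := ((h.tendsto_reflect_zero (V := V) (W := W)).mul (h.zero₂ i)).sub
      ((h.zero₁ i).mul hF0)
    have e : I * conj rm / (q0 : ℂ) ^ 2 * (∑ n, W n) * -(I * rm * ![1, 0] i)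
        - -(I * conj rm * ![0, 1] i) * F 0 = ρ := by
      rw [hρ]
      generalize (![1, 0] i : ℂ) = α
      field_simp
      linear_combination (-(I ^ 2 * (∑ n, W n) * α)) * hr - ((q0 : ℂ) ^ 2 * (∑ n, W n) * α) * I_sq
    rw [e] at h1
    refine h1.congr' ?_
    filter_upwards [hfin0] with z hz
    rw [hPe z hz]
    ring
  have h0 : (0 : ℂ) ∉ Dminus q0 := fun h1 => ne_zero_of_mem_Dminus h1 rfl
  have h0' : (0 : ℂ) ∉ Dminus q0 ∪ Sigma0 q0 := fun h1 => ne_zero_of_mem_DmS h1 rfl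
  have hmP : ∀ z ∈ Dminus q0 ∪ Sigma0 q0, hat q0 z ∈ Dplus q0 ∪ Sigma0 q0 :=
    fun z hz => (hat_mem_DS h.pos).2 hz
  have regm : HalfRegular q0 (Dminus q0) fun z => (q0 : ℂ) ^ 2 / z / z * P (hat q0 z) :=
    (((HalfRegular.const _).div_id h.pos h0).div_id h.pos h0).mul
      (hP.comp_hat h.pos h0 fun z hz => (hat_mem_Dplus h.pos).2 hz)
  have em : ∀ z : ℂ, z ≠ 0 → z * ((q0 : ℂ) ^ 2 / z / z * P (hat q0 z)) = -(hat q0 z * P (hat q0 z)) := by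
    intro z hz
    have : hat q0 z = -(q0 : ℂ) ^ 2 / z := rfl
    generalize P (hat q0 z) = P1
    rw [this]
    field_simp
  have zerom : Tendsto (fun z => z * ((q0 : ℂ) ^ 2 / z / z * P (hat q0 z)))
      (atZero q0 (Dminus q0)) (𝓝 ρ) := by
    have h1 := (infP.comp (tendsto_hat_atZero h.pos h0' hmP)).neg
    rw [neg_neg] at h1
    refine h1.congr' ?_
    filter_upwards [eventually_atZero_mem] with z hz
    exact (em z (ne_zero_of_mem_DmS hz)).symm
  have hinf : Tendsto (hat q0) (atInf q0 (Dminus q0)) (atZero q0 (Dplus q0)) := by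
    refine tendsto_nhdsWithin_iff.2 ⟨?_, eventually_atInf_mem.mono hmP⟩
    have := (tendsto_inv_atInf (q0 := q0) (D := Dminus q0)).const_mul (-(q0 : ℂ) ^ 2)
    rw [mul_zero] at this
    exact this.congr fun z => by rw [hat, div_eq_mul_inv]
  have infm : Tendsto (fun z => z * ((q0 : ℂ) ^ 2 / z / z * P (hat q0 z)))
      (atInf q0 (Dminus q0)) (𝓝 (-ρ)) := by
    refine (zeroP.comp hinf).neg.congr' ?_
    filter_upwards [eventually_atInf_mem] with z hz
    exact (em z (ne_zero_of_mem_DmS hz)).symm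
  refine ⟨ρ, P, hP, fun z hz => ?_, hPe⟩
  refine liouville_plus h.pos hP regm (fun z hz => ?_) (tendsto_of_tendsto_mul infP)
    (tendsto_of_tendsto_mul infm) zeroP zerom hz
  rw [hPe z (h.notMem_of_Sigma0 hz), hPe _ (h.notMem_of_Sigma0 ((hat_mem_Sigma0 h.pos).2 hz)),
    h.cross_symm hz, div_div, ← sq]

end NoJump

namespace NoJump

variable {q0 : ℝ} {rm : ℂ} {ι : Type*} [Fintype ι] {p C χ : ι → ℂ} {f g : Fin 2 → ℂ → ℂ}
  (h : NoJump q0 rm p C χ f g) {V W : ι → ℂ}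
include h

/-- The squared norm of the constants of `NoJump.eq_div`. -/
theorem norm_eq {ρ : Fin 2 → ℂ} {P : Fin 2 → ℂ → ℂ} (hP : ∀ i, HalfRegular q0 (Dplus q0) (P i))
    (hPρ : ∀ i, ∀ z ∈ Dplus q0, P i z = ρ i / z)
    (hPe : ∀ i z, z ∉ Set.range p →
      P i z = reflect q0 rm (doublePoles V W p) z * g i z - f i z * doublePoles V W p z)
    {z : ℂ} (hz : z ∈ Sigma0 q0) (hn : ‖z‖ = q0) (him : z.im ≠ 0) :
    ρ 1 * conj (ρ 1) + ρ 0 * conj (ρ 0) = (z ^ 2 + (q0 : ℂ) ^ 2) *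
      (reflect q0 rm (doublePoles V W p) z * conj (reflect q0 rm (doublePoles V W p) (conj z))
        + doublePoles V W p z * conj (doublePoles V W p (conj z))) := by
  -- The relation with the adjugate is inverted: multiplication by (f, g) recovers the row vector
  -- times γ, up to the factor z.
  have key : ∀ z ∈ Sigma0 q0, ‖z‖ = q0 → z.im ≠ 0 →
      ρ 1 * f 0 z - ρ 0 * f 1 z = z * (reflect q0 rm (doublePoles V W p) z * gam q0 z) ∧
      ρ 1 * g 0 z - ρ 0 * g 1 z = z * (doublePoles V W p z * gam q0 z) := by
    intro z hz hn him
    have hz0 : z ≠ 0 := hz.2.1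
    have e : ∀ i, ρ i = z * (reflect q0 rm (doublePoles V W p) z * g i z
        - f i z * doublePoles V W p z) := by
      intro i
      rw [← hPe i z (h.notMem_of_Sigma0 hz), (hP i).eq_on_circle h.pos (hPρ i) hz hn him
        (continuousAt_const.div continuousAt_id hz0)]
      field_simp
    rw [e, e, ← h.det z (Or.inr hz) (h.notMem_of_Sigma0 hz)]
    constructor <;> ring
  have hz' : conj z ∈ Sigma0 q0 := conj_mem_Sigma0.2 hz
  obtain ⟨a1, b1⟩ := key z hz hn him
  obtain ⟨a2, b2⟩ := key (conj z) hz' (by rwa [RCLike.norm_conj]) (by rwa [conj_im, neg_ne_zero])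
  have c1 := h.conj₁₁ (conj z) hz'
  have c0 := h.conj₀₁ (conj z) hz'
  have d1 := h.conj₁₁ z hz
  have d0 := h.conj₀₁ z hz
  rw [conj_conj] at c1 c0
  rw [c1, c0] at b2
  have a3 := congrArg conj a2
  have b3 := congrArg conj b2
  simp only [map_sub, map_mul, map_neg, conj_conj] at a3 b3
  have d0' : conj (f 1 (conj z)) = -g 0 z := by rw [d0, neg_neg]
  rw [← d1, d0'] at a3
  have hγ : conj (gam q0 (conj z)) = gam q0 z := by simp [gam]
  rw [hγ] at a3 b3
  have hdet := h.det z (Or.inr hz) (h.notMem_of_Sigma0 hz)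
  have hne := gam_ne_zero_DS (Or.inr hz : z ∈ Dplus q0 ∪ Sigma0 q0)
  have hγz : z ^ 2 * gam q0 z = z ^ 2 + (q0 : ℂ) ^ 2 := by
    have hz0 : z ≠ 0 := hz.2.1
    rw [gam]
    field_simp
  rw [← hγz]
  refine mul_left_cancel₀ hne ?_
  generalize reflect q0 rm (doublePoles V W p) z = N1 at *
  generalize reflect q0 rm (doublePoles V W p) (conj z) = N1' at *
  generalize doublePoles V W p z = N2 at *
  generalize doublePoles V W p (conj z) = N2' at *
  generalize f 0 z = x at *
  generalize f 1 z = y at *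
  generalize g 0 z = u at *
  generalize g 1 z = v at *
  generalize gam q0 z = γ at *
  rw [← hdet] at a1 b1 a3 b3 ⊢
  linear_combination a1 * (conj (ρ 1) * v + conj (ρ 0) * u)
    + z * N1 * (x * v - y * u) * a3 + b1 * (-conj (ρ 1) * y - conj (ρ 0) * x)
    + z * N2 * (x * v - y * u) * b3

/-- There is no nonzero combination of the principal parts that is compatible with the symmetry. -/
theorem reflect_eq_zero (hV : ∀ n, V n = C n * reflect q0 rm (doublePoles V W p) (p n))
    (hW : ∀ n, W n = C n * (deriv (reflect q0 rm (doublePoles V W p)) (p n)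
      + χ n * reflect q0 rm (doublePoles V W p) (p n))) (n : ι) :
    reflect q0 rm (doublePoles V W p) (p n) = 0 ∧
      deriv (reflect q0 rm (doublePoles V W p)) (p n) = 0 := by
  have hq' : (q0 : ℂ) ≠ 0 := ofReal_ne_zero.2 h.pos.ne'
  have hb := branch_notMem (q0 := q0)
  choose ρ P hP hPρ hPe using fun i => h.eq_div hV hW i
  have hρ : ρ 1 * conj (ρ 1) + ρ 0 * conj (ρ 0) = 0 := by
    -- Along the circle Φ equals the constant |ρ₁|² + |ρ₀|². At the branch point iq₀ the row vector
    -- is continuous while z² + q₀² vanishes, so the constant is 0.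
    set Φ : ℂ → ℂ := fun z => (z ^ 2 + (q0 : ℂ) ^ 2) *
      (reflect q0 rm (doublePoles V W p) z * conj (reflect q0 rm (doublePoles V W p) (conj z))
        + doublePoles V W p z * conj (doublePoles V W p (conj z))) with hΦ
    have hI : conj (I * (q0 : ℂ)) = -(I * q0) := by simp
    have nb : I * (q0 : ℂ) ∉ Set.range p := h.notMem_range fun h => hb.1 (Or.inl h)
    have nb' : -(I * (q0 : ℂ)) ∉ Set.range p := h.notMem_range fun h => hb.2.1 (Or.inl h)
    have n0 : I * (q0 : ℂ) ≠ 0 := mul_ne_zero I_ne_zero hq'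
    have c1 : ContinuousAt (reflect q0 rm (doublePoles V W p)) (I * q0) :=
      (differentiableAt_reflect n0 (by rwa [hat_branch h.pos])).continuousAt
    have c2 : ContinuousAt (reflect q0 rm (doublePoles V W p)) (conj (I * q0)) := by
      rw [hI]
      exact (differentiableAt_reflect (neg_ne_zero.2 n0)
        (by rwa [hat_neg, hat_branch h.pos])).continuousAt
    have c3 : ContinuousAt (doublePoles V W p) (I * q0) :=
      (differentiableAt_doublePoles nb).continuousAt
    have c4 : ContinuousAt (doublePoles V W p) (conj (I * q0)) := by
      rw [hI]; exact (differentiableAt_doublePoles nb').continuousAt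
    have cc : Continuous (fun z : ℂ => conj z) := continuous_conj
    have cΦ : ContinuousAt Φ (I * q0) :=
      ((continuousAt_id.pow 2).add continuousAt_const).mul
        ((c1.mul (cc.continuousAt.comp (ContinuousAt.comp (f := fun z : ℂ => conj z) c2 cc.continuousAt))).add
          (c3.mul (cc.continuousAt.comp (ContinuousAt.comp (f := fun z : ℂ => conj z) c4 cc.continuousAt))))
    have hΦ0 : Φ (I * q0) = 0 := by
      simp only [hΦ, mul_pow, I_sq]
      ring
    have hcirc : Tendsto (fun φ : ℝ => (q0 : ℂ) * exp (I * φ)) (𝓝[<] (Real.pi / 2)) (𝓝 (I * q0)) := by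
      have : Continuous fun φ : ℝ => (q0 : ℂ) * exp (I * φ) := by fun_prop
      have h1 := (this.tendsto (Real.pi / 2)).mono_left (nhdsWithin_le_nhds (s := Set.Iio (Real.pi / 2)))
      have e : (q0 : ℂ) * exp (I * (Real.pi / 2 : ℝ)) = I * q0 := by
        rw [mul_comm I, ofReal_div, ofReal_ofNat, exp_pi_div_two_mul_I, mul_comm]
      rwa [e] at h1
    have h1 := cΦ.tendsto.comp hcirc
    rw [hΦ0] at h1
    refine tendsto_nhds_unique (tendsto_const_nhds.congr' ?_) h1
    have hpi := Real.pi_pos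
    filter_upwards [self_mem_nhdsWithin,
      mem_nhdsWithin_of_mem_nhds (lt_mem_nhds (half_pos hpi))] with φ hφ1 hφ0
    have hφ1' : φ < Real.pi / 2 := hφ1
    refine h.norm_eq hP hPρ hPe (circle_mem_Sigma0 h.pos ⟨⟨by linarith, by linarith⟩, ?_⟩)
      (norm_circle h.pos.le φ) ?_
    · rintro (h1 | h1)
      · exact hφ1'.ne h1
      · rw [Set.mem_singleton_iff.1 h1] at hφ0; linarith
    · rw [im_circle]
      exact (mul_pos h.pos (Real.sin_pos_of_pos_of_lt_pi hφ0 (by linarith))).ne'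
  have hρ0 : ∀ i, ρ i = 0 := by
    rw [Complex.mul_conj, Complex.mul_conj, ← ofReal_add, ofReal_eq_zero] at hρ
    have h1 := normSq_nonneg (ρ 1)
    have h2 := normSq_nonneg (ρ 0)
    exact Fin.forall_fin_two.2
      ⟨normSq_eq_zero.1 (by linarith), normSq_eq_zero.1 (by linarith)⟩
  have hz : ∀ᶠ z in 𝓝[≠] (p n), reflect q0 rm (doublePoles V W p) z = 0 := by
    have h1 : ∀ᶠ z in 𝓝 (p n), z ∉ Set.range p \ {p n} :=
      ((Set.finite_range p).subset Set.sdiff_subset).isClosed.isOpen_compl.mem_nhds (by simp)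
    filter_upwards [self_mem_nhdsWithin, mem_nhdsWithin_of_mem_nhds h1,
      mem_nhdsWithin_of_mem_nhds ((isOpen_Dplus q0).mem_nhds (h.mem n))] with z hz1 hz2 hzD
    have hzr : z ∉ Set.range p := fun h1 => hz2 ⟨h1, hz1⟩
    have e : ∀ i, reflect q0 rm (doublePoles V W p) z * g i z - f i z * doublePoles V W p z = 0 := by
      intro i
      rw [← hPe i z hzr, hPρ i z hzD, hρ0, zero_div]
    -- The row vector is annihilated by the adjugate of (f, g), whose determinant γ does not vanish
    -- on D⁺.
    refine (mul_eq_zero.1 ?_).resolve_right (gam_ne_zero_DS (Or.inl hzD : z ∈ Dplus q0 ∪ Sigma0 q0))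
    rw [← h.det z (Or.inl hzD) hzr]
    linear_combination f 0 z * e 1 - f 1 z * e 0
  have hev := (h.analyticAt_reflect (V := V) (W := W) n).frequently_zero_iff_eventually_zero.1
    hz.frequently
  refine ⟨hev.self_of_nhds, ?_⟩
  have : reflect q0 rm (doublePoles V W p) =ᶠ[𝓝 (p n)] fun _ => 0 := hev
  rw [this.deriv_eq, deriv_const]

end NoJump

/-! ## The reflectionless case -/

namespace Sided

variable {q0 : ℝ} {D₁ D₂ : Set ℂ} {rm qx : ℂ} {V : ℂ → Matrix (Fin 2) (Fin 2) ℂ}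
  (h : Sided q0 D₁ D₂ rm qx V)
include h

theorem tendsto_infty₁ : ∀ i, Tendsto (fun z => V z i 0) (atInf q0 D₁) (𝓝 (![1, 0] i)) := by
  refine Fin.forall_fin_two.2 ⟨?_, ?_⟩
  · simpa using (h.isBigO₁.1.trans_tendsto tendsto_inv_atInf).add_const 1
  · have h1 := (h.isBigO₁.2.trans isBigO_inv_sq_inv).trans_tendsto tendsto_inv_atInf
    have h2 := ((tendsto_inv_atInf (q0 := q0) (D := D₁)).const_mul I).mul_const (conj qx)
    simpa [div_eq_mul_inv] using h1.sub h2

theorem tendsto_infty₂ : ∀ i, Tendsto (fun z => V z i 1) (atInf q0 D₂) (𝓝 (![0, 1] i)) := by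
  refine Fin.forall_fin_two.2 ⟨?_, ?_⟩
  · have h1 := (h.isBigO₂.2.trans isBigO_inv_sq_inv).trans_tendsto tendsto_inv_atInf
    have h2 := ((tendsto_inv_atInf (q0 := q0) (D := D₂)).const_mul I).mul_const qx
    simpa [div_eq_mul_inv] using h1.sub h2
  · simpa using (h.isBigO₂.1.trans_tendsto tendsto_inv_atInf).add_const 1

theorem tendsto_zero₁ (hq : 0 < q0) (h0 : (0 : ℂ) ∉ D₁ ∪ Sigma0 q0)
    (hD : ∀ z ∈ D₁ ∪ Sigma0 q0, hat q0 z ∈ D₂ ∪ Sigma0 q0) (i : Fin 2) :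
    Tendsto (fun z => z * V z i 0) (atZero q0 D₁) (𝓝 (-(I * conj rm * ![0, 1] i))) := by
  have h1 := ((h.tendsto_infty₂ i).comp (tendsto_hat_atZero hq h0 hD)).const_mul (-(I * conj rm))
  rw [← neg_mul]
  refine h1.congr' ?_
  filter_upwards [eventually_atZero_mem] with z hz
  have hz0 : z ≠ 0 := fun h => h0 (h ▸ hz)
  rw [h.symm₁ z hz i]
  simp only [Function.comp_apply]
  field_simp

theorem tendsto_zero₂ (hq : 0 < q0) (h0 : (0 : ℂ) ∉ D₂ ∪ Sigma0 q0)
    (hD : ∀ z ∈ D₂ ∪ Sigma0 q0, hat q0 z ∈ D₁ ∪ Sigma0 q0) (i : Fin 2) :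
    Tendsto (fun z => z * V z i 1) (atZero q0 D₂) (𝓝 (-(I * rm * ![1, 0] i))) := by
  have h1 := ((h.tendsto_infty₁ i).comp (tendsto_hat_atZero hq h0 hD)).const_mul (-(I * rm))
  rw [← neg_mul]
  refine h1.congr' ?_
  filter_upwards [eventually_atZero_mem] with z hz
  have hz0 : z ≠ 0 := fun h => h0 (h ▸ hz)
  rw [h.symm₂ z hz i]
  simp only [Function.comp_apply]
  field_simp

end Sided

/-! ### The linear system -/

section System

variable {q0 : ℝ} {N : ℕ} {z : Fin N → ℂ} {A B : Idx N → ℂ} {x t : ℝ}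

/-- With (V, W) as the values and derivatives at ξ̂_n of an unknown function, the upper rows
evaluate at ξ_k the sum of double poles built from it. The diagonal term is what the involution
symmetry adds. -/
theorem Mtilde_mulVec_inl (qm : ℂ) (V W : Idx N → ℂ) (k : Idx N) :
    (Mtilde q0 z qm A B x t).mulVec (Sum.elim V W) (Sum.inl k) =
      doublePoles (fun n => Aexp q0 z A x t n * V n)
        (fun n => Aexp q0 z A x t n * (W n + chi q0 z B x t n * V n)) (xiHat q0 z) (xi q0 z k)
        + I * qm / xi q0 z k * V k := by
  have e : I * qm / xi q0 z k * V k = ∑ n, (if k = n then I * qm / xi q0 z k else 0) * V n := by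
    simp
  rw [Matrix.mulVec, dotProduct, Fintype.sum_sum_type, ← Finset.sum_add_distrib, e, doublePoles,
    ← Finset.sum_add_distrib]
  refine Finset.sum_congr rfl fun n _ => ?_
  simp only [Mtilde, Matrix.fromBlocks_apply₁₁, Matrix.fromBlocks_apply₁₂, Matrix.of_apply,
    Sum.elim_inl, Sum.elim_inr, Hplus, doublePole, div_eq_mul_inv, ← inv_pow]
  ring

/-- The lower rows are the negative derivative at ξ_k of the relation encoded in the upper rows; the
factor q₀²/ξ_k² of the term in W comes from differentiating the involution. -/
theorem Mtilde_mulVec_inr (qm : ℂ) (V W : Idx N → ℂ) (k : Idx N)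
    (hk : xi q0 z k ∉ Set.range (xiHat q0 z)) :
    (Mtilde q0 z qm A B x t).mulVec (Sum.elim V W) (Sum.inr k) =
      -deriv (doublePoles (fun n => Aexp q0 z A x t n * V n)
        (fun n => Aexp q0 z A x t n * (W n + chi q0 z B x t n * V n)) (xiHat q0 z)) (xi q0 z k)
        + I * qm / xi q0 z k ^ 2 * V k - I * qm * (q0 : ℂ) ^ 2 / xi q0 z k ^ 3 * W k := by
  have e1 : I * qm / xi q0 z k ^ 2 * V k =
      ∑ n, (if k = n then I * qm / xi q0 z k ^ 2 else 0) * V n := by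
    simp
  have e2 : I * qm * (q0 : ℂ) ^ 2 / xi q0 z k ^ 3 * W k =
      ∑ n, (if k = n then I * qm * (q0 : ℂ) ^ 2 / xi q0 z k ^ 3 else 0) * W n := by
    simp
  rw [Matrix.mulVec, dotProduct, Fintype.sum_sum_type, ← Finset.sum_add_distrib, e1, e2, (hasDerivAt_doublePoles hk).deriv, ← Finset.sum_neg_distrib, ← Finset.sum_add_distrib,
    ← Finset.sum_sub_distrib]
  refine Finset.sum_congr rfl fun n _ => ?_
  simp only [Mtilde, Matrix.fromBlocks_apply₂₁, Matrix.fromBlocks_apply₂₂, Matrix.of_apply,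
    Sum.elim_inl, Sum.elim_inr, Hplus, div_eq_mul_inv, ← inv_pow]
  ring

/-- Schur complement of the invertible block: the corner 0 contributes nothing, and only -ωᵀM̃⁻¹ν
remains. -/
theorem det_bordered {qm : ℂ} (hdet : (Mtilde q0 z qm A B x t).det ≠ 0) {X : Idx N ⊕ Idx N → ℂ}
    (hX : (Mtilde q0 z qm A B x t).mulVec X = nuVec q0 z qm) :
    (bordered q0 z qm A B x t).det =
      -((Mtilde q0 z qm A B x t).det * (omegaVec q0 z A B x t ⬝ᵥ X)) := by
  let _ := Matrix.invertibleOfIsUnitDet _ (isUnit_iff_ne_zero.2 hdet)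
  rw [bordered, Matrix.det_fromBlocks₁₁, Matrix.mul_assoc]
  have e : ⅟(Mtilde q0 z qm A B x t) * Matrix.of (fun k (_ : Unit) => nuVec q0 z qm k) =
      Matrix.of fun k (_ : Unit) => X k := by
    rw [← hX]
    have : Matrix.of (fun k (_ : Unit) => (Mtilde q0 z qm A B x t).mulVec X k) =
        Mtilde q0 z qm A B x t * Matrix.of (fun k (_ : Unit) => X k) := rfl
    rw [this, Matrix.invOf_mul_cancel_left]
  rw [e, Matrix.det_unique (n := Unit), ← mul_neg]
  exact congrArg _ (zero_sub (omegaVec q0 z A B x t ⬝ᵥ X))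

end System

section

variable {q0 : ℝ} {q : ℝ → ℝ → ℂ} {qm qp : ℂ} {ψm ψp : ℝ → ℝ → ℂ → Matrix (Fin 2) (Fin 2) ℂ}
  (h : JostPair q0 q qm qp ψm ψp) {N : ℕ} {z : Fin N → ℂ} {A B : Idx N → ℂ}
  (hd : DiscreteData q0 ψm ψp z A B) {x t : ℝ} (hG : ∀ ζ ∈ Sigma0 q0, Gmat q0 ψm ψp x t ζ = 0)
include h hd

theorem DiscreteData.xi_notMem (k : Idx N) : xi q0 z k ∉ Set.range (xiHat q0 z) := by
  rintro ⟨n, hn⟩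
  exact notMem_Sigma0_of_Dplus (h.xiHat_mem hd.zeros n) (Or.inl (hn ▸ h.xi_mem hd.zeros k))

include hG

/-- Without jump, u₊₂/s₂₂ coincides with u₋₂ on Σ₀. The symmetries of u₋ thereby become symmetries
between two functions that both live on D⁺. -/
theorem DiscreteData.noJump : NoJump q0 qm (xiHat q0 z) (Aexp q0 z A x t) (chi q0 z B x t)
    (fun i w => modified q0 ψm x t w i 0)
    (fun i w => modified q0 ψp x t w i 1 / s22 q0 ψm ψp w) := by
  have Sm := h.sided_minus x t
  have Sp := h.sided_plus x t
  have hnj : ∀ w ∈ Sigma0 q0, ∀ i,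
      modified q0 ψp x t w i 1 / s22 q0 ψm ψp w = modified q0 ψm x t w i 1 :=
    fun w hw i => (h.no_jump hd.sing hw (hG w hw) i).1
  have hne : (0 : ℂ) ∉ Dplus q0 ∪ Sigma0 q0 := fun h1 => ne_zero_of_mem_DS h1 rfl
  have hhat : ∀ w ∈ Dplus q0 ∪ Sigma0 q0, hat q0 w ∈ Dminus q0 ∪ Sigma0 q0 :=
    fun w hw => (hat_mem_DmS h.pos).2 hw
  refine ⟨h.pos, h.qm_mul_conj, h.xiHat_mem hd.zeros, h.xiHat_injective hd.zeros, Sm.reg₁,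
    hd.halfRegularOff h x t, hd.principal_part h x t, fun w hw hr => ?_, fun w hw i => ?_,
    fun w hw i => ?_, fun w hw => ?_, fun w hw => ?_, Sm.tendsto_infty₁, fun i => ?_,
    Sm.tendsto_zero₁ h.pos hne hhat, fun i => ?_⟩
  · have h1 := h.s22_mul_gam hw x t
    have h2 := hd.s22_ne_zero h hw hr
    field_simp
    linear_combination -h1
  · rw [hnj _ ((hat_mem_Sigma0 h.pos).2 hw), Sm.symm₁ w (Or.inr hw)]
  · rw [hnj w hw, Sm.symm₂ w (Or.inr hw)]
  · rw [hnj w hw, Sm.conj₁₁ w (Or.inr hw)]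
  · rw [hnj w hw, Sm.conj₀₁ w (Or.inr hw)]
  · simpa [div_eq_mul_inv] using (Sp.tendsto_infty₂ i).mul (tendsto_s22_inv_infty h)
  · have h1 := (Sp.tendsto_zero₂ h.pos hne hhat i).mul (tendsto_s22_inv_zero h)
    have e : -(I * qp * ![1, 0] i) * (qm / qp) = -(I * qm * ![1, 0] i) := by
      have := h.qp_ne_zero
      generalize (![1, 0] i : ℂ) = α
      field_simp
    rw [e] at h1
    refine h1.congr fun w => ?_
    rw [mul_assoc, div_eq_mul_inv]

/-- A kernel vector (V, W) defines a sum F of double poles. The upper rows say that the reflection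
of F takes the values V_k at ξ̂_k, the lower rows that its derivative takes the values W_k. This
closes the loop required by `NoJump.reflect_eq_zero`, so V = W = 0. -/
theorem DiscreteData.det_Mtilde_ne_zero : (Mtilde q0 z qm A B x t).det ≠ 0 := by
  have nj := hd.noJump h hG
  have hqm := h.qm_mul_conj
  have hq := h.q0_ne_zero
  have hqm0 := h.qm_ne_zero
  have hI := I_sq
  intro hdet
  obtain ⟨v, hv, hMv⟩ := Matrix.exists_mulVec_eq_zero_iff.2 hdet
  obtain ⟨V, W, rfl⟩ : ∃ V W : Idx N → ℂ, v = Sum.elim V W :=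
    ⟨v ∘ Sum.inl, v ∘ Sum.inr, (Sum.elim_comp_inl_inr v).symm⟩
  have r1 := fun k => (Mtilde_mulVec_inl qm V W k).symm.trans (congrFun hMv (Sum.inl k))
  have r2 := fun k => (Mtilde_mulVec_inr qm V W k (hd.xi_notMem h k)).symm.trans
    (congrFun hMv (Sum.inr k))
  set F := doublePoles (fun n => Aexp q0 z A x t n * V n)
    (fun n => Aexp q0 z A x t n * (W n + chi q0 z B x t n * V n)) (xiHat q0 z) with hF
  have hxi : ∀ k, hat q0 (xiHat q0 z k) = xi q0 z k := fun k => by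
    rw [xiHat_eq_hat, hat_hat h.pos]
  have hne : ∀ k, xi q0 z k ≠ 0 := fun k => ne_zero_of_mem_Dminus (h.xi_mem hd.zeros k)
  have hne' : ∀ k, xiHat q0 z k ≠ 0 := fun k => ne_zero_of_mem_Dplus (h.xiHat_mem hd.zeros k)
  have hV : ∀ k, reflect q0 qm F (xiHat q0 z k) = V k := by
    intro k
    have e : F (xi q0 z k) = -(I * qm / xi q0 z k * V k) := by
      have := r1 k
      rw [Pi.zero_apply] at this
      linear_combination this
    have hk := hne k
    rw [reflect, hxi, e, xiHat_eq_hat, hat]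
    field_simp
    linear_combination (-(I ^ 2 * V k)) * hqm - ((q0 : ℂ) ^ 2 * V k) * hI
  have hW : ∀ k, deriv (reflect q0 qm F) (xiHat q0 z k) = W k := by
    intro k
    have e : F (xi q0 z k) = -(I * qm / xi q0 z k * V k) := by
      have := r1 k
      rw [Pi.zero_apply] at this
      linear_combination this
    have e' : deriv F (xi q0 z k) =
        I * qm / xi q0 z k ^ 2 * V k - I * qm * (q0 : ℂ) ^ 2 / xi q0 z k ^ 3 * W k := by
      have := r2 k
      rw [Pi.zero_apply] at this
      linear_combination -this
    have hk := hne k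
    have hk' := hne' k
    have dF : HasDerivAt F (deriv F (xi q0 z k)) (hat q0 (xiHat q0 z k)) := by
      rw [hxi]
      exact (differentiableAt_doublePoles (hd.xi_notMem h k)).hasDerivAt
    have d1 := ((dF.comp _ (hasDerivAt_hat hk')).div (hasDerivAt_id _) hk').const_mul (-(I * conj qm))
    have d2 : HasDerivAt (reflect q0 qm F) _ (xiHat q0 z k) := d1
    rw [d2.deriv]
    simp only [Function.comp_apply, id]
    rw [hxi, e, e', xiHat_eq_hat, hat]
    field_simp
    linear_combination (-(I ^ 2 * (q0 : ℂ) ^ 2 * W k)) * hqm - ((q0 : ℂ) ^ 4 * W k) * hI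
  refine hv (funext ?_)
  have key := nj.reflect_eq_zero (V := fun n => Aexp q0 z A x t n * V n)
    (W := fun n => Aexp q0 z A x t n * (W n + chi q0 z B x t n * V n))
    (fun n => by rw [← hF, hV]) (fun n => by rw [← hF, hV, hW])
  rintro (k | k)
  · exact (hV k).symm.trans (key k).1
  · exact (hW k).symm.trans (key k).2

/-- `u₋₁₂` is the sum of its principal parts, with a pole at the origin. -/
theorem DiscreteData.eq_principalParts {w : ℂ} (hw : w ∈ Dminus q0) :
    modified q0 ψm x t w 0 1 = principalParts q0 z ψm A B x t w - I * qm / w := by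
  obtain ⟨g, hg, hgr⟩ := hd.exists_regular h x t
  have ap := hd.admissible_plus h hg hgr
  have am := hd.admissible_minus h x t
  have := liouville_minus h.pos hg am.toHalfRegular (fun w hw => by
    rw [hgr w (hd.notMem_of_Sigma0 h hw), (h.no_jump hd.sing hw (hG w hw) 0).1])
    (tendsto_of_tendsto_mul ap.infty) (tendsto_of_tendsto_mul am.infty) ap.zero am.zero hw
  rw [neg_div] at this
  linear_combination this

/-- The jump formula with zero jump equates the two limits -iq - `poleSum` and -iq₋. -/
theorem DiscreteData.q_eq : q x t = qm + I * poleSum q0 z ψm A B x t := by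
  obtain ⟨g, hg, hgr⟩ := hd.exists_regular h x t
  have := sigmaIntegral_jump (h := fun _ => 0) h.pos (hd.admissible_plus h hg hgr)
    (hd.admissible_minus h x t) (fun w hw => by
      rw [hgr w (hd.notMem_of_Sigma0 h hw), (h.no_jump hd.sing hw (hG w hw) 0).1, sub_self])
    (by simp)
  rw [sigmaIntegral_zero, eq_comm, mul_eq_zero] at this
  rcases this with h1 | h1
  · simp [Real.pi_ne_zero] at h1
  · linear_combination I * h1 + (q x t - qm) * I_sq

/-- On D⁻ the entry u₋₁₂ has two expressions: its partial fractions, and -(iq₋/w)u₋₁₁(ŵ) by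
symmetry. Equating them and their derivatives at w = ξ_k gives the system, with ν stemming from the
pole at the origin. -/
theorem DiscreteData.Mtilde_mulVec : (Mtilde q0 z qm A B x t).mulVec
    (Sum.elim (fun n => modified q0 ψm x t (xiHat q0 z n) 0 0)
      fun n => deriv (fun w => modified q0 ψm x t w 0 0) (xiHat q0 z n)) = nuVec q0 z qm := by
  have Sm := h.sided_minus x t
  have key : ∀ w ∈ Dminus q0, principalParts q0 z ψm A B x t w =
      I * qm / w - I * qm / w * modified q0 ψm x t (hat q0 w) 0 0 := by
    intro w hw
    have h1 := hd.eq_principalParts h hG hw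
    rw [Sm.symm₂ w (Or.inl hw) 0] at h1
    linear_combination -h1
  refine funext (Sum.forall.2 ⟨fun k => ?_, fun k => ?_⟩)
  · rw [Mtilde_mulVec_inl]
    have h1 := key _ (h.xi_mem hd.zeros k)
    rw [principalParts, ← xiHat_eq_hat] at h1
    rw [h1]
    exact sub_add_cancel _ _
  · rw [Mtilde_mulVec_inr _ _ _ _ (hd.xi_notMem h k)]
    have hmem := h.xi_mem hd.zeros k
    have hne : xi q0 z k ≠ 0 := ne_zero_of_mem_Dminus hmem
    have hev : principalParts q0 z ψm A B x t =ᶠ[𝓝 (xi q0 z k)]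
        fun w => I * qm / w - I * qm / w * modified q0 ψm x t (hat q0 w) 0 0 := by
      filter_upwards [(isOpen_Dminus q0).mem_nhds hmem] with w hw using key w hw
    have du : HasDerivAt (fun w => modified q0 ψm x t w 0 0)
        (deriv (fun w => modified q0 ψm x t w 0 0) (xiHat q0 z k)) (hat q0 (xi q0 z k)) :=
      ((Sm.reg₁ 0).diff.differentiableAt
        ((isOpen_Dplus q0).mem_nhds (h.xiHat_mem hd.zeros k))).hasDerivAt
    have d0 := (hasDerivAt_const (xi q0 z k) (I * qm)).div (hasDerivAt_id _) hne
    have d1 : HasDerivAt (fun w => I * qm / w - I * qm / w * modified q0 ψm x t (hat q0 w) 0 0) _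
        (xi q0 z k) := d0.sub (d0.mul (du.comp _ (hasDerivAt_hat hne)))
    have h1 := hev.deriv_eq.trans d1.deriv
    rw [principalParts] at h1
    rw [h1]
    simp only [id, nuVec, Sum.elim_inr, ← xiHat_eq_hat, Pi.div_apply]
    field_simp
    ring

theorem DiscreteData.reflectionless : q x t = qm + I * poleSum q0 z ψm A B x t ∧
    (Mtilde q0 z qm A B x t).det ≠ 0 ∧
    q x t = qm - I * ((bordered q0 z qm A B x t).det / (Mtilde q0 z qm A B x t).det) := by
  have hdet := hd.det_Mtilde_ne_zero h hG
  refine ⟨hd.q_eq h hG, hdet, ?_⟩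
  rw [det_bordered hdet (hd.Mtilde_mulVec h hG), neg_div, mul_div_cancel_left₀ _ hdet,
    dotProduct, Fintype.sum_sum_type, ← Finset.sum_add_distrib, mul_neg, sub_neg_eq_add,
    hd.q_eq h hG, poleSum]
  refine congrArg (fun s => qm + I * s) (Finset.sum_congr rfl fun n _ => ?_)
  simp only [omegaVec, Sum.elim_inl, Sum.elim_inr]
  ring

end

end KE

end

theorem mainTheorem9
    (β q0 : ℝ) (hq0 : 0 < q0) (qm qp : ℂ) (hqm : ‖qm‖ = q0) (hqp : ‖qp‖ = q0)
    (qh q : ℝ → ℝ → ℂ) (φ : ℝ → ℝ → ℝ)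
    (hsol : KE.IsSolution β qh) (hgauge : KE.IsGauge β q0 qh q φ)
    (hbv : KE.HasBoundaryValues q qm qp)
    (ψm ψp : ℝ → ℝ → ℂ → Matrix (Fin 2) (Fin 2) ℂ)
    (hψm : KE.IsJostMinus q0 q qm ψm) (hψp : KE.IsJostPlus q0 q qp ψp)
    (hsing : KE.NoSpectralSingularity q0 ψm ψp)
    (N : ℕ) (z : Fin N → ℂ) (hz : KE.HasDoubleZeros q0 ψm ψp z) :
    -- all derivatives with respect to `z` that occur below exist
    (∀ x t i, DifferentiableOn ℂ (fun w => ψm x t w i 0) (KE.Dplus q0) ∧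
      DifferentiableOn ℂ (fun w => ψp x t w i 1) (KE.Dplus q0)) ∧
    DifferentiableOn ℂ (KE.s22 q0 ψm ψp) (KE.Dplus q0) ∧
    (∀ n : KE.Idx N, KE.xiHat q0 z n ∈ KE.Dplus q0 ∧
      iteratedDeriv 2 (KE.s22 q0 ψm ψp) (KE.xiHat q0 z n) ≠ 0) ∧
    -- the norming constants exist and are unique
    (∀ n : KE.Idx N, ∃! p : ℂ × ℂ, KE.IsNorming ψm ψp (KE.xiHat q0 z n) p.1 p.2) ∧
    ∀ b d : KE.Idx N → ℂ, (∀ n, KE.IsNorming ψm ψp (KE.xiHat q0 z n) (b n) (d n)) →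
      (∀ n, b n ≠ 0) ∧
      ∀ A B : KE.Idx N → ℂ,
        (∀ n, A n = KE.Aplus q0 ψm ψp (KE.xiHat q0 z n) (b n)) →
        (∀ n, B n = KE.Bplus q0 ψm ψp (KE.xiHat q0 z n) (b n) (d n)) →
        -- reconstruction formula
        (∀ x t : ℝ,
          KE.SigmaIntegrable q0
            (fun ζ => (KE.Mminus q0 ψm ψp x t ζ * KE.Gmat q0 ψm ψp x t ζ) 0 1) ∧
          q x t = qm + Complex.I * KE.poleSum q0 z ψm A B x t
            + 1 / (2 * (Real.pi : ℂ)) * KE.sigmaIntegral q0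
                (fun ζ => (KE.Mminus q0 ψm ψp x t ζ * KE.Gmat q0 ψm ψp x t ζ) 0 1)) ∧
        -- reflectionless case
        ((∀ x t : ℝ, ∀ ζ ∈ KE.Sigma0 q0, KE.Gmat q0 ψm ψp x t ζ = 0) →
          ∀ x t : ℝ,
            q x t = qm + Complex.I * KE.poleSum q0 z ψm A B x t ∧
            (KE.Mtilde q0 z qm A B x t).det ≠ 0 ∧
            q x t = qm - Complex.I * ((KE.bordered q0 z qm A B x t).det
              / (KE.Mtilde q0 z qm A B x t).det)) := by
  have h : KE.JostPair q0 q qm qp ψm ψp := ⟨hq0, hqm, hqp, hbv, hψm, hψp⟩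
  refine ⟨fun x t i => ⟨h.differentiableOn_minus x t i, h.differentiableOn_plus x t i⟩,
    h.differentiableOn_s22, fun n => ⟨h.xiHat_mem hz n, (h.s22_double hz n).2⟩, fun n => ?_,
    fun b d hbd => ?_⟩
  · obtain ⟨b, d, hbd⟩ := h.exists_norming (h.xiHat_mem hz n)
      ((h.s22_eq_zero_iff hz (h.xiHat_mem hz n)).2 ⟨n, rfl⟩) (h.s22_double hz n).1
    refine ⟨(b, d), hbd, fun p hp => ?_⟩
    have := h.norming_unique (h.xiHat_mem hz n) hp hbd
    exact Prod.ext this.1 this.2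
  · have hb : ∀ n, b n ≠ 0 := fun n => h.norming_ne_zero (h.xiHat_mem hz n) (hbd n)
    refine ⟨hb, fun A B hA hB => ?_⟩
    have hd : KE.DiscreteData q0 ψm ψp z A B :=
      ⟨hsing, hz, fun n => ⟨b n, d n, hb n, hbd n, hA n, hB n⟩⟩
    exact ⟨hd.reconstruction h, fun hG x t => hd.reflectionless h (hG x t)⟩
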